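/- Let $n\ge 1$ and let $B_{2n}$ be the braid group on $2n$ strands with Artin generators $\sigma_1,\dots,\sigma_{2n-1}$. Let $<_D$ be the Dehornoy order on $B_{2n}$: $\alpha<_D\beta$ if and only if $\alpha^{-1}\beta$ is represented by a braid word in which the generator of lowest index that occurs does so with positive exponents only. Let $H_{2n}\le B_{2n}$ be the Hilden subgroup, consisting of the braids whose action on the disc with $2n$ marked points extends to a homeomorphism of the standard trivial $n$-string tangle, that is, of the ball together with $n$ standard arcs joining adjacent marked points in pairs. For $\beta\in B_{2n}$ write $[\beta]_H=H_{2n}\beta H_{2n}$, and let $\operatorname{pl}(\beta)\subset S^3$ be the plat closure of $\beta$. Let $c_n\colon B_{2n}\to\mathbb N$ be a function such that $\{\beta : c_n(\beta)\le N\}$ is finite for every $N\in\mathbb N$. For a double coset $C\in H_{2n}\backslash B_{2n}/H_{2n}$, let $r_{D,n}(C)$ be the $<_D$-least element of the set $M_n(C)$ of those elements of $C$ at which $c_n|_C$ is minimal. Let $\mathcal L$ be a (tame, unoriented, non-empty) link type in $S^3$ with bridge number $b(\mathcal L)\le n$, where $b(\mathcal L)$ is the least $m\ge1$ such that $\mathcal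 L$ has an $m$-bridge position, i.e. a smooth representative on which the height function has exactly $2m$ critical points, all non-degenerate, with every local maximum value greater than every local minimum value. Let $\mathcal B^{(n)}(\mathcal L)=\{\beta\in B_{2n} : \operatorname{pl}(\beta)\in\mathcal L\}$ and let $M^{(n)}_{\mathcal L}$ be the set of those elements of $\mathcal B^{(n)}(\mathcal L)$ at which $c_n|_{\mathcal B^{(n)}(\mathcal L)}$ is minimal. Then $M^{(n)}_{\mathcal L}$ has a unique $<_D$-least element $\beta_{D,\mathcal L}^{(n)}$; and, with $\operatorname{CanPlat}_D^{(n)}(\mathcal L):=[\beta_{D,\mathcal L}^{(n)}]_H$, the set $M_n(\operatorname{CanPlat}_D^{(n)}(\mathcal L))$ has a unique $<_D$-least element, and $$\beta_{D,\mathcal L}^{(n)}=r_{D,n}\bigl(\operatorname{CanPlat}_D^{(n)}(\mathcal L)\bigr).$$ -/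

import Mathlib

open scoped ContDiff

noncomputable section

namespace Plat

/-! ### The braid group and the Dehornoy order -/

/-- Artin's relators for the braid group on `m` strands; the generator `i : Fin (m - 1)` is the
half twist of the strands in positions `i` and `i + 1` (positions are `0, …, m - 1`). -/
def braidRels (m : ℕ) : Set (FreeGroup (Fin (m - 1))) :=
  {r | (∃ i j : Fin (m - 1), (i : ℕ) + 2 ≤ j ∧
          r = FreeGroup.of i * FreeGroup.of j * (FreeGroup.of j * FreeGroup.of i)⁻¹) ∨
       (∃ i j : Fin (m - 1), (i : ℕ) + 1 = j ∧
          r = FreeGroup.of i * FreeGroup.of j * FreeGroup.of i *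
            (FreeGroup.of j * FreeGroup.of i * FreeGroup.of j)⁻¹)}

/-- The braid group `B_m` on `m` strands. -/
abbrev BraidGroup (m : ℕ) : Type := PresentedGroup (braidRels m)

/-- Braid words on `m` strands: `(i, true)` is `σ_i` and `(i, false)` is `σ_i⁻¹`. -/
abbrev BraidWord (m : ℕ) : Type := List (Fin (m - 1) × Bool)

/-- The braid represented by a word. -/
def BraidWord.toBraid {m : ℕ} (w : BraidWord m) : BraidGroup m :=
  PresentedGroup.mk (braidRels m) (FreeGroup.mk w)

/-- A braid is `σ`-positive if it is represented by a word in which the generator of lowest index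
that occurs does so with positive exponent only. -/
def SigmaPositive {m : ℕ} (β : BraidGroup m) : Prop :=
  ∃ w : BraidWord m, w.toBraid = β ∧ ∃ i : Fin (m - 1),
    (i, true) ∈ w ∧ (i, false) ∉ w ∧ ∀ x ∈ w, i ≤ x.1

/-- The Dehornoy order: `α <_D β` iff `α⁻¹ β` is `σ`-positive. -/
def DehornoyLT {m : ℕ} (α β : BraidGroup m) : Prop := SigmaPositive (α⁻¹ * β)

/-- `β` is the `<_D`-least element of `S`. -/
def IsDehornoyLeast {m : ℕ} (S : Set (BraidGroup m)) (β : BraidGroup m) : Prop :=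
  β ∈ S ∧ ∀ γ ∈ S, γ ≠ β → DehornoyLT β γ

open Classical in
/-- `min_{<_D} S`, with the value `1` if `S` has no `<_D`-least element. -/
def dehornoyMin {m : ℕ} (S : Set (BraidGroup m)) : BraidGroup m :=
  if h : ∃ β, IsDehornoyLeast S β then h.choose else 1

/-! ### The half twists of the plane -/

/-- Radial cut-off: `1` on `r ≤ 1/2` and `0` on `r ≥ 1`. -/
def cutoff (r : ℝ) : ℝ := max 0 (min 1 (2 - 2 * r))

/-- The midpoint of the marked points `i` and `i + 1` of the plane. -/
def center (i : ℕ) : ℂ := (i : ℂ) + 1 / 2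

/-- The rotation by the angle `π a` of the disc of radius `1/2` about the midpoint of `i` and
`i + 1`, damped to the identity outside the disc of radius `1`. For `a = 1` this is the
counterclockwise half twist that exchanges the points `i` and `i + 1`; the variable `a` gives an
isotopy to it from the identity. -/
def twist (i : ℕ) (a : ℝ) (z : ℂ) : ℂ :=
  center i + Complex.exp (((Real.pi * a * cutoff ‖z - center i‖ : ℝ) : ℂ) * Complex.I) *
    (z - center i)

theorem twist_neg_twist (i : ℕ) (a : ℝ) (z : ℂ) : twist i (-a) (twist i a z) = z := by
  have h : ‖twist i a z - center i‖ = ‖z - center i‖ := by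
    rw [twist, add_sub_cancel_left, norm_mul, Complex.norm_exp_ofReal_mul_I, one_mul]
  rw [twist, h]
  simp only [twist, add_sub_cancel_left]
  rw [← mul_assoc, ← Complex.exp_add]
  have h0 : ((Real.pi * -a * cutoff ‖z - center i‖ : ℝ) : ℂ) * Complex.I +
      ((Real.pi * a * cutoff ‖z - center i‖ : ℝ) : ℂ) * Complex.I = 0 := by
    push_cast; ring
  rw [h0]; simp

theorem continuous_twist (i : ℕ) (a : ℝ) : Continuous (twist i a) := by
  unfold twist cutoff
  fun_prop

/-- The half twist exchanging `i` and `i + 1`, as a homeomorphism of the plane. -/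
def halfTwist (i : ℕ) : ℂ ≃ₜ ℂ where
  toFun := twist i 1
  invFun := twist i (-1)
  left_inv z := twist_neg_twist i 1 z
  right_inv z := by simpa using twist_neg_twist i (-1) z
  continuous_toFun := continuous_twist i 1
  continuous_invFun := continuous_twist i (-1)

/-- The action of braid words on the plane, by products of half twists. -/
def planeAction (m : ℕ) : FreeGroup (Fin (m - 1)) →* (ℂ ≃ₜ ℂ) :=
  FreeGroup.lift fun i => halfTwist i

/-! ### The standard trivial tangle and the Hilden subgroup -/

/-- Three-space, as the product of the horizontal plane and the vertical line. -/
abbrev R3 : Type := ℂ × ℝ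

/-- The standard cap system: for each `i < n` a semicircle in the upper half-space that joins the
marked points `2 i` and `2 i + 1` of the boundary plane. -/
def caps (n : ℕ) : Set R3 :=
  {p | ∃ i < n, p.1.im = 0 ∧ 0 ≤ p.2 ∧ (p.1.re - (2 * i + 1 / 2)) ^ 2 + p.2 ^ 2 = 1 / 4}

/-- The closed upper half-space: the closed three-ball without one boundary point. -/
abbrev UpperHalfSpace : Type := {p : R3 // 0 ≤ p.2}

/-- The homeomorphisms of the plane that extend to a homeomorphism of the pair
(upper half-space, standard caps). Homeomorphisms of the closed half-space are the same as
homeomorphisms of its one-point compactification, a closed ball, that fix the point at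
infinity. -/
def extendable (n : ℕ) : Subgroup (ℂ ≃ₜ ℂ) where
  carrier := {f | ∃ F : UpperHalfSpace ≃ₜ UpperHalfSpace,
    (∀ z : ℂ, F ⟨(z, 0), le_refl 0⟩ = ⟨(f z, 0), le_refl 0⟩) ∧
    (∀ p : UpperHalfSpace, (F p : R3) ∈ caps n ↔ (p : R3) ∈ caps n)}
  one_mem' := ⟨Homeomorph.refl _, fun _ => rfl, fun _ => Iff.rfl⟩
  mul_mem' := by
    rintro f g ⟨F, hF, hF'⟩ ⟨G, hG, hG'⟩
    refine ⟨G.trans F, fun z => ?_, fun p => ?_⟩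
    · simp [hG, hF]
    · simp [hG', hF']
  inv_mem' := by
    rintro f ⟨F, hF, hF'⟩
    refine ⟨F.symm, fun z => ?_, fun p => ?_⟩
    · rw [Homeomorph.symm_apply_eq, hF]
      congr 2
      exact (f.apply_symm_apply z).symm
    · rw [← hF', F.apply_symm_apply]

/-- The Hilden subgroup `H_{2n}`: the braids whose action on the plane with its `2n` marked points
extends to a homeomorphism of the standard trivial tangle. -/
def hilden (n : ℕ) : Subgroup (BraidGroup (2 * n)) :=
  ((extendable n).comap (planeAction (2 * n))).map (PresentedGroup.mk (braidRels (2 * n)))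

/-- `P_{2n} = H_{2n} \ B_{2n} / H_{2n}`. -/
abbrev PlatClass (n : ℕ) : Type :=
  DoubleCoset.Quotient (hilden n : Set (BraidGroup (2 * n))) (hilden n)

/-- The double coset `[β]_H` of a braid. -/
def platClass {n : ℕ} (β : BraidGroup (2 * n)) : PlatClass n :=
  DoubleCoset.mk (hilden n) (hilden n) β

/-- The braids that lie in a double coset. -/
def PlatClass.elements {n : ℕ} (C : PlatClass n) : Set (BraidGroup (2 * n)) :=
  {β | platClass β = C}

/-! ### Links, link types, bridge number -/

/-- The three-sphere. -/
abbrev S3 : Type := OnePoint R3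

/-- Ambient isotopy of subsets of the three-sphere. -/
def AmbientIsotopic (K K' : Set S3) : Prop :=
  ∃ H : unitInterval → (S3 ≃ₜ S3), Continuous (fun p : unitInterval × S3 => H p.1 p.2) ∧
    H 0 = Homeomorph.refl S3 ∧ H 1 '' K = K'

/-- `k` disjoint smoothly embedded circles in three-space, parametrized with period one. -/
structure IsLinkParam {k : ℕ} (γ : Fin k → ℝ → R3) : Prop where
  smooth : ∀ i, ContDiff ℝ ∞ (γ i)
  periodic : ∀ i, Function.Periodic (γ i) 1
  immersed : ∀ i t, deriv (γ i) t ≠ 0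
  injective : ∀ i j, ∀ s ∈ Set.Ico (0 : ℝ) 1, ∀ t ∈ Set.Ico (0 : ℝ) 1,
    γ i s = γ j t → i = j ∧ s = t

/-- The set traced out by a system of curves, in the three-sphere. -/
def trace {k : ℕ} (γ : Fin k → ℝ → R3) : Set S3 :=
  {x | ∃ i t, x = ((γ i t : R3) : S3)}

/-- A link type: the ambient isotopy class of a smooth link with at least one component. -/
def IsLinkType (𝓛 : Set (Set S3)) : Prop :=
  ∃ (k : ℕ) (γ : Fin k → ℝ → R3), 1 ≤ k ∧ IsLinkParam γ ∧
    𝓛 = {K | AmbientIsotopic (trace γ) K}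

/-- The height of the `i`-th curve. -/
def height {k : ℕ} (γ : Fin k → ℝ → R3) (i : Fin k) (t : ℝ) : ℝ := (γ i t).2

/-- The critical points of the height function on a link. -/
def critical {k : ℕ} (γ : Fin k → ℝ → R3) : Set (Fin k × ℝ) :=
  {p | p.2 ∈ Set.Ico (0 : ℝ) 1 ∧ deriv (height γ p.1) p.2 = 0}

/-- A link in `n`-bridge position: the height function has exactly `2n` critical points on it, all
of them are non-degenerate, and every local maximum value is greater than every local minimum
value. -/
structure IsBridgePosition (n : ℕ) {k : ℕ} (γ : Fin k → ℝ → R3) : Prop where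
  isLink : IsLinkParam γ
  finite : (critical γ).Finite
  card : (critical γ).ncard = 2 * n
  nondegenerate : ∀ p ∈ critical γ, iteratedDeriv 2 (height γ p.1) p.2 ≠ 0
  separated : ∀ p ∈ critical γ, ∀ q ∈ critical γ,
    IsLocalMax (height γ p.1) p.2 → IsLocalMin (height γ q.1) q.2 →
      height γ q.1 q.2 < height γ p.1 p.2

/-- The bridge number: the least `m ≥ 1` such that the link type has an `m`-bridge position
(`⊤` if there is none). -/
def bridgeNumber (𝓛 : Set (Set S3)) : ℕ∞ :=
  sInf {b : ℕ∞ | ∃ m : ℕ, b = m ∧ 1 ≤ m ∧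
    ∃ (k : ℕ) (γ : Fin k → ℝ → R3), IsBridgePosition m γ ∧ trace γ ∈ 𝓛}

/-! ### Plat closures -/

/-- The exponent of a letter. -/
def letterSign (b : Bool) : ℝ := if b then 1 else -1

/-- The geometric braid of a word, drawn downwards from height `0`: the letter number `j` occupies
the heights from `-(j+1)` to `-j`, where, upwards, the marked points `0, …, 2n - 1` undergo the
half twist of that letter. -/
def strands {n : ℕ} (w : BraidWord (2 * n)) : Set R3 :=
  {p | ∃ (j : ℕ) (hj : j < w.length) (q : Fin (2 * n)), ∃ t ∈ Set.Icc (0 : ℝ) 1,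
    p = (twist (w[j]).1 (letterSign (w[j]).2 * t) ((q : ℕ) : ℂ), -((j : ℝ) + 1) + t)}

/-- The standard cups below the geometric braid: the mirror images of the caps. -/
def cups (n l : ℕ) : Set R3 :=
  {p | (p.1, -(l : ℝ) - p.2) ∈ caps n}

/-- The plat closure of a braid word, as a subset of the three-sphere. -/
def plat {n : ℕ} (w : BraidWord (2 * n)) : Set S3 :=
  (fun p : R3 => (p : S3)) '' (caps n ∪ strands w ∪ cups n w.length)

/-- The set `B^{(n)}(𝓛)` of braids whose plat closure lies in `𝓛`. (The isotopy class of the plat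
closure does not depend on the word that is used to draw the braid.) -/
def platBraids (n : ℕ) (𝓛 : Set (Set S3)) : Set (BraidGroup (2 * n)) :=
  {β | ∃ w : BraidWord (2 * n), w.toBraid = β ∧ plat w ∈ 𝓛}

/-! ### Canonical representatives -/

/-- A complexity function is proper if its sublevel sets are finite. -/
def ProperComplexity {m : ℕ} (c : BraidGroup m → ℕ) : Prop :=
  ∀ N : ℕ, {β | c β ≤ N}.Finite

/-- The elements of `S` of minimal complexity. -/
def minimalElements {m : ℕ} (c : BraidGroup m → ℕ) (S : Set (BraidGroup m)) :
    Set (BraidGroup m) :=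
  {β | β ∈ S ∧ c β = sInf (c '' S)}

/-- `r_{D,n}(C)`, the Dehornoy canonical representative of a double coset. -/
def cosetRep {n : ℕ} (c : BraidGroup (2 * n) → ℕ) (C : PlatClass n) : BraidGroup (2 * n) :=
  dehornoyMin (minimalElements c C.elements)

/-- `β_{D,𝓛}^{(n)}`, the global canonical braid of a link type. -/
def globalBraid {n : ℕ} (c : BraidGroup (2 * n) → ℕ) (𝓛 : Set (Set S3)) : BraidGroup (2 * n) :=
  dehornoyMin (minimalElements c (platBraids n 𝓛))

/-- `CanPlat_D^{(n)}(𝓛)`, the distinguished plat presentation class of a link type. -/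
def canPlat {n : ℕ} (c : BraidGroup (2 * n) → ℕ) (𝓛 : Set (Set S3)) : PlatClass n :=
  platClass (globalBraid c 𝓛)

end Plat

end

open scoped ContDiff

noncomputable section

namespace Plat

/-! ### A positive rational action of the braid group -/

/-! Three facts carry the theorem: `<_D` is a strict linear order, the set of braids with plat
closure in `𝓛` is a union of double cosets of the Hilden subgroup, and it is non-empty when the
bridge number is at most `n`. Granted these, the conclusion is formal (`canonical_representative`).
Properness makes each set of minimal elements finite, so it has a least element. The double coset of
the global least braid lies inside the set of all braids for `𝓛` and contains a global minimizer of
the complexity. Hence its minimal elements are exactly the global ones that lie in it, and the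
global least one is least among them.

Linearity of the order. A σ-positive braid is non-trivial because the braid group acts on sequences
of positive pairs by subtraction-free rational maps for which `σ_i` strictly increases one
coordinate of the entry `i`, and the generators of higher index leave that entry alone
(`not_sigmaPositive_one`). For comparability, a braid word is turned into a path in the finite graph
of left divisors of a power of the central full twist. Garside's theory gives this graph least
common multiples in both directions, and a confluence argument, by descending induction on the
lowest label used, rewrites any zigzag path as an equality or as a monotone path at its lowest label
(`sigmaPositive_trichotomy`).

Invariance. A braid whose plane homeomorphism extends over the caps can be created or absorbed
there: give the caps long vertical legs, then apply the extension above the legs and the braid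
motion on them. The resulting homeomorphism is the identity on a half-space, so Alexander's trick
makes it an ambient isotopy (`isotopic_of_eq_on_halfSpace`, `exists_homeo_absorb`). The cups are
treated by reflection.

Non-emptiness. A link in bridge position is tilted into general position and cut at its critical
points into monotone arcs that meet in pairs. Each tip is alone in its vertical line, so the maxima
can be lifted to one height and the minima lowered to another without a crossing. The arcs become
strands over an interval of heights, their ends are straightened into standard caps and cups, and
the middle is a path of configurations of points. Covering the configuration space by star-convex
charts, one for each ordering of the points, shows that such a path is homotopic to the motion of a
braid word (`exists_word_of_path`). Additional maxima and minima are inserted to pass from the given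
number of bridges to any larger one (`ArcSystem.exists_stabilization`). -/

/-- Sequences of pairs of positive real numbers. -/
abbrev PosSeq : Type := {s : ℕ → ℝ × ℝ // ∀ k, 0 < (s k).1 ∧ 0 < (s k).2}

/-- The subtraction-free rational Yang-Baxter map obtained from Dynnikov's coordinates. -/
def dynMap (p q : ℝ × ℝ) : (ℝ × ℝ) × (ℝ × ℝ) :=
  ((p.1 * (1 + p.2) + q.1 * p.2,
    q.2 * q.1 * p.2 / (q.1 * p.2 + p.1 * (1 + p.2) * (1 + q.2))),
   (p.1 * q.1 * q.2 / (q.1 + p.1 * (1 + q.2)),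
    p.2 + p.1 * (1 + p.2) * (1 + q.2) / q.1))

/-- The inverse of `dynMap`. -/
def dynInv (p q : ℝ × ℝ) : (ℝ × ℝ) × (ℝ × ℝ) :=
  ((p.1 * q.1 / (q.1 * (1 + p.2) + p.1 * p.2),
    q.2 * p.1 * p.2 / (p.1 * p.2 + (1 + p.2) * q.1 * (1 + q.2))),
   ((p.1 + q.1 * (1 + q.2)) / q.2,
    p.2 + (1 + p.2) * q.1 * (1 + q.2) / p.1))

/-- Apply a map of pairs to the entries `i` and `i + 1` of a sequence. -/
def applyAt {X : Type*} (f : X → X → X × X) (i : ℕ) (s : ℕ → X) (k : ℕ) : X :=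
  if k = i then (f (s i) (s (i + 1))).1 else
    if k = i + 1 then (f (s i) (s (i + 1))).2 else s k

theorem dynMap_pos {p q : ℝ × ℝ} (hp : 0 < p.1 ∧ 0 < p.2) (hq : 0 < q.1 ∧ 0 < q.2) :
    (0 < (dynMap p q).1.1 ∧ 0 < (dynMap p q).1.2) ∧
      (0 < (dynMap p q).2.1 ∧ 0 < (dynMap p q).2.2) := by
  obtain ⟨h1, h2⟩ := hp
  obtain ⟨h3, h4⟩ := hq
  refine ⟨⟨?_, ?_⟩, ⟨?_, ?_⟩⟩ <;> simp only [dynMap] <;> positivity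

theorem dynInv_pos {p q : ℝ × ℝ} (hp : 0 < p.1 ∧ 0 < p.2) (hq : 0 < q.1 ∧ 0 < q.2) :
    (0 < (dynInv p q).1.1 ∧ 0 < (dynInv p q).1.2) ∧
      (0 < (dynInv p q).2.1 ∧ 0 < (dynInv p q).2.2) := by
  obtain ⟨h1, h2⟩ := hp
  obtain ⟨h3, h4⟩ := hq
  refine ⟨⟨?_, ?_⟩, ⟨?_, ?_⟩⟩ <;> simp only [dynInv] <;> positivity

theorem dynInv_dynMap {p q : ℝ × ℝ} (hp : 0 < p.1 ∧ 0 < p.2) (hq : 0 < q.1 ∧ 0 < q.2) :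
    dynInv (dynMap p q).1 (dynMap p q).2 = (p, q) := by
  obtain ⟨a, b⟩ := p
  obtain ⟨c, d⟩ := q
  obtain ⟨h1, h2⟩ := hp
  obtain ⟨h3, h4⟩ := hq
  simp only at h1 h2 h3 h4
  simp only [dynMap, dynInv, Prod.mk.injEq]
  refine ⟨⟨?_, ?_⟩, ⟨?_, ?_⟩⟩ <;> field_simp <;> ring

theorem dynMap_dynInv {p q : ℝ × ℝ} (hp : 0 < p.1 ∧ 0 < p.2) (hq : 0 < q.1 ∧ 0 < q.2) :
    dynMap (dynInv p q).1 (dynInv p q).2 = (p, q) := by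
  obtain ⟨a, b⟩ := p
  obtain ⟨c, d⟩ := q
  obtain ⟨h1, h2⟩ := hp
  obtain ⟨h3, h4⟩ := hq
  simp only at h1 h2 h3 h4
  simp only [dynMap, dynInv, Prod.mk.injEq]
  refine ⟨⟨?_, ?_⟩, ⟨?_, ?_⟩⟩ <;> field_simp <;> ring

theorem dynMap_mk (a b c d : ℝ) : dynMap (a, b) (c, d) =
    ((a * (1 + b) + c * b, d * c * b / (c * b + a * (1 + b) * (1 + d))),
     (a * c * d / (c + a * (1 + d)), b + a * (1 + b) * (1 + d) / c)) := rfl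

/-- This lemma and the next three compute the two sides of the Yang–Baxter equation one application
at a time, in closed forms chosen so that the final results on both sides coincide literally. -/
theorem dynMap_left_right {a b c d e f : ℝ} (h1 : 0 < a) (h2 : 0 < b) (h3 : 0 < c) (h4 : 0 < d)
    (h5 : 0 < e) (h6 : 0 < f) :
    dynMap (a * c * d / (c + a * (1 + d)), b + a * (1 + b) * (1 + d) / c) (e, f) =
    (((a * c * d * (1 + b) + e * (c * b + a * (1 + b) * (1 + d))) / c,
      e * f * (c * b + a * (1 + b) * (1 + d)) /
        (e * (c * b + a * (1 + b) * (1 + d)) + a * c * d * (1 + b) * (1 + f))),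
     (a * c * d * e * f / (e * (c + a * (1 + d)) + a * c * d * (1 + f)),
      (e * (c * b + a * (1 + b) * (1 + d)) + a * c * d * (1 + b) * (1 + f)) / (c * e))) := by
  have key : a * c * d / (c + a * (1 + d)) * (1 + (b + a * (1 + b) * (1 + d) / c)) =
      a * d * (1 + b) := by
    field_simp; ring
  rw [dynMap_mk, key]
  simp only [Prod.mk.injEq]
  refine ⟨⟨?_, ?_⟩, ⟨?_, ?_⟩⟩ <;> field_simp

theorem dynMap_left {a b c d e f : ℝ} (h1 : 0 < a) (h2 : 0 < b) (h3 : 0 < c) (h4 : 0 < d)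
    (h5 : 0 < e) (h6 : 0 < f) :
    dynMap (a * (1 + b) + c * b, d * c * b / (c * b + a * (1 + b) * (1 + d)))
      ((a * c * d * (1 + b) + e * (c * b + a * (1 + b) * (1 + d))) / c,
      e * f * (c * b + a * (1 + b) * (1 + d)) /
        (e * (c * b + a * (1 + b) * (1 + d)) + a * c * d * (1 + b) * (1 + f))) =
    ((a * (1 + b) + b * c * (1 + d) + e * b * d,
      e * f * b * d / (b * (e * d + c * (1 + d) * (1 + f)) + a * (1 + b) * (1 + f))),
     ((a * (1 + b) + c * b) * e * f / (e + c * (1 + f)),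
      c * (b * (e * d + c * (1 + d) * (1 + f)) + a * (1 + b) * (1 + f)) /
        (e * (c * b + a * (1 + b) * (1 + d)) + a * c * d * (1 + b) * (1 + f)))) := by
  obtain ⟨S, hS⟩ : ∃ S, S = c * b + a * (1 + b) * (1 + d) := ⟨_, rfl⟩
  obtain ⟨A, hA⟩ : ∃ A, A = a * (1 + b) + c * b := ⟨_, rfl⟩
  obtain ⟨U, hU⟩ : ∃ U, U = e * S + a * c * d * (1 + b) * (1 + f) := ⟨_, rfl⟩
  obtain ⟨Q, hQ⟩ : ∃ Q, Q = a * c * d * (1 + b) + e * S := ⟨_, rfl⟩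
  obtain ⟨K, hK⟩ : ∃ K, K = b * (e * d + c * (1 + d) * (1 + f)) + a * (1 + b) * (1 + f) :=
    ⟨_, rfl⟩
  have pS : 0 < S := by rw [hS]; positivity
  have pA : 0 < A := by rw [hA]; positivity
  have pU : 0 < U := by rw [hU]; positivity
  have pQ : 0 < Q := by rw [hQ]; positivity
  have pK : 0 < K := by rw [hK]; positivity
  rw [← hS, ← hA, ← hU, ← hQ, ← hK, dynMap_mk]
  -- The second coordinates enter the map through `1 +` themselves; these expressions factor into
  -- the named polynomials, which makes the cancellations visible.
  have k1 : 1 + d * c * b / S = (1 + d) * A / S := by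
    field_simp; rw [hS, hA]; ring
  have k2 : 1 + e * f * S / U = (1 + f) * Q / U := by
    field_simp; rw [hU, hQ]; ring
  have k3 : U + c * A * (1 + f) = S * (e + c * (1 + f)) := by
    rw [hU, hA, hS]; ring
  have k4 : b * d * U + A ^ 2 * (1 + d) * (1 + f) = S * K := by
    rw [hU, hA, hK, hS]; ring
  have k5 : Q / c * (d * c * b / S) + A * ((1 + d) * A / S) * ((1 + f) * Q / U) = Q * K / U := by
    field_simp; linear_combination k4
  have k6 : Q / c + A * ((1 + f) * Q / U) = Q * S * (e + c * (1 + f)) / (c * U) := by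
    field_simp; linear_combination k3
  rw [k1, k2, k5, k6]
  simp only [Prod.mk.injEq]
  refine ⟨⟨?_, ?_⟩, ⟨?_, ?_⟩⟩
  · field_simp; rw [hQ, hA, hS]; ring
  · field_simp
  · field_simp
  · field_simp; linear_combination k4

theorem dynMap_right_left {a b c d e f : ℝ} (h1 : 0 < a) (h2 : 0 < b) (h3 : 0 < c) (h4 : 0 < d)
    (h5 : 0 < e) (h6 : 0 < f) :
    dynMap (a, b) (c * (1 + d) + e * d, f * e * d / (e * d + c * (1 + d) * (1 + f))) =
    ((a * (1 + b) + b * c * (1 + d) + e * b * d,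
      e * f * b * d / (b * (e * d + c * (1 + d) * (1 + f)) + a * (1 + b) * (1 + f))),
     (a * d * e * f / (e * d + c * (1 + d) * (1 + f) + a * (1 + f)),
      (b * (e * d + c * (1 + d) * (1 + f)) + a * (1 + b) * (1 + f)) /
        (e * d + c * (1 + d) * (1 + f)))) := by
  have k : 1 + f * e * d / (e * d + c * (1 + d) * (1 + f)) =
      (1 + f) * (c * (1 + d) + e * d) / (e * d + c * (1 + d) * (1 + f)) := by
    field_simp; ring
  rw [dynMap_mk, k]
  obtain ⟨S, hS⟩ : ∃ S, S = e * d + c * (1 + d) * (1 + f) := ⟨_, rfl⟩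
  have pS : 0 < S := by rw [hS]; positivity
  rw [← hS]
  simp only [Prod.mk.injEq]
  refine ⟨⟨?_, ?_⟩, ⟨?_, ?_⟩⟩
  · ring
  · field_simp
  · field_simp
  · field_simp

theorem dynMap_right {a b c d e f : ℝ} (h1 : 0 < a) (h2 : 0 < b) (h3 : 0 < c) (h4 : 0 < d)
    (h5 : 0 < e) (h6 : 0 < f) :
    dynMap (a * d * e * f / (e * d + c * (1 + d) * (1 + f) + a * (1 + f)),
      (b * (e * d + c * (1 + d) * (1 + f)) + a * (1 + b) * (1 + f)) /
        (e * d + c * (1 + d) * (1 + f)))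
      (c * e * f / (e + c * (1 + f)), d + c * (1 + d) * (1 + f) / e) =
    (((a * (1 + b) + c * b) * e * f / (e + c * (1 + f)),
      c * (b * (e * d + c * (1 + d) * (1 + f)) + a * (1 + b) * (1 + f)) /
        (e * (c * b + a * (1 + b) * (1 + d)) + a * c * d * (1 + b) * (1 + f))),
     (a * c * d * e * f / (e * (c + a * (1 + d)) + a * c * d * (1 + f)),
      (e * (c * b + a * (1 + b) * (1 + d)) + a * c * d * (1 + b) * (1 + f)) / (c * e))) := by
  obtain ⟨S, hS⟩ : ∃ S, S = e * d + c * (1 + d) * (1 + f) := ⟨_, rfl⟩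
  obtain ⟨T, hT⟩ : ∃ T, T = e + c * (1 + f) := ⟨_, rfl⟩
  obtain ⟨L, hL⟩ : ∃ L, L = S + a * (1 + f) := ⟨_, rfl⟩
  obtain ⟨K, hK⟩ : ∃ K, K = b * S + a * (1 + b) * (1 + f) := ⟨_, rfl⟩
  obtain ⟨U, hU⟩ : ∃ U, U = e * (c * b + a * (1 + b) * (1 + d)) + a * c * d * (1 + b) * (1 + f) :=
    ⟨_, rfl⟩
  obtain ⟨V, hV⟩ : ∃ V, V = e * (c + a * (1 + d)) + a * c * d * (1 + f) := ⟨_, rfl⟩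
  have pS : 0 < S := by rw [hS]; positivity
  have pT : 0 < T := by rw [hT]; positivity
  have pL : 0 < L := by rw [hL]; positivity
  have pK : 0 < K := by rw [hK]; positivity
  have pU : 0 < U := by rw [hU]; positivity
  have pV : 0 < V := by rw [hV]; positivity
  have k0 : d + c * (1 + d) * (1 + f) / e = S / e := by
    field_simp; rw [hS]; ring
  rw [k0, ← hS, ← hT, ← hL, ← hK, ← hU, ← hV, dynMap_mk]
  have k1 : 1 + K / S = (1 + b) * L / S := by
    field_simp; rw [hK, hL]; ring
  have k2 : 1 + S / e = (1 + d) * T / e := by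
    field_simp; rw [hS, hT]; ring
  have k3 : a * d * (1 + b) * T + c * K = (a * (1 + b) + c * b) * S := by
    rw [hT, hK, hS]; ring
  have k4 : c * e * K + a * d * (1 + b) * (1 + d) * T ^ 2 = S * U := by
    rw [hK, hU, hT, hS]; ring
  have k6 : c * e * L + a * d * (1 + d) * T ^ 2 = S * V := by
    rw [hL, hV, hT, hS]; ring
  have k7 : c * e * f / T * (K / S) + a * d * e * f / L * ((1 + b) * L / S) * ((1 + d) * T / e) =
      f * U / T := by
    field_simp; linear_combination k4
  have k8 : c * e * f / T + a * d * e * f / L * ((1 + d) * T / e) = f * S * V / (T * L) := by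
    field_simp; linear_combination k6
  rw [k1, k2, k7, k8]
  simp only [Prod.mk.injEq]
  refine ⟨⟨?_, ?_⟩, ⟨?_, ?_⟩⟩
  · field_simp; linear_combination k3
  · field_simp
  · field_simp
  · field_simp; linear_combination k4

/-- The three entries of the two triple composites agree; this is the braid relation for `dynPerm`.
-/
theorem dynMap_yangBaxter {p q r : ℝ × ℝ} (hp : 0 < p.1 ∧ 0 < p.2) (hq : 0 < q.1 ∧ 0 < q.2)
    (hr : 0 < r.1 ∧ 0 < r.2) :
    (dynMap (dynMap p q).1 (dynMap (dynMap p q).2 r).1).1 = (dynMap p (dynMap q r).1).1 ∧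
    (dynMap (dynMap p q).1 (dynMap (dynMap p q).2 r).1).2 =
      (dynMap (dynMap p (dynMap q r).1).2 (dynMap q r).2).1 ∧
    (dynMap (dynMap p q).2 r).2 =
      (dynMap (dynMap p (dynMap q r).1).2 (dynMap q r).2).2 := by
  obtain ⟨a, b⟩ := p
  obtain ⟨c, d⟩ := q
  obtain ⟨e, f⟩ := r
  obtain ⟨h1, h2⟩ := hp
  obtain ⟨h3, h4⟩ := hq
  obtain ⟨h5, h6⟩ := hr
  rw [dynMap_mk a b c d, dynMap_mk c d e f, dynMap_left_right h1 h2 h3 h4 h5 h6,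
    dynMap_left h1 h2 h3 h4 h5 h6, dynMap_right_left h1 h2 h3 h4 h5 h6,
    dynMap_right h1 h2 h3 h4 h5 h6]
  exact ⟨rfl, rfl, rfl⟩

theorem applyAt_pos {f : ℝ × ℝ → ℝ × ℝ → (ℝ × ℝ) × (ℝ × ℝ)}
    (hf : ∀ {p q : ℝ × ℝ}, 0 < p.1 ∧ 0 < p.2 → 0 < q.1 ∧ 0 < q.2 →
      (0 < (f p q).1.1 ∧ 0 < (f p q).1.2) ∧ (0 < (f p q).2.1 ∧ 0 < (f p q).2.2))
    (i : ℕ) (s : PosSeq) (k : ℕ) : 0 < (applyAt f i s.1 k).1 ∧ 0 < (applyAt f i s.1 k).2 := by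
  unfold applyAt
  split_ifs
  · exact (hf (s.2 _) (s.2 _)).1
  · exact (hf (s.2 _) (s.2 _)).2
  · exact s.2 k

/-- The permutation of positive sequences assigned to a braid generator. -/
def dynPerm (i : ℕ) : Equiv.Perm PosSeq where
  toFun s := ⟨applyAt dynMap i s.1, applyAt_pos dynMap_pos i s⟩
  invFun s := ⟨applyAt dynInv i s.1, applyAt_pos dynInv_pos i s⟩
  left_inv s := by
    ext1; funext k
    have := dynInv_dynMap (s.2 i) (s.2 (i + 1))
    by_cases h1 : k = i
    · subst h1; simp [applyAt, this]
    by_cases h2 : k = i + 1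
    · subst h2; simp [applyAt, this]
    simp [applyAt, h1, h2]
  right_inv s := by
    ext1; funext k
    have := dynMap_dynInv (s.2 i) (s.2 (i + 1))
    by_cases h1 : k = i
    · subst h1; simp [applyAt, this]
    by_cases h2 : k = i + 1
    · subst h2; simp [applyAt, this]
    simp [applyAt, h1, h2]

theorem dynPerm_comm {i j : ℕ} (h : i + 2 ≤ j) :
    dynPerm i * dynPerm j = dynPerm j * dynPerm i := by
  ext1 s; ext1; funext k
  simp only [dynPerm, Equiv.Perm.coe_mul, Function.comp, Equiv.coe_fn_mk, applyAt]
  have e1 : i ≠ j := by omega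
  have e2 : i + 1 ≠ j := by omega
  have e3 : i ≠ j + 1 := by omega
  have e4 : j ≠ i + 1 := by omega
  have e5 : j + 1 ≠ i + 1 := by omega
  simp only [e1, e1.symm, e2, e3, e3.symm, e4, e5, e5.symm, if_false]
  by_cases h1 : k = i <;> by_cases h2 : k = i + 1 <;> by_cases h3 : k = j <;>
    by_cases h4 : k = j + 1 <;> simp only [h1, h2, h3, h4, if_true, if_false] <;> first | rfl | omega | simp_all

theorem dynPerm_braid (i : ℕ) :
    dynPerm i * dynPerm (i + 1) * dynPerm i = dynPerm (i + 1) * dynPerm i * dynPerm (i + 1) := by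
  ext1 s; ext1; funext k
  have := dynMap_yangBaxter (s.2 i) (s.2 (i + 1)) (s.2 (i + 1 + 1))
  simp only [dynPerm, Equiv.Perm.coe_mul, Function.comp, Equiv.coe_fn_mk, applyAt]
  have e1 : i ≠ i + 1 + 1 := by omega
  by_cases h1 : k = i
  · subst h1; simp [e1, e1.symm, this.1]
  by_cases h2 : k = i + 1
  · subst h2; simp [e1, e1.symm, this.2.1]
  by_cases h3 : k = i + 1 + 1
  · subst h3; simp [e1, e1.symm, this.2.2]
  simp [h1, h2, h3]

/-- The action of the braid group on positive sequences. -/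
def dynAction (m : ℕ) : BraidGroup m →* Equiv.Perm PosSeq :=
  PresentedGroup.toGroup (f := fun i : Fin (m - 1) => dynPerm i) (by
    rintro r (⟨i, j, h, rfl⟩ | ⟨i, j, h, rfl⟩)
    · simp only [map_mul, map_inv, FreeGroup.lift_apply_of]
      rw [dynPerm_comm h, mul_inv_cancel]
    · simp only [map_mul, map_inv, FreeGroup.lift_apply_of]
      rw [← h, dynPerm_braid, mul_inv_cancel])

/-! ### Braid words under the action, and the irreflexivity of σ-positivity -/

/-- The generator of the braid group. -/
def sig {m : ℕ} (i : Fin (m - 1)) : BraidGroup m := PresentedGroup.of i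

/-- The braid of a letter. -/
def letterBraid {m : ℕ} (x : Fin (m - 1) × Bool) : BraidGroup m :=
  if x.2 then sig x.1 else (sig x.1)⁻¹

theorem toBraid_nil {m : ℕ} : BraidWord.toBraid ([] : BraidWord m) = 1 := rfl

theorem toBraid_append {m : ℕ} (u v : BraidWord m) :
    BraidWord.toBraid (u ++ v) = BraidWord.toBraid u * BraidWord.toBraid v := by
  unfold BraidWord.toBraid
  rw [← map_mul, FreeGroup.mul_mk]

theorem toBraid_singleton {m : ℕ} (x : Fin (m - 1) × Bool) :
    BraidWord.toBraid [x] = letterBraid x := by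
  obtain ⟨i, b⟩ := x
  cases b
  · rfl
  · rfl

theorem toBraid_cons {m : ℕ} (x : Fin (m - 1) × Bool) (v : BraidWord m) :
    BraidWord.toBraid (x :: v) = letterBraid x * BraidWord.toBraid v := by
  rw [← toBraid_singleton, ← toBraid_append]; rfl

theorem toBraid_surjective {m : ℕ} (β : BraidGroup m) : ∃ w : BraidWord m, w.toBraid = β := by
  obtain ⟨g, rfl⟩ := PresentedGroup.mk_surjective _ β
  exact ⟨g.toWord, by rw [BraidWord.toBraid, FreeGroup.mk_toWord]⟩

theorem dynAction_sig {m : ℕ} (i : Fin (m - 1)) : dynAction m (sig i) = dynPerm i :=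
  PresentedGroup.toGroup.of _

/-- The new coordinate is the old one plus products of positive numbers. This monotone quantity is
what the action is needed for. -/
theorem dynPerm_fst_lt (i : ℕ) (s : PosSeq) : (s.1 i).1 < ((dynPerm i s).1 i).1 := by
  have h1 := s.2 i
  have h2 := s.2 (i + 1)
  have h3 := mul_pos h1.1 h1.2
  have h4 := mul_pos h2.1 h1.2
  simp only [dynPerm, Equiv.coe_fn_mk, applyAt, dynMap, if_true]
  nlinarith

theorem dynPerm_apply_of_lt {i j : ℕ} (h : i < j) (s : PosSeq) :
    (dynPerm j s).1 i = s.1 i := by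
  simp only [dynPerm, Equiv.coe_fn_mk, applyAt]
  rw [if_neg (by omega), if_neg (by omega)]

theorem dynPerm_inv_apply_of_lt {i j : ℕ} (h : i < j) (s : PosSeq) :
    ((dynPerm j)⁻¹ s).1 i = s.1 i := by
  change ((dynPerm j).symm s).1 i = s.1 i
  simp only [dynPerm, Equiv.coe_fn_symm_mk, applyAt]
  rw [if_neg (by omega), if_neg (by omega)]

/-- A word in which `i` is the lowest index and occurs with positive exponents only does not
represent the trivial braid. -/
theorem dynAction_le {m : ℕ} (i : Fin (m - 1)) (s : PosSeq) (w : BraidWord m)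
    (hneg : (i, false) ∉ w) (hlow : ∀ x ∈ w, i ≤ x.1) :
    (s.1 i).1 ≤ ((dynAction m w.toBraid s).1 i).1 ∧
      ((i, true) ∈ w → (s.1 i).1 < ((dynAction m w.toBraid s).1 i).1) := by
  induction w with
  | nil => simp [toBraid_nil]
  | cons x w ih =>
    have ih := ih (fun h => hneg (List.mem_cons_of_mem _ h))
      (fun y hy => hlow y (List.mem_cons_of_mem _ hy))
    -- The head letter acts last, after the rest of the word has produced `t`.
    rw [toBraid_cons, map_mul, Equiv.Perm.mul_apply]
    set t := dynAction m (BraidWord.toBraid w) s with ht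
    obtain ⟨j, b⟩ := x
    have hj : i ≤ j := hlow (j, b) List.mem_cons_self
    rcases eq_or_lt_of_le hj with rfl | hj
    · have hb : b = true := by
        by_contra hb
        exact hneg (by simp [Bool.eq_false_of_not_eq_true hb])
      subst hb
      have : (t.1 i).1 < ((dynAction m (letterBraid (i, true)) t).1 i).1 := by
        rw [letterBraid, if_pos rfl, dynAction_sig]; exact dynPerm_fst_lt _ _
      exact ⟨by linarith [ih.1], fun _ => by linarith [ih.1]⟩
    · have : (dynAction m (letterBraid (j, b)) t).1 i = t.1 i := by
        cases b
        · simp only [letterBraid, Bool.false_eq_true, if_false, map_inv, dynAction_sig]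
          exact dynPerm_inv_apply_of_lt hj t
        · simp only [letterBraid, if_true, dynAction_sig]
          exact dynPerm_apply_of_lt hj t
      rw [this]
      refine ⟨ih.1, fun h => ih.2 ?_⟩
      rcases List.mem_cons.1 h with h | h
      · exact absurd (congrArg Prod.fst h) (ne_of_lt hj)
      · exact h

/-- The first coordinate at the lowest index would strictly increase under the identity; any base
point serves, here the constant sequence. -/
theorem not_sigmaPositive_one {m : ℕ} : ¬ SigmaPositive (1 : BraidGroup m) := by
  rintro ⟨w, hw, i, h1, h2, h3⟩
  have := (dynAction_le i ⟨fun _ => (1, 1), fun _ => by simp⟩ w h2 h3).2 h1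
  simp [hw] at this

/-- Concatenate the words: the smaller of the two lowest indices is the lowest one of the product,
and it still occurs only positively. This is the transitivity of the order. -/
theorem SigmaPositive.mul {m : ℕ} {α β : BraidGroup m} (hα : SigmaPositive α)
    (hβ : SigmaPositive β) : SigmaPositive (α * β) := by
  obtain ⟨u, rfl, i, hi, hi', hil⟩ := hα
  obtain ⟨v, rfl, j, hj, hj', hjl⟩ := hβ
  refine ⟨u ++ v, toBraid_append u v, ?_⟩
  rcases lt_trichotomy i j with h | rfl | h
  · refine ⟨i, by simp [hi], ?_, ?_⟩
    · simp only [List.mem_append, not_or]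
      exact ⟨hi', fun h' => absurd (hjl _ h') (not_le.2 h)⟩
    · intro x hx
      rcases List.mem_append.1 hx with hx | hx
      · exact hil x hx
      · exact h.le.trans (hjl x hx)
  · refine ⟨i, by simp [hi], by simp [hi', hj'], ?_⟩
    intro x hx
    rcases List.mem_append.1 hx with hx | hx
    · exact hil x hx
    · exact hjl x hx
  · refine ⟨j, by simp [hj], ?_, ?_⟩
    · simp only [List.mem_append, not_or]
      exact ⟨fun h' => absurd (hil _ h') (not_le.2 h), hj'⟩
    · intro x hx
      rcases List.mem_append.1 hx with hx | hx
      · exact h.le.trans (hil x hx)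
      · exact hjl x hx

/-! ### The positive braid monoid -/

/-- Indices of commuting generators. -/
def Far {N : ℕ} (i j : Fin N) : Prop := (i : ℕ) + 2 ≤ j ∨ (j : ℕ) + 2 ≤ i

/-- Adjacent indices. -/
def Adj {N : ℕ} (i j : Fin N) : Prop := (i : ℕ) + 1 = j ∨ (j : ℕ) + 1 = i

theorem Far.symm {N : ℕ} {i j : Fin N} (h : Far i j) : Far j i := Or.symm h

theorem Adj.symm {N : ℕ} {i j : Fin N} (h : Adj i j) : Adj j i := Or.symm h

theorem eq_or_far_or_adj {N : ℕ} (i j : Fin N) : i = j ∨ Far i j ∨ Adj i j := by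
  unfold Far Adj
  rcases lt_trichotomy (i : ℕ) j with h | h | h
  · omega
  · exact Or.inl (Fin.ext h)
  · omega

/-- One application of a braid relation to a positive word. -/
inductive BraidMove {N : ℕ} : List (Fin N) → List (Fin N) → Prop
  | comm (u v : List (Fin N)) (i j : Fin N) (h : Far i j) :
      BraidMove (u ++ i :: j :: v) (u ++ j :: i :: v)
  | braid (u v : List (Fin N)) (i j : Fin N) (h : Adj i j) :
      BraidMove (u ++ i :: j :: i :: v) (u ++ j :: i :: j :: v)

theorem BraidMove.symm {N : ℕ} {a b : List (Fin N)} (h : BraidMove a b) : BraidMove b a := by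
  cases h with
  | comm u v i j h => exact .comm u v j i h.symm
  | braid u v i j h => exact .braid u v j i h.symm

theorem BraidMove.length_eq {N : ℕ} {a b : List (Fin N)} (h : BraidMove a b) :
    a.length = b.length := by
  cases h <;> simp

theorem BraidMove.append_left {N : ℕ} {a b : List (Fin N)} (h : BraidMove a b)
    (w : List (Fin N)) : BraidMove (w ++ a) (w ++ b) := by
  cases h with
  | comm u v i j h => simpa using BraidMove.comm (w ++ u) v i j h
  | braid u v i j h => simpa using BraidMove.braid (w ++ u) v i j h

theorem BraidMove.append_right {N : ℕ} {a b : List (Fin N)} (h : BraidMove a b)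
    (w : List (Fin N)) : BraidMove (a ++ w) (b ++ w) := by
  cases h with
  | comm u v i j h => simpa using BraidMove.comm u (v ++ w) i j h
  | braid u v i j h => simpa using BraidMove.braid u (v ++ w) i j h

theorem BraidMove.reverse {N : ℕ} {a b : List (Fin N)} (h : BraidMove a b) :
    BraidMove a.reverse b.reverse := by
  cases h with
  | comm u v i j h => simpa using BraidMove.comm v.reverse u.reverse j i h.symm
  | braid u v i j h => simpa using BraidMove.braid v.reverse u.reverse i j h

/-- The congruence of positive words generated by the braid relations. -/
def posCon (N : ℕ) : Con (FreeMonoid (Fin N)) where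
  r a b := Relation.ReflTransGen BraidMove a.toList b.toList
  iseqv := ⟨fun _ => .refl,
    fun h => by
      have : Std.Symm (BraidMove (N := N)) := ⟨fun _ _ h => h.symm⟩
      exact Relation.ReflTransGen.stdSymm.symm _ _ h, fun h h' => h.trans h'⟩
  mul' {a b c d} h h' := by
    have h1 : Relation.ReflTransGen BraidMove (a.toList ++ c.toList) (b.toList ++ c.toList) :=
      h.lift (· ++ c.toList) fun _ _ h => h.append_right _
    have h2 : Relation.ReflTransGen BraidMove (b.toList ++ c.toList) (b.toList ++ d.toList) :=
      h'.lift (b.toList ++ ·) fun _ _ h => h.append_left _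
    exact h1.trans h2

/-- The positive braid monoid with `N` generators. -/
abbrev PosMonoid (N : ℕ) : Type := (posCon N).Quotient

/-- The class of a positive word. -/
def pw {N : ℕ} (a : List (Fin N)) : PosMonoid N := ((FreeMonoid.ofList a : FreeMonoid (Fin N)) :)

/-- A generator of the positive braid monoid. -/
def pg {N : ℕ} (i : Fin N) : PosMonoid N := pw [i]

theorem pw_eq {N : ℕ} {a b : List (Fin N)} :
    pw a = pw b ↔ Relation.ReflTransGen BraidMove a b := (posCon N).eq

theorem pw_append {N : ℕ} (a b : List (Fin N)) : pw (a ++ b) = pw a * pw b := rfl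

theorem pw_cons {N : ℕ} (i : Fin N) (b : List (Fin N)) : pw (i :: b) = pg i * pw b := rfl

theorem pw_nil {N : ℕ} : pw ([] : List (Fin N)) = 1 := rfl

theorem pw_surjective {N : ℕ} (x : PosMonoid N) : ∃ a, pw a = x := by
  obtain ⟨a, rfl⟩ := (posCon N).mk'_surjective x
  exact ⟨a.toList, rfl⟩

theorem length_eq_of_pw_eq {N : ℕ} {a b : List (Fin N)} (h : pw a = pw b) :
    a.length = b.length := by
  rw [pw_eq] at h
  induction h with
  | refl => rfl
  | tail _ h ih => exact ih.trans h.length_eq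

theorem pg_comm {N : ℕ} {i j : Fin N} (h : Far i j) (x : PosMonoid N) :
    pg i * (pg j * x) = pg j * (pg i * x) := by
  obtain ⟨a, rfl⟩ := pw_surjective x
  rw [← pw_cons, ← pw_cons, ← pw_cons, ← pw_cons, pw_eq]
  exact .single (.comm [] a i j h)

theorem pg_braid {N : ℕ} {i j : Fin N} (h : Adj i j) (x : PosMonoid N) :
    pg i * (pg j * (pg i * x)) = pg j * (pg i * (pg j * x)) := by
  obtain ⟨a, rfl⟩ := pw_surjective x
  simp only [← pw_cons]
  rw [pw_eq]
  exact .single (.braid [] a i j h)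

/-- The length of a positive braid. -/
def plen {N : ℕ} (x : PosMonoid N) : ℕ := (pw_surjective x).choose.length

theorem plen_pw {N : ℕ} (a : List (Fin N)) : plen (pw a) = a.length :=
  length_eq_of_pw_eq (pw_surjective (pw a)).choose_spec

theorem plen_pg_mul {N : ℕ} (i : Fin N) (x : PosMonoid N) : plen (pg i * x) = plen x + 1 := by
  obtain ⟨a, rfl⟩ := pw_surjective x
  rw [← pw_cons, plen_pw, plen_pw, List.length_cons]

/-- The conclusion of Garside's theorem on common multiples. -/
def HasLcm {N : ℕ} (i k : Fin N) (A B : PosMonoid N) : Prop :=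
  (i = k → A = B) ∧ (Far i k → ∃ C, A = pg k * C ∧ B = pg i * C) ∧
    (Adj i k → ∃ C, A = pg k * (pg i * C) ∧ B = pg i * (pg k * C))

theorem not_adj_self {N : ℕ} (i : Fin N) : ¬ Adj i i := by unfold Adj; omega

theorem not_far_self {N : ℕ} (i : Fin N) : ¬ Far i i := by unfold Far; omega

theorem Far.not_adj {N : ℕ} {i j : Fin N} (h : Far i j) : ¬ Adj i j := by
  unfold Far at h; unfold Adj; omega

/-- Inductive step for Garside's theorem when the chain of moves from a word beginning with `i`
commutes the heads `j`, `k` of its last word. The common multiple of `i` and `j` is known, and the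
remaining relations concern shorter elements, so `ih` resolves them in each relative position of
`i`, `j`, `k`. -/
theorem hasLcm_far_step {N r : ℕ} (ih : ∀ (A B : PosMonoid N) (i k : Fin N), plen A < r →
      pg i * A = pg k * B → HasLcm i k A B)
    {i j k : Fin N} {A D : PosMonoid N} (hr : plen D + 1 = r)
    (hjk : Far j k) (h : HasLcm i j A (pg k * D)) : HasLcm i k A (pg j * D) := by
  rcases eq_or_far_or_adj i j with rfl | hij | hij
  · exact ⟨fun e => absurd (e ▸ hjk) (not_far_self _), fun _ => ⟨D, h.1 rfl, rfl⟩,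
      fun e => absurd e hjk.not_adj⟩
  · obtain ⟨C, hA, hC⟩ := h.2.1 hij
    have H := ih D C k i (by omega) hC
    refine ⟨?_, fun hik => ?_, fun hik => ?_⟩
    · rintro rfl
      rw [hA, H.1 rfl]
    · obtain ⟨E, hD, hC'⟩ := H.2.1 hik.symm
      exact ⟨pg j * E, by rw [hA, hC', pg_comm hjk], by rw [hD, pg_comm hij.symm]⟩
    · obtain ⟨E, hD, hC'⟩ := H.2.2 hik.symm
      exact ⟨pg j * E, by rw [hA, hC', pg_comm hjk, pg_comm hij.symm],
        by rw [hD, pg_comm hij.symm, pg_comm hjk]⟩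
  · obtain ⟨C, hA, hC⟩ := h.2.2 hij
    have lC := congrArg plen hC
    simp only [plen_pg_mul] at lC
    have H := ih D (pg j * C) k i (by omega) hC
    refine ⟨?_, fun hik => ?_, fun hik => ?_⟩
    · rintro rfl
      exact absurd hij hjk.symm.not_adj
    · obtain ⟨E, hD, hC'⟩ := H.2.1 hik.symm
      obtain ⟨F, hC2, hE⟩ := (ih C E j k (by omega) hC').2.1 hjk
      exact ⟨pg j * (pg i * F), by rw [hA, hC2, pg_comm hik, pg_comm hjk],
        by rw [hD, hE, pg_braid hij.symm]⟩
    · obtain ⟨E, hD, hC'⟩ := H.2.2 hik.symm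
      have lE := congrArg plen hD
      simp only [plen_pg_mul] at lE
      obtain ⟨F, hC2, hE⟩ := (ih C (pg i * E) j k (by omega) hC').2.1 hjk
      obtain ⟨G, hE2, hF⟩ := (ih E F i j (by omega) hE).2.2 hij
      refine ⟨pg j * (pg i * (pg k * G)), ?_, ?_⟩
      · rw [hA, hC2, hF, pg_braid hik, pg_comm hjk, pg_comm hjk.symm G, pg_braid hij.symm]
      · rw [hD, hE2, pg_comm hjk.symm, pg_braid hij.symm, pg_braid hik, pg_comm hjk]

/-- The same step when the last move is a braid relation between the heads `j` and `k`. -/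
theorem hasLcm_adj_step {N r : ℕ} (ih : ∀ (A B : PosMonoid N) (i k : Fin N), plen A < r →
      pg i * A = pg k * B → HasLcm i k A B)
    {i j k : Fin N} {A D : PosMonoid N} (hr : plen D + 2 = r)
    (hjk : Adj j k) (h : HasLcm i j A (pg k * (pg j * D))) :
    HasLcm i k A (pg j * (pg k * D)) := by
  rcases eq_or_far_or_adj i j with rfl | hij | hij
  · exact ⟨fun e => absurd (e ▸ hjk) (not_adj_self _), fun e => absurd hjk e.not_adj,
      fun _ => ⟨D, h.1 rfl, rfl⟩⟩
  · obtain ⟨C, hA, hC⟩ := h.2.1 hij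
    have lC := congrArg plen hC
    simp only [plen_pg_mul] at lC
    have H := ih (pg j * D) C k i (by rw [plen_pg_mul]; omega) hC
    refine ⟨?_, fun hik => ?_, fun hik => ?_⟩
    · rintro rfl
      exact absurd hjk hij.symm.not_adj
    · obtain ⟨E, hD, hC'⟩ := H.2.1 hik.symm
      obtain ⟨F, hD2, hE⟩ := (ih D E j i (by omega) hD).2.1 hij.symm
      exact ⟨pg j * (pg k * F), by rw [hA, hC', hE, pg_braid hjk],
        by rw [hD2, pg_comm hik.symm, pg_comm hij.symm]⟩
    · obtain ⟨E, hD, hC'⟩ := H.2.2 hik.symm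
      have lE := congrArg plen hD
      simp only [plen_pg_mul] at lE
      obtain ⟨F, hD2, hE⟩ := (ih D (pg k * E) j i (by omega) hD).2.1 hij.symm
      obtain ⟨G, hE2, hF⟩ := (ih E F k j (by omega) hE).2.2 hjk.symm
      refine ⟨pg j * (pg k * (pg i * G)), ?_, ?_⟩
      · rw [hA, hC', hE2, pg_comm hij, pg_braid hjk, pg_braid hik.symm, pg_comm hij.symm]
      · rw [hD2, hF, pg_braid hik.symm, pg_comm hij.symm, pg_comm hij G, pg_braid hjk]
  · obtain ⟨C, hA, hC⟩ := h.2.2 hij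
    have lC := congrArg plen hC
    simp only [plen_pg_mul] at lC
    have H := ih (pg j * D) (pg j * C) k i (by rw [plen_pg_mul]; omega) hC
    refine ⟨?_, fun hik => ?_, fun hik => ?_⟩
    · rintro rfl
      rw [hA, (ih D C j j (by omega) (H.1 rfl)).1 rfl]
    · obtain ⟨E, hD, hC'⟩ := H.2.1 hik.symm
      have lE := congrArg plen hD
      simp only [plen_pg_mul] at lE
      obtain ⟨F, hD2, hE⟩ := (ih D E j i (by omega) hD).2.2 hij.symm
      obtain ⟨G, hC2, hE2⟩ := (ih C E j k (by omega) hC').2.2 hjk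
      have lF := congrArg plen hE
      simp only [plen_pg_mul] at lF
      have e1 := (ih (pg i * F) (pg k * G) j j (by rw [plen_pg_mul]; omega)
        (hE.symm.trans hE2)).1 rfl
      obtain ⟨K, hF, hG⟩ := (ih F G i k (by omega) e1).2.1 hik
      refine ⟨pg j * (pg k * (pg i * (pg j * K))), ?_, ?_⟩
      · rw [hA, hC2, hG, pg_comm hik, pg_braid hij, pg_braid hjk]
      · rw [hD2, hF, pg_comm hik.symm, pg_braid hjk.symm, pg_braid hij.symm, pg_comm hik]
    -- Three indices cannot be pairwise adjacent.
    · exfalso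
      unfold Adj at hij hjk hik
      omega

/-- A move either takes place behind the first letter, and then does not change it, or it is a
relation at the very beginning of the word. -/
theorem BraidMove.cons_cases {N : ℕ} {j k : Fin N} {c b : List (Fin N)}
    (h : BraidMove (j :: c) (k :: b)) :
    (j = k ∧ pw c = pw b) ∨ (Far j k ∧ ∃ d, c = k :: d ∧ b = j :: d) ∨
      (Adj j k ∧ ∃ d, c = k :: j :: d ∧ b = j :: k :: d) := by
  generalize hx : j :: c = x at h
  generalize hy : k :: b = y at h
  cases h with
  | comm u v i l h =>
    cases u with
    | nil =>
      simp only [List.nil_append, List.cons.injEq] at hx hy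
      obtain ⟨rfl, rfl⟩ := hx
      obtain ⟨rfl, rfl⟩ := hy
      exact Or.inr (Or.inl ⟨h, v, rfl, rfl⟩)
    | cons e u =>
      simp only [List.cons_append, List.cons.injEq] at hx hy
      obtain ⟨rfl, rfl⟩ := hx
      obtain ⟨rfl, rfl⟩ := hy
      exact Or.inl ⟨rfl, pw_eq.2 (.single (.comm u v i l h))⟩
  | braid u v i l h =>
    cases u with
    | nil =>
      simp only [List.nil_append, List.cons.injEq] at hx hy
      obtain ⟨rfl, rfl⟩ := hx
      obtain ⟨rfl, rfl⟩ := hy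
      exact Or.inr (Or.inr ⟨h, v, rfl, rfl⟩)
    | cons e u =>
      simp only [List.cons_append, List.cons.injEq] at hx hy
      obtain ⟨rfl, rfl⟩ := hx
      obtain ⟨rfl, rfl⟩ := hy
      exact Or.inl ⟨rfl, pw_eq.2 (.single (.braid u v i l h))⟩

/-- Garside's theorem: common multiples of two generators are multiples of their least common
multiple, and the monoid is left cancellative. -/
theorem hasLcm_of_length {N : ℕ} (r : ℕ) : ∀ (a b : List (Fin N)) (i k : Fin N), a.length = r →
    pg i * pw a = pg k * pw b → HasLcm i k (pw a) (pw b) := by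
  induction r using Nat.strong_induction_on with
  | _ r ih =>
  intro a b i k ha h
  have ih' : ∀ (A B : PosMonoid N) (i k : Fin N), plen A < r →
      pg i * A = pg k * B → HasLcm i k A B := by
    intro A B i k hl h
    obtain ⟨a, rfl⟩ := pw_surjective A
    obtain ⟨b, rfl⟩ := pw_surjective B
    rw [plen_pw] at hl
    exact ih a.length hl a b i k rfl h
  rw [← pw_cons, ← pw_cons, pw_eq] at h
  -- The second induction runs along the chain of moves that starts at `i :: a`; `k` and `b` vary
  -- with the current end of the chain.
  generalize hw : k :: b = w at h
  induction h generalizing k b with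
  | refl =>
    obtain ⟨rfl, rfl⟩ := List.cons.inj hw
    exact ⟨fun _ => rfl, fun h => absurd h (not_far_self _), fun h => absurd h (not_adj_self _)⟩
  | @tail x y hx hxy ihx =>
    subst hw
    have hlen : x.length = r + 1 := by
      rw [← length_eq_of_pw_eq (pw_eq.2 hx)]; simp [ha]
    cases x with
    | nil => simp at hlen
    | cons j c =>
    have h1 := ihx c j rfl
    rcases hxy.cons_cases with ⟨rfl, hc⟩ | ⟨hf, d, rfl, rfl⟩ | ⟨hf, d, rfl, rfl⟩
    · rwa [← hc]
    · simp only [pw_cons] at h1 ⊢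
      exact hasLcm_far_step ih' (by simpa [plen_pw] using hlen) hf h1
    · simp only [pw_cons] at h1 ⊢
      exact hasLcm_adj_step ih' (by simpa [plen_pw] using hlen) hf h1

theorem hasLcm {N : ℕ} {A B : PosMonoid N} {i k : Fin N} (h : pg i * A = pg k * B) :
    HasLcm i k A B := by
  obtain ⟨a, rfl⟩ := pw_surjective A
  obtain ⟨b, rfl⟩ := pw_surjective B
  exact hasLcm_of_length _ a b i k rfl h

/-- The set of braid relations is stable under reversal of words. This turns statements on left
multiples into statements on right multiples. -/
theorem pw_reverse_eq {N : ℕ} {a b : List (Fin N)} (h : pw a = pw b) :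
    pw a.reverse = pw b.reverse := by
  rw [pw_eq] at h ⊢
  exact h.lift List.reverse fun _ _ h => h.reverse

theorem pw_singleton {N : ℕ} (i : Fin N) : pw [i] = pg i := rfl

/-- The mirror image of `hasLcm`. -/
theorem hasLcm_right {N : ℕ} {A B : PosMonoid N} {i k : Fin N} (h : A * pg i = B * pg k) :
    (i = k → A = B) ∧ (Far i k → ∃ C, A = C * pg k ∧ B = C * pg i) ∧
    (Adj i k → ∃ C, A = C * pg i * pg k ∧ B = C * pg k * pg i) := by
  obtain ⟨a, rfl⟩ := pw_surjective A
  obtain ⟨b, rfl⟩ := pw_surjective B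
  rw [← pw_singleton, ← pw_singleton, ← pw_append, ← pw_append] at h
  have h' := pw_reverse_eq h
  simp only [List.reverse_append, List.reverse_singleton, List.singleton_append, pw_cons] at h'
  have H := hasLcm h'
  have key : ∀ (x : List (Fin N)) (l : List (Fin N)), pw x.reverse = pw l → pw x = pw l.reverse := by
    intro x l hx
    simpa using pw_reverse_eq hx
  refine ⟨fun e => ?_, fun e => ?_, fun e => ?_⟩
  · simpa using pw_reverse_eq (H.1 e)
  · obtain ⟨C, h1, h2⟩ := H.2.1 e
    obtain ⟨c, rfl⟩ := pw_surjective C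
    refine ⟨pw c.reverse, ?_, ?_⟩
    · rw [key a (k :: c) h1, List.reverse_cons, pw_append]; rfl
    · rw [key b (i :: c) h2, List.reverse_cons, pw_append]; rfl
  · obtain ⟨C, h1, h2⟩ := H.2.2 e
    obtain ⟨c, rfl⟩ := pw_surjective C
    refine ⟨pw c.reverse, ?_, ?_⟩
    · rw [key a (k :: i :: c) h1, List.reverse_cons, List.reverse_cons, pw_append, pw_append]; rfl
    · rw [key b (i :: k :: c) h2, List.reverse_cons, List.reverse_cons, pw_append, pw_append]; rfl

theorem pos_mul_left_cancel {N : ℕ} {x A B : PosMonoid N} (h : x * A = x * B) : A = B := by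
  obtain ⟨a, rfl⟩ := pw_surjective x
  induction a with
  | nil => simpa [pw_nil] using h
  | cons i a ih =>
    rw [pw_cons, mul_assoc, mul_assoc] at h
    exact ih ((hasLcm h).1 rfl)

/-! ### A central element -/

theorem pg_mul_pw_comm {N : ℕ} {j : Fin N} {a : List (Fin N)} (h : ∀ x ∈ a, Far j x) :
    pg j * pw a = pw a * pg j := by
  induction a with
  | nil => simp [pw_nil]
  | cons i a ih =>
    rw [pw_cons, pg_comm (h i List.mem_cons_self),
      ih fun x hx => h x (List.mem_cons_of_mem _ hx), mul_assoc]

/-- The product of all generators in increasing order. -/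
def pdelta (N : ℕ) : PosMonoid N := pw (List.finRange N)

/-- Write the product as `P σ_i σ_j Q` with `j = i + 1`. The generator `σ_j` commutes with `P`,
where only indices below `i` occur, the braid relation turns `σ_j σ_i σ_j` into `σ_i σ_j σ_i`, and
the last `σ_i` commutes with `Q`. -/
theorem pg_succ_mul_pdelta {N : ℕ} (i j : Fin N) (h : (i : ℕ) + 1 = j) :
    pg j * pdelta N = pdelta N * pg i := by
  have hd : List.finRange N = (List.finRange N).take i ++ i :: j ::
      (List.finRange N).drop (i + 2) := by
    conv_lhs => rw [← List.take_append_drop i (List.finRange N)]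
    rw [List.drop_eq_getElem_cons (by simp), List.drop_eq_getElem_cons (by simp; omega)]
    have e1 : (List.finRange N)[(i : ℕ)]'(by simp) = i := by simp
    have e2 : (List.finRange N)[(i : ℕ) + 1]'(by simp; omega) = j := by ext; simp [h]
    rw [e1, e2]
  have h1 : ∀ x ∈ (List.finRange N).take i, Far j x := by
    intro x hx
    obtain ⟨l, hl, rfl⟩ := List.mem_take_iff_getElem.1 hx
    simp only [List.getElem_finRange, Far]
    rw [lt_min_iff] at hl
    right; simp; omega
  have h2 : ∀ x ∈ (List.finRange N).drop (i + 2), Far i x := by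
    intro x hx
    obtain ⟨l, hl, rfl⟩ := List.mem_drop_iff_getElem.1 hx
    simp only [List.getElem_finRange, Far]
    left; simp
  rw [pdelta, hd, pw_append, pw_cons, pw_cons, ← mul_assoc, pg_mul_pw_comm h1, mul_assoc, mul_assoc,
    pg_braid (Or.inr h), pg_mul_pw_comm h2]
  simp only [mul_assoc]

theorem pg_mul_pdelta_pow {N : ℕ} (i j : Fin N) (k : ℕ) (h : (i : ℕ) + k = j) :
    pg j * pdelta N ^ k = pdelta N ^ k * pg i := by
  induction k generalizing j with
  | zero => rw [show i = j from Fin.ext (by simpa using h)]; simp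
  | succ k ih =>
    have hj : (i : ℕ) + k < N := by omega
    rw [pow_succ', ← mul_assoc, pg_succ_mul_pdelta ⟨i + k, hj⟩ j (by simp; omega), mul_assoc,
      ih ⟨i + k, hj⟩ rfl, mul_assoc]

theorem pdelta_succ_left (N : ℕ) :
    pdelta (N + 1) = pg 0 * pw ((List.finRange N).map Fin.succ) := by
  rw [pdelta, List.finRange_succ, pw_cons]

theorem pdelta_succ_right (N : ℕ) :
    pdelta (N + 1) = pw ((List.finRange N).map Fin.castSucc) * pg (Fin.last N) := by
  rw [pdelta, List.finRange_succ_last, pw_append]; rfl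

theorem pdelta_mul_castSucc (N : ℕ) (l : List (Fin N)) :
    pdelta (N + 1) * pw (l.map Fin.castSucc) = pw (l.map Fin.succ) * pdelta (N + 1) := by
  induction l with
  | nil => simp [pw_nil]
  | cons i l ih =>
    rw [List.map_cons, List.map_cons, pw_cons, pw_cons, ← mul_assoc,
      ← pg_succ_mul_pdelta i.castSucc i.succ (by simp), mul_assoc, ih, mul_assoc]

/-- Conjugation by `pdelta` shifts the indices and is not defined on the last generator; its square
takes the last generator back to the first. Indeed the square is `(σ_1 ⋯ σ_N) δ σ_N`, and a further
`σ_0` in front completes the first factor to `δ`. -/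
theorem pg_zero_mul_pdelta_sq (N : ℕ) :
    pg 0 * pdelta (N + 1) ^ 2 = pdelta (N + 1) ^ 2 * pg (Fin.last N) := by
  have h : pdelta (N + 1) ^ 2 =
      pw ((List.finRange N).map Fin.succ) * pdelta (N + 1) * pg (Fin.last N) := by
    have := pdelta_mul_castSucc N (List.finRange N)
    rw [← this, mul_assoc, ← pdelta_succ_right, sq]
  conv_lhs => rw [h, ← mul_assoc, ← mul_assoc, ← pdelta_succ_left]
  rw [sq]

/-- The full twist. -/
def fullTwist (N : ℕ) : PosMonoid N := pdelta N ^ (N + 1)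

/-- The index runs once around a cycle: down to the first generator, around to the last, and down
again to where it started. -/
theorem pg_mul_fullTwist {N : ℕ} (i : Fin N) : pg i * fullTwist N = fullTwist N * pg i := by
  cases N with
  | zero => exact i.elim0
  | succ N =>
  -- The exponents of the three stages: `i` from `σ_i` to `σ_0`, two from `σ_0` to `σ_N`, and `N -
  -- i` from `σ_N` to `σ_i`.
  have e : N + 1 + 1 = (i : ℕ) + 2 + (N - i) := by omega
  rw [fullTwist, e, pow_add, pow_add, ← mul_assoc, ← mul_assoc,
    pg_mul_pdelta_pow 0 i i (by simp), mul_assoc _ (pg 0), pg_zero_mul_pdelta_sq, ← mul_assoc,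
    mul_assoc _ (pg (Fin.last N)),
    pg_mul_pdelta_pow i (Fin.last N) (N - i) (by simp; omega)]
  simp only [mul_assoc]

/-- Moved to the right through `δ ^ i`, the generator `σ_i` becomes `σ_0`, which is the first letter
of a further factor `δ`. -/
theorem exists_pg_mul_eq_fullTwist {N : ℕ} (i : Fin N) : ∃ d, pg i * d = fullTwist N := by
  cases N with
  | zero => exact i.elim0
  | succ N =>
  have e : N + 1 + 1 = (i : ℕ) + 1 + (N + 1 - i) := by omega
  refine ⟨pdelta (N + 1) ^ (i : ℕ) * pw ((List.finRange N).map Fin.succ) *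
    pdelta (N + 1) ^ (N + 1 - (i : ℕ)), ?_⟩
  rw [fullTwist, e, pow_add _ _ (N + 1 - (i : ℕ)), pow_succ, ← mul_assoc, ← mul_assoc,
    pg_mul_pdelta_pow 0 i i (by simp), mul_assoc (pdelta (N + 1) ^ (i : ℕ)) (pg 0),
    ← pdelta_succ_left]

/-- The same quotient works on the other side, by centrality and left cancellation. -/
theorem exists_mul_pg_eq_fullTwist {N : ℕ} (i : Fin N) : ∃ d, d * pg i = fullTwist N := by
  obtain ⟨d, hd⟩ := exists_pg_mul_eq_fullTwist i
  refine ⟨d, pos_mul_left_cancel (x := pg i) ?_⟩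
  rw [pg_mul_fullTwist, ← mul_assoc, hd]

theorem mul_fullTwist_comm {N : ℕ} (x : PosMonoid N) : x * fullTwist N = fullTwist N * x := by
  obtain ⟨a, rfl⟩ := pw_surjective x
  induction a with
  | nil => simp [pw_nil]
  | cons i a ih => rw [pw_cons, mul_assoc, ih, ← mul_assoc, pg_mul_fullTwist, mul_assoc]

/-- Each letter divides one full twist, and the full twists are central, so one factor for each
letter suffices. -/
theorem exists_mul_eq_fullTwist_pow {N : ℕ} (x : PosMonoid N) (k : ℕ) (h : plen x ≤ k) :
    ∃ y, x * y = fullTwist N ^ k := by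
  obtain ⟨a, rfl⟩ := pw_surjective x
  rw [plen_pw] at h
  induction a generalizing k with
  | nil => exact ⟨fullTwist N ^ k, by simp [pw_nil]⟩
  | cons i a ih =>
    cases k with
    | zero => simp at h
    | succ k =>
      obtain ⟨y, hy⟩ := ih k (by simpa using h)
      obtain ⟨d, hd⟩ := exists_pg_mul_eq_fullTwist i
      refine ⟨y * d, ?_⟩
      have : Commute d (fullTwist N) := mul_fullTwist_comm d
      rw [pw_cons, mul_assoc, ← mul_assoc (pw a), hy, ← (this.pow_right k).eq, ← mul_assoc, hd,
        pow_succ']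

/-! ### Comparison in labelled graphs -/

/-- Graphs with edges labelled by the generators of a braid group that have the closure properties
of the divisors of a positive braid. -/
structure DivisorGraph {V : Type} (E : ℕ → V → V → Prop) : Prop where
  left_unique : ∀ {i x y a}, E i x a → E i y a → x = y
  right_unique : ∀ {i x y a}, E i a x → E i a y → x = y
  comm : ∀ {i j x y z}, i + 2 ≤ j → E i x y → E j y z → ∃ u, E j x u ∧ E i u z
  comm' : ∀ {i j x y z}, i + 2 ≤ j → E j x y → E i y z → ∃ u, E i x u ∧ E j u z
  upper_far : ∀ {i j x y a}, i + 2 ≤ j → E i x a → E j y a → ∃ u, E j u x ∧ E i u y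
  lower_far : ∀ {i j x y a}, i + 2 ≤ j → E i a x → E j a y → ∃ u, E j x u ∧ E i y u
  upper_adj : ∀ {i x y a}, E i x a → E (i + 1) y a →
    ∃ c p q, E i c p ∧ E (i + 1) p x ∧ E (i + 1) c q ∧ E i q y
  lower_adj : ∀ {i x y a}, E i a x → E (i + 1) a y →
    ∃ c p q, E i p c ∧ E (i + 1) x p ∧ E (i + 1) q c ∧ E i y q

/-- The opposite labelled graph. -/
def opEdge {V : Type} (E : ℕ → V → V → Prop) (i : ℕ) (x y : V) : Prop := E i y x

theorem DivisorGraph.op {V : Type} {E : ℕ → V → V → Prop} (h : DivisorGraph E) :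
    DivisorGraph (opEdge E) where
  left_unique h1 h2 := h.right_unique h1 h2
  right_unique h1 h2 := h.left_unique h1 h2
  comm hij h1 h2 := by
    obtain ⟨u, hu, hu'⟩ := h.comm' hij h2 h1
    exact ⟨u, hu', hu⟩
  comm' hij h1 h2 := by
    obtain ⟨u, hu, hu'⟩ := h.comm hij h2 h1
    exact ⟨u, hu', hu⟩
  upper_far hij h1 h2 := h.lower_far hij h1 h2
  lower_far hij h1 h2 := h.upper_far hij h1 h2
  upper_adj h1 h2 := h.lower_adj h1 h2
  lower_adj h1 h2 := h.upper_adj h1 h2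

/-- Connection by edges with labels at least `k`, in both directions. -/
def Linked {V : Type} (E : ℕ → V → V → Prop) (k : ℕ) : V → V → Prop :=
  Relation.ReflTransGen fun x y => ∃ j, k ≤ j ∧ (E j x y ∨ E j y x)

/-- One upward edge with label `k`, up to edges with larger labels. -/
def Up {V : Type} (E : ℕ → V → V → Prop) (k : ℕ) (x y : V) : Prop :=
  ∃ x' y', Linked E (k + 1) x x' ∧ E k x' y' ∧ Linked E (k + 1) y' y

/-- Comparability of two vertices at level `k`. -/
def Comparable {V : Type} (E : ℕ → V → V → Prop) (k : ℕ) (x y : V) : Prop :=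
  Relation.TransGen (Up E k) x y ∨ Linked E (k + 1) x y ∨ Relation.TransGen (Up E k) y x

section Graph

variable {V : Type} {E : ℕ → V → V → Prop} {k : ℕ} {x y z a b : V}

theorem Linked.symm (h : Linked E k x y) : Linked E k y x := by
  have : Std.Symm (fun x y => ∃ j, k ≤ j ∧ (E j x y ∨ E j y x)) :=
    ⟨fun _ _ ⟨j, hj, h⟩ => ⟨j, hj, h.symm⟩⟩
  exact Relation.ReflTransGen.stdSymm.symm _ _ h

theorem Linked.trans (h : Linked E k x y) (h' : Linked E k y z) : Linked E k x z :=
  Relation.ReflTransGen.trans h h'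

theorem Linked.mono {l : ℕ} (hl : l ≤ k) (h : Linked E k x y) : Linked E l x y :=
  Relation.ReflTransGen.mono (fun _ _ ⟨j, hj, h⟩ => ⟨j, hl.trans hj, h⟩) _ _ h

theorem linked_edge {j : ℕ} (hj : k ≤ j) (h : E j x y) : Linked E k x y :=
  .single ⟨j, hj, Or.inl h⟩

theorem Up.linked_left (h : Linked E (k + 1) x y) (h' : Up E k y z) : Up E k x z := by
  obtain ⟨a, b, h1, h2, h3⟩ := h'
  exact ⟨a, b, h.trans h1, h2, h3⟩

theorem Up.linked_right (h : Up E k x y) (h' : Linked E (k + 1) y z) : Up E k x z := by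
  obtain ⟨a, b, h1, h2, h3⟩ := h
  exact ⟨a, b, h1, h2, h3.trans h'⟩

theorem up_edge (h : E k x y) : Up E k x y := ⟨x, y, .refl, h, .refl⟩

theorem transUp_linked_left (h : Linked E (k + 1) x y) (h' : Relation.TransGen (Up E k) y z) :
    Relation.TransGen (Up E k) x z := by
  induction h' with
  | single h' => exact .single (h'.linked_left h)
  | tail _ h' ih => exact ih.tail h'

theorem transUp_linked_right (h : Relation.TransGen (Up E k) x y) (h' : Linked E (k + 1) y z) :
    Relation.TransGen (Up E k) x z := by
  cases h with
  | single h => exact .single (h.linked_right h')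
  | tail h h'' => exact h.tail (h''.linked_right h')

theorem Comparable.linked (h1 : Linked E (k + 1) x a) (h : Comparable E k a b)
    (h2 : Linked E (k + 1) b y) : Comparable E k x y := by
  rcases h with h | h | h
  · exact Or.inl (transUp_linked_left h1 (transUp_linked_right h h2))
  · exact Or.inr (Or.inl ((h1.trans h).trans h2))
  · exact Or.inr (Or.inr (transUp_linked_left h2.symm (transUp_linked_right h h1.symm)))

theorem Comparable.symm (h : Comparable E k x y) : Comparable E k y x := by
  rcases h with h | h | h
  · exact Or.inr (Or.inr h)
  · exact Or.inr (Or.inl h.symm)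
  · exact Or.inl h

/-- Labels at least `k + 2` commute with the label `k`, so a `k`-edge can be carried along such a
path square by square. -/
theorem push_linked (hE : DivisorGraph E) (h : Linked E (k + 2) a b) (hy : E k y b) :
    ∃ u, E k u a ∧ Linked E (k + 2) u y := by
  induction h using Relation.ReflTransGen.head_induction_on with
  | refl => exact ⟨y, hy, .refl⟩
  | head h _ ih =>
    obtain ⟨u, hu, hu'⟩ := ih
    obtain ⟨j, hj, h | h⟩ := h
    · obtain ⟨v, hv, hv'⟩ := hE.upper_far hj hu h
      exact ⟨v, hv', (linked_edge hj hv).trans hu'⟩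
    · obtain ⟨v, hv, hv'⟩ := hE.comm hj hu h
      exact ⟨v, hv', (linked_edge hj hv).symm.trans hu'⟩

/-- The common upper end of a `k`-edge and a `(k + 1)`-edge completes to the hexagon of the braid
relation. The side from `u` to `y` descends a `(k + 1)`-edge, ascends a `k`-edge and ascends a `(k +
1)`-edge, and is therefore a single upward step at level `k`. -/
theorem push_edge (hE : DivisorGraph E) (h : E (k + 1) a b) (hy : E k y b) :
    ∃ u, E k u a ∧ Up E k u y := by
  obtain ⟨c, p, q, h1, h2, h3, h4⟩ := hE.upper_adj hy h
  exact ⟨q, h4, c, p, (linked_edge le_rfl h3).symm, h1, linked_edge le_rfl h2⟩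

theorem push_up (hE : DivisorGraph E) (h : Up E (k + 1) a b) (hy : E k y b) :
    ∃ u, E k u a ∧ Up E k u y := by
  obtain ⟨a', b', h1, h2, h3⟩ := h
  obtain ⟨u, hu, hu'⟩ := push_linked hE h3 hy
  obtain ⟨v, hv, hv'⟩ := push_edge hE h2 hu
  obtain ⟨w, hw, hw'⟩ := push_linked hE h1 hv
  exact ⟨w, hw, (hv'.linked_right (hu'.mono (by omega))).linked_left (hw'.mono (by omega))⟩

theorem push_transUp (hE : DivisorGraph E) (h : Relation.TransGen (Up E (k + 1)) a b)
    (hy : E k y b) : ∃ u, E k u a ∧ Relation.TransGen (Up E k) u y := by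
  induction h using Relation.TransGen.head_induction_on with
  | single h =>
    obtain ⟨u, hu, hu'⟩ := push_up hE h hy
    exact ⟨u, hu, .single hu'⟩
  | head h _ ih =>
    obtain ⟨u, hu, hu'⟩ := ih
    obtain ⟨v, hv, hv'⟩ := push_up hE h hu
    exact ⟨v, hv, .head hv' hu'⟩

/-- This lowers the level: a comparison of the upper ends of two `k`-edges by means of labels at
least `k + 1` is pushed down to their lower ends, where it becomes a comparison at level `k`.
Uniqueness of lower ends identifies the pushed edge with the given one. -/
theorem comparable_of_edges (hE : DivisorGraph E) (hx : E k x a) (hy : E k y b)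
    (h : Comparable E (k + 1) a b) : Comparable E k x y := by
  rcases h with h | h | h
  · obtain ⟨u, hu, hu'⟩ := push_transUp hE h hy
    rw [hE.left_unique hu hx] at hu'
    exact Or.inl hu'
  · obtain ⟨u, hu, hu'⟩ := push_linked hE h hy
    rw [hE.left_unique hu hx] at hu'
    exact Or.inr (Or.inl (hu'.mono (by omega)))
  · obtain ⟨u, hu, hu'⟩ := push_transUp hE h hx
    rw [hE.left_unique hu hy] at hu'
    exact Or.inr (Or.inr hu')

theorem comparable_of_peak (hE : DivisorGraph E)
    (ih : ∀ x y, Linked E (k + 1) x y → Comparable E (k + 1) x y)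
    (hx : Up E k x a) (hy : Up E k y a) : Comparable E k x y := by
  obtain ⟨x', p, h1, h2, h3⟩ := hx
  obtain ⟨y', q, h4, h5, h6⟩ := hy
  exact .linked h1 (comparable_of_edges hE h2 h5 (ih p q (h3.trans h6.symm))) h4.symm

/-- A confluence argument for peaks. Acyclicity and finiteness make the upward relation
well-founded. The last vertices before the peak `m` are comparable by `comparable_of_peak`, so `x`
and `y` lie below the higher of these, a peak lower than `m`. -/
theorem comparable_of_joined [Finite V] (hE : DivisorGraph E)
    (hA : ∀ k x, ¬ Relation.TransGen (Up E k) x x)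
    (ih : ∀ x y, Linked E (k + 1) x y → Comparable E (k + 1) x y) (m : V) :
    ∀ x y, (Relation.TransGen (Up E k) x m ∨ Linked E (k + 1) x m) →
      (Relation.TransGen (Up E k) y m ∨ Linked E (k + 1) y m) → Comparable E k x y := by
  have : Std.Irrefl (Relation.TransGen (Up E k)) := ⟨hA k⟩
  have wf : WellFounded (Relation.TransGen (Up E k)) := Finite.wellFounded_of_trans_of_irrefl _
  induction m using wf.induction with
  | _ m ihm =>
  rintro x y (hx | hx) (hy | hy)
  · obtain ⟨p, hp, hp'⟩ := Relation.TransGen.tail'_iff.1 hx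
    obtain ⟨q, hq, hq'⟩ := Relation.TransGen.tail'_iff.1 hy
    have key : ∀ {x p}, Relation.ReflTransGen (Up E k) x p →
        Relation.TransGen (Up E k) x p ∨ Linked E (k + 1) x p := by
      intro x p h
      rcases Relation.reflTransGen_iff_eq_or_transGen.1 h with rfl | h
      · exact Or.inr .refl
      · exact Or.inl h
    rcases comparable_of_peak hE ih hp' hq' with h | h | h
    · refine ihm q (.single hq') x y (Or.inl ?_) (key hq)
      exact Relation.TransGen.trans_right hp h
    · refine ihm q (.single hq') x y ?_ (key hq)
      rcases key hp with hp | hp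
      · exact Or.inl (transUp_linked_right hp h)
      · exact Or.inr (hp.trans h)
    · refine ihm p (.single hp') x y (key hp) (Or.inl ?_)
      exact Relation.TransGen.trans_right hq h
  · exact Or.inl (transUp_linked_right hx hy.symm)
  · exact Or.inr (Or.inr (transUp_linked_right hy hx.symm))
  · exact Or.inr (Or.inl (hx.trans hy.symm))

theorem linked_op : Linked (opEdge E) k x y ↔ Linked E k x y := by
  unfold Linked opEdge
  constructor <;> intro h <;> refine Relation.ReflTransGen.mono ?_ _ _ h <;>
    exact fun _ _ ⟨j, hj, h⟩ => ⟨j, hj, h.symm⟩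

theorem up_op : Up (opEdge E) k x y ↔ Up E k y x := by
  unfold Up
  simp only [linked_op]
  constructor
  · rintro ⟨p, q, h1, h2, h3⟩
    exact ⟨q, p, h3.symm, h2, h1.symm⟩
  · rintro ⟨p, q, h1, h2, h3⟩
    exact ⟨q, p, h3.symm, h2, h1.symm⟩

theorem transUp_op :
    Relation.TransGen (Up (opEdge E) k) x y ↔ Relation.TransGen (Up E k) y x := by
  rw [← Relation.transGen_swap]
  have : Up (opEdge E) k = Function.swap (Up E k) := by
    funext x y; exact propext up_op
  rw [this]

theorem comparable_op : Comparable (opEdge E) k x y ↔ Comparable E k y x := by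
  unfold Comparable
  rw [transUp_op, transUp_op, linked_op]
  exact ⟨fun h => h.imp_right (Or.imp_left Linked.symm),
    fun h => h.imp_right (Or.imp_left Linked.symm)⟩

/-- Descending induction on the level, starting above all labels, where linked vertices are equal.
At level `k` the path is followed edge by edge: a change of direction is a peak or a valley and is
resolved by `comparable_of_joined`, while edges of higher label do not affect the comparison. -/
theorem comparable_of_linked [Finite V] (hE : DivisorGraph E)
    (hA : ∀ k x, ¬ Relation.TransGen (Up E k) x x) {N : ℕ} (hN : ∀ j x y, E j x y → j < N)
    (d : ℕ) : ∀ k x y, N ≤ k + d → Linked E k x y → Comparable E k x y := by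
  induction d with
  | zero =>
    intro k x y hk h
    have : x = y := by
      induction h with
      | refl => rfl
      | tail _ h ih =>
        obtain ⟨j, hj, h | h⟩ := h
        · have := hN _ _ _ h; omega
        · have := hN _ _ _ h; omega
    subst this
    exact Or.inr (Or.inl .refl)
  | succ d ih =>
    intro k x y hk h
    have ih' : ∀ x y, Linked E (k + 1) x y → Comparable E (k + 1) x y :=
      fun x y => ih (k + 1) x y (by omega)
    have up := comparable_of_joined hE hA ih'
    -- Valleys are the peaks of the opposite graph.
    have down := comparable_of_joined (E := opEdge E) (k := k) hE.op
      (fun k x h => hA k x (transUp_op.1 h))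
      (fun x y h => comparable_op.2 (ih' y x (linked_op.1 h).symm))
    simp only [transUp_op, linked_op, comparable_op] at down
    induction h with
    | refl => exact Or.inr (Or.inl .refl)
    | @tail y z hxy hyz ihy =>
      obtain ⟨j, hj, hyz⟩ := hyz
      rcases hj.eq_or_lt with rfl | hj
      · rcases hyz with hyz | hyz
        · rcases ihy with h | h | h
          · exact Or.inl (h.tail (up_edge hyz))
          · exact Or.inl (.single ((up_edge hyz).linked_left h))
          · exact (down y x z (Or.inl h) (Or.inl (.single (up_edge hyz)))).symm
        · rcases ihy with h | h | h
          · exact up y x z (Or.inl h) (Or.inl (.single (up_edge hyz)))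
          · exact Or.inr (Or.inr (.single ((up_edge hyz).linked_right h.symm)))
          · exact Or.inr (Or.inr (.head (up_edge hyz) h))
      · refine .linked .refl ihy ?_
        rcases hyz with hyz | hyz
        · exact linked_edge hj hyz
        · exact (linked_edge hj hyz).symm

/-- If the comparison at level `k` is undecided, the vertices are linked at level `k + 1` and the
comparison is repeated there; beyond the last label it can only end in equality. -/
theorem trichotomy_of_linked [Finite V] (hE : DivisorGraph E)
    (hA : ∀ k x, ¬ Relation.TransGen (Up E k) x x) {N : ℕ} (hN : ∀ j x y, E j x y → j < N)
    (d : ℕ) : ∀ k x y, N ≤ k + d → Linked E k x y →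
      x = y ∨ (∃ j, Relation.TransGen (Up E j) x y) ∨ ∃ j, Relation.TransGen (Up E j) y x := by
  induction d with
  | zero =>
    intro k x y hk h
    left
    induction h with
    | refl => rfl
    | tail _ h ih =>
      obtain ⟨j, hj, h | h⟩ := h
      · have := hN _ _ _ h; omega
      · have := hN _ _ _ h; omega
  | succ d ih =>
    intro k x y hk h
    rcases comparable_of_linked hE hA hN (d + 1) k x y hk h with h | h | h
    · exact Or.inr (Or.inl ⟨k, h⟩)
    · exact ih (k + 1) x y (by omega) h
    · exact Or.inr (Or.inr ⟨k, h⟩)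

end Graph

/-! ### The Dehornoy order is a strict linear order -/

theorem sig_comm {m : ℕ} {i j : Fin (m - 1)} (h : (i : ℕ) + 2 ≤ j) :
    sig i * sig j = sig j * sig i := by
  have := PresentedGroup.one_of_mem (rels := braidRels m) (Or.inl ⟨i, j, h, rfl⟩)
  rw [map_mul, map_inv, mul_inv_eq_one] at this
  simp only [map_mul] at this
  exact this

theorem sig_braid {m : ℕ} {i j : Fin (m - 1)} (h : (i : ℕ) + 1 = j) :
    sig i * sig j * sig i = sig j * sig i * sig j := by
  have := PresentedGroup.one_of_mem (rels := braidRels m) (Or.inr ⟨i, j, h, rfl⟩)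
  rw [map_mul, map_inv, mul_inv_eq_one] at this
  simp only [map_mul] at this
  exact this

/-- The braid represented by a positive braid. -/
def posBraid {m : ℕ} : PosMonoid (m - 1) →* BraidGroup m :=
  (posCon (m - 1)).lift (FreeMonoid.lift sig) (by
    intro a b h
    rw [Con.ker_rel]
    change Relation.ReflTransGen BraidMove a.toList b.toList at h
    have key : ∀ u v : List (Fin (m - 1)), Relation.ReflTransGen BraidMove u v →
        (u.map sig).prod = (v.map (sig (m := m))).prod := by
      intro u v h
      induction h with
      | refl => rfl
      | tail _ h ih =>
        rw [ih]
        cases h with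
        | comm u v i j h =>
          have : sig i * sig j = sig j * sig i := by
            rcases h with h | h
            · exact sig_comm h
            · exact (sig_comm h).symm
          simp only [List.map_append, List.map_cons, List.prod_append, List.prod_cons]
          rw [← mul_assoc (sig i), this, mul_assoc]
        | braid u v i j h =>
          have : sig i * sig j * sig i = sig j * sig i * sig j := by
            rcases h with h | h
            · exact sig_braid h
            · exact (sig_braid h).symm
          simp only [List.map_append, List.map_cons, List.prod_append, List.prod_cons]
          rw [← mul_assoc (sig i), ← mul_assoc (sig i * sig j), this]
          simp only [mul_assoc]
    rw [FreeMonoid.lift_apply, FreeMonoid.lift_apply]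
    exact key _ _ h)

theorem posBraid_pg {m : ℕ} (i : Fin (m - 1)) : posBraid (pg i) = sig i := by
  change (posCon (m - 1)).lift _ _ ((FreeMonoid.ofList [i] : FreeMonoid _) : PosMonoid _) = _
  rw [Con.lift_coe]; rfl

/-! ### The divisors of a positive braid as a labelled graph -/

/-- The left divisors of a positive braid. -/
abbrev Divisors {N : ℕ} (D : PosMonoid N) : Type := {x : PosMonoid N // ∃ y, x * y = D}

theorem plen_mul {N : ℕ} (x y : PosMonoid N) : plen (x * y) = plen x + plen y := by
  obtain ⟨a, rfl⟩ := pw_surjective x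
  obtain ⟨b, rfl⟩ := pw_surjective y
  rw [← pw_append, plen_pw, plen_pw, plen_pw, List.length_append]

instance {N : ℕ} (D : PosMonoid N) : Finite (Divisors D) := by
  have h1 : {l : List (Fin N) | l.length ≤ plen D}.Finite := List.finite_length_le _ _
  have h2 : {x : PosMonoid N | ∃ y, x * y = D}.Finite := by
    refine (h1.image pw).subset ?_
    rintro x ⟨y, hy⟩
    obtain ⟨a, rfl⟩ := pw_surjective x
    refine ⟨a, ?_, rfl⟩
    have := congrArg plen hy
    rw [plen_mul, plen_pw] at this
    change a.length ≤ _
    omega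
  exact h2.to_subtype

/-- Multiplication by a generator within the divisors of a positive braid. -/
def divEdge {N : ℕ} (D : PosMonoid N) (i : ℕ) (x y : Divisors D) : Prop :=
  ∃ h : i < N, y.1 = x.1 * pg ⟨i, h⟩

theorem pg_comm_right {N : ℕ} {i j : Fin N} (h : Far i j) (x : PosMonoid N) :
    x * pg i * pg j = x * pg j * pg i := by
  have := pg_comm h 1
  simp only [mul_one] at this
  rw [mul_assoc, this, mul_assoc]

theorem pg_braid_right {N : ℕ} {i j : Fin N} (h : Adj i j) (x : PosMonoid N) :
    x * pg i * pg j * pg i = x * pg j * pg i * pg j := by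
  have := pg_braid h 1
  simp only [mul_one] at this
  simp only [mul_assoc]
  rw [this]

/-- The properties at upper ends are Garside's theorem for right multiplication. For those at lower
ends, the common left factor `a` is cancelled in the two factorizations of `D` and Garside's theorem
is applied to the cofactors, so that the least common multiple found is again a divisor of `D`. -/
theorem divisorGraph_divEdge {N : ℕ} (D : PosMonoid N) : DivisorGraph (divEdge D) where
  left_unique := by
    rintro i x y a ⟨h, h1⟩ ⟨_, h2⟩
    exact Subtype.ext ((hasLcm_right (h1.symm.trans h2)).1 rfl)
  right_unique := by
    rintro i x y a ⟨h, h1⟩ ⟨_, h2⟩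
    exact Subtype.ext (h1.trans h2.symm)
  comm := by
    rintro i j ⟨x, hx⟩ ⟨y, hy⟩ ⟨z, w, hz⟩ hij ⟨hi, rfl⟩ ⟨hj, rfl⟩
    have e := pg_comm_right (i := (⟨i, hi⟩ : Fin N)) (j := ⟨j, hj⟩) (Or.inl hij) x
    exact ⟨⟨x * pg ⟨j, hj⟩, pg ⟨i, hi⟩ * w, by rw [← mul_assoc, ← e, hz]⟩, ⟨hj, rfl⟩, hi, e⟩
  comm' := by
    rintro i j ⟨x, hx⟩ ⟨y, hy⟩ ⟨z, w, hz⟩ hij ⟨hj, rfl⟩ ⟨hi, rfl⟩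
    have e := pg_comm_right (i := (⟨i, hi⟩ : Fin N)) (j := ⟨j, hj⟩) (Or.inl hij) x
    exact ⟨⟨x * pg ⟨i, hi⟩, pg ⟨j, hj⟩ * w, by rw [← mul_assoc, e, hz]⟩, ⟨hi, rfl⟩, hj, e.symm⟩
  upper_far := by
    rintro i j ⟨x, w, hx⟩ ⟨y, hy⟩ ⟨a, ha⟩ hij ⟨hi, h1⟩ ⟨hj, h2⟩
    obtain ⟨C, rfl, rfl⟩ := (hasLcm_right (h1.symm.trans h2)).2.1 (Or.inl hij)
    exact ⟨⟨C, pg ⟨j, hj⟩ * w, by rw [← mul_assoc, hx]⟩, ⟨hj, rfl⟩, hi, rfl⟩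
  lower_far := by
    rintro i j ⟨x, w, hx⟩ ⟨y, v, hy⟩ ⟨a, ha⟩ hij ⟨hi, rfl⟩ ⟨hj, rfl⟩
    have h := hx.trans hy.symm
    rw [mul_assoc, mul_assoc] at h
    obtain ⟨C, rfl, rfl⟩ := (hasLcm (pos_mul_left_cancel h)).2.1 (Or.inl hij)
    refine ⟨⟨a * pg ⟨i, hi⟩ * pg ⟨j, hj⟩, C, by rw [mul_assoc _ _ C, hx]⟩, ⟨hj, rfl⟩, hi, ?_⟩
    exact pg_comm_right (Or.inl hij) a
  upper_adj := by
    rintro i ⟨x, w, hx⟩ ⟨y, v, hy⟩ ⟨a, ha⟩ ⟨hi, h1⟩ ⟨hj, h2⟩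
    obtain ⟨C, rfl, rfl⟩ := (hasLcm_right (h1.symm.trans h2)).2.2 (Or.inl rfl)
    refine ⟨⟨C, pg ⟨i, hi⟩ * (pg ⟨i + 1, hj⟩ * w), by rw [← hx]; simp only [mul_assoc]⟩,
      ⟨C * pg ⟨i, hi⟩, pg ⟨i + 1, hj⟩ * w, by rw [← hx]; simp only [mul_assoc]⟩,
      ⟨C * pg ⟨i + 1, hj⟩, pg ⟨i, hi⟩ * v, by rw [← hy]; simp only [mul_assoc]⟩,
      ⟨hi, rfl⟩, ⟨hj, rfl⟩, ⟨hj, rfl⟩, hi, rfl⟩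
  lower_adj := by
    rintro i ⟨x, w, hx⟩ ⟨y, v, hy⟩ ⟨a, ha⟩ ⟨hi, rfl⟩ ⟨hj, rfl⟩
    have h := hx.trans hy.symm
    rw [mul_assoc, mul_assoc] at h
    obtain ⟨C, rfl, rfl⟩ := (hasLcm (pos_mul_left_cancel h)).2.2 (Or.inl rfl)
    refine ⟨⟨a * pg ⟨i, hi⟩ * pg ⟨i + 1, hj⟩ * pg ⟨i, hi⟩, C, by rw [← hx]; simp only [mul_assoc]⟩,
      ⟨a * pg ⟨i, hi⟩ * pg ⟨i + 1, hj⟩, pg ⟨i, hi⟩ * C, by rw [← hx]; simp only [mul_assoc]⟩,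
      ⟨a * pg ⟨i + 1, hj⟩ * pg ⟨i, hi⟩, pg ⟨i + 1, hj⟩ * C, by rw [← hy]; simp only [mul_assoc]⟩,
      ⟨hi, rfl⟩, ⟨hj, rfl⟩, ⟨hj, ?_⟩, hi, rfl⟩
    exact pg_braid_right (Or.inl rfl) a

theorem exists_word_of_linked {m : ℕ} {D : PosMonoid (m - 1)} {k : ℕ} {x y : Divisors D}
    (h : Linked (divEdge D) k x y) :
    ∃ w : BraidWord m, (∀ l ∈ w, k ≤ (l.1 : ℕ)) ∧ posBraid x.1 * w.toBraid = posBraid y.1 := by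
  induction h with
  | refl => exact ⟨[], by simp, by simp [toBraid_nil]⟩
  | tail _ h ih =>
    obtain ⟨w, hw, e⟩ := ih
    obtain ⟨j, hj, ⟨hjm, h⟩ | ⟨hjm, h⟩⟩ := h
    · refine ⟨w ++ [(⟨j, hjm⟩, true)], ?_, ?_⟩
      · intro l hl
        rcases List.mem_append.1 hl with hl | hl
        · exact hw l hl
        · simp only [List.mem_singleton] at hl; subst hl; exact hj
      · rw [toBraid_append, toBraid_singleton, ← mul_assoc, e, h, map_mul, posBraid_pg]; rfl
    · refine ⟨w ++ [(⟨j, hjm⟩, false)], ?_, ?_⟩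
      · intro l hl
        rcases List.mem_append.1 hl with hl | hl
        · exact hw l hl
        · simp only [List.mem_singleton] at hl; subst hl; exact hj
      · rw [toBraid_append, toBraid_singleton, ← mul_assoc, e, h, map_mul, posBraid_pg,
          letterBraid, if_neg (by simp), mul_inv_cancel_right]

/-- The path spells a word `u σ_k v` in which `u` and `v` use only indices above `k`. -/
theorem sigmaPositive_of_up {m : ℕ} {D : PosMonoid (m - 1)} {k : ℕ} {x y : Divisors D}
    (h : Up (divEdge D) k x y) : SigmaPositive ((posBraid x.1)⁻¹ * posBraid (m := m) y.1) := by
  obtain ⟨a, b, h1, ⟨hk, h2⟩, h3⟩ := h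
  obtain ⟨u, hu, e1⟩ := exists_word_of_linked h1
  obtain ⟨v, hv, e2⟩ := exists_word_of_linked h3
  refine ⟨u ++ (⟨k, hk⟩, true) :: v, ?_, ⟨k, hk⟩, by simp, ?_, ?_⟩
  · rw [eq_inv_mul_iff_mul_eq, toBraid_append, toBraid_cons, ← mul_assoc, e1, ← mul_assoc, ← e2,
      h2, map_mul, posBraid_pg]; rfl
  · simp only [List.mem_append, List.mem_cons, Prod.mk.injEq, Bool.false_eq_true, and_false,
      false_or, not_or]
    exact ⟨fun h => by have := hu _ h; simp at this, fun h => by have := hv _ h; simp at this⟩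
  · intro l hl
    simp only [List.mem_append, List.mem_cons] at hl
    rcases hl with hl | rfl | hl
    · have := hu _ hl; exact Fin.mk_le_of_le_val (by omega)
    · exact le_rfl
    · have := hv _ hl; exact Fin.mk_le_of_le_val (by omega)

theorem sigmaPositive_of_transUp {m : ℕ} {D : PosMonoid (m - 1)} {k : ℕ} {x y : Divisors D}
    (h : Relation.TransGen (Up (divEdge D) k) x y) :
    SigmaPositive ((posBraid x.1)⁻¹ * posBraid (m := m) y.1) := by
  induction h with
  | single h => exact sigmaPositive_of_up h
  | tail _ h ih =>
    have := ih.mul (sigmaPositive_of_up h)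
    rwa [mul_assoc, mul_inv_cancel_left] at this

/-- The word is read from left to right as a walk among positive braids, beginning at `x` times one
central full twist for each letter. The threshold `L` makes the finitely many vertices divide the
power that defines the graph. -/
theorem exists_path_of_word {m : ℕ} (w : BraidWord m) (x : PosMonoid (m - 1)) :
    ∃ L : ℕ, ∀ K, L ≤ K → ∃ (a b : Divisors (fullTwist (m - 1) ^ K)),
      Linked (divEdge _) 0 a b ∧ a.1 = x * fullTwist (m - 1) ^ w.length ∧
      posBraid (m := m) a.1 * w.toBraid = posBraid b.1 := by
  induction w generalizing x with
  | nil =>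
    refine ⟨plen x, fun K hK => ?_⟩
    exact ⟨⟨x, exists_mul_eq_fullTwist_pow x K hK⟩, ⟨x, exists_mul_eq_fullTwist_pow x K hK⟩,
      .refl, by simp, by simp [toBraid_nil]⟩
  | cons l w ih =>
    obtain ⟨i, s⟩ := l
    have hc : ∀ y : PosMonoid (m - 1), ∀ k : ℕ,
        Commute y (fullTwist (m - 1) ^ k) := fun y k =>
      Commute.pow_right (show Commute y _ from mul_fullTwist_comm y) k
    cases s with
    | true =>
      obtain ⟨L, hL⟩ := ih (x * fullTwist (m - 1) * pg i)
      refine ⟨max L (plen (x * fullTwist (m - 1) ^ (w.length + 1))), fun K hK => ?_⟩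
      obtain ⟨a, b, h1, h2, h3⟩ := hL K (le_of_max_le_left hK)
      have e : a.1 = x * fullTwist (m - 1) ^ (w.length + 1) * pg i := by
        rw [h2, pow_succ', mul_assoc, (hc (pg i) _).eq]; simp only [mul_assoc]
      refine ⟨⟨x * fullTwist (m - 1) ^ (w.length + 1),
        exists_mul_eq_fullTwist_pow _ K (le_of_max_le_right hK)⟩, b, ?_, rfl, ?_⟩
      · exact (linked_edge (Nat.zero_le i) ⟨i.2, e⟩).trans h1
      · rw [toBraid_cons, ← mul_assoc, ← h3, e, map_mul posBraid _ (pg i), posBraid_pg]; rfl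
    | false =>
      obtain ⟨d, hd⟩ := exists_mul_pg_eq_fullTwist i
      obtain ⟨L, hL⟩ := ih (x * d)
      refine ⟨max L (plen (x * fullTwist (m - 1) ^ (w.length + 1))), fun K hK => ?_⟩
      obtain ⟨a, b, h1, h2, h3⟩ := hL K (le_of_max_le_left hK)
      -- One full twist is spent as `d * pg i`, so the inverse letter is an edge traversed
      -- backwards.
      have e : x * fullTwist (m - 1) ^ (w.length + 1) = a.1 * pg i := by
        rw [h2, pow_succ', mul_assoc (x * d), ← (hc (pg i) _).eq, ← hd]; simp only [mul_assoc]
      refine ⟨⟨x * fullTwist (m - 1) ^ (w.length + 1),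
        exists_mul_eq_fullTwist_pow _ K (le_of_max_le_right hK)⟩, b, ?_, rfl, ?_⟩
      · exact (Linked.symm (linked_edge (Nat.zero_le i) ⟨i.2, e⟩)).trans h1
      · change posBraid (x * fullTwist (m - 1) ^ (w.length + 1)) * _ = _
        rw [toBraid_cons, ← mul_assoc, ← h3, e, map_mul, posBraid_pg, letterBraid,
          if_neg (by simp), mul_inv_cancel_right]

/-- The word of the braid traces a path among the divisors of a power of the full twist, and the
trichotomy of its end points there is the one for the braid. The required acyclicity holds because a
closed ascending path would make the trivial braid σ-positive. -/
theorem sigmaPositive_trichotomy {m : ℕ} (β : BraidGroup m) :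
    β = 1 ∨ SigmaPositive β ∨ SigmaPositive β⁻¹ := by
  obtain ⟨w, rfl⟩ := toBraid_surjective β
  obtain ⟨L, hL⟩ := exists_path_of_word w 1
  obtain ⟨a, b, h1, -, h3⟩ := hL L le_rfl
  have e : w.toBraid = (posBraid a.1)⁻¹ * posBraid b.1 := by rw [← h3, inv_mul_cancel_left]
  have hA : ∀ k (x : Divisors (fullTwist (m - 1) ^ L)),
      ¬ Relation.TransGen (Up (divEdge (fullTwist (m - 1) ^ L)) k) x x := by
    intro k x h
    have := sigmaPositive_of_transUp (m := m) h
    rw [inv_mul_cancel] at this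
    exact not_sigmaPositive_one this
  rcases trichotomy_of_linked (divisorGraph_divEdge _) hA (fun j x y h => h.1) (m - 1) 0 a b
    (by omega) h1 with rfl | ⟨j, h⟩ | ⟨j, h⟩
  · left; rw [e, inv_mul_cancel]
  · right; left; rw [e]; exact sigmaPositive_of_transUp h
  · right; right; rw [e, mul_inv_rev, inv_inv]; exact sigmaPositive_of_transUp h

theorem DehornoyLT.trans {m : ℕ} {α β γ : BraidGroup m} (h1 : DehornoyLT α β)
    (h2 : DehornoyLT β γ) : DehornoyLT α γ := by
  have := SigmaPositive.mul h1 h2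
  rwa [mul_assoc, mul_inv_cancel_left] at this

theorem DehornoyLT.asymm {m : ℕ} {α β : BraidGroup m} (h1 : DehornoyLT α β) :
    ¬ DehornoyLT β α := by
  intro h2
  have := h1.trans h2
  unfold DehornoyLT at this
  rw [inv_mul_cancel] at this
  exact not_sigmaPositive_one this

theorem dehornoyLT_trichotomy {m : ℕ} (α β : BraidGroup m) :
    α = β ∨ DehornoyLT α β ∨ DehornoyLT β α := by
  rcases sigmaPositive_trichotomy (α⁻¹ * β) with h | h | h
  · left; exact inv_mul_eq_one.1 h
  · exact Or.inr (Or.inl h)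
  · right; right
    unfold DehornoyLT
    rwa [mul_inv_rev, inv_inv] at h

/-! ### Least elements and the formal reduction -/

theorem IsDehornoyLeast.unique {m : ℕ} {S : Set (BraidGroup m)} {α β : BraidGroup m}
    (hα : IsDehornoyLeast S α) (hβ : IsDehornoyLeast S β) : α = β := by
  by_contra h
  exact (hα.2 β hβ.1 (Ne.symm h)).asymm (hβ.2 α hα.1 h)

theorem exists_isDehornoyLeast {m : ℕ} {S : Set (BraidGroup m)} (hS : S.Finite)
    (hne : S.Nonempty) : ∃ β, IsDehornoyLeast S β := by
  induction S, hS using Set.Finite.induction_on with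
  | empty => exact absurd hne Set.not_nonempty_empty
  | @insert a S ha hS ih =>
    rcases S.eq_empty_or_nonempty with rfl | hne'
    · exact ⟨a, by simp, fun γ hγ h => absurd (by simpa using hγ) h⟩
    obtain ⟨β, hβ, hmin⟩ := ih hne'
    rcases dehornoyLT_trichotomy a β with h | h | h
    · subst h
      exact absurd hβ ha
    · refine ⟨a, Set.mem_insert _ _, fun γ hγ hne => ?_⟩
      rcases hγ with rfl | hγ
      · exact absurd rfl hne
      · by_cases e : γ = β
        · rwa [e]
        · exact h.trans (hmin γ hγ e)
    · refine ⟨β, Set.mem_insert_of_mem _ hβ, fun γ hγ hne => ?_⟩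
      rcases hγ with rfl | hγ
      · exact h
      · exact hmin γ hγ hne

theorem isDehornoyLeast_iff_eq_dehornoyMin {m : ℕ} {S : Set (BraidGroup m)} (hS : S.Finite)
    (hne : S.Nonempty) (β : BraidGroup m) : IsDehornoyLeast S β ↔ β = dehornoyMin S := by
  have h := exists_isDehornoyLeast hS hne
  have hm : dehornoyMin S = h.choose := by rw [dehornoyMin, dif_pos h]
  rw [hm]
  exact ⟨fun hβ => hβ.unique h.choose_spec, fun e => e ▸ h.choose_spec⟩

theorem minimalElements_finite {m : ℕ} {c : BraidGroup m → ℕ} (hc : ProperComplexity c)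
    (S : Set (BraidGroup m)) : (minimalElements c S).Finite :=
  (hc (sInf (c '' S))).subset fun _ h => h.2.le

theorem minimalElements_nonempty {m : ℕ} {c : BraidGroup m → ℕ} {S : Set (BraidGroup m)}
    (hS : S.Nonempty) : (minimalElements c S).Nonempty := by
  obtain ⟨β, hβ, h⟩ := Nat.sInf_mem (hS.image c)
  exact ⟨β, hβ, h⟩

/-- The formal part of the main theorem: it holds as soon as the set of braids is non-empty and a
union of double cosets. -/
theorem canonical_representative {n : ℕ} {c : BraidGroup (2 * n) → ℕ} (hc : ProperComplexity c)
    {𝓛 : Set (Set S3)} (hne : (platBraids n 𝓛).Nonempty)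
    (hcoset : ∀ β ∈ platBraids n 𝓛, ∀ γ, platClass γ = platClass β → γ ∈ platBraids n 𝓛) :
    (∀ β, IsDehornoyLeast (minimalElements c (platBraids n 𝓛)) β ↔ β = globalBraid c 𝓛) ∧
    (∀ β, IsDehornoyLeast (minimalElements c (canPlat c 𝓛).elements) β ↔
      β = cosetRep c (canPlat c 𝓛)) ∧
    globalBraid c 𝓛 = cosetRep c (canPlat c 𝓛) := by
  have h1 := isDehornoyLeast_iff_eq_dehornoyMin (minimalElements_finite hc (platBraids n 𝓛))
    (minimalElements_nonempty hne)
  have hmem : globalBraid c 𝓛 ∈ (canPlat c 𝓛).elements := rfl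
  have h2 := isDehornoyLeast_iff_eq_dehornoyMin (minimalElements_finite hc (canPlat c 𝓛).elements)
    (minimalElements_nonempty ⟨_, hmem⟩)
  have hleast := (h1 _).2 rfl
  have hsub : (canPlat c 𝓛).elements ⊆ platBraids n 𝓛 :=
    fun γ hγ => hcoset _ hleast.1.1 γ hγ
  -- The double coset lies in the full set and contains one of its minimizers, so the two minima of
  -- the complexity agree.
  have hinf : sInf (c '' (canPlat c 𝓛).elements) = sInf (c '' platBraids n 𝓛) := by
    refine le_antisymm ?_ ?_
    · rw [← hleast.1.2]
      exact Nat.sInf_le ⟨_, hmem, rfl⟩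
    · exact csInf_le_csInf (OrderBot.bddBelow _) ⟨_, _, hmem, rfl⟩ (Set.image_mono hsub)
  refine ⟨h1, h2, (h2 _).1 ⟨⟨hmem, ?_⟩, fun γ hγ => hleast.2 γ ⟨hsub hγ.1, ?_⟩⟩⟩
  · rw [hinf]; exact hleast.1.2
  · rw [← hinf]; exact hγ.2

/-! ### Ambient isotopies of the three-sphere -/

theorem AmbientIsotopic.refl (K : Set S3) : AmbientIsotopic K K :=
  ⟨fun _ => Homeomorph.refl S3, continuous_snd, rfl, by simp⟩

theorem AmbientIsotopic.trans {K K' K'' : Set S3} (h : AmbientIsotopic K K')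
    (h' : AmbientIsotopic K' K'') : AmbientIsotopic K K'' := by
  obtain ⟨H, hH, h0, h1⟩ := h
  obtain ⟨G, hG, g0, g1⟩ := h'
  refine ⟨fun t => (H t).trans (G t), ?_, ?_, ?_⟩
  · exact hG.comp (continuous_fst.prodMk hH)
  · simp only [h0, g0]; rfl
  · rw [← g1, ← h1, Set.image_image]; rfl

/-- Continuity of the inverse isotopy holds because its track is a continuous bijection of the
compact Hausdorff space `[0, 1] × S³`. -/
theorem AmbientIsotopic.symm {K K' : Set S3} (h : AmbientIsotopic K K') :
    AmbientIsotopic K' K := by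
  obtain ⟨H, hH, h0, h1⟩ := h
  let e : unitInterval × S3 ≃ unitInterval × S3 :=
    { toFun := fun p => (p.1, H p.1 p.2)
      invFun := fun p => (p.1, (H p.1).symm p.2)
      left_inv := fun p => by simp
      right_inv := fun p => by simp }
  have he : Continuous e := continuous_fst.prodMk hH
  have hs : Continuous e.symm := (he.homeoOfEquivCompactToT2).symm.continuous
  refine ⟨fun t => (H t).symm, continuous_snd.comp hs, ?_, ?_⟩
  · simp only [h0]; rfl
  · rw [← h1, Set.image_image]; simp

/-- Ambient isotopy of subsets of three-space in the three-sphere. -/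
def Isotopic (K K' : Set R3) : Prop :=
  AmbientIsotopic ((fun p : R3 => (p : S3)) '' K) ((fun p : R3 => (p : S3)) '' K')

theorem Isotopic.refl (K : Set R3) : Isotopic K K := AmbientIsotopic.refl _

theorem Isotopic.trans {K K' K'' : Set R3} (h : Isotopic K K') (h' : Isotopic K' K'') :
    Isotopic K K'' := AmbientIsotopic.trans h h'

theorem Isotopic.symm {K K' : Set R3} (h : Isotopic K K') : Isotopic K' K :=
  AmbientIsotopic.symm h

/-- A continuous family of homeomorphisms of three-space that starts at the identity is an ambient
isotopy of the three-sphere. -/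
theorem isotopic_of_family (H G : unitInterval → R3 → R3)
    (hH : Continuous fun p : unitInterval × R3 => H p.1 p.2)
    (hG : Continuous fun p : unitInterval × R3 => G p.1 p.2)
    (hGH : ∀ s x, G s (H s x) = x) (hHG : ∀ s x, H s (G s x) = x) (h0 : ∀ x, H 0 x = x)
    (K : Set R3) : Isotopic K (H 1 '' K) := by
  let e : unitInterval → (R3 ≃ₜ R3) := fun s =>
    { toFun := H s
      invFun := G s
      left_inv := hGH s
      right_inv := hHG s
      continuous_toFun := hH.comp (continuous_const.prodMk continuous_id)
      continuous_invFun := hG.comp (continuous_const.prodMk continuous_id) }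
  have hcoe : ∀ s (x : R3), (e s).onePointCongr (x : S3) = ((H s x : R3) : S3) := fun s x => rfl
  have hinf : ∀ s, (e s).onePointCongr (OnePoint.infty : S3) = OnePoint.infty := fun s => rfl
  refine ⟨fun s => (e s).onePointCongr, ?_, ?_, ?_⟩
  · rw [continuous_iff_continuousAt]
    rintro ⟨s, x⟩
    induction x using OnePoint.rec with
    | coe x =>
      have hemb : Topology.IsOpenEmbedding
          (Prod.map id (fun p : R3 => (p : S3)) : unitInterval × R3 → unitInterval × S3) :=
        Topology.IsOpenEmbedding.id.prodMap OnePoint.isOpenEmbedding_coe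
      have : ContinuousAt ((fun p : unitInterval × S3 => (e p.1).onePointCongr p.2) ∘
          (Prod.map id (fun p : R3 => (p : S3)))) (s, x) :=
        (OnePoint.continuous_coe.comp hH).continuousAt
      exact (hemb.continuousAt_iff (x := (s, x))).1 this
    | infty =>
      rw [ContinuousAt]
      simp only [hinf]
      rw [OnePoint.hasBasis_nhds_infty.tendsto_right_iff]
      rintro C ⟨hC1, hC2⟩
      -- A point outside the compact set swept out by the inverse images of `C` is mapped outside
      -- `C` at every time. This gives continuity at infinity, uniformly in the parameter.
      have hC' : IsCompact ((fun p : unitInterval × R3 => G p.1 p.2) '' (Set.univ ×ˢ C)) :=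
        (isCompact_univ.prod hC2).image hG
      have hn : (((fun p : R3 => (p : S3)) ''
          ((fun p : unitInterval × R3 => G p.1 p.2) '' (Set.univ ×ˢ C))ᶜ) ∪ {OnePoint.infty}) ∈
          nhds (OnePoint.infty : S3) :=
        OnePoint.hasBasis_nhds_infty.mem_of_mem ⟨hC'.isClosed, hC'⟩
      have := prod_mem_nhds (Filter.univ_mem (f := nhds s)) hn
      filter_upwards [this]
      rintro ⟨t, y⟩ ⟨-, hy⟩
      rcases hy with ⟨y, hy, rfl⟩ | hy
      · left
        refine ⟨H t y, fun hc => hy ⟨(t, H t y), ⟨trivial, hc⟩, hGH t y⟩, rfl⟩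
      · right
        rw [Set.mem_singleton_iff] at hy ⊢
        subst hy
        exact hinf t
  · ext x
    induction x using OnePoint.rec with
    | coe x => simp only [hcoe, h0]; rfl
    | infty => rfl
  · rw [Set.image_image, Set.image_image]
    rfl

/-- The Alexander trick: a homeomorphism of three-space that is the identity on a half-space is
isotopic to the identity; the isotopy conjugates it by translations that tend to infinity. -/
theorem isotopic_of_eq_on_halfSpace (f : R3 ≃ₜ R3) (ε a : ℝ) (hε : ε * ε = 1)
    (hf : ∀ p : R3, ε * p.2 ≤ a → f p = p) (K : Set R3) : Isotopic K (f '' K) := by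
  -- The height of the translation, `(1 - s) / s`, is zero at `s = 1` and tends to infinity as `s`
  -- tends to `0`; the sign `ε` decides which half-space is fixed.
  have key : ∀ g : R3 ≃ₜ R3, (∀ p : R3, ε * p.2 ≤ a → g p = p) →
      Continuous fun p : unitInterval × R3 => if (p.1 : ℝ) = 0 then p.2 else
        (g (p.2.1, p.2.2 - ε * ((1 - (p.1 : ℝ)) / p.1)) + (0, ε * ((1 - (p.1 : ℝ)) / p.1)) : R3) := by
    intro g hg
    rw [continuous_iff_continuousAt]
    rintro ⟨s, x⟩
    by_cases hs : (s : ℝ) = 0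
    -- Near `s = 0` the translation carries a neighbourhood of `x` into the half-space on which `g`
    -- is the identity, so the family is locally constant there.
    · have hloc : ∀ᶠ p : unitInterval × R3 in nhds (s, x),
          (fun p : unitInterval × R3 => p.2) p = if (p.1 : ℝ) = 0 then p.2 else
        (g (p.2.1, p.2.2 - ε * ((1 - (p.1 : ℝ)) / p.1)) + (0, ε * ((1 - (p.1 : ℝ)) / p.1)) : R3) := by
        have c1 : Continuous fun p : unitInterval × R3 => (p.1 : ℝ) * (ε * p.2.2 - a + 1) := by
          fun_prop
        have h1 : ∀ᶠ p : unitInterval × R3 in nhds (s, x),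
            (p.1 : ℝ) * (ε * p.2.2 - a + 1) < 1 :=
          c1.continuousAt.eventually_lt_const (by simp [hs])
        filter_upwards [h1] with p hp
        split_ifs with h
        · rfl
        · have hpos : 0 < (p.1 : ℝ) := lt_of_le_of_ne p.1.2.1 (Ne.symm h)
          rw [hg]
          · ext <;> simp
          · simp only
            have : ε * (p.2.2 - ε * ((1 - (p.1 : ℝ)) / p.1)) = ε * p.2.2 - (1 - (p.1 : ℝ)) / p.1 := by
              linear_combination (-(1 - (p.1 : ℝ)) / p.1) * hε
            rw [this, sub_le_iff_le_add, ← sub_le_iff_le_add', le_div_iff₀ hpos]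
            linarith
      exact continuous_snd.continuousAt.congr hloc
    · have hU : ∀ᶠ p : unitInterval × R3 in nhds (s, x), (p.1 : ℝ) ≠ 0 :=
        (continuous_subtype_val.comp continuous_fst).continuousAt.eventually_ne hs
      have hc : ContinuousAt (fun p : unitInterval × R3 =>
        (g (p.2.1, p.2.2 - ε * ((1 - (p.1 : ℝ)) / p.1)) + (0, ε * ((1 - (p.1 : ℝ)) / p.1)) : R3))
          (s, x) := by
        have hd : ContinuousAt (fun p : unitInterval × R3 => ε * ((1 - (p.1 : ℝ)) / p.1)) (s, x) := by
          refine continuousAt_const.mul (ContinuousAt.div ?_ ?_ hs)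
          · fun_prop
          · fun_prop
        refine ContinuousAt.add ?_ (continuousAt_const.prodMk hd)
        refine g.continuous.continuousAt.comp ?_
        refine ContinuousAt.prodMk (by fun_prop) (ContinuousAt.sub (by fun_prop) hd)
      refine hc.congr ?_
      filter_upwards [hU] with p hp
      rw [if_neg hp]
  have hf' : ∀ p : R3, ε * p.2 ≤ a → f.symm p = p := fun p hp => by
    rw [Homeomorph.symm_apply_eq, hf p hp]
  have := isotopic_of_family
    (fun s x => if (s : ℝ) = 0 then x else
        (f (x.1, x.2 - ε * ((1 - (s : ℝ)) / s)) + (0, ε * ((1 - (s : ℝ)) / s)) : R3))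
    (fun s x => if (s : ℝ) = 0 then x else
        (f.symm (x.1, x.2 - ε * ((1 - (s : ℝ)) / s)) + (0, ε * ((1 - (s : ℝ)) / s)) : R3))
    (key f hf) (key f.symm hf') ?_ ?_ (by simp) K
  · simpa [Prod.mk_zero_zero] using this
  · intro s x
    by_cases h : (s : ℝ) = 0
    · simp [h]
    · simp [h]
  · intro s x
    by_cases h : (s : ℝ) = 0
    · simp [h]
    · simp [h]

/-! ### Level-preserving homeomorphisms -/

/-- On every level the identity plus a map with Lipschitz constant `1 / 2` is bijective: the
preimage of `y` is the fixed point of the contraction `z ↦ y - W t z`. The estimate `anti` gives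
injectivity and the continuity of the inverse across levels. -/
theorem exists_homeo_of_contraction (W : ℝ → ℂ → ℂ) (hW : Continuous fun p : R3 => W p.2 p.1)
    (hL : ∀ t z z', ‖W t z - W t z'‖ ≤ 1 / 2 * ‖z - z'‖) :
    ∃ Φ : R3 ≃ₜ R3, ∀ p, Φ p = (p.1 + W p.2 p.1, p.2) := by
  have anti : ∀ t z z', ‖z - z'‖ ≤ 2 * ‖(z + W t z) - (z' + W t z')‖ := by
    intro t z z'
    have h1 := hL t z z'
    have h2 : ‖z - z'‖ ≤ ‖(z + W t z) - (z' + W t z')‖ + ‖W t z - W t z'‖ := by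
      have : z - z' = ((z + W t z) - (z' + W t z')) - (W t z - W t z') := by ring
      conv_lhs => rw [this]
      exact norm_sub_le _ _
    linarith
  have surj : ∀ t y, ∃ z, z + W t z = y := by
    intro t y
    have hc : ContractingWith (1 / 2 : NNReal) (fun z => y - W t z) := by
      refine ⟨by rw [← NNReal.coe_lt_coe]; norm_num, LipschitzWith.of_dist_le_mul fun z z' => ?_⟩
      rw [dist_eq_norm, dist_eq_norm]
      have := hL t z z'
      have e : y - W t z - (y - W t z') = -(W t z - W t z') := by ring
      rw [e, norm_neg]
      simpa using this
    refine ⟨ContractingWith.fixedPoint _ hc, ?_⟩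
    have := hc.fixedPoint_isFixedPt
    have e : y - W t (ContractingWith.fixedPoint _ hc) = ContractingWith.fixedPoint _ hc := this
    exact (sub_eq_iff_eq_add.1 e).symm
  choose g hg using surj
  have hcg : Continuous fun p : R3 => g p.2 p.1 := by
    rw [continuous_iff_continuousAt]
    rintro ⟨y0, t0⟩
    rw [ContinuousAt, tendsto_iff_norm_sub_tendsto_zero]
    have hlim : Filter.Tendsto (fun p : R3 => 2 * ‖p.1 - (g t0 y0 + W p.2 (g t0 y0))‖)
        (nhds (y0, t0)) (nhds 0) := by
      have hc : Continuous fun p : R3 => 2 * ‖p.1 - (g t0 y0 + W p.2 (g t0 y0))‖ := by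
        have : Continuous fun p : R3 => W p.2 (g t0 y0) :=
          hW.comp (continuous_const.prodMk continuous_snd)
        exact continuous_const.mul (continuous_fst.sub (continuous_const.add this)).norm
      have := hc.tendsto (y0, t0)
      simpa [hg] using this
    refine squeeze_zero (fun _ => norm_nonneg _) (fun p => ?_) hlim
    have := anti p.2 (g p.2 p.1) (g t0 y0)
    rwa [hg] at this
  refine ⟨{ toFun := fun p => (p.1 + W p.2 p.1, p.2)
            invFun := fun p => (g p.2 p.1, p.2)
            left_inv := fun p => ?_
            right_inv := fun p => ?_
            continuous_toFun := (continuous_fst.add hW).prodMk continuous_snd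
            continuous_invFun := hcg.prodMk continuous_snd }, fun p => rfl⟩
  · refine Prod.ext ?_ rfl
    have := anti p.2 (g p.2 (p.1 + W p.2 p.1)) p.1
    rw [hg, sub_self, norm_zero, mul_zero] at this
    exact sub_eq_zero.1 (norm_le_zero_iff.1 this)
  · exact Prod.ext (hg _ _) rfl

/-- Finitely many real data with small Lipschitz constant extend to the plane, with the same bound,
continuously in a parameter. -/
theorem exists_real_extension {ι : Type*} [Fintype ι] [Nonempty ι] (Z : ι → ℝ → ℂ)
    (hZ : ∀ q, Continuous (Z q)) (d : ι → ℝ → ℝ) (hd : ∀ q, Continuous (d q)) (M : ℝ → ℝ)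
    (hM : Continuous M) (hdM : ∀ q t, |d q t| ≤ M t) (K : ℝ) (hK : 0 ≤ K)
    (h : ∀ t q q', |d q t - d q' t| ≤ K * ‖Z q t - Z q' t‖) :
    ∃ w : ℝ → ℂ → ℝ, (Continuous fun p : R3 => w p.2 p.1) ∧
      (∀ t z z', |w t z - w t z'| ≤ K * ‖z - z'‖) ∧ (∀ q t, w t (Z q t) = d q t) ∧
      ∀ t z, |w t z| ≤ M t := by
  have hM0 : ∀ t, 0 ≤ M t := fun t =>
    (abs_nonneg _).trans (hdM (Classical.arbitrary ι) t)
  -- McShane's extension formula, applied on each level.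
  let u : ℝ → ℂ → ℝ := fun t z =>
    Finset.univ.inf' Finset.univ_nonempty fun q => d q t + K * ‖z - Z q t‖
  have hu : Continuous fun p : R3 => u p.2 p.1 := by
    refine Continuous.finset_inf'_apply _ fun q _ => ?_
    have := hZ q
    have := hd q
    fun_prop
  have hule : ∀ t z z', u t z ≤ u t z' + K * ‖z - z'‖ := by
    intro t z z'
    rw [← sub_le_iff_le_add]
    refine Finset.le_inf' _ _ fun q _ => ?_
    have h1 : u t z ≤ d q t + K * ‖z - Z q t‖ := Finset.inf'_le _ (Finset.mem_univ q)
    have h2 : ‖z - Z q t‖ ≤ ‖z - z'‖ + ‖z' - Z q t‖ := norm_sub_le_norm_sub_add_norm_sub _ _ _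
    nlinarith [mul_le_mul_of_nonneg_left h2 hK]
  have huL : ∀ t z z', |u t z - u t z'| ≤ K * ‖z - z'‖ := by
    intro t z z'
    rw [abs_sub_le_iff]
    have h1 := hule t z z'
    have h2 := hule t z' z
    rw [norm_sub_rev] at h2
    constructor <;> linarith
  have huZ : ∀ q t, u t (Z q t) = d q t := by
    intro q t
    apply le_antisymm
    · refine (Finset.inf'_le _ (Finset.mem_univ q)).trans ?_
      simp
    · refine Finset.le_inf' _ _ fun q' _ => ?_
      have := (abs_sub_le_iff.1 (h t q q')).1
      linarith
  -- The truncation preserves the Lipschitz bound and the prescribed values, and makes the extension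
  -- vanish on the levels where the bound `M` does.
  refine ⟨fun t z => max (-M t) (min (M t) (u t z)), ?_, ?_, ?_, ?_⟩
  · have : Continuous fun p : R3 => M p.2 := hM.comp continuous_snd
    fun_prop
  · intro t z z'
    refine le_trans ?_ (huL t z z')
    have h1 := abs_max_sub_max_le_max (-M t) (min (M t) (u t z)) (-M t) (min (M t) (u t z'))
    have h2 := abs_min_sub_min_le_max (M t) (u t z) (M t) (u t z')
    simp only [sub_self, abs_zero] at h1 h2
    rw [max_eq_right (a := (0 : ℝ)) (abs_nonneg _)] at h1 h2
    exact h1.trans h2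
  · intro q t
    have := abs_le.1 (hdM q t)
    simp only [huZ]
    rw [min_eq_right this.2, max_eq_right this.1]
  · intro t z
    rw [abs_le]
    exact ⟨le_max_left _ _, max_le (by linarith [hM0 t]) (min_le_left _ _)⟩

/-- The real and the imaginary part of the displacement are extended separately with constant `1 /
4`, so that together they satisfy the bound `1 / 2` of `exists_homeo_of_contraction`. Bounding them
by the sum of all displacements makes the map the identity on levels where nothing moves. -/
theorem exists_homeo_of_displacement {ι : Type*} [Fintype ι] [Nonempty ι] (Z D : ι → ℝ → ℂ)
    (hZ : ∀ q, Continuous (Z q)) (hD : ∀ q, Continuous (D q))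
    (h : ∀ t q q', ‖D q t - D q' t‖ ≤ 1 / 4 * ‖Z q t - Z q' t‖) :
    ∃ Φ : R3 ≃ₜ R3, (∀ q t, Φ (Z q t, t) = (Z q t + D q t, t)) ∧
      (∀ p, (Φ p).2 = p.2) ∧ ∀ p : R3, (∀ q, D q p.2 = 0) → Φ p = p := by
  let M : ℝ → ℝ := fun t => ∑ q, ‖D q t‖
  have hM : Continuous M := by
    have := hD
    fun_prop
  have hDM : ∀ q t, ‖D q t‖ ≤ M t := fun q t =>
    Finset.single_le_sum (f := fun q => ‖D q t‖) (fun _ _ => norm_nonneg _) (Finset.mem_univ q)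
  obtain ⟨w1, c1, l1, z1, b1⟩ := exists_real_extension Z hZ (fun q t => (D q t).re)
    (fun q => Complex.continuous_re.comp (hD q)) M hM
    (fun q t => (Complex.abs_re_le_norm _).trans (hDM q t)) (1 / 4) (by norm_num)
    (fun t q q' => by
      rw [← Complex.sub_re]; exact (Complex.abs_re_le_norm _).trans (h t q q'))
  obtain ⟨w2, c2, l2, z2, b2⟩ := exists_real_extension Z hZ (fun q t => (D q t).im)
    (fun q => Complex.continuous_im.comp (hD q)) M hM
    (fun q t => (Complex.abs_im_le_norm _).trans (hDM q t)) (1 / 4) (by norm_num)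
    (fun t q q' => by
      rw [← Complex.sub_im]; exact (Complex.abs_im_le_norm _).trans (h t q q'))
  obtain ⟨Φ, hΦ⟩ := exists_homeo_of_contraction (fun t z => (w1 t z : ℂ) + (w2 t z : ℂ) * Complex.I)
    ((Complex.continuous_ofReal.comp c1).add
      ((Complex.continuous_ofReal.comp c2).mul continuous_const)) (by
      intro t z z'
      have e : (w1 t z : ℂ) + (w2 t z : ℂ) * Complex.I - ((w1 t z' : ℂ) + (w2 t z' : ℂ) * Complex.I) =
          ((w1 t z - w1 t z' : ℝ) : ℂ) + ((w2 t z - w2 t z' : ℝ) : ℂ) * Complex.I := by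
        push_cast; ring
      rw [e]
      refine (norm_add_le _ _).trans ?_
      rw [norm_mul, Complex.norm_I, mul_one, Complex.norm_real, Complex.norm_real,
        Real.norm_eq_abs, Real.norm_eq_abs]
      linarith [l1 t z z', l2 t z z'])
  refine ⟨Φ, fun q t => ?_, fun p => by rw [hΦ], fun p hp => ?_⟩
  · rw [hΦ]
    simp only [z1, z2, Complex.re_add_im]
  · have hM0 : M p.2 = 0 := by simp [M, hp]
    have h1 : w1 p.2 p.1 = 0 := by
      have := b1 p.2 p.1
      rw [hM0] at this
      exact abs_nonpos_iff.1 this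
    have h2 : w2 p.2 p.1 = 0 := by
      have := b2 p.2 p.1
      rw [hM0] at this
      exact abs_nonpos_iff.1 this
    rw [hΦ]
    simp [h1, h2]

/-- Isotopy extension for finite systems of moving points: the systems `Z τ` are related by
level-preserving homeomorphisms if they change slowly compared to their separation. -/
theorem exists_homeo_of_family {ι : Type*} [Fintype ι] [Nonempty ι] (Z : ℝ → ι → ℝ → ℂ)
    (hZ : ∀ τ ∈ Set.Icc (0 : ℝ) 1, ∀ q, Continuous (Z τ q))
    (hloc : ∀ τ ∈ Set.Icc (0 : ℝ) 1, ∀ᶠ τ' in nhdsWithin τ (Set.Icc 0 1), ∀ t q q',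
      ‖(Z τ' q t - Z τ q t) - (Z τ' q' t - Z τ q' t)‖ ≤ 1 / 4 * ‖Z τ q t - Z τ q' t‖) :
    ∃ Φ : R3 ≃ₜ R3, (∀ q t, Φ (Z 0 q t, t) = (Z 1 q t, t)) ∧ (∀ p, (Φ p).2 = p.2) ∧
      ∀ p : R3, (∀ τ ∈ Set.Icc (0 : ℝ) 1, ∀ q, Z τ q p.2 = Z 0 q p.2) → Φ p = p := by
  let P : ℝ → ℝ → Prop := fun a b =>
    ∃ Φ : R3 ≃ₜ R3, (∀ q t, Φ (Z a q t, t) = (Z b q t, t)) ∧ (∀ p, (Φ p).2 = p.2) ∧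
      ∀ p : R3, (∀ τ ∈ Set.Icc (0 : ℝ) 1, ∀ q, Z τ q p.2 = Z 0 q p.2) → Φ p = p
  have htrans : ∀ a b c, P a b → P b c → P a c := by
    rintro a b c ⟨Φ, h1, h2, h3⟩ ⟨Ψ, k1, k2, k3⟩
    refine ⟨Φ.trans Ψ, fun q t => ?_, fun p => ?_, fun p hp => ?_⟩
    · simp [h1, k1]
    · simp [h2, k2]
    · simp [h3 p hp, k3 p hp]
  have hsymm : ∀ a b, P a b → P b a := by
    rintro a b ⟨Φ, h1, h2, h3⟩
    refine ⟨Φ.symm, fun q t => ?_, fun p => ?_, fun p hp => ?_⟩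
    · rw [Homeomorph.symm_apply_eq, h1]
    · have := h2 (Φ.symm p)
      rw [Φ.apply_symm_apply] at this
      exact this.symm
    · rw [Homeomorph.symm_apply_eq, h3 p hp]
  -- The relation `P` is transitive and holds in both directions between neighbouring parameters, so
  -- connectedness of the interval gives `P 0 1`.
  refine isPreconnected_Icc.induction₂' (s := Set.Icc (0 : ℝ) 1) P ?_ ?_ (by simp) (by simp)
  · intro τ hτ
    filter_upwards [hloc τ hτ, self_mem_nhdsWithin] with τ' h hτ'
    obtain ⟨Φ, h1, h2, h3⟩ := exists_homeo_of_displacement (Z τ) (fun q t => Z τ' q t - Z τ q t)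
      (hZ τ hτ) (fun q => (hZ τ' hτ' q).sub (hZ τ hτ q)) h
    have : P τ τ' := by
      refine ⟨Φ, fun q t => ?_, h2, fun p hp => h3 p fun q => ?_⟩
      · rw [h1, add_sub_cancel]
      · rw [hp τ' hτ' q, hp τ hτ q, sub_self]
    exact ⟨this, hsymm _ _ this⟩
  · intro a b c _ _ _
    exact htrans a b c

/-- The linear case of `exists_homeo_of_family`. -/
theorem exists_homeo_of_linear {ι : Type*} [Fintype ι] [Nonempty ι] (Z D : ι → ℝ → ℂ)
    (hZ : ∀ q, Continuous (Z q)) (hD : ∀ q, Continuous (D q))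
    (h : ∀ τ ∈ Set.Icc (0 : ℝ) 1, ∃ c : ℝ, ∀ t q q',
      ‖D q t - D q' t‖ ≤ c * ‖(Z q t + τ * D q t) - (Z q' t + τ * D q' t)‖) :
    ∃ Φ : R3 ≃ₜ R3, (∀ q t, Φ (Z q t, t) = (Z q t + D q t, t)) ∧ (∀ p, (Φ p).2 = p.2) ∧
      ∀ p : R3, (∀ q, D q p.2 = 0) → Φ p = p := by
  obtain ⟨Φ, h1, h2, h3⟩ := exists_homeo_of_family (fun τ q t => Z q t + τ * D q t)
    (fun τ _ q => (hZ q).add (continuous_const.mul (hD q))) (by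
      intro τ hτ
      obtain ⟨c, hc⟩ := h τ hτ
      have hlim : ∀ᶠ τ' in nhdsWithin τ (Set.Icc 0 1), |τ' - τ| * |c| < 1 / 4 := by
        apply Filter.Eventually.filter_mono nhdsWithin_le_nhds
        have : Continuous fun τ' : ℝ => |τ' - τ| * |c| := by fun_prop
        exact this.continuousAt.eventually_lt_const (by simp)
      filter_upwards [hlim] with τ' hτ' t q q'
      have e : Z q t + τ' * D q t - (Z q t + τ * D q t) -
          (Z q' t + τ' * D q' t - (Z q' t + τ * D q' t)) =
          ((τ' - τ : ℝ) : ℂ) * (D q t - D q' t) := by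
        push_cast; ring
      rw [e, norm_mul, Complex.norm_real, Real.norm_eq_abs]
      calc |τ' - τ| * ‖D q t - D q' t‖
          ≤ |τ' - τ| * (|c| * ‖Z q t + τ * D q t - (Z q' t + τ * D q' t)‖) := by
            refine mul_le_mul_of_nonneg_left ((hc t q q').trans ?_) (abs_nonneg _)
            exact mul_le_mul_of_nonneg_right (le_abs_self c) (norm_nonneg _)
        _ = (|τ' - τ| * |c|) * ‖Z q t + τ * D q t - (Z q' t + τ * D q' t)‖ := by ring
        _ ≤ _ := mul_le_mul_of_nonneg_right hτ'.le (norm_nonneg _))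
  refine ⟨Φ, fun q t => ?_, h2, fun p hp => h3 p fun τ _ q => by simp [hp]⟩
  have := h1 q t
  simpa using this

/-! ### Stretching the caps -/

theorem letterSign_abs (b : Bool) : |letterSign b| = 1 := by cases b <;> simp [letterSign]

theorem letterSign_mul_self (b : Bool) : letterSign b * letterSign b = 1 := by
  cases b <;> simp [letterSign]

/-- Half the width, at height `t`, of a cap on vertical legs of length `l`. -/
def legWidth (l t : ℝ) : ℝ := √(1 / 4 - (max (t - l) 0) ^ 2)

/-- Half the width, at height `t`, of a cap stretched to the height `l + 1 / 2`. -/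
def stretchWidth (l t : ℝ) : ℝ := √(1 / 4 - (max t 0 / (2 * l + 1)) ^ 2)

theorem continuous_legWidth (l : ℝ) : Continuous (legWidth l) := by
  unfold legWidth; fun_prop

theorem continuous_stretchWidth (l : ℝ) : Continuous (stretchWidth l) := by
  unfold stretchWidth; fun_prop

theorem legWidth_le_half (l t : ℝ) : legWidth l t ≤ 1 / 2 := by
  unfold legWidth
  rw [Real.sqrt_le_left (by norm_num)]
  nlinarith [sq_nonneg (max (t - l) 0)]

theorem stretchWidth_le_legWidth {l t : ℝ} (hl : 0 ≤ l) : stretchWidth l t ≤ legWidth l t := by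
  unfold stretchWidth legWidth
  rcases le_or_gt t (l + 1 / 2) with ht | ht
  · apply Real.sqrt_le_sqrt
    have h0 : 0 ≤ max (t - l) 0 := le_max_right _ _
    have h1 : max (t - l) 0 ≤ max t 0 / (2 * l + 1) := by
      rw [le_div_iff₀ (by linarith)]
      rcases le_total t l with h | h
      · rw [max_eq_right (by linarith)]
        simp
      · rw [max_eq_left (by linarith), max_eq_left (by linarith)]
        nlinarith
    nlinarith
  · have : √(1 / 4 - (max t 0 / (2 * l + 1)) ^ 2) = 0 := by
      apply Real.sqrt_eq_zero_of_nonpos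
      have h1 : 1 / 2 ≤ max t 0 / (2 * l + 1) := by
        rw [le_div_iff₀ (by linarith), max_eq_left (by linarith)]
        linarith
      nlinarith
    rw [this]
    exact Real.sqrt_nonneg _

/-- Both widths vanish like a square root at the height `l + 1 / 2`, so their quotient stays bounded
up to the tip. Interpolation between the two shapes is therefore controlled even where the legs of a
cap meet. -/
theorem legWidth_le_mul_stretchWidth {l t : ℝ} (hl : 0 ≤ l) :
    legWidth l t ≤ (2 * (2 * l + 1)) * stretchWidth l t := by
  have hk : 0 < 2 * l + 1 := by linarith
  unfold stretchWidth legWidth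
  rw [Real.sqrt_le_left (by positivity), mul_pow]
  rcases le_or_gt t (l + 1 / 2) with ht | ht
  · have hx : max t 0 / (2 * l + 1) ≤ 1 / 2 := by
      rw [div_le_iff₀ hk]
      rcases max_cases t 0 with h | h <;> linarith
    have hx0 : 0 ≤ max t 0 / (2 * l + 1) := by positivity
    rw [Real.sq_sqrt (by nlinarith)]
    set x := max t 0 / (2 * l + 1) with hxdef
    have hxe : x * (2 * l + 1) = max t 0 := by rw [hxdef]; field_simp
    have h1 : 1 / 4 - x ^ 2 ≥ 1 / 2 * (1 / 2 - x) := by nlinarith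
    have h2 : (2 * (2 * l + 1)) ^ 2 * (1 / 4 - x ^ 2) ≥ 2 * (2 * l + 1) * (1 / 4 - x ^ 2) := by
      have : 0 ≤ 1 / 4 - x ^ 2 := by nlinarith
      have h3 : 2 * (2 * l + 1) ≤ (2 * (2 * l + 1)) ^ 2 := by nlinarith
      exact mul_le_mul_of_nonneg_right h3 this
    have h3 : 2 * (2 * l + 1) * (1 / 4 - x ^ 2) ≥ l + 1 / 2 - max t 0 := by nlinarith
    rcases le_total t l with h | h
    · rw [max_eq_right (by linarith : t - l ≤ 0)]
      rcases max_cases t 0 with h' | h' <;> nlinarith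
    · rw [max_eq_left (by linarith : 0 ≤ t - l)]
      rw [max_eq_left (by linarith : 0 ≤ t)] at h3
      nlinarith
  · have h1 : 1 / 4 - (max (t - l) 0) ^ 2 ≤ 0 := by
      rw [max_eq_left (by linarith)]; nlinarith
    exact h1.trans (by positivity)

/-- The end points of the arcs of a system of caps of half width `r`. -/
def capPoint {n : ℕ} (r : ℝ) (q : Fin n × Bool) : ℂ :=
  ((2 * (q.1 : ℕ) + 1 / 2 + letterSign q.2 * r : ℝ) : ℂ)

theorem mem_caps_iff {n : ℕ} {p : R3} : p ∈ caps n ↔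
    ∃ q : Fin n × Bool, 0 ≤ p.2 ∧ p.2 ≤ 1 / 2 ∧ p.1 = capPoint (√(1 / 4 - p.2 ^ 2)) q := by
  constructor
  · rintro ⟨i, hi, h1, h2, h3⟩
    have h4 : p.2 ≤ 1 / 2 := by nlinarith [sq_nonneg (p.1.re - (2 * i + 1 / 2))]
    have h5 : (p.1.re - (2 * i + 1 / 2)) ^ 2 = 1 / 4 - p.2 ^ 2 := by linarith
    rcases le_total 0 (p.1.re - (2 * i + 1 / 2)) with h | h
    · refine ⟨(⟨i, hi⟩, true), h2, h4, ?_⟩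
      apply Complex.ext
      · simp only [capPoint, letterSign, if_true, Complex.ofReal_re]
        rw [← h5, Real.sqrt_sq h]; ring
      · simp [capPoint, h1]
    · refine ⟨(⟨i, hi⟩, false), h2, h4, ?_⟩
      apply Complex.ext
      · simp only [capPoint, letterSign, Complex.ofReal_re]
        rw [← h5, ← neg_sq, Real.sqrt_sq (by linarith)]; simp
      · simp [capPoint, h1]
  · rintro ⟨⟨i, b⟩, h1, h2, h3⟩
    refine ⟨i, i.2, ?_, h1, ?_⟩
    · rw [h3]; simp [capPoint]
    · rw [h3]
      simp only [capPoint, Complex.ofReal_re, add_sub_cancel_left]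
      rw [mul_pow, Real.sq_sqrt (by nlinarith), sq, letterSign_mul_self]
      ring

theorem norm_capPoint_sub {n : ℕ} (a b : ℝ) (q q' : Fin n × Bool) :
    ‖capPoint a q - capPoint b q'‖ =
      |2 * ((q.1 : ℕ) - (q'.1 : ℕ) : ℝ) + (letterSign q.2 * a - letterSign q'.2 * b)| := by
  rw [capPoint, capPoint, ← Complex.ofReal_sub, Complex.norm_real, Real.norm_eq_abs]
  congr 1; ring

/-- Two systems of caps of comparable widths are separated in a comparable way. -/
theorem capPoint_comparable {n : ℕ} {C r d : ℝ} (hC : 1 ≤ C) (hr0 : 0 ≤ r) (hr : r ≤ 1 / 2)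
    (hd0 : |d| ≤ 1 / 2) (hd : |d| ≤ C * r) (q q' : Fin n × Bool) :
    |letterSign q.2 * d - letterSign q'.2 * d| ≤ C * ‖capPoint r q - capPoint r q'‖ := by
  rw [norm_capPoint_sub]
  obtain ⟨i, b⟩ := q
  obtain ⟨j, b'⟩ := q'
  simp only
  have hsum : |letterSign b * d - letterSign b' * d| ≤ 2 * |d| := by
    refine (abs_sub _ _).trans ?_
    rw [abs_mul, abs_mul, letterSign_abs, letterSign_abs]; linarith
  by_cases hij : i = j
  · subst hij
    by_cases hb : b = b'
    · subst hb; simp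
    · have h2 : |letterSign b * r - letterSign b' * r| = 2 * r := by
        cases b <;> cases b' <;> simp [letterSign] at hb ⊢
        · rw [abs_of_nonpos (by linarith)]; ring
        · rw [abs_of_nonneg (by linarith)]; ring
      rw [sub_self, mul_zero, zero_add, h2]
      nlinarith
  · have h1 : (1 : ℝ) ≤ |((i : ℕ) - (j : ℕ) : ℝ)| := by
      have : ((i : ℕ) : ℤ) - ((j : ℕ) : ℤ) ≠ 0 := by
        intro h; apply hij; ext; omega
      have := Int.one_le_abs this
      have h' : ((1 : ℤ) : ℝ) ≤ ((|((i : ℕ) : ℤ) - ((j : ℕ) : ℤ)| : ℤ) : ℝ) := by exact_mod_cast this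
      simpa using h'
    have h2 : |letterSign b * r - letterSign b' * r| ≤ 1 := by
      refine (abs_sub _ _).trans ?_
      rw [abs_mul, abs_mul, letterSign_abs, letterSign_abs, abs_of_nonneg hr0]; linarith
    have h3 : 1 ≤ |2 * ((i : ℕ) - (j : ℕ) : ℝ) + (letterSign b * r - letterSign b' * r)| := by
      have := abs_sub_abs_le_abs_sub (2 * ((i : ℕ) - (j : ℕ) : ℝ))
        (-(letterSign b * r - letterSign b' * r))
      rw [abs_neg, sub_neg_eq_add, abs_mul, abs_two] at this
      linarith
    nlinarith

/-- Multiplication of the positive heights by a positive factor. -/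
def scaleUpper (k : ℝ) (hk : 0 < k) : R3 ≃ₜ R3 where
  toFun p := (p.1, min p.2 0 + k * max p.2 0)
  invFun p := (p.1, min p.2 0 + k⁻¹ * max p.2 0)
  left_inv p := by
    refine Prod.ext rfl ?_
    rcases le_total p.2 0 with h | h
    · simp [h]
    · have : 0 ≤ k * p.2 := by positivity
      simp [h, this]
      field_simp
  right_inv p := by
    refine Prod.ext rfl ?_
    rcases le_total p.2 0 with h | h
    · simp [h]
    · have : 0 ≤ k⁻¹ * p.2 := by positivity
      simp [h, this]
      field_simp
  continuous_toFun := by fun_prop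
  continuous_invFun := by fun_prop

/-- A vertical scaling makes the semicircles into half ellipses of height `l + 1 / 2`, and a
level-preserving homeomorphism widens these to vertical legs of length `l` topped by semicircles.
Braids are inserted on the legs later. -/
theorem exists_homeo_stretch {n : ℕ} (hn : 1 ≤ n) {l : ℝ} (hl : 0 ≤ l) :
    ∃ Θ : R3 ≃ₜ R3, (∀ p : R3, p.2 ≤ 0 → Θ p = p) ∧
      Θ '' caps n = {p | ∃ q : Fin n × Bool, 0 ≤ p.2 ∧ p.2 ≤ l + 1 / 2 ∧
        p.1 = capPoint (legWidth l p.2) q} := by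
  have : Nonempty (Fin n × Bool) := ⟨(⟨0, by omega⟩, true)⟩
  have hk : 0 < 2 * l + 1 := by linarith
  obtain ⟨Φ, h1, h2, h3⟩ := exists_homeo_of_linear
    (fun (q : Fin n × Bool) t => capPoint (stretchWidth l t) q)
    (fun q t => ((letterSign q.2 * (legWidth l t - stretchWidth l t) : ℝ) : ℂ))
    (fun q => by
      have := continuous_stretchWidth l
      unfold capPoint; fun_prop)
    (fun q => by
      have := continuous_stretchWidth l
      have := continuous_legWidth l
      fun_prop) (by
      intro τ hτ
      -- The interpolated half width lies between the two given ones, so the quotient bound serves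
      -- for all `τ` at once.
      refine ⟨2 * (2 * l + 1), fun t q q' => ?_⟩
      have hs : 0 ≤ stretchWidth l t := Real.sqrt_nonneg _
      have hle := stretchWidth_le_legWidth (t := t) hl
      have hle' := legWidth_le_mul_stretchWidth (t := t) hl
      have hh := legWidth_le_half l t
      set r := stretchWidth l t + τ * (legWidth l t - stretchWidth l t) with hr
      have hr1 : stretchWidth l t ≤ r := by
        rw [hr]; nlinarith [hτ.1]
      have hr2 : r ≤ legWidth l t := by
        rw [hr]; nlinarith [hτ.2]
      have e : ∀ q : Fin n × Bool, capPoint (stretchWidth l t) q +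
          τ * ((letterSign q.2 * (legWidth l t - stretchWidth l t) : ℝ) : ℂ) = capPoint r q := by
        intro q
        rw [capPoint, capPoint, hr]; push_cast; ring
      rw [e, e, ← Complex.ofReal_sub, Complex.norm_real, Real.norm_eq_abs]
      refine capPoint_comparable (by linarith) (by linarith) (by linarith) ?_ ?_ q q'
      · rw [abs_of_nonneg (by linarith)]; linarith
      · rw [abs_of_nonneg (by linarith)]; nlinarith)
  refine ⟨(scaleUpper (2 * l + 1) hk).trans Φ, fun p hp => ?_, ?_⟩
  · have e : scaleUpper (2 * l + 1) hk p = p := by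
      refine Prod.ext rfl ?_
      simp [scaleUpper, hp]
    rw [Homeomorph.trans_apply, e]
    refine h3 p fun q => ?_
    have : legWidth l p.2 = stretchWidth l p.2 := by
      unfold legWidth stretchWidth
      rw [max_eq_right (by linarith), max_eq_right hp]; simp
    rw [this]; simp
  · have key : ∀ (q : Fin n × Bool) (t : ℝ), 0 ≤ t →
        (scaleUpper (2 * l + 1) hk).trans Φ (capPoint (√(1 / 4 - t ^ 2)) q, t) =
          (capPoint (legWidth l ((2 * l + 1) * t)) q, (2 * l + 1) * t) := by
      intro q t ht
      have e : scaleUpper (2 * l + 1) hk (capPoint (√(1 / 4 - t ^ 2)) q, t) =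
          (capPoint (stretchWidth l ((2 * l + 1) * t)) q, (2 * l + 1) * t) := by
        refine Prod.ext ?_ ?_
        · change capPoint (√(1 / 4 - t ^ 2)) q = capPoint (stretchWidth l ((2 * l + 1) * t)) q
          unfold stretchWidth
          rw [max_eq_left (by positivity), mul_div_cancel_left₀ _ hk.ne']
        · simp [scaleUpper, ht]
      rw [Homeomorph.trans_apply, e, h1]
      refine Prod.ext ?_ rfl
      simp only [capPoint]
      push_cast; ring
    ext p
    simp only [Set.mem_image, Set.mem_ofPred_eq]
    constructor
    · rintro ⟨p', hp', rfl⟩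
      obtain ⟨q, a1, a2, a3⟩ := mem_caps_iff.1 hp'
      obtain ⟨z, t⟩ := p'
      simp only at a1 a2 a3
      subst a3
      rw [key q t a1]
      exact ⟨q, by positivity, by simp only; nlinarith, rfl⟩
    · rintro ⟨q, a1, a2, a3⟩
      refine ⟨(capPoint (√(1 / 4 - (p.2 / (2 * l + 1)) ^ 2)) q, p.2 / (2 * l + 1)), ?_, ?_⟩
      · refine mem_caps_iff.2 ⟨q, by positivity, ?_, rfl⟩
        simp only
        rw [div_le_iff₀ hk]; linarith
      · rw [key q _ (by positivity), mul_div_cancel₀ _ hk.ne', ← a3]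

/-! ### Geometric braids as level-preserving motions -/

theorem twist_zero (i : ℕ) (z : ℂ) : twist i 0 z = z := by simp [twist]

theorem twist_add (i : ℕ) (a b : ℝ) (z : ℂ) : twist i a (twist i b z) = twist i (a + b) z := by
  have h : ‖twist i b z - center i‖ = ‖z - center i‖ := by
    rw [twist, add_sub_cancel_left, norm_mul, Complex.norm_exp_ofReal_mul_I, one_mul]
  rw [twist, h]
  simp only [twist, add_sub_cancel_left]
  rw [← mul_assoc, ← Complex.exp_add]
  congr 3
  push_cast; ring

/-- The partial half twist, as a homeomorphism of the plane. -/
def twistHomeo (i : ℕ) (a : ℝ) : ℂ ≃ₜ ℂ where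
  toFun := twist i a
  invFun := twist i (-a)
  left_inv z := twist_neg_twist i a z
  right_inv z := by simpa using twist_neg_twist i (-a) z
  continuous_toFun := continuous_twist i a
  continuous_invFun := continuous_twist i (-a)

theorem continuous_twist_uncurry (i : ℕ) : Continuous fun p : ℝ × ℂ => twist i p.1 p.2 := by
  unfold twist cutoff
  fun_prop

/-- A half twist exchanges two of the marked points and fixes the other ones. -/
theorem twist_mark (i k : ℕ) (b : Bool) :
    twist i (letterSign b) (k : ℂ) = (Equiv.swap i (i + 1) k : ℕ) := by
  have hexp : ∀ b : Bool, Complex.exp (((Real.pi * letterSign b * 1 : ℝ) : ℂ) * Complex.I) = -1 := by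
    intro b
    cases b
    · simp [letterSign, Complex.exp_neg]
    · simp [letterSign]
  have hnorm : ‖(k : ℂ) - center i‖ = |(k : ℝ) - i - 1 / 2| := by
    have : (k : ℂ) - center i = (((k : ℝ) - i - 1 / 2 : ℝ) : ℂ) := by
      rw [center]; push_cast; ring
    rw [this, Complex.norm_real, Real.norm_eq_abs]
  rw [twist, hnorm]
  by_cases h1 : k = i
  · subst h1
    have : cutoff |(k : ℝ) - k - 1 / 2| = 1 := by
      rw [sub_self, zero_sub, abs_neg, abs_of_pos (by norm_num), cutoff]; norm_num
    rw [this, hexp, Equiv.swap_apply_left, center]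
    push_cast; ring
  by_cases h2 : k = i + 1
  · subst h2
    have : cutoff |((i + 1 : ℕ) : ℝ) - i - 1 / 2| = 1 := by
      have : ((i + 1 : ℕ) : ℝ) - i - 1 / 2 = 1 / 2 := by push_cast; ring
      rw [this, abs_of_pos (by norm_num), cutoff]; norm_num
    rw [this, hexp, Equiv.swap_apply_right, center]
    push_cast; ring
  · have : cutoff |(k : ℝ) - i - 1 / 2| = 0 := by
      have h : 1 ≤ |(k : ℝ) - i - 1 / 2| := by
        rcases Nat.lt_or_ge k i with h | h
        · have : (k : ℝ) + 1 ≤ i := by exact_mod_cast h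
          rw [abs_of_neg (by linarith)]; linarith
        · have : (i : ℝ) + 2 ≤ k := by
            have : i + 2 ≤ k := by omega
            exact_mod_cast this
          rw [abs_of_nonneg (by linarith)]; linarith
      rw [cutoff, max_eq_left]
      exact (min_le_right _ _).trans (by linarith)
    rw [this, Equiv.swap_apply_of_ne_of_ne h1 h2]
    simp

theorem exists_perm_twist {m : ℕ} (i : Fin (m - 1)) (b : Bool) :
    ∃ π : Equiv.Perm (Fin m), ∀ q : Fin m,
      twist i (letterSign b) ((q : ℕ) : ℂ) = ((π q : ℕ) : ℂ) := by
  refine ⟨Equiv.swap ⟨i, by omega⟩ ⟨i + 1, by omega⟩, fun q => ?_⟩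
  rw [twist_mark]
  congr 1
  simp only [Equiv.swap_apply_def, Fin.ext_iff]
  split_ifs <;> rfl

/-- Truncation to the unit interval. -/
def clamp (s : ℝ) : ℝ := max 0 (min 1 s)

theorem clamp_of_nonpos {s : ℝ} (h : s ≤ 0) : clamp s = 0 :=
  max_eq_left ((min_le_right _ _).trans h)

theorem clamp_of_one_le {s : ℝ} (h : 1 ≤ s) : clamp s = 1 := by
  rw [clamp, min_eq_left h]; norm_num

theorem clamp_of_mem {s : ℝ} (h0 : 0 ≤ s) (h1 : s ≤ 1) : clamp s = s := by
  rw [clamp, min_eq_right h1, max_eq_right h0]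

theorem clamp_mem (s : ℝ) : clamp s ∈ Set.Icc (0 : ℝ) 1 :=
  ⟨le_max_left _ _, max_le (by norm_num) (min_le_left _ _)⟩

@[fun_prop]
theorem continuous_clamp : Continuous clamp := by unfold clamp; fun_prop

/-- The position, at height `t`, of the motion of the plane that is given by a braid word drawn
downwards from height `0`. -/
def motion {m : ℕ} : BraidWord m → ℝ → (ℂ ≃ₜ ℂ)
  | [], _ => Homeomorph.refl ℂ
  | x :: w, t => (motion w (t + 1)).trans (twistHomeo x.1 (letterSign x.2 * clamp (t + 1)))

theorem motion_cons {m : ℕ} (x : Fin (m - 1) × Bool) (w : BraidWord m) (t : ℝ) (z : ℂ) :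
    motion (x :: w) t z = twist x.1 (letterSign x.2 * clamp (t + 1)) (motion w (t + 1) z) := rfl

theorem continuous_motion {m : ℕ} (w : BraidWord m) :
    Continuous fun p : R3 => motion w p.2 p.1 := by
  induction w with
  | nil => exact continuous_fst
  | cons x w ih =>
    have h1 : Continuous fun p : R3 => motion w (p.2 + 1) p.1 :=
      ih.comp (by fun_prop : Continuous fun p : R3 => ((p.1, p.2 + 1) : R3))
    exact (continuous_twist_uncurry x.1).comp
      ((by fun_prop : Continuous fun p : R3 => letterSign x.2 * clamp (p.2 + 1)).prodMk h1)

theorem continuous_motion_symm {m : ℕ} (w : BraidWord m) :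
    Continuous fun p : R3 => (motion w p.2).symm p.1 := by
  induction w with
  | nil => exact continuous_fst
  | cons x w ih =>
    have h1 : Continuous fun p : R3 => twist x.1 (-(letterSign x.2 * clamp (p.2 + 1))) p.1 :=
      (continuous_twist_uncurry x.1).comp
      ((by fun_prop : Continuous fun p : R3 => -(letterSign x.2 * clamp (p.2 + 1))).prodMk
        continuous_fst)
    exact ih.comp (h1.prodMk (by fun_prop : Continuous fun p : R3 => p.2 + 1))

theorem motion_of_le {m : ℕ} (w : BraidWord m) {t : ℝ} (ht : t ≤ -(w.length : ℝ)) (z : ℂ) :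
    motion w t z = z := by
  induction w generalizing t with
  | nil => rfl
  | cons x w ih =>
    rw [List.length_cons] at ht
    push_cast at ht
    rw [motion_cons, ih (by linarith), clamp_of_nonpos (by
      have : (0 : ℝ) ≤ w.length := by positivity
      linarith), mul_zero, twist_zero]

theorem motion_of_nonneg {m : ℕ} (w : BraidWord m) {t : ℝ} (ht : 0 ≤ t) :
    motion w t = planeAction m (FreeGroup.mk w) := by
  induction w generalizing t with
  | nil =>
    rw [← FreeGroup.one_eq_mk, map_one]; rfl
  | cons x w ih =>
    have h : FreeGroup.mk (x :: w) = FreeGroup.mk [x] * FreeGroup.mk w := by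
      rw [FreeGroup.mul_mk]; rfl
    rw [h, map_mul, ← ih (t := t + 1) (by linarith)]
    ext z
    rw [motion_cons, clamp_of_one_le (by linarith), mul_one]
    obtain ⟨i, b⟩ := x
    cases b
    · simp [planeAction, letterSign, FreeGroup.lift_mk]
      rfl
    · simp [planeAction, letterSign, FreeGroup.lift_mk]
      rfl

theorem exists_perm_motion {m : ℕ} (w : BraidWord m) : ∃ π : Equiv.Perm (Fin m),
    ∀ (q : Fin m) (t : ℝ), 0 ≤ t → motion w t ((q : ℕ) : ℂ) = ((π q : ℕ) : ℂ) := by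
  induction w with
  | nil => exact ⟨1, fun q t _ => rfl⟩
  | cons x w ih =>
    obtain ⟨π, hπ⟩ := ih
    obtain ⟨ρ, hρ⟩ := exists_perm_twist x.1 x.2
    refine ⟨ρ * π, fun q t ht => ?_⟩
    rw [motion_cons, hπ q _ (by linarith), clamp_of_one_le (by linarith), mul_one, hρ]
    rfl

/-! ### Geometric braids as subsets of space -/

/-- The strands of a geometric braid. -/
def braidSet {m : ℕ} (w : BraidWord m) : Set R3 :=
  {p | -(w.length : ℝ) ≤ p.2 ∧ p.2 ≤ 0 ∧ ∃ q : Fin m, p.1 = motion w p.2 ((q : ℕ) : ℂ)}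

/-- The strands of the geometric braid of a single letter. -/
def letterSet {m : ℕ} (x : Fin (m - 1) × Bool) : Set R3 :=
  {p | -1 ≤ p.2 ∧ p.2 ≤ 0 ∧
    ∃ q : Fin m, p.1 = twist x.1 (letterSign x.2 * (p.2 + 1)) ((q : ℕ) : ℂ)}

theorem mem_braidSet_nil {m : ℕ} {p : R3} :
    p ∈ braidSet ([] : BraidWord m) ↔ p.2 = 0 ∧ ∃ q : Fin m, p.1 = ((q : ℕ) : ℂ) := by
  constructor
  · rintro ⟨h1, h2, q, h3⟩
    exact ⟨le_antisymm h2 (by simpa using h1), q, h3⟩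
  · rintro ⟨h, q, h3⟩
    exact ⟨by simp [h], h.le, q, h3⟩

/-- At the heights of the first letter the motion of the rest has already reached its final
positions, a permutation of the marked points; below them the first letter has not started. -/
theorem mem_braidSet_cons {m : ℕ} (x : Fin (m - 1) × Bool) (w : BraidWord m) (p : R3) :
    p ∈ braidSet (x :: w) ↔ p ∈ letterSet x ∨ (p.1, p.2 + 1) ∈ braidSet w := by
  obtain ⟨z, t⟩ := p
  obtain ⟨π, hπ⟩ := exists_perm_motion w
  have hl : (0 : ℝ) ≤ w.length := by positivity
  constructor
  · rintro ⟨h1, h2, q, h3⟩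
    simp only [List.length_cons, Nat.cast_add, Nat.cast_one] at h1 h2 h3
    rw [motion_cons] at h3
    rcases le_or_gt (-1) t with ht | ht
    · left
      refine ⟨ht, h2, π q, ?_⟩
      rw [h3, hπ q _ (by linarith), clamp_of_mem (by linarith) (by linarith)]
    · right
      refine ⟨by simp only; linarith, by simp only; linarith, q, ?_⟩
      rw [h3, clamp_of_nonpos (by linarith), mul_zero, twist_zero]
  · rintro (⟨h1, h2, q, h3⟩ | ⟨h1, h2, q, h3⟩)
    · refine ⟨by simp only [List.length_cons] at *; push_cast; linarith, h2, π.symm q, ?_⟩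
      simp only at h1 h2 h3 ⊢
      rw [motion_cons, hπ _ _ (by linarith), clamp_of_mem (by linarith) (by linarith), h3]
      simp
    · simp only at h1 h2 h3
      refine ⟨by simp only [List.length_cons]; push_cast; linarith, by simp only; linarith, q, ?_⟩
      simp only
      rw [motion_cons, h3, clamp_of_nonpos h2, mul_zero, twist_zero]

theorem mark_mem_letterSet {m : ℕ} (x : Fin (m - 1) × Bool) (q : Fin m) {p : R3}
    (h1 : p.1 = ((q : ℕ) : ℂ)) (h2 : p.2 = 0 ∨ p.2 = -1) : p ∈ letterSet x := by
  rcases h2 with h2 | h2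
  · obtain ⟨π, hπ⟩ := exists_perm_twist x.1 x.2
    refine ⟨by rw [h2]; norm_num, h2.le, π.symm q, ?_⟩
    rw [h1, h2, zero_add, mul_one, hπ]; simp
  · refine ⟨h2.ge, by rw [h2]; norm_num, q, ?_⟩
    rw [h1, h2]; simp [twist_zero]

theorem mem_braidSet_singleton {m : ℕ} (x : Fin (m - 1) × Bool) (p : R3) :
    p ∈ braidSet [x] ↔ p ∈ letterSet x := by
  rw [mem_braidSet_cons, mem_braidSet_nil, or_iff_left_of_imp]
  rintro ⟨h, q, h'⟩
  exact mark_mem_letterSet x q h' (Or.inr (by simp only at h; linarith))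

theorem mark_mem_braidSet {m : ℕ} (w : BraidWord m) (q : Fin m) {p : R3}
    (h1 : p.1 = ((q : ℕ) : ℂ)) (h2 : p.2 = 0 ∨ p.2 = -(w.length : ℝ)) : p ∈ braidSet w := by
  have hl : (0 : ℝ) ≤ w.length := by positivity
  rcases h2 with h2 | h2
  · obtain ⟨π, hπ⟩ := exists_perm_motion w
    refine ⟨by rw [h2]; linarith, h2.le, π.symm q, ?_⟩
    rw [h1, h2, hπ _ _ le_rfl]; simp
  · refine ⟨h2.ge, by rw [h2]; linarith, q, ?_⟩
    rw [h1, motion_of_le w h2.le]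

theorem mem_braidSet_append {m : ℕ} (u w : BraidWord m) (p : R3) :
    p ∈ braidSet (u ++ w) ↔ p ∈ braidSet u ∨ (p.1, p.2 + u.length) ∈ braidSet w := by
  induction u generalizing p with
  | nil =>
    obtain ⟨z, t⟩ := p
    rw [List.nil_append, mem_braidSet_nil]
    simp only [List.length_nil, Nat.cast_zero, add_zero]
    rw [or_iff_right_of_imp]
    rintro ⟨h, q, h'⟩
    exact mark_mem_braidSet w q h' (Or.inl h)
  | cons x u ih =>
    rw [List.cons_append, mem_braidSet_cons, mem_braidSet_cons, ih, or_assoc]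
    simp only [List.length_cons, Nat.cast_add, Nat.cast_one]
    rw [show p.2 + 1 + (u.length : ℝ) = p.2 + (u.length + 1) by ring]

theorem mem_letterSet_reflect {m : ℕ} (i : Fin (m - 1)) (b : Bool) (p : R3) :
    p ∈ letterSet (i, b) ↔ (p.1, -1 - p.2) ∈ letterSet (i, !b) := by
  -- A complete half twist permutes the marked points. A partial twist of one of them is thus the
  -- partial opposite twist of its final position.
  have key : ∀ (b : Bool) (p : R3), p ∈ letterSet (i, b) →
      ((p.1, -1 - p.2) : R3) ∈ letterSet (i, !b) := by
    rintro b p ⟨h1, h2, q, h3⟩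
    obtain ⟨π, hπ⟩ := exists_perm_twist i b
    refine ⟨by simp only; linarith, by simp only; linarith, π q, ?_⟩
    simp only
    rw [h3, ← hπ, twist_add]
    have : letterSign (!b) = - letterSign b := by cases b <;> simp [letterSign]
    rw [this]
    congr 1; ring
  refine ⟨key b p, fun h => ?_⟩
  have := key (!b) _ h
  simpa using this

/-- Turning the picture upside down reverses the order of the letters and the direction of each
twist. -/
theorem mem_braidSet_invRev {m : ℕ} (u : BraidWord m) (p : R3) :
    p ∈ braidSet u ↔ (p.1, -(u.length : ℝ) - p.2) ∈ braidSet (FreeGroup.invRev u) := by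
  induction u generalizing p with
  | nil => simp [mem_braidSet_nil]
  | cons x u ih =>
    have e : FreeGroup.invRev (x :: u) = FreeGroup.invRev u ++ [(x.1, !x.2)] := by
      simp [FreeGroup.invRev]
    rw [mem_braidSet_cons, ih, e, mem_braidSet_append, mem_braidSet_singleton, or_comm,
      mem_letterSet_reflect]
    simp only [List.length_cons, Nat.cast_add, Nat.cast_one, FreeGroup.invRev_length]
    rw [show -(u.length : ℝ) - (p.2 + 1) = -(u.length + 1) - p.2 by ring,
      show -((u.length : ℝ) + 1) - p.2 + u.length = -1 - p.2 by ring]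

theorem mem_strands_cons {n : ℕ} (x : Fin (2 * n - 1) × Bool) (w : BraidWord (2 * n)) (p : R3) :
    p ∈ strands (x :: w) ↔ p ∈ letterSet x ∨ (p.1, p.2 + 1) ∈ strands w := by
  constructor
  · rintro ⟨j, hj, q, t, ht, rfl⟩
    rcases j with _ | j
    · left
      refine ⟨by simp [ht.1], by simp [ht.2], q, ?_⟩
      simp
    · right
      refine ⟨j, by simpa using hj, q, t, ht, ?_⟩
      simp only [List.getElem_cons_succ]
      refine Prod.ext rfl ?_
      push_cast; ring
  · rintro (⟨h1, h2, q, h3⟩ | ⟨j, hj, q, t, ht, h⟩)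
    · refine ⟨0, by simp, q, p.2 + 1, ⟨by linarith, by linarith⟩, ?_⟩
      refine Prod.ext ?_ ?_
      · simpa using h3
      · simp
    · refine ⟨j + 1, by simpa using hj, q, t, ht, ?_⟩
      simp only [List.getElem_cons_succ]
      have ha := congrArg Prod.fst h
      have hb := congrArg Prod.snd h
      simp only at ha hb
      refine Prod.ext ha ?_
      push_cast; linarith

/-- The two descriptions differ only for the empty word, for which `strands` is empty while
`braidSet` consists of the marked points at height `0`. -/
theorem mem_strands_or_iff {n : ℕ} (w : BraidWord (2 * n)) (p : R3) :
    p ∈ strands w ∨ p ∈ braidSet ([] : BraidWord (2 * n)) ↔ p ∈ braidSet w := by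
  induction w generalizing p with
  | nil =>
    rw [or_iff_right_of_imp]
    rintro ⟨j, hj, -⟩
    simp at hj
  | cons x w ih =>
    rw [mem_strands_cons, mem_braidSet_cons, ← ih]
    have h0 : p ∈ braidSet ([] : BraidWord (2 * n)) → p ∈ letterSet x := fun h =>
      let ⟨h1, q, h2⟩ := mem_braidSet_nil.1 h
      mark_mem_letterSet x q h2 (Or.inl h1)
    have h1 : ((p.1, p.2 + 1) : R3) ∈ braidSet ([] : BraidWord (2 * n)) → p ∈ letterSet x := fun h =>
      let ⟨h1, q, h2⟩ := mem_braidSet_nil.1 h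
      mark_mem_letterSet x q h2 (Or.inr (by simp only at h1; linarith))
    tauto

/-- The plat closure of a braid word in three-space. -/
def platSet {n : ℕ} (w : BraidWord (2 * n)) : Set R3 :=
  {p | p ∈ caps n ∨ p ∈ braidSet w ∨ (p.1, -(w.length : ℝ) - p.2) ∈ caps n}

theorem mark_mem_caps {n : ℕ} (q : Fin (2 * n)) : (((q : ℕ) : ℂ), (0 : ℝ)) ∈ caps n := by
  refine ⟨(q : ℕ) / 2, by omega, by simp, le_rfl, ?_⟩
  simp only [Complex.natCast_re]
  have : ((q : ℕ) : ℝ) = 2 * ((q / 2 : ℕ) : ℝ) + ((q % 2 : ℕ) : ℝ) := by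
    exact_mod_cast (Nat.div_add_mod (q : ℕ) 2).symm
  rcases Nat.mod_two_eq_zero_or_one (q : ℕ) with h | h <;> rw [h] at this <;>
    · rw [this]; push_cast; ring

theorem plat_eq {n : ℕ} (w : BraidWord (2 * n)) :
    plat w = (fun p : R3 => (p : S3)) '' platSet w := by
  rw [plat]
  congr 1
  ext p
  have h0 : p ∈ braidSet ([] : BraidWord (2 * n)) → p ∈ caps n := fun h => by
    obtain ⟨h1, q, h2⟩ := mem_braidSet_nil.1 h
    have : p = (((q : ℕ) : ℂ), (0 : ℝ)) := Prod.ext h2 h1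
    rw [this]; exact mark_mem_caps q
  have h1 := mem_strands_or_iff w p
  change (p ∈ caps n ∨ p ∈ strands w) ∨ (p.1, -(w.length : ℝ) - p.2) ∈ caps n ↔
    p ∈ caps n ∨ p ∈ braidSet w ∨ (p.1, -(w.length : ℝ) - p.2) ∈ caps n
  tauto

/-! ### Invariance of the plat closure under the Hilden subgroup -/

theorem isotopic_translate (K : Set R3) (l : ℝ) : Isotopic K {p | (p.1, p.2 - l) ∈ K} := by
  have := isotopic_of_family (fun s p => (p.1, p.2 + s * l)) (fun s p => (p.1, p.2 - s * l))
    (by fun_prop) (by fun_prop) (fun s p => by simp) (fun s p => by simp) (fun p => by simp) K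
  convert this using 1
  ext p
  simp only [Set.mem_ofPred_eq, Set.mem_image]
  constructor
  · intro h
    exact ⟨_, h, by simp⟩
  · rintro ⟨p, h, rfl⟩
    simpa using h


/-- The homeomorphism of three-space that is a given homeomorphism on the upper half-space and
the motion of a braid word below it. -/
def glueHomeo {m : ℕ} (u : BraidWord m) (F : UpperHalfSpace ≃ₜ UpperHalfSpace)
    (hF : ∀ z : ℂ, F ⟨(z, 0), le_refl 0⟩ = ⟨(motion u 0 z, 0), le_refl 0⟩) : R3 ≃ₜ R3 where
  toFun p := if p.2 ≤ 0 then (motion u p.2 p.1, p.2) else F ⟨(p.1, max p.2 0), le_max_right _ _⟩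
  invFun p := if p.2 ≤ 0 then ((motion u p.2).symm p.1, p.2) else
    F.symm ⟨(p.1, max p.2 0), le_max_right _ _⟩
  left_inv p := by
    obtain ⟨z, t⟩ := p
    by_cases h : t ≤ 0
    · simp [h]
    -- The boundary plane is already mapped onto itself, so by injectivity no other point reaches
    -- it.
    · have hF' : ∀ p : UpperHalfSpace, (F p : R3).2 ≤ 0 → (p : R3).2 ≤ 0 := by
        intro p hp
        have h2 : F p = F ⟨((motion u 0).symm (F p : R3).1, 0), le_refl 0⟩ := by
          rw [hF]
          refine Subtype.ext (Prod.ext ?_ (le_antisymm hp (F p).2))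
          simp
        rw [F.injective h2]
      have h1 : ¬ (F ⟨(z, max t 0), le_max_right _ _⟩ : R3).2 ≤ 0 := fun h' => h (by
        have := hF' _ h'
        exact (le_max_left _ _).trans this)
      simp only [h, if_false, h1]
      have h3 : (⟨((F ⟨(z, max t 0), le_max_right _ _⟩ : R3).1,
          max (F ⟨(z, max t 0), le_max_right _ _⟩ : R3).2 0), le_max_right _ _⟩ : UpperHalfSpace) =
            F ⟨(z, max t 0), le_max_right _ _⟩ := by
        refine Subtype.ext (Prod.ext rfl (max_eq_left (F _).2))
      rw [h3, F.symm_apply_apply]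
      exact Prod.ext rfl (max_eq_left (not_le.1 h).le)
  right_inv p := by
    obtain ⟨z, t⟩ := p
    by_cases h : t ≤ 0
    · simp [h]
    · have hF' : ∀ p : UpperHalfSpace, (F.symm p : R3).2 ≤ 0 → (p : R3).2 ≤ 0 := by
        intro p hp
        have h2 : F.symm p = ⟨((F.symm p : R3).1, 0), le_refl 0⟩ :=
          Subtype.ext (Prod.ext rfl (le_antisymm hp (F.symm p).2))
        rw [Homeomorph.symm_apply_eq, hF] at h2
        rw [h2]
      have h1 : ¬ (F.symm ⟨(z, max t 0), le_max_right _ _⟩ : R3).2 ≤ 0 := fun h' => h (by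
        have := hF' _ h'
        exact (le_max_left _ _).trans this)
      simp only [h, if_false, h1]
      have h3 : (⟨((F.symm ⟨(z, max t 0), le_max_right _ _⟩ : R3).1,
          max (F.symm ⟨(z, max t 0), le_max_right _ _⟩ : R3).2 0), le_max_right _ _⟩ :
            UpperHalfSpace) = F.symm ⟨(z, max t 0), le_max_right _ _⟩ := by
        refine Subtype.ext (Prod.ext rfl (max_eq_left (F.symm _).2))
      rw [h3, F.apply_symm_apply]
      exact Prod.ext rfl (max_eq_left (not_le.1 h).le)
  continuous_toFun := by
    refine Continuous.if_le ?_ ?_ continuous_snd continuous_const ?_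
    · exact (continuous_motion u).prodMk continuous_snd
    · exact continuous_subtype_val.comp (F.continuous.comp
        (Continuous.subtype_mk (by fun_prop) _))
    · rintro ⟨z, t⟩ h
      simp only at h
      subst h
      have h3 : (⟨(z, max 0 0), le_max_right _ _⟩ : UpperHalfSpace) = ⟨(z, 0), le_refl 0⟩ := by
        simp
      simp only [h3, hF]
  continuous_invFun := by
    refine Continuous.if_le ?_ ?_ continuous_snd continuous_const ?_
    · exact (continuous_motion_symm u).prodMk continuous_snd
    · exact continuous_subtype_val.comp (F.symm.continuous.comp
        (Continuous.subtype_mk (by fun_prop) _))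
    · rintro ⟨z, t⟩ h
      simp only at h
      subst h
      have h3 : (⟨(z, max 0 0), le_max_right _ _⟩ : UpperHalfSpace) = ⟨(z, 0), le_refl 0⟩ := by
        simp
      have h4 : F.symm ⟨(z, 0), le_refl 0⟩ = ⟨((motion u 0).symm z, 0), le_refl 0⟩ := by
        rw [Homeomorph.symm_apply_eq, hF]; simp
      simp only [h3, h4]

theorem glueHomeo_of_nonpos {m : ℕ} (u : BraidWord m) (F : UpperHalfSpace ≃ₜ UpperHalfSpace)
    (hF : ∀ z : ℂ, F ⟨(z, 0), le_refl 0⟩ = ⟨(motion u 0 z, 0), le_refl 0⟩) {p : R3}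
    (hp : p.2 ≤ 0) : glueHomeo u F hF p = (motion u p.2 p.1, p.2) := if_pos hp

theorem glueHomeo_of_nonneg {m : ℕ} (u : BraidWord m) (F : UpperHalfSpace ≃ₜ UpperHalfSpace)
    (hF : ∀ z : ℂ, F ⟨(z, 0), le_refl 0⟩ = ⟨(motion u 0 z, 0), le_refl 0⟩) {p : R3}
    (hp : 0 ≤ p.2) : glueHomeo u F hF p = F ⟨p, hp⟩ := by
  rcases eq_or_lt_of_le hp with h | h
  · obtain ⟨z, t⟩ := p
    simp only at h
    subst h
    rw [glueHomeo_of_nonpos u F hF le_rfl, hF]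
  · refine (if_neg (not_le.2 h)).trans ?_
    congr 2
    exact Subtype.ext (Prod.ext rfl (max_eq_left h.le))

/-- Vertical translation. -/
def vertical (l : ℝ) : R3 ≃ₜ R3 where
  toFun p := (p.1, p.2 + l)
  invFun p := (p.1, p.2 - l)
  left_inv p := by simp
  right_inv p := by simp
  continuous_toFun := by fun_prop
  continuous_invFun := by fun_prop

theorem mark_eq_capPoint {n : ℕ} {z : ℂ} :
    (∃ q : Fin (2 * n), z = ((q : ℕ) : ℂ)) ↔ ∃ q : Fin n × Bool, z = capPoint (1 / 2) q := by
  constructor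
  · rintro ⟨q, rfl⟩
    refine ⟨(⟨q / 2, by omega⟩, decide ((q : ℕ) % 2 = 1)), ?_⟩
    have : ((q : ℕ) : ℂ) = 2 * ((q / 2 : ℕ) : ℂ) + ((q % 2 : ℕ) : ℂ) := by
      exact_mod_cast (Nat.div_add_mod (q : ℕ) 2).symm
    rcases Nat.mod_two_eq_zero_or_one (q : ℕ) with h | h
    · rw [this, h]; simp [capPoint, letterSign]
    · rw [this, h]; simp [capPoint, letterSign]; ring
  · rintro ⟨⟨i, b⟩, rfl⟩
    cases b
    · refine ⟨⟨2 * i, by omega⟩, ?_⟩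
      simp [capPoint, letterSign]
    · refine ⟨⟨2 * i + 1, by omega⟩, ?_⟩
      simp [capPoint, letterSign]; ring

/-- A braid that extends over the standard tangle can be absorbed by the caps. -/
theorem exists_homeo_absorb {n : ℕ} (hn : 1 ≤ n) (u : BraidWord (2 * n))
    (hu : planeAction (2 * n) (FreeGroup.mk u) ∈ extendable n) :
    ∃ Θ : R3 ≃ₜ R3, (∀ p : R3, p.2 ≤ 0 → Θ p = p) ∧
      Θ '' caps n = {p | (p.1, p.2 - (u.length : ℝ)) ∈ caps n ∨
        (p.1, p.2 - (u.length : ℝ)) ∈ braidSet u} := by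
  obtain ⟨F, hF, hF'⟩ := hu
  have hl : (0 : ℝ) ≤ u.length := by positivity
  rw [← motion_of_nonneg u le_rfl] at hF
  -- The legs get the length of the word. After a translation that puts their upper ends at height
  -- `0`, the glued homeomorphism twists the legs into the strands of `u` and maps the caps above to
  -- themselves; below the legs the motion is trivial.
  obtain ⟨Θ, h1, h2⟩ := exists_homeo_stretch hn hl
  refine ⟨Θ.trans ((vertical (-u.length)).trans ((glueHomeo u F hF).trans (vertical u.length))),
    fun p hp => ?_, ?_⟩
  · simp only [Homeomorph.trans_apply, h1 p hp]
    have e : vertical (-u.length) p = (p.1, p.2 - u.length) := rfl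
    rw [e, glueHomeo_of_nonpos u F hF (by simp only; linarith),
      motion_of_le u (by simp only; linarith)]
    exact Prod.ext rfl (by simp [vertical])
  · have hcomp : ∀ Ψ : R3 ≃ₜ R3, Θ.trans Ψ '' caps n = Ψ '' (Θ '' caps n) := fun Ψ =>
      Set.image_comp Ψ Θ _
    rw [hcomp, h2]
    ext p
    simp only [Set.mem_ofPred_eq]
    have hleg : ∀ t : ℝ, t ≤ u.length → legWidth u.length t = 1 / 2 := by
      intro t ht
      rw [legWidth, max_eq_right (by linarith)]
      rw [show (1 / 4 - 0 ^ 2 : ℝ) = (1 / 2) ^ 2 by norm_num, Real.sqrt_sq (by norm_num)]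
    constructor
    · rintro ⟨⟨z, t⟩, ⟨q, a1, a2, a3⟩, rfl⟩
      simp only [Homeomorph.trans_apply] at a1 a2 a3 ⊢
      have e : vertical (-u.length) (z, t) = (z, t - u.length) := rfl
      rw [e]
      rcases le_total t u.length with ht | ht
      · right
        rw [glueHomeo_of_nonpos u F hF (by simp only; linarith)]
        rw [hleg t ht] at a3
        obtain ⟨q', hq'⟩ := mark_eq_capPoint.2 ⟨q, a3⟩
        refine ⟨?_, ?_, q', ?_⟩
        · simp [vertical]; linarith
        · simp [vertical]; linarith
        · rw [hq']; simp [vertical]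
      · left
        rw [glueHomeo_of_nonneg u F hF (by simp only; linarith)]
        have : ((F ⟨(z, t - u.length), by simp only; linarith⟩ : R3)) ∈ caps n := by
          rw [hF']
          refine mem_caps_iff.2 ⟨q, by simp only; linarith, by simp only; linarith, ?_⟩
          simp only
          rw [a3, legWidth, max_eq_left (by linarith)]
        simpa [vertical] using this
    · intro hp
      set p' : R3 := (p.1, p.2 - u.length) with hp'
      have hv : vertical u.length p' = p := by
        refine Prod.ext rfl ?_
        simp [vertical, hp']
      suffices h : ∃ x : R3, (∃ q : Fin n × Bool, 0 ≤ x.2 + u.length ∧ x.2 ≤ 1 / 2 ∧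
          x.1 = capPoint (legWidth u.length (x.2 + u.length)) q) ∧ glueHomeo u F hF x = p' by
        obtain ⟨x, ⟨q, b1, b2, b3⟩, hx⟩ := h
        refine ⟨(x.1, x.2 + u.length), ⟨q, b1, by simp only; linarith, b3⟩, ?_⟩
        simp only [Homeomorph.trans_apply]
        have e : vertical (-u.length) (x.1, x.2 + u.length) = x := by
          refine Prod.ext rfl ?_
          simp [vertical]
        rw [e, hx, hv]
      rcases hp with hp | hp
      · have hp0 : 0 ≤ p'.2 := by obtain ⟨i, hi, a1, a2, a3⟩ := hp; exact a2
        have hm : ((F.symm ⟨p', hp0⟩ : UpperHalfSpace) : R3) ∈ caps n := by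
          rw [← hF', F.apply_symm_apply]; exact hp
        obtain ⟨q, b1, b2, b3⟩ := mem_caps_iff.1 hm
        refine ⟨(F.symm ⟨p', hp0⟩ : UpperHalfSpace), ⟨q, by linarith, b2, ?_⟩, ?_⟩
        · rw [b3, legWidth, add_sub_cancel_right, max_eq_left b1]
        · rw [glueHomeo_of_nonneg u F hF b1]
          simp
      · obtain ⟨b1, b2, q, b3⟩ := hp
        obtain ⟨q', hq'⟩ := mark_eq_capPoint.1 ⟨q, rfl⟩
        refine ⟨(((q : ℕ) : ℂ), p'.2), ⟨q', by simp only [p']; linarith, ?_, ?_⟩, ?_⟩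
        · simp only [p']; linarith
        · simp only
          rw [hleg _ (by simp only [p']; linarith), hq']
        · rw [glueHomeo_of_nonpos u F hF (p := (((q : ℕ) : ℂ), p'.2)) b2]
          exact Prod.ext b3.symm rfl

theorem height_caps_nonneg {n : ℕ} {p : R3} (hp : p ∈ caps n) : 0 ≤ p.2 := by
  obtain ⟨i, hi, a1, a2, a3⟩ := hp
  exact a2

/-- The caps are replaced by caps followed by the braid `u`, with everything below height `0` fixed;
up to a translation the result is the plat of `u ++ w`. -/
theorem isotopic_platSet_append_left {n : ℕ} (hn : 1 ≤ n) (u w : BraidWord (2 * n))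
    (hu : planeAction (2 * n) (FreeGroup.mk u) ∈ extendable n) :
    Isotopic (platSet w) (platSet (u ++ w)) := by
  obtain ⟨Θ, h1, h2⟩ := exists_homeo_absorb hn u hu
  refine (isotopic_of_eq_on_halfSpace Θ 1 0 (by norm_num) (fun p hp => h1 p (by linarith)) _).trans
    ?_
  have h := isotopic_translate (platSet (u ++ w)) u.length
  convert h.symm using 1
  have hw : platSet w = caps n ∪ {p | p ∈ braidSet w ∨ (p.1, -(w.length : ℝ) - p.2) ∈ caps n} := by
    ext p; rfl
  have hid : Θ '' {p | p ∈ braidSet w ∨ (p.1, -(w.length : ℝ) - p.2) ∈ caps n} =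
      {p | p ∈ braidSet w ∨ (p.1, -(w.length : ℝ) - p.2) ∈ caps n} := by
    have : ∀ p ∈ {p : R3 | p ∈ braidSet w ∨ (p.1, -(w.length : ℝ) - p.2) ∈ caps n}, Θ p = p := by
      intro p hp
      refine h1 p ?_
      rcases hp with hp | hp
      · exact hp.2.1
      · have := height_caps_nonneg hp
        simp only at this
        have : (0 : ℝ) ≤ w.length := by positivity
        linarith
    rw [Set.image_congr this]; simp
  rw [hw, Set.image_union, hid, h2]
  ext p
  simp only [platSet, Set.mem_union, Set.mem_ofPred_eq, mem_braidSet_append, sub_add_cancel,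
    List.length_append, Nat.cast_add]
  rw [show -((u.length : ℝ) + w.length) - (p.2 - u.length) = -(w.length : ℝ) - p.2 by ring]
  tauto

/-- Reflection in a horizontal plane. -/
def reflect : R3 ≃ₜ R3 where
  toFun p := (p.1, -p.2)
  invFun p := (p.1, -p.2)
  left_inv p := by simp
  right_inv p := by simp
  continuous_toFun := by fun_prop
  continuous_invFun := by fun_prop

/-- The reflection that exchanges the cups of `w` with the standard caps reduces this to absorption
at the top. It turns `u` into its inverse, so the inverse word is the one to absorb. -/
theorem isotopic_platSet_append_right {n : ℕ} (hn : 1 ≤ n) (u w : BraidWord (2 * n))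
    (hu : planeAction (2 * n) (FreeGroup.mk u) ∈ extendable n) :
    Isotopic (platSet w) (platSet (w ++ u)) := by
  obtain ⟨Θ, h1, h2⟩ := exists_homeo_absorb hn (FreeGroup.invRev u) (by
    rw [← FreeGroup.inv_mk, map_inv]; exact inv_mem hu)
  set Ψ := ((vertical w.length).trans reflect).trans
    (Θ.trans (((vertical w.length).trans reflect)).symm) with hΨ
  have e1 : ∀ p : R3, ((vertical w.length).trans reflect) p = (p.1, -(w.length : ℝ) - p.2) := by
    intro p
    refine Prod.ext rfl ?_
    simp [vertical, reflect]; ring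
  have e2 : ∀ p : R3, ((vertical w.length).trans reflect).symm p = (p.1, -(w.length : ℝ) - p.2) := by
    intro p
    refine Prod.ext rfl ?_
    simp [vertical, reflect]; ring
  have hΨ' : ∀ p : R3, Ψ p = ((Θ (p.1, -(w.length : ℝ) - p.2)).1,
      -(w.length : ℝ) - (Θ (p.1, -(w.length : ℝ) - p.2)).2) := by
    intro p
    rw [hΨ]
    simp only [Homeomorph.trans_apply Θ, Homeomorph.trans_apply ((vertical w.length).trans reflect)]
    rw [e2, e1]
  have hid : ∀ p : R3, -(w.length : ℝ) ≤ p.2 → Ψ p = p := by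
    intro p hp
    rw [hΨ', h1 _ (by simp only; linarith)]
    simp
  refine (isotopic_of_eq_on_halfSpace Ψ (-1) w.length (by norm_num)
    (fun p hp => hid p (by linarith)) _).trans ?_
  suffices h : Ψ '' platSet w = platSet (w ++ u) by rw [h]; exact Isotopic.refl _
  have hw : platSet w = {p | p ∈ caps n ∨ p ∈ braidSet w} ∪
      {p | (p.1, -(w.length : ℝ) - p.2) ∈ caps n} := by
    ext p
    simp only [platSet, Set.mem_union, Set.mem_ofPred_eq]
    tauto
  have hid' : Ψ '' {p | p ∈ caps n ∨ p ∈ braidSet w} = {p | p ∈ caps n ∨ p ∈ braidSet w} := by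
    have : ∀ p ∈ {p : R3 | p ∈ caps n ∨ p ∈ braidSet w}, Ψ p = p := by
      intro p hp
      refine hid p ?_
      rcases hp with hp | hp
      · have := height_caps_nonneg hp
        have : (0 : ℝ) ≤ w.length := by positivity
        linarith
      · exact hp.1
    rw [Set.image_congr this]; simp
  have hcup : Ψ '' {p | (p.1, -(w.length : ℝ) - p.2) ∈ caps n} =
      {p | (p.1, -(w.length : ℝ) - p.2) ∈ Θ '' caps n} := by
    ext p
    simp only [Set.mem_image, Set.mem_ofPred_eq]
    constructor
    · rintro ⟨x, hx, rfl⟩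
      refine ⟨_, hx, ?_⟩
      rw [hΨ']; simp
    · rintro ⟨x, hx, hx'⟩
      refine ⟨(x.1, -(w.length : ℝ) - x.2), by simpa using hx, ?_⟩
      rw [hΨ']
      simp [hx']
  rw [hw, Set.image_union, hid', hcup, h2]
  ext p
  have key := mem_braidSet_invRev u (p.1, p.2 + w.length)
  simp only [platSet, Set.mem_union, Set.mem_ofPred_eq, mem_braidSet_append,
    List.length_append, Nat.cast_add, FreeGroup.invRev_length, key]
  rw [show -((w.length : ℝ) + u.length) - p.2 = -(w.length : ℝ) - p.2 - u.length by ring,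
    show -(u.length : ℝ) - (p.2 + w.length) = -(w.length : ℝ) - p.2 - u.length by ring]
  tauto

/-- The set of braids whose plat closure is of a given type is a union of double cosets of the
Hilden subgroup. -/
theorem mem_platBraids_of_platClass_eq {n : ℕ} (hn : 1 ≤ n) {𝓛 : Set (Set S3)}
    (h𝓛 : IsLinkType 𝓛) {β γ : BraidGroup (2 * n)} (hβ : β ∈ platBraids n 𝓛)
    (h : platClass γ = platClass β) : γ ∈ platBraids n 𝓛 := by
  obtain ⟨w, rfl, hw⟩ := hβ
  obtain ⟨a, ha, b, hb, rfl⟩ := (DoubleCoset.eq _ _ _ _).1 h.symm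
  obtain ⟨u, hu, rfl⟩ := ha
  obtain ⟨v, hv, rfl⟩ := hb
  obtain ⟨u, rfl⟩ := Quot.exists_rep u
  obtain ⟨v, rfl⟩ := Quot.exists_rep v
  refine ⟨u ++ w ++ v, ?_, ?_⟩
  · rw [toBraid_append, toBraid_append]; rfl
  · obtain ⟨k, δ, -, -, rfl⟩ := h𝓛
    refine AmbientIsotopic.trans hw ?_
    rw [plat_eq, plat_eq]
    exact (isotopic_platSet_append_left hn u w hu).trans
      (isotopic_platSet_append_right hn v (u ++ w) hv)

/-! ### Configurations of points of the plane -/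

/-- Ordered configurations of `N` distinct points of the plane. -/
abbrev Conf (N : ℕ) : Type := {c : Fin N → ℂ // Function.Injective c}

/-- The configuration in which the point `k` has the position `ρ k` on the line. -/
def std {N : ℕ} (ρ : Equiv.Perm (Fin N)) : Conf N :=
  ⟨fun k => ((ρ k : ℕ) : ℂ), fun j k h => by
    have h' : ((ρ j : ℕ) : ℂ) = ((ρ k : ℕ) : ℂ) := h
    exact ρ.injective (Fin.ext (by exact_mod_cast h'))⟩

theorem std_apply {N : ℕ} (ρ : Equiv.Perm (Fin N)) (k : Fin N) : (std ρ).1 k = ((ρ k : ℕ) : ℂ) := rfl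

/-- The configurations that are ordered by `ρ` up to a deformation in a product of slit planes. -/
def chart {N : ℕ} (ρ : Equiv.Perm (Fin N)) : Set (Fin N → ℂ) :=
  {c | ∀ j k, ρ j < ρ k → c k - c j ∈ Complex.slitPlane}

theorem injective_of_mem_chart {N : ℕ} {ρ : Equiv.Perm (Fin N)} {c : Fin N → ℂ} (h : c ∈ chart ρ) :
    Function.Injective c := by
  intro j k hjk
  by_contra hne
  rcases lt_or_gt_of_ne (fun h => hne (ρ.injective h)) with h1 | h1
  · have := h j k h1
    rw [hjk, sub_self] at this
    exact Complex.zero_notMem_slitPlane this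
  · have := h k j h1
    rw [hjk, sub_self] at this
    exact Complex.zero_notMem_slitPlane this

theorem isOpen_chart {N : ℕ} (ρ : Equiv.Perm (Fin N)) : IsOpen (chart ρ) := by
  have : chart ρ = ⋂ j, ⋂ k, ⋂ _ : ρ j < ρ k, {c | c k - c j ∈ Complex.slitPlane} := by
    ext c; simp [chart]
  rw [this]
  refine isOpen_iInter_of_finite fun j => isOpen_iInter_of_finite fun k =>
    isOpen_iInter_of_finite fun _ => Complex.isOpen_slitPlane.preimage (by fun_prop)

theorem std_sub {N : ℕ} (ρ : Equiv.Perm (Fin N)) (j k : Fin N) :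
    (std ρ).1 k - (std ρ).1 j = (((ρ k : ℕ) - (ρ j : ℕ) : ℝ) : ℂ) := by
  rw [std_apply, std_apply]; push_cast; rfl

theorem std_sub_pos {N : ℕ} {ρ : Equiv.Perm (Fin N)} {j k : Fin N} (h : ρ j < ρ k) :
    (1 : ℝ) ≤ (ρ k : ℕ) - (ρ j : ℕ) := by
  have : ((ρ j : ℕ) : ℝ) + 1 ≤ (ρ k : ℕ) := by exact_mod_cast h
  linarith

theorem std_mem_chart {N : ℕ} (ρ : Equiv.Perm (Fin N)) : (std ρ).1 ∈ chart ρ := by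
  intro j k h
  rw [std_sub]
  exact Complex.ofReal_mem_slitPlane.2 (by linarith [std_sub_pos h])

theorem add_smul_sub_mem_slitPlane {x : ℝ} (hx : 0 < x) {z : ℂ} (hz : z ∈ Complex.slitPlane)
    {a b : ℝ} (ha : 0 ≤ a) (hb : 0 ≤ b) (hab : a + b = 1) :
    (a : ℂ) * x + b * z ∈ Complex.slitPlane := by
  have := Complex.starConvex_ofReal_slitPlane hx hz ha hb hab
  simpa using this

/-- Differences of the standard configuration in increasing order are positive reals, and the slit
plane is star-convex about these. -/
theorem starConvex_chart {N : ℕ} (ρ : Equiv.Perm (Fin N)) : StarConvex ℝ (std ρ).1 (chart ρ) := by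
  intro c hc a b ha hb hab j k h
  have h1 := add_smul_sub_mem_slitPlane (by linarith [std_sub_pos h] :
    (0 : ℝ) < (ρ k : ℕ) - (ρ j : ℕ)) (hc j k h) ha hb hab
  rw [← std_sub] at h1
  convert h1 using 1
  simp only [Pi.add_apply, Pi.smul_apply, Complex.real_smul]
  ring

/-- Sort the points by imaginary part and then by real part. The difference of a later and an
earlier point has positive imaginary part or is a positive real, so it avoids the slit. -/
theorem exists_mem_chart {N : ℕ} (c : Conf N) : ∃ ρ : Equiv.Perm (Fin N), c.1 ∈ chart ρ := by
  let f : Fin N → ℝ ×ₗ ℝ := fun k => toLex ((c.1 k).im, (c.1 k).re)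
  refine ⟨(Tuple.sort f).symm, fun j k h => ?_⟩
  have h1 := Tuple.monotone_sort f h.le
  simp only [Function.comp_apply, Equiv.apply_symm_apply] at h1
  rw [Prod.Lex.le_iff] at h1
  rw [Complex.mem_slitPlane_iff]
  simp only [f, ofLex_toLex] at h1
  rcases h1 with h1 | ⟨h1, h2⟩
  · right
    rw [Complex.sub_im]
    exact (sub_pos.2 h1).ne'
  · left
    rw [Complex.sub_re, sub_pos]
    refine lt_of_le_of_ne h2 fun h3 => ?_
    have : j = k := c.2 (Complex.ext h3 h1)
    rw [this] at h
    exact lt_irrefl _ h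

-- A chart is star-convex, hence contractible, and it consists of injective systems, so homotopies
-- in it are homotopies of configurations.
open Path.Homotopic in
theorem homotopic_of_mem_chart {N : ℕ} {ρ : Equiv.Perm (Fin N)} {x y : Conf N} (p q : Path x y)
    (hp : ∀ s, (p s).1 ∈ chart ρ) (hq : ∀ s, (q s).1 ∈ chart ρ) : p.Homotopic q := by
  have : ContractibleSpace (chart ρ) := (starConvex_chart ρ).contractibleSpace ⟨_, std_mem_chart ρ⟩
  let incl : C(chart ρ, Conf N) := ⟨fun c => ⟨c.1, injective_of_mem_chart c.2⟩, by fun_prop⟩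
  have hx : x.1 ∈ chart ρ := by simpa using hp 0
  have hy : y.1 ∈ chart ρ := by simpa using hp 1
  let lift : ∀ r : Path x y, (∀ s, (r s).1 ∈ chart ρ) →
      Path (⟨x.1, hx⟩ : chart ρ) (⟨y.1, hy⟩ : chart ρ) := fun r hr =>
    { toFun := fun s => ⟨(r s).1, hr s⟩
      continuous_toFun := by fun_prop
      source' := by simp
      target' := by simp }
  exact (SimplyConnectedSpace.paths_homotopic (lift p hp) (lift q hq)).map incl

/-- A path of configurations from a path of systems of points. -/
def confPath {N : ℕ} {x y : Conf N} (p : Path x.1 y.1) (hp : ∀ s, Function.Injective (p s)) :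
    Path x y where
  toFun s := ⟨p s, hp s⟩
  continuous_toFun := by fun_prop
  source' := by simp
  target' := by simp

theorem exists_path_of_joinedIn {N : ℕ} {E : Set (Fin N → ℂ)} (hE : ∀ c ∈ E, Function.Injective c)
    {x y : Conf N} (h : JoinedIn E x.1 y.1) : ∃ p : Path x y, ∀ s, (p s).1 ∈ E :=
  ⟨confPath h.somePath fun s => hE _ (h.somePath_mem s), fun s => h.somePath_mem s⟩

theorem exists_link {N : ℕ} (ρ : Equiv.Perm (Fin N)) (x : Conf N) (hx : x.1 ∈ chart ρ) :
    ∃ p : Path (std ρ) x, ∀ s, (p s).1 ∈ chart ρ := by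
  refine exists_path_of_joinedIn (fun c hc => injective_of_mem_chart hc) ?_
  exact JoinedIn.of_segment_subset ((starConvex_chart ρ).segment_subset hx)

/-- The class of the paths in a chart from its centre to a given configuration. -/
def link {N : ℕ} (ρ : Equiv.Perm (Fin N)) (x : Conf N) (hx : x.1 ∈ chart ρ) :
    Path.Homotopic.Quotient (std ρ) x :=
  Path.Homotopic.Quotient.mk (exists_link ρ x hx).choose

theorem mk_eq_link {N : ℕ} {ρ : Equiv.Perm (Fin N)} {x : Conf N} (hx : x.1 ∈ chart ρ)
    (p : Path (std ρ) x) (hp : ∀ s, (p s).1 ∈ chart ρ) :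
    Path.Homotopic.Quotient.mk p = link ρ x hx :=
  Path.Homotopic.Quotient.eq.2 (homotopic_of_mem_chart _ _ hp (exists_link ρ x hx).choose_spec)

theorem link_trans_mk {N : ℕ} {ρ : Equiv.Perm (Fin N)} {x y : Conf N} (hx : x.1 ∈ chart ρ)
    (hy : y.1 ∈ chart ρ) (p : Path x y) (hp : ∀ s, (p s).1 ∈ chart ρ) :
    (link ρ x hx).trans (Path.Homotopic.Quotient.mk p) = link ρ y hy := by
  rw [link, ← Path.Homotopic.Quotient.mk_trans]
  refine mk_eq_link hy _ fun s => ?_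
  have h1 := (exists_link ρ x hx).choose_spec
  have : ((exists_link ρ x hx).choose.trans p) s ∈
      Set.range ((exists_link ρ x hx).choose.trans p) := ⟨s, rfl⟩
  rw [Path.trans_range] at this
  rcases this with ⟨s, h⟩ | ⟨s, h⟩
  · rw [← h]; exact h1 s
  · rw [← h]; exact hp s

/-! ### Homotopy classes of words -/

/-- The homotopy classes of the paths that are given by braid words. -/
def IsWordClass {N : ℕ} {ρ ρ' : Equiv.Perm (Fin N)}
    (P : Path.Homotopic.Quotient (std ρ) (std ρ')) : Prop :=
  ∃ (w : BraidWord N) (p : Path (std ρ) (std ρ')), Path.Homotopic.Quotient.mk p = P ∧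
    ∀ s k, (p s).1 k = motion w (w.length * ((s : ℝ) - 1)) ((ρ k : ℕ) : ℂ)

/-- All three paths factor through the real line, which is simply connected. -/
theorem homotopic_of_reparam {X : Type*} [TopologicalSpace X] {g : ℝ → X} (hg : Continuous g)
    {a b c : ℝ} {x y z : X} (p : Path x y) (q : Path y z) (r : Path x z)
    (hp : ∀ s : unitInterval, p s = g (a + (b - a) * s))
    (hq : ∀ s : unitInterval, q s = g (b + (c - b) * s))
    (hr : ∀ s : unitInterval, r s = g (a + (c - a) * s)) : (p.trans q).Homotopic r := by
  obtain rfl : g a = x := by simpa using (hp 0).symm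
  obtain rfl : g b = y := by simpa using (hp 1).symm
  obtain rfl : g c = z := by simpa using (hq 1).symm
  let line : ∀ a b : ℝ, Path a b := fun a b =>
    { toFun := fun s => a + (b - a) * s
      continuous_toFun := by fun_prop
      source' := by simp
      target' := by simp }
  have e1 : p = (line a b).map hg := by ext s; exact hp s
  have e2 : q = (line b c).map hg := by ext s; exact hq s
  have e3 : r = (line a c).map hg := by ext s; exact hr s
  rw [e1, e2, e3, ← Path.map_trans]
  exact (SimplyConnectedSpace.paths_homotopic ((line a b).trans (line b c)) (line a c)).map ⟨g, hg⟩

theorem motion_append {m : ℕ} (v w : BraidWord m) (t : ℝ) (z : ℂ) :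
    motion (v ++ w) t z = motion v t (motion w (t + v.length) z) := by
  induction v generalizing t with
  | nil => simp [motion]
  | cons x v ih =>
    rw [List.cons_append, motion_cons, ih, motion_cons, List.length_cons]
    push_cast
    rw [add_assoc, add_comm (1 : ℝ)]

theorem continuous_motion_left {m : ℕ} (w : BraidWord m) (z : ℂ) :
    Continuous fun t : ℝ => motion w t z :=
  (continuous_motion w).comp (by fun_prop : Continuous fun t : ℝ => ((z, t) : R3))

/-- Words are drawn downwards while paths run upwards, so the path of `w` followed by that of `v` is
the motion of `v ++ w`. -/
theorem IsWordClass.trans {N : ℕ} {ρ ρ' ρ'' : Equiv.Perm (Fin N)}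
    {P : Path.Homotopic.Quotient (std ρ) (std ρ')} {Q : Path.Homotopic.Quotient (std ρ') (std ρ'')}
    (hP : IsWordClass P) (hQ : IsWordClass Q) : IsWordClass (P.trans Q) := by
  obtain ⟨w, p, rfl, hp⟩ := hP
  obtain ⟨v, q, rfl, hq⟩ := hQ
  have hend : ∀ k (t : ℝ), 0 ≤ t → motion w t ((ρ k : ℕ) : ℂ) = ((ρ' k : ℕ) : ℂ) := by
    intro k t ht
    have := hp 1 k
    rw [p.target, std_apply] at this
    rw [this, motion_of_nonneg w ht, motion_of_nonneg w (by simp)]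
  let g : ℝ → Conf N := fun t => ⟨fun k => motion (v ++ w) t ((ρ k : ℕ) : ℂ), fun j k h =>
    (std ρ).2 ((motion (v ++ w) t).injective h)⟩
  have hg : Continuous g := Continuous.subtype_mk
    (continuous_pi fun k => continuous_motion_left _ _) _
  have hv : (0 : ℝ) ≤ v.length := by positivity
  have hw : (0 : ℝ) ≤ w.length := by positivity
  have hp' : ∀ s : unitInterval, p s = g (-(v.length + w.length) +
      (-v.length - -(v.length + w.length)) * s) := by
    intro s
    refine Subtype.ext (funext fun k => ?_)
    change _ = motion (v ++ w) _ _
    have hs := s.2.2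
    rw [hp, motion_append, motion_of_le v (by nlinarith)]
    congr 2; ring
  have hq' : ∀ s : unitInterval, q s = g (-v.length + (0 - -v.length) * s) := by
    intro s
    refine Subtype.ext (funext fun k => ?_)
    change _ = motion (v ++ w) _ _
    have hs := s.2.1
    rw [hq, motion_append, hend k _ (by nlinarith)]
    congr 2; ring
  have h0 : g (-(v.length + w.length)) = std ρ := by
    have := hp' 0
    simpa using this.symm
  have h1 : g 0 = std ρ'' := by
    have := hq' 1
    simpa using this.symm
  refine ⟨v ++ w, ⟨⟨fun s => g ((v.length + w.length) * ((s : ℝ) - 1)), by fun_prop⟩,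
    by simpa using h0, by simpa using h1⟩, ?_, fun s k => ?_⟩
  · rw [← Path.Homotopic.Quotient.mk_trans, Path.Homotopic.Quotient.eq]
    refine (homotopic_of_reparam hg p q _ hp' hq' fun s => ?_).symm
    change g _ = g _
    congr 1; ring
  · change motion (v ++ w) _ _ = _
    rw [List.length_append]; push_cast; rfl

theorem isWordClass_refl {N : ℕ} (ρ : Equiv.Perm (Fin N)) :
    IsWordClass (Path.Homotopic.Quotient.refl (std ρ)) :=
  ⟨[], Path.refl _, rfl, fun _ _ => rfl⟩

/-! ### Paths of configurations and braid words -/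

/-- The transposition of the adjacent positions `i` and `i + 1`. -/
def adjSwap {N : ℕ} (i : Fin (N - 1)) : Equiv.Perm (Fin N) :=
  Equiv.swap ⟨i, by omega⟩ ⟨i + 1, by omega⟩

theorem adjSwap_val {N : ℕ} (i : Fin (N - 1)) (q : Fin N) :
    (adjSwap i q : ℕ) = if (q : ℕ) = i then (i : ℕ) + 1 else if (q : ℕ) = i + 1 then i else q := by
  simp only [adjSwap, Equiv.swap_apply_def, Fin.ext_iff]
  split_ifs <;> rfl

theorem adjSwap_lt_iff {N : ℕ} (i : Fin (N - 1)) (p q : Fin N)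
    (h1 : ¬((p : ℕ) = i ∧ (q : ℕ) = i + 1)) (h2 : ¬((p : ℕ) = i + 1 ∧ (q : ℕ) = i)) :
    adjSwap i p < adjSwap i q ↔ p < q := by
  rw [Fin.lt_def, Fin.lt_def, adjSwap_val, adjSwap_val]
  split_ifs <;> omega

theorem twist_left (i : ℕ) (a : ℝ) :
    twist i a (i : ℂ) = center i - Complex.exp ((Real.pi * a : ℝ) * Complex.I) / 2 := by
  have h : (i : ℂ) - center i = ((-(1 / 2) : ℝ) : ℂ) := by rw [center]; push_cast; ring
  have hc : cutoff ‖(i : ℂ) - center i‖ = 1 := by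
    rw [h, Complex.norm_real, Real.norm_eq_abs, abs_neg, abs_of_pos (by norm_num), cutoff]
    norm_num
  rw [twist, hc, h, mul_one]
  push_cast; ring

theorem twist_right (i : ℕ) (a : ℝ) :
    twist i a ((i + 1 : ℕ) : ℂ) = center i + Complex.exp ((Real.pi * a : ℝ) * Complex.I) / 2 := by
  have h : ((i + 1 : ℕ) : ℂ) - center i = ((1 / 2 : ℝ) : ℂ) := by rw [center]; push_cast; ring
  have hc : cutoff ‖((i + 1 : ℕ) : ℂ) - center i‖ = 1 := by
    rw [h, Complex.norm_real, Real.norm_eq_abs, abs_of_pos (by norm_num), cutoff]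
    norm_num
  rw [twist, hc, h, mul_one]
  push_cast; ring

theorem twist_of_ne (i k : ℕ) (a : ℝ) (h1 : k ≠ i) (h2 : k ≠ i + 1) : twist i a (k : ℂ) = k := by
  have hnorm : ‖(k : ℂ) - center i‖ = |(k : ℝ) - i - 1 / 2| := by
    have : (k : ℂ) - center i = (((k : ℝ) - i - 1 / 2 : ℝ) : ℂ) := by
      rw [center]; push_cast; ring
    rw [this, Complex.norm_real, Real.norm_eq_abs]
  have : cutoff |(k : ℝ) - i - 1 / 2| = 0 := by
    have h : 1 ≤ |(k : ℝ) - i - 1 / 2| := by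
      rcases Nat.lt_or_ge k i with h | h
      · have : (k : ℝ) + 1 ≤ i := by exact_mod_cast h
        rw [abs_of_neg (by linarith)]; linarith
      · have : (i : ℝ) + 2 ≤ k := by
          have : i + 2 ≤ k := by omega
          exact_mod_cast this
        rw [abs_of_nonneg (by linarith)]; linarith
    rw [cutoff, max_eq_left]
    exact (min_le_right _ _).trans (by linarith)
  rw [twist, hnorm, this]
  simp

/-- During a half twist the point at `i` moves to the right by at most one, the point at `i + 1` to
the left by at most one, and the others rest; only these two can change their order. -/
theorem re_twist_sub_pos (i p q : ℕ) (a : ℝ) (hpq : p < q) (h : ¬(p = i ∧ q = i + 1)) :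
    0 < (twist i a (q : ℂ) - twist i a (p : ℂ)).re := by
  have bd : ∀ k : ℕ, (k : ℝ) - (if k = i + 1 then 1 else 0) ≤ (twist i a (k : ℂ)).re ∧
      (twist i a (k : ℂ)).re ≤ k + (if k = i then 1 else 0) := by
    intro k
    have c1 := Real.cos_le_one (Real.pi * a)
    have c2 := Real.neg_one_le_cos (Real.pi * a)
    have hre : (Complex.exp ((Real.pi * a : ℝ) * Complex.I) / 2).re = Real.cos (Real.pi * a) / 2 := by
      rw [← Complex.exp_ofReal_mul_I_re, ← Complex.ofReal_ofNat, Complex.div_ofReal_re]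
    have hce : (center i).re = i + 1 / 2 := by simp [center]
    by_cases hk : k = i
    · subst hk
      rw [twist_left, Complex.sub_re, hre, hce]
      simp
      constructor <;> linarith
    by_cases hk' : k = i + 1
    · subst hk'
      rw [twist_right, Complex.add_re, hre, hce]
      simp
      constructor <;> linarith
    · rw [twist_of_ne i k a hk hk']
      simp [hk, hk']
  have hp := (bd p).2
  have hq := (bd q).1
  rw [Complex.sub_re, sub_pos]
  have : (p : ℝ) + (if p = i then 1 else 0) < q - (if q = i + 1 then 1 else 0) := by
    split_ifs with h1 h2 h2
    · exact absurd ⟨h1, h2⟩ h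
    · have : p + 2 ≤ q := by omega
      have : (p : ℝ) + 2 ≤ q := by exact_mod_cast this
      linarith
    · have : p + 2 ≤ q := by omega
      have : (p : ℝ) + 2 ≤ q := by exact_mod_cast this
      linarith
    · have : (p : ℝ) + 1 ≤ q := by exact_mod_cast hpq
      linarith
  linarith

theorem exp_mem_slitPlane {a : ℝ} (ha : |a| < 1) :
    Complex.exp ((Real.pi * a : ℝ) * Complex.I) ∈ Complex.slitPlane := by
  rw [Complex.mem_slitPlane_iff, Complex.exp_ofReal_mul_I_re, Complex.exp_ofReal_mul_I_im]
  by_cases h : Real.sin (Real.pi * a) = 0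
  · left
    obtain ⟨h1, h2⟩ := abs_lt.1 ha
    have hpi := Real.pi_pos
    have := (Real.sin_eq_zero_iff_of_lt_of_lt (by nlinarith) (by nlinarith)).1 h
    rw [this]; simp
  · exact Or.inr h

theorem mem_slitPlane_of_re_pos {z : ℂ} (h : 0 < z.re) : z ∈ Complex.slitPlane :=
  Complex.mem_slitPlane_iff.2 (Or.inl h)

theorem mem_slitPlane_of_mul_im_pos {z : ℂ} {a : ℝ} (h : 0 < a * z.im) :
    z ∈ Complex.slitPlane ∧ -z ∈ Complex.slitPlane := by
  have : z.im ≠ 0 := fun h' => by rw [h', mul_zero] at h; exact lt_irrefl _ h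
  exact ⟨Complex.mem_slitPlane_iff.2 (Or.inr this),
    Complex.mem_slitPlane_iff.2 (Or.inr (by simpa using this))⟩

/-- The overlap of the charts of two orders that differ by an adjacent transposition: the
component in which the two points involved pass each other on a given side. -/
def overlap {N : ℕ} (ρ : Equiv.Perm (Fin N)) (j k : Fin N) (ε : ℝ) : Set (Fin N → ℂ) :=
  {c | (∀ a b, ρ a < ρ b → ¬(a = j ∧ b = k) → c b - c a ∈ Complex.slitPlane) ∧
    0 < ε * (c k - c j).im}

theorem overlap_subset_chart {N : ℕ} (ρ : Equiv.Perm (Fin N)) (j k : Fin N) (ε : ℝ) :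
    overlap ρ j k ε ⊆ chart ρ := by
  rintro c ⟨h1, h2⟩ a b hab
  by_cases h : a = j ∧ b = k
  · rw [h.1, h.2]
    exact (mem_slitPlane_of_mul_im_pos h2).1
  · exact h1 a b hab h

theorem overlap_subset_chart_swap {N : ℕ} (ρ : Equiv.Perm (Fin N)) (i : Fin (N - 1)) {j k : Fin N}
    (hj : (ρ j : ℕ) = i) (hk : (ρ k : ℕ) = i + 1) (ε : ℝ) :
    overlap ρ j k ε ⊆ chart (adjSwap i * ρ) := by
  rintro c ⟨h1, h2⟩ a b hab
  rw [Equiv.Perm.mul_apply, Equiv.Perm.mul_apply] at hab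
  by_cases h : a = k ∧ b = j
  · rw [h.1, h.2, ← neg_sub]
    exact (mem_slitPlane_of_mul_im_pos h2).2
  by_cases h' : a = j ∧ b = k
  · rw [h'.1, h'.2, Fin.lt_def, adjSwap_val, adjSwap_val, hj, hk] at hab
    simp at hab
  · refine h1 a b ?_ h'
    rwa [adjSwap_lt_iff] at hab
    · rintro ⟨e1, e2⟩
      exact h' ⟨ρ.injective (Fin.ext (e1.trans hj.symm)), ρ.injective (Fin.ext (e2.trans hk.symm))⟩
    · rintro ⟨e1, e2⟩
      exact h ⟨ρ.injective (Fin.ext (e1.trans hk.symm)), ρ.injective (Fin.ext (e2.trans hj.symm))⟩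

theorem mem_overlap_of_mem_charts {N : ℕ} {ρ : Equiv.Perm (Fin N)} {j k : Fin N} {ε : ℝ}
    {c : Fin N → ℂ} (h : c ∈ chart ρ) (h' : 0 < ε * (c k - c j).im) : c ∈ overlap ρ j k ε :=
  ⟨fun a b hab _ => h a b hab, h'⟩

theorem scale_mem_overlap {N : ℕ} {ρ : Equiv.Perm (Fin N)} {j k : Fin N} {ε : ℝ}
    {c : Fin N → ℂ} (h : c ∈ overlap ρ j k ε) {η : ℝ} (h0 : 0 < η) (h1 : η ≤ 1) :
    (fun a => (1 - η : ℝ) * (std ρ).1 a + η * c a) ∈ overlap ρ j k ε := by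
  refine ⟨fun a b hab hne => ?_, ?_⟩
  · have := add_smul_sub_mem_slitPlane (by linarith [std_sub_pos hab] :
      (0 : ℝ) < (ρ b : ℕ) - (ρ a : ℕ)) (h.1 a b hab hne) (by linarith : 0 ≤ 1 - η) h0.le (by ring)
    rw [← std_sub] at this
    convert this using 1
    ring
  · have e : ((1 - η : ℝ) * (std ρ).1 k + η * c k - ((1 - η : ℝ) * (std ρ).1 j + η * c j)).im =
        η * (c k - c j).im := by
      simp [std_apply]; ring
    rw [e]
    have := mul_pos h0 h.2
    linarith

/-- Shrink both configurations towards the standard one. This keeps them in the overlap, since the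
standard configuration is real and the sign of the imaginary part of the distinguished difference is
preserved. After strong shrinking all differences have positive real part, and a segment joins the
two. -/
theorem joinedIn_overlap {N : ℕ} {ρ : Equiv.Perm (Fin N)} {j k : Fin N} {ε : ℝ}
    {x y : Fin N → ℂ} (hx : x ∈ overlap ρ j k ε) (hy : y ∈ overlap ρ j k ε) :
    JoinedIn (overlap ρ j k ε) x y := by
  obtain ⟨M, hM⟩ : ∃ M : ℝ, ∀ a, ‖x a‖ + ‖y a‖ + N ≤ M :=
    ⟨∑ a, (‖x a‖ + ‖y a‖ + N), fun a => Finset.single_le_sum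
      (f := fun a => ‖x a‖ + ‖y a‖ + N) (fun a _ => by positivity) (Finset.mem_univ a)⟩
  -- So small that the perturbation of a difference of real parts stays below the gap `1` of the
  -- standard configuration.
  set η : ℝ := 1 / (4 * (|M| + 1)) with hη
  have hη0 : 0 < η := by positivity
  have hη1 : η ≤ 1 := by
    rw [hη, div_le_one (by positivity)]; linarith [abs_nonneg M]
  have hηM : η * M < 1 / 4 := by
    have : η * (|M| + 1) = 1 / 4 := by rw [hη]; field_simp
    nlinarith [le_abs_self M]
  let sc : (Fin N → ℂ) → Fin N → ℂ := fun c a => (1 - η : ℝ) * (std ρ).1 a + η * c a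
  have hto : ∀ c ∈ overlap ρ j k ε, JoinedIn (overlap ρ j k ε) c (sc c) := by
    intro c hc
    refine JoinedIn.of_segment_subset ?_
    rintro d ⟨a, b, ha, hb, hab, rfl⟩
    have := scale_mem_overlap hc (η := a + b * η) (by
      rcases ha.eq_or_lt with h | h
      · have : b = 1 := by linarith
        rw [← h, this]; linarith
      · positivity) (by nlinarith)
    convert this using 1
    ext q
    simp only [sc, Pi.add_apply, Pi.smul_apply, Complex.real_smul]
    have hb' : b = 1 - a := by linarith
    rw [hb']
    push_cast; ring
  refine (hto x hx).trans (JoinedIn.trans ?_ (hto y hy).symm)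
  refine JoinedIn.of_segment_subset ?_
  rintro d ⟨a, b, ha, hb, hab, rfl⟩
  have e : ∀ p q : Fin N, (a • sc x + b • sc y) q - (a • sc x + b • sc y) p =
      (1 - η : ℝ) * ((std ρ).1 q - (std ρ).1 p) +
        η * (a * (x q - x p) + b * (y q - y p)) := by
    intro p q
    simp only [sc, Pi.add_apply, Pi.smul_apply, Complex.real_smul]
    have hb' : b = 1 - a := by linarith
    rw [hb']
    push_cast; ring
  refine ⟨fun p q hpq hne => mem_slitPlane_of_re_pos ?_, ?_⟩
  · rw [e, std_sub, Complex.add_re, Complex.re_ofReal_mul, Complex.re_ofReal_mul, Complex.ofReal_re,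
      Complex.add_re, Complex.re_ofReal_mul, Complex.re_ofReal_mul, Complex.sub_re, Complex.sub_re]
    have h1 := std_sub_pos hpq
    have b1 := (abs_le.1 (Complex.abs_re_le_norm (x p)))
    have b2 := (abs_le.1 (Complex.abs_re_le_norm (x q)))
    have b3 := (abs_le.1 (Complex.abs_re_le_norm (y p)))
    have b4 := (abs_le.1 (Complex.abs_re_le_norm (y q)))
    have m1 := hM p
    have m2 := hM q
    have n0 : (0 : ℝ) ≤ N := by positivity
    have nx := norm_nonneg (x p)
    have nx' := norm_nonneg (x q)
    have ny := norm_nonneg (y p)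
    have ny' := norm_nonneg (y q)
    have N1 : (1 : ℝ) ≤ N := by
      have : 1 ≤ N := by have := p.2; omega
      exact_mod_cast this
    have k1 : -(2 * M) ≤ (x q).re - (x p).re := by linarith
    have k2 : -(2 * M) ≤ (y q).re - (y p).re := by linarith
    have k3 : -(2 * M) ≤ a * ((x q).re - (x p).re) + b * ((y q).re - (y p).re) := by
      have := mul_le_mul_of_nonneg_left k1 ha
      have := mul_le_mul_of_nonneg_left k2 hb
      nlinarith
    have k4 := mul_le_mul_of_nonneg_left k3 hη0.le
    have M1 : 1 ≤ M := by linarith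
    have η4 : η < 1 / 4 := by nlinarith
    nlinarith
  · rw [e, std_sub, Complex.add_im, Complex.im_ofReal_mul, Complex.im_ofReal_mul, Complex.ofReal_im,
      Complex.add_im, Complex.im_ofReal_mul, Complex.im_ofReal_mul]
    have h1 := hx.2
    have h2 := hy.2
    have : 0 < a * (ε * (x k - x j).im) + b * (ε * (y k - y j).im) := by
      rcases ha.eq_or_lt with h | h
      · have : b = 1 := by linarith
        rw [← h, this]; linarith
      · have := mul_pos h h1
        have := mul_nonneg hb h2.le
        linarith
    have := mul_pos hη0 this
    nlinarith

theorem trans_symm_congr {X : Type*} [TopologicalSpace X] {a b x y : X} (P : Path.Homotopic.Quotient a x)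
    (Q : Path.Homotopic.Quotient b x) (R : Path.Homotopic.Quotient x y) : (P.trans R).trans (Q.trans R).symm = P.trans Q.symm := by
  obtain ⟨p, rfl⟩ := Path.Homotopic.Quotient.mk_surjective P
  obtain ⟨q, rfl⟩ := Path.Homotopic.Quotient.mk_surjective Q
  obtain ⟨r, rfl⟩ := Path.Homotopic.Quotient.mk_surjective R
  have : ((Path.Homotopic.Quotient.mk q).trans (Path.Homotopic.Quotient.mk r)).symm =
      (Path.Homotopic.Quotient.mk r).symm.trans (Path.Homotopic.Quotient.mk q).symm := by
    rw [← Path.Homotopic.Quotient.mk_trans, ← Path.Homotopic.Quotient.mk_symm, Path.trans_symm, Path.Homotopic.Quotient.mk_trans,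
      Path.Homotopic.Quotient.mk_symm, Path.Homotopic.Quotient.mk_symm]
  rw [this, Path.Homotopic.Quotient.trans_assoc, ← Path.Homotopic.Quotient.trans_assoc (Path.Homotopic.Quotient.mk r), Path.Homotopic.Quotient.trans_symm,
    Path.Homotopic.Quotient.refl_trans]

/-- By connectedness of the overlap the transition between the two charts does not depend on the
configuration through which it passes. At the midpoint of a half twist it is the class of that half
twist, whose first half lies in one chart and whose second half lies in the other. -/
theorem isWordClass_adjacent {N : ℕ} (ρ : Equiv.Perm (Fin N)) (i : Fin (N - 1)) (b : Bool)
    {j k : Fin N} (hj : (ρ j : ℕ) = i) (hk : (ρ k : ℕ) = i + 1) (x : Conf N)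
    (hx : x.1 ∈ chart ρ) (hx' : x.1 ∈ chart (adjSwap i * ρ))
    (him : 0 < letterSign b * (x.1 k - x.1 j).im) :
    IsWordClass ((link ρ x hx).trans (link (adjSwap i * ρ) x hx').symm) := by
  have hjk : ∀ a : ℝ, twist i a ((ρ k : ℕ) : ℂ) - twist i a ((ρ j : ℕ) : ℂ) =
      Complex.exp ((Real.pi * a : ℝ) * Complex.I) := by
    intro a
    rw [hj, hk, twist_left, twist_right]; ring
  let g : ℝ → Conf N := fun s => ⟨fun a => twist i (letterSign b * s) ((ρ a : ℕ) : ℂ), fun p q h =>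
    (std ρ).2 ((twistHomeo i (letterSign b * s)).injective h)⟩
  have hg : Continuous g := Continuous.subtype_mk (continuous_pi fun a =>
    (continuous_twist_uncurry i).comp (by fun_prop :
      Continuous fun s : ℝ => ((letterSign b * s, ((ρ a : ℕ) : ℂ)) : ℝ × ℂ))) _
  have habs : ∀ s : ℝ, |letterSign b * s| = |s| := fun s => by
    rw [abs_mul, letterSign_abs, one_mul]
  have g0 : g 0 = std ρ := Subtype.ext (funext fun a => by
    change twist _ _ _ = _
    rw [mul_zero, twist_zero]; rfl)
  have g1 : g 1 = std (adjSwap i * ρ) := Subtype.ext (funext fun a => by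
    change twist _ _ _ = _
    rw [mul_one, twist_mark, std_apply, Equiv.Perm.mul_apply, adjSwap_val]
    simp only [Equiv.swap_apply_def])
  have hlow : ∀ s : ℝ, |s| < 1 → (g s).1 ∈ chart ρ := by
    intro s hs p q hpq
    by_cases h : p = j ∧ q = k
    · rw [h.1, h.2]
      change twist _ _ _ - twist _ _ _ ∈ _
      rw [hjk]
      exact exp_mem_slitPlane (by rwa [habs])
    · refine mem_slitPlane_of_re_pos (re_twist_sub_pos i _ _ _ hpq fun h' => h ?_)
      exact ⟨ρ.injective (Fin.ext (h'.1.trans hj.symm)), ρ.injective (Fin.ext (h'.2.trans hk.symm))⟩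
  have hexp : ∀ s : ℝ, Complex.exp ((Real.pi * (letterSign b * s) : ℝ) * Complex.I) =
      -Complex.exp ((Real.pi * (letterSign b * (s - 1)) : ℝ) * Complex.I) := by
    intro s
    have h1 : Complex.exp ((Real.pi * letterSign b : ℝ) * Complex.I) = -1 := by
      cases b
      · simp [letterSign, Complex.exp_neg]
      · simp [letterSign]
    have h2 : ((Real.pi * (letterSign b * s) : ℝ) : ℂ) * Complex.I =
        (Real.pi * letterSign b : ℝ) * Complex.I +
          (Real.pi * (letterSign b * (s - 1)) : ℝ) * Complex.I := by push_cast; ring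
    rw [h2, Complex.exp_add, h1, neg_one_mul]
  have hhigh : ∀ s : ℝ, |s - 1| < 1 → (g s).1 ∈ chart (adjSwap i * ρ) := by
    intro s hs p q hpq
    rw [Equiv.Perm.mul_apply, Equiv.Perm.mul_apply] at hpq
    by_cases h : p = k ∧ q = j
    · rw [h.1, h.2, ← neg_sub]
      change -(twist _ _ _ - twist _ _ _) ∈ _
      rw [hjk, hexp, neg_neg]
      exact exp_mem_slitPlane (by rwa [habs])
    by_cases h' : p = j ∧ q = k
    · rw [h'.1, h'.2, Fin.lt_def, adjSwap_val, adjSwap_val, hj, hk] at hpq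
      simp at hpq
    · have hnot : ¬((ρ p : ℕ) = i ∧ (ρ q : ℕ) = i + 1) := fun e =>
        h' ⟨ρ.injective (Fin.ext (e.1.trans hj.symm)), ρ.injective (Fin.ext (e.2.trans hk.symm))⟩
      rw [adjSwap_lt_iff _ _ _ hnot fun e =>
        h ⟨ρ.injective (Fin.ext (e.1.trans hk.symm)), ρ.injective (Fin.ext (e.2.trans hj.symm))⟩] at hpq
      exact mem_slitPlane_of_re_pos (re_twist_sub_pos i _ _ _ hpq hnot)
  -- Here the two twisted points are vertically aligned, on the side that is determined by the sign
  -- of the letter.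
  set y := g (1 / 2) with hydef
  have hy : y.1 ∈ chart ρ := hlow _ (by rw [abs_of_pos] <;> norm_num)
  have hy' : y.1 ∈ chart (adjSwap i * ρ) := hhigh _ (by rw [abs_of_neg] <;> norm_num)
  have hyo : y.1 ∈ overlap ρ j k (letterSign b) := by
    refine mem_overlap_of_mem_charts hy ?_
    change 0 < _ * (twist _ _ _ - twist _ _ _).im
    rw [hjk, Complex.exp_ofReal_mul_I_im]
    cases b
    · have e : letterSign false = -1 := by simp [letterSign]
      rw [e, show Real.pi * (-1 * (1 / 2)) = -(Real.pi / 2) by ring, Real.sin_neg,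
        Real.sin_pi_div_two]
      norm_num
    · have e : letterSign true = 1 := rfl
      rw [e, show Real.pi * (1 * (1 / 2)) = Real.pi / 2 by ring, Real.sin_pi_div_two]
      norm_num
  obtain ⟨r, hr⟩ := exists_path_of_joinedIn (fun c hc =>
    injective_of_mem_chart (overlap_subset_chart ρ j k _ hc))
    (joinedIn_overlap (mem_overlap_of_mem_charts hx him) hyo)
  have e : (link ρ x hx).trans (link (adjSwap i * ρ) x hx').symm =
      (link ρ y hy).trans (link (adjSwap i * ρ) y hy').symm := by
    rw [← link_trans_mk hx hy r fun s => overlap_subset_chart ρ j k _ (hr s),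
      ← link_trans_mk hx' hy' r fun s => overlap_subset_chart_swap ρ i hj hk _ (hr s),
      trans_symm_congr]
  let p : Path (std ρ) y := ⟨⟨fun s => g (0 + (1 / 2 - 0) * s), by fun_prop⟩, by simp [g0], by simp [y]⟩
  let q : Path y (std (adjSwap i * ρ)) :=
    ⟨⟨fun s => g (1 / 2 + (1 - 1 / 2) * s), by fun_prop⟩, by simp [y], by
      simp only
      rw [show (1 / 2 + (1 - 1 / 2) * ((1 : unitInterval) : ℝ) : ℝ) = 1 by norm_num, g1]⟩
  let t : Path (std ρ) (std (adjSwap i * ρ)) :=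
    ⟨⟨fun s => g (0 + (1 - 0) * s), by fun_prop⟩, by simp [g0], by simp [g1]⟩
  have hp : Path.Homotopic.Quotient.mk p = link ρ y hy := mk_eq_link hy p fun s => hlow _ (by
    have h0 := s.2.1
    have h1 := s.2.2
    rw [abs_of_nonneg] <;> linarith)
  have hq : Path.Homotopic.Quotient.mk q.symm = link (adjSwap i * ρ) y hy' := mk_eq_link hy' q.symm fun s =>
    hhigh _ (by
      have h0 := (unitInterval.symm s).2.1
      have h1 := (unitInterval.symm s).2.2
      rw [abs_of_nonpos] <;> linarith)
  have ht : Path.Homotopic.Quotient.mk t = (Path.Homotopic.Quotient.mk p).trans (Path.Homotopic.Quotient.mk q) := by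
    rw [← Path.Homotopic.Quotient.mk_trans, Path.Homotopic.Quotient.eq]
    exact (homotopic_of_reparam hg p q t (fun _ => rfl) (fun _ => rfl) fun _ => rfl).symm
  refine ⟨[(i, b)], t, ?_, fun s a => ?_⟩
  · rw [e, ht, ← hp, ← hq, ← Path.Homotopic.Quotient.mk_symm, Path.symm_symm]
  · change twist _ _ _ = _
    rw [motion_cons]
    simp only [List.length_singleton, Nat.cast_one, one_mul, sub_add_cancel]
    rw [clamp_of_mem s.2.1 s.2.2]
    simp [motion]

/-- The pairs that are ordered differently by two orders. -/
def inversions {N : ℕ} (ρ ρ' : Equiv.Perm (Fin N)) : Finset (Fin N × Fin N) :=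
  Finset.univ.filter fun p => ρ p.1 < ρ p.2 ∧ ρ' p.2 < ρ' p.1

/-- Otherwise `ρ' ∘ ρ⁻¹` would increase from each position to the next, and a strictly monotone
permutation is the identity. -/
theorem exists_adjacent_inversion {N : ℕ} {ρ ρ' : Equiv.Perm (Fin N)} (h : ρ ≠ ρ') :
    ∃ (i : Fin (N - 1)) (j k : Fin N), (ρ j : ℕ) = i ∧ (ρ k : ℕ) = i + 1 ∧ ρ' k < ρ' j := by
  by_contra hcon
  push Not at hcon
  apply h
  rcases N with _ | N
  · exact Subsingleton.elim _ _
  have hmono : StrictMono (ρ' ∘ ρ.symm) := by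
    rw [Fin.strictMono_iff_lt_succ]
    intro i
    have h1 := hcon ⟨i, by simp⟩ (ρ.symm i.castSucc) (ρ.symm i.succ) (by simp) (by simp)
    refine lt_of_le_of_ne h1 fun h2 => ?_
    have := ρ.symm.injective (ρ'.injective h2)
    exact (Fin.castSucc_lt_succ (i := i)).ne this
  have hid : ρ' ∘ ρ.symm = id := by
    rw [← StrictMono.range_inj hmono strictMono_id,
      (ρ'.surjective.comp ρ.symm.surjective).range_eq, Set.range_id]
  ext a
  have := congrFun hid (ρ a)
  simp at this
  rw [this]

/-- Induction on the number of pairs that the two orders rank differently. An adjacent such pair is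
exchanged through the intermediate chart, which contains `x` as well and has fewer inversions. -/
theorem isWordClass_link {N : ℕ} (x : Conf N) (ρ ρ' : Equiv.Perm (Fin N)) (hx : x.1 ∈ chart ρ)
    (hx' : x.1 ∈ chart ρ') : IsWordClass ((link ρ x hx).trans (link ρ' x hx').symm) := by
  induction hc : (inversions ρ ρ').card using Nat.strong_induction_on generalizing ρ with
  | _ c ih =>
    by_cases h : ρ = ρ'
    · subst h
      rw [Path.Homotopic.Quotient.trans_symm]
      exact isWordClass_refl ρ
    obtain ⟨i, j, k, hj, hk, hlt⟩ := exists_adjacent_inversion h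
    have hjk : ρ j < ρ k := by rw [Fin.lt_def, hj, hk]; omega
    -- Both the difference and its negative lie in the slit plane, so it is not real. The sign of
    -- its imaginary part selects the letter.
    have him : (x.1 k - x.1 j).im ≠ 0 := by
      intro h0
      have h1 := Complex.mem_slitPlane_iff.1 (hx j k hjk)
      have h2 := Complex.mem_slitPlane_iff.1 (hx' k j hlt)
      rw [← neg_sub, Complex.neg_re, Complex.neg_im, h0] at h2
      rw [h0] at h1
      simp only [neg_zero, ne_eq, not_true_eq_false, or_false] at h1 h2
      linarith
    have hmem : ∃ b : Bool, 0 < letterSign b * (x.1 k - x.1 j).im := by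
      rcases lt_or_gt_of_ne him with h | h
      · exact ⟨false, by simp only [letterSign]; norm_num; simpa using h⟩
      · exact ⟨true, by simp only [letterSign]; norm_num; simpa using h⟩
    obtain ⟨b, hb⟩ := hmem
    have hx1 : x.1 ∈ chart (adjSwap i * ρ) :=
      overlap_subset_chart_swap ρ i hj hk _ (mem_overlap_of_mem_charts hx hb)
    have key := isWordClass_adjacent ρ i b hj hk x hx hx1 hb
    have hsub : inversions (adjSwap i * ρ) ρ' ⊂ inversions ρ ρ' := by
      rw [Finset.ssubset_iff_of_subset]
      · refine ⟨(j, k), by simp [inversions, hjk, hlt], ?_⟩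
        simp only [inversions, Finset.mem_filter, Equiv.Perm.mul_apply, Fin.lt_def, adjSwap_val,
          hj, hk]
        simp
      · rintro ⟨p, q⟩ hpq
        rw [inversions, Finset.mem_filter] at hpq ⊢
        replace hpq := hpq.2
        simp only [Equiv.Perm.mul_apply] at hpq
        simp only [Finset.mem_univ, true_and]
        refine ⟨?_, hpq.2⟩
        by_cases h1 : p = k ∧ q = j
        · rw [h1.1, h1.2] at hpq
          exact absurd hpq.2 (not_lt.2 hlt.le)
        by_cases h2 : p = j ∧ q = k
        · rw [h2.1, h2.2]; exact hjk
        have h3 := hpq.1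
        rwa [adjSwap_lt_iff] at h3
        · rintro ⟨e1, e2⟩
          exact h2 ⟨ρ.injective (Fin.ext (e1.trans hj.symm)),
            ρ.injective (Fin.ext (e2.trans hk.symm))⟩
        · rintro ⟨e1, e2⟩
          exact h1 ⟨ρ.injective (Fin.ext (e1.trans hk.symm)),
            ρ.injective (Fin.ext (e2.trans hj.symm))⟩
    have h2 := ih _ (hc ▸ Finset.card_lt_card hsub) (adjSwap i * ρ) hx1 rfl
    have h3 := key.trans h2
    rwa [Path.Homotopic.Quotient.trans_assoc, ← Path.Homotopic.Quotient.trans_assoc (link (adjSwap i * ρ) x hx1).symm,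
      Path.Homotopic.Quotient.symm_trans, Path.Homotopic.Quotient.refl_trans] at h3

/-- A segment of a curve, as a path. -/
def curveSegment {X : Type*} [TopologicalSpace X] (g : ℝ → X) (hg : Continuous g) (a b : ℝ) :
    Path (g a) (g b) where
  toFun s := g (a + (b - a) * s)
  continuous_toFun := by fun_prop
  source' := by simp
  target' := by simp

/-- A short segment of the curve stays in one chart, and changes of chart are word classes. The
statement, made for all charts at the two ends, is closed under concatenation, so it spreads along
the connected line. -/
theorem isWordClass_curveSegment {N : ℕ} (g : ℝ → Conf N) (hg : Continuous g) (a b : ℝ)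
    (ρ ρ' : Equiv.Perm (Fin N)) (ha : (g a).1 ∈ chart ρ) (hb : (g b).1 ∈ chart ρ') :
    IsWordClass (((link ρ (g a) ha).trans (Path.Homotopic.Quotient.mk (curveSegment g hg a b))).trans
      (link ρ' (g b) hb).symm) := by
  let P : ℝ → ℝ → Prop := fun a b => ∀ (ρ ρ' : Equiv.Perm (Fin N)) (ha : (g a).1 ∈ chart ρ)
    (hb : (g b).1 ∈ chart ρ'), IsWordClass (((link ρ (g a) ha).trans
      (Path.Homotopic.Quotient.mk (curveSegment g hg a b))).trans (link ρ' (g b) hb).symm)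
  have hnear : ∀ (a b : ℝ) (ρ₀ : Equiv.Perm (Fin N)),
      (∀ s ∈ Set.uIcc a b, (g s).1 ∈ chart ρ₀) → P a b := by
    intro a b ρ₀ h ρ ρ' ha hb
    have ha0 := h a Set.left_mem_uIcc
    have hb0 := h b Set.right_mem_uIcc
    have h1 := (isWordClass_link (g a) ρ ρ₀ ha ha0).trans (isWordClass_link (g b) ρ₀ ρ' hb0 hb)
    rw [← link_trans_mk ha0 hb0 (curveSegment g hg a b) fun s => h _ ?_] at h1
    · rwa [Path.Homotopic.Quotient.trans_assoc, Path.Homotopic.Quotient.trans_assoc, ← Path.Homotopic.Quotient.trans_assoc (link ρ₀ _ ha0).symm,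
        Path.Homotopic.Quotient.symm_trans, Path.Homotopic.Quotient.refl_trans, ← Path.Homotopic.Quotient.trans_assoc] at h1
    · have h0 := s.2.1
      have h1 := s.2.2
      rcases le_total a b with h | h
      · rw [Set.uIcc_of_le h]; constructor <;> nlinarith
      · rw [Set.uIcc_of_ge h]; constructor <;> nlinarith
  have main : P a b := by
    refine PreconnectedSpace.induction₂' P ?_ ?_ a b
    · intro a
      obtain ⟨ρ₀, h0⟩ := exists_mem_chart (g a)
      have hopen : IsOpen {s : ℝ | (g s).1 ∈ chart ρ₀} :=
        (isOpen_chart ρ₀).preimage (continuous_subtype_val.comp hg)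
      obtain ⟨ε, hε, hball⟩ := Metric.isOpen_iff.1 hopen a h0
      filter_upwards [Metric.ball_mem_nhds a hε] with b hb
      have hs : Set.uIcc a b ⊆ Metric.ball a ε := by
        rw [← segment_eq_uIcc]
        exact (convex_ball a ε).segment_subset (Metric.mem_ball_self hε) hb
      exact ⟨hnear a b ρ₀ fun s h => hball (hs h),
        hnear b a ρ₀ fun s h => hball (hs (Set.uIcc_comm b a ▸ h))⟩
    · refine ⟨fun a b c hab hbc ρ ρ' ha hc => ?_⟩
      obtain ⟨ρ₀, h0⟩ := exists_mem_chart (g b)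
      have h1 := (hab ρ ρ₀ ha h0).trans (hbc ρ₀ ρ' h0 hc)
      have h2 : (Path.Homotopic.Quotient.mk (curveSegment g hg a b)).trans (Path.Homotopic.Quotient.mk (curveSegment g hg b c)) =
          Path.Homotopic.Quotient.mk (curveSegment g hg a c) := by
        rw [← Path.Homotopic.Quotient.mk_trans, Path.Homotopic.Quotient.eq]
        exact homotopic_of_reparam hg _ _ _ (fun _ => rfl) (fun _ => rfl) fun _ => rfl
      rw [← h2]
      rw [Path.Homotopic.Quotient.trans_assoc, Path.Homotopic.Quotient.trans_assoc (link ρ₀ _ h0),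
        ← Path.Homotopic.Quotient.trans_assoc (link ρ₀ _ h0).symm, Path.Homotopic.Quotient.symm_trans, Path.Homotopic.Quotient.refl_trans,
        Path.Homotopic.Quotient.trans_assoc] at h1
      rwa [Path.Homotopic.Quotient.trans_assoc, Path.Homotopic.Quotient.trans_assoc]
  exact main ρ ρ' ha hb

/-- Every path between standard configurations is homotopic to the motion of a braid word. -/
theorem exists_word_of_path {N : ℕ} {ρ ρ' : Equiv.Perm (Fin N)} (p : Path (std ρ) (std ρ')) :
    ∃ (w : BraidWord N) (q : Path (std ρ) (std ρ')), p.Homotopic q ∧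
      ∀ s k, (q s).1 k = motion w (w.length * ((s : ℝ) - 1)) ((ρ k : ℕ) : ℂ) := by
  -- The end points are made variable so that they can be replaced by the values of the extended
  -- path.
  have key : ∀ (x y : Conf N) (p : Path x y) (g : ℝ → Conf N) (hg : Continuous g)
      (_ : ∀ s : unitInterval, p s = g s) (ρ ρ' : Equiv.Perm (Fin N)) (hx : x.1 ∈ chart ρ)
      (hy : y.1 ∈ chart ρ'), IsWordClass (((link ρ x hx).trans (Path.Homotopic.Quotient.mk p)).trans
        (link ρ' y hy).symm) := by
    intro x y p g hg h ρ ρ' hx hy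
    obtain rfl : g 0 = x := by simpa using (h 0).symm
    obtain rfl : g 1 = y := by simpa using (h 1).symm
    have e : p = curveSegment g hg 0 1 := by
      ext1; funext s
      rw [h s]
      simp [curveSegment]
    rw [e]
    exact isWordClass_curveSegment g hg 0 1 ρ ρ' hx hy
  obtain ⟨w, q, h1, h2⟩ := key _ _ p p.extend p.continuous_extend (fun s => by simp) ρ ρ'
    (std_mem_chart ρ) (std_mem_chart ρ')
  have hrefl : ∀ ρ : Equiv.Perm (Fin N), link ρ (std ρ) (std_mem_chart ρ) = Path.Homotopic.Quotient.refl _ :=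
    fun ρ => (mk_eq_link (std_mem_chart ρ) (Path.refl _) fun s => std_mem_chart ρ).symm
  refine ⟨w, q, ?_, h2⟩
  rw [hrefl, hrefl, Path.Homotopic.Quotient.refl_trans] at h1
  have h3 : (Path.Homotopic.Quotient.refl (std ρ')).symm = Path.Homotopic.Quotient.refl (std ρ') := by
    rw [← Path.Homotopic.Quotient.mk_refl, ← Path.Homotopic.Quotient.mk_symm, Path.refl_symm]
  rw [h3, Path.Homotopic.Quotient.trans_refl] at h1
  exact Path.Homotopic.Quotient.eq.1 h1.symm

/-! ### Strands closed by standard caps and cups -/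

/-- The union of finitely many strands over the heights from `-T` to `T` with standard caps above
and standard cups below. -/
def strandClosure (n : ℕ) {ι : Type*} (T : ℝ) (Z : ι → ℝ → ℂ) : Set R3 :=
  {p | (p.1, p.2 - T) ∈ caps n ∨ (-T ≤ p.2 ∧ p.2 ≤ T ∧ ∃ q, p.1 = Z q p.2) ∨
    (p.1, -T - p.2) ∈ caps n}

/-- By compactness the points of the homotopy have a uniform distance, so isotopy extension gives a
level-preserving homeomorphism from one system of strands to the other. The end points of the
homotopy are fixed, so it is the identity on the caps and cups and Alexander's trick applies. -/
theorem isotopic_strandClosure_of_homotopy {n N : ℕ} (hN : 1 ≤ N) {T : ℝ} (hT : 0 < T)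
    {x y : Conf N} {p q : Path x y} (F : Path.Homotopy p q) (Z Z' : Fin N → ℝ → ℂ)
    (hZ : ∀ k (s : unitInterval), Z k (-T + 2 * T * s) = (p s).1 k)
    (hZ' : ∀ k (s : unitInterval), Z' k (-T + 2 * T * s) = (q s).1 k) :
    Isotopic (strandClosure n T Z) (strandClosure n T Z') := by
  have : Nonempty (Fin N) := ⟨⟨0, hN⟩⟩
  let pr : ℝ → unitInterval := Set.projIcc (0 : ℝ) 1 zero_le_one
  have hpr : Continuous pr := continuous_projIcc
  let W : ℝ → Fin N → ℝ → ℂ := fun τ k t => (F (pr τ, pr ((t + T) / (2 * T)))).1 k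
  have hF : Continuous fun a : unitInterval × unitInterval => (F a).1 :=
    continuous_subtype_val.comp F.continuous
  obtain ⟨ε, hε, hsep⟩ : ∃ ε > 0, ∀ (a : unitInterval × unitInterval) (j k : Fin N), j ≠ k →
      ε ≤ ‖(F a).1 j - (F a).1 k‖ := by
    have h1 : ∀ jk : Fin N × Fin N, ∃ ε > 0, ∀ a : unitInterval × unitInterval, jk.1 ≠ jk.2 →
        ε ≤ ‖(F a).1 jk.1 - (F a).1 jk.2‖ := by
      intro jk
      by_cases h : jk.1 = jk.2
      · exact ⟨1, one_pos, fun a h' => absurd h h'⟩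
      · have hc : Continuous fun a : unitInterval × unitInterval =>
            ‖(F a).1 jk.1 - (F a).1 jk.2‖ :=
          (((continuous_apply _).comp hF).sub ((continuous_apply _).comp hF)).norm
        obtain ⟨a, -, ha⟩ := isCompact_univ.exists_isMinOn Set.univ_nonempty hc.continuousOn
        refine ⟨_, norm_pos_iff.2 (sub_ne_zero.2 fun h' => h ((F a).2 h')), fun b _ => ha ?_⟩
        exact Set.mem_univ b
    choose e he0 he using h1
    obtain ⟨jk, hjk⟩ := Finite.exists_min e
    exact ⟨e jk, he0 jk, fun a j k h => (hjk (j, k)).trans (he (j, k) a h)⟩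
  obtain ⟨Φ, h1, h2, h3⟩ := exists_homeo_of_family W (fun τ _ k =>
    (continuous_apply k).comp (hF.comp (by fun_prop))) (by
      intro τ _
      -- Each point moves by at most `ε / 8`, so relative displacements are at most a quarter of the
      -- separation.
      obtain ⟨δ, hδ, hu⟩ := Metric.uniformContinuous_iff.1
        (CompactSpace.uniformContinuous_of_continuous hF) (ε / 8) (by positivity)
      have hev : ∀ᶠ τ' in nhdsWithin τ (Set.Icc 0 1), dist (pr τ') (pr τ) < δ :=
        (hpr.continuousAt.eventually (Metric.ball_mem_nhds _ hδ)).filter_mono nhdsWithin_le_nhds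
      filter_upwards [hev] with τ' hτ' t j k
      by_cases hjk : j = k
      · subst hjk; simp
      have hclose : ∀ i, ‖W τ' i t - W τ i t‖ ≤ ε / 8 := by
        intro i
        have := hu (a := (pr τ', pr ((t + T) / (2 * T)))) (b := (pr τ, pr ((t + T) / (2 * T))))
          (by rw [Prod.dist_eq, dist_self, max_eq_left dist_nonneg]; exact hτ')
        rw [dist_pi_lt_iff (by positivity)] at this
        have := (this i).le
        rwa [dist_eq_norm] at this
      have hs := hsep (pr τ, pr ((t + T) / (2 * T))) j k hjk
      calc _ ≤ ‖W τ' j t - W τ j t‖ + ‖W τ' k t - W τ k t‖ := norm_sub_le _ _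
        _ ≤ 1 / 4 * ε := by linarith [hclose j, hclose k]
        _ ≤ _ := by linarith)
  have hlow : ∀ p : R3, p.2 ≤ -T → Φ p = p := by
    intro p hp
    refine h3 p fun τ _ k => ?_
    have : pr ((p.2 + T) / (2 * T)) = 0 :=
      Set.projIcc_of_le_left _ (div_nonpos_of_nonpos_of_nonneg (by linarith) (by linarith))
    simp only [W, this, F.source]
  have hhigh : ∀ p : R3, T ≤ p.2 → Φ p = p := by
    intro p hp
    refine h3 p fun τ _ k => ?_
    have : pr ((p.2 + T) / (2 * T)) = 1 := Set.projIcc_of_right_le _ (by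
      rw [le_div_iff₀ (by linarith)]; linarith)
    simp only [W, this, F.target]
  have hs : ∀ t, -T ≤ t → t ≤ T → ∃ s : unitInterval, pr ((t + T) / (2 * T)) = s ∧
      t = -T + 2 * T * s := by
    intro t h1 h2
    have hm : (t + T) / (2 * T) ∈ Set.Icc (0 : ℝ) 1 :=
      ⟨div_nonneg (by linarith) (by linarith), by rw [div_le_one (by linarith)]; linarith⟩
    refine ⟨⟨_, hm⟩, Set.projIcc_of_mem _ hm, ?_⟩
    simp only
    field_simp; ring
  have hW0 : ∀ t k, -T ≤ t → t ≤ T → W 0 k t = Z k t := by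
    intro t k ha hb
    obtain ⟨s, hs1, hs2⟩ := hs t ha hb
    have : pr 0 = 0 := Set.projIcc_left _
    simp only [W, hs1, this, F.apply_zero]
    rw [hs2, hZ]; rfl
  have hW1 : ∀ t k, -T ≤ t → t ≤ T → W 1 k t = Z' k t := by
    intro t k ha hb
    obtain ⟨s, hs1, hs2⟩ := hs t ha hb
    have : pr 1 = 1 := Set.projIcc_right _
    simp only [W, hs1, this, F.apply_one]
    rw [hs2, hZ']; rfl
  have himage : Φ '' strandClosure n T Z = strandClosure n T Z' := by
    have key : ∀ p : R3, p ∈ strandClosure n T Z ↔ Φ p ∈ strandClosure n T Z' := by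
      intro p
      rcases le_or_gt T p.2 with hp | hp
      · rw [hhigh p hp]
        refine or_congr Iff.rfl (or_congr ?_ Iff.rfl)
        refine and_congr_right fun a => and_congr_right fun b => exists_congr fun q => ?_
        have : W 0 q p.2 = W 1 q p.2 := by
          have := h1 q p.2
          rw [hhigh (W 0 q p.2, p.2) hp] at this
          exact congrArg Prod.fst this
        rw [← hW0 _ _ a b, ← hW1 _ _ a b, this]
      rcases le_or_gt p.2 (-T) with hp' | hp'
      · rw [hlow p hp']
        refine or_congr Iff.rfl (or_congr ?_ Iff.rfl)
        refine and_congr_right fun a => and_congr_right fun b => exists_congr fun q => ?_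
        have : W 0 q p.2 = W 1 q p.2 := by
          have := h1 q p.2
          rw [hlow (W 0 q p.2, p.2) hp'] at this
          exact congrArg Prod.fst this
        rw [← hW0 _ _ a b, ← hW1 _ _ a b, this]
      · have n1 : ∀ x : R3, x.2 = p.2 → (x.1, x.2 - T) ∉ caps n := fun x hx h => by
          have := height_caps_nonneg h
          simp only at this; linarith
        have n2 : ∀ x : R3, x.2 = p.2 → (x.1, -T - x.2) ∉ caps n := fun x hx h => by
          have := height_caps_nonneg h
          simp only at this; linarith
        have m1 := n1 (Φ p) (h2 p)
        have m2 := n2 (Φ p) (h2 p)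
        rw [h2 p] at m1 m2
        simp only [strandClosure, Set.mem_ofPred_eq, n1 p rfl, n2 p rfl, m1, m2, h2 p, hp'.le,
          hp.le, true_and, false_or, or_false]
        refine exists_congr fun q => ?_
        rw [← hW0 _ _ hp'.le hp.le, ← hW1 _ _ hp'.le hp.le]
        constructor
        · intro h
          have := h1 q p.2
          rw [← h] at this
          exact congrArg Prod.fst this
        · intro h
          have e : Φ p = Φ (W 0 q p.2, p.2) := by
            rw [h1]; exact Prod.ext h (h2 p)
          exact congrArg Prod.fst (Φ.injective e)
    ext p
    constructor
    · rintro ⟨x, hx, rfl⟩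
      exact (key x).1 hx
    · intro hp
      exact ⟨Φ.symm p, (key _).2 (by simpa using hp), by simp⟩
  rw [← himage]
  exact isotopic_of_eq_on_halfSpace Φ 1 (-T) (by norm_num) (fun p hp => hlow p (by linarith)) _

theorem isotopic_scaleUpper (k : ℝ) (hk : 0 < k) (K : Set R3) :
    Isotopic K (scaleUpper k hk '' K) :=
  isotopic_of_eq_on_halfSpace _ 1 0 (by norm_num) (fun p hp => by
    refine Prod.ext rfl ?_
    have : p.2 ≤ 0 := by linarith
    simp [scaleUpper, this]) K

theorem isotopic_vertical (l : ℝ) (K : Set R3) : Isotopic K (vertical l '' K) := by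
  convert isotopic_translate K l using 1
  ext p
  constructor
  · rintro ⟨x, hx, rfl⟩
    simpa [vertical] using hx
  · intro h
    exact ⟨_, h, by simp [vertical]⟩

/-- Only the vertical scale differs: heights from `-T` to `T` are rescaled to the length of the
word, which has to be positive for this. -/
theorem isotopic_strandClosure_motion {n : ℕ} {T : ℝ} (hT : 0 < T) (w : BraidWord (2 * n))
    (hw : w ≠ []) : Isotopic (strandClosure n T fun (q : Fin (2 * n)) t =>
      motion w (w.length * ((t - T) / (2 * T))) ((q : ℕ) : ℂ)) (platSet w) := by
  have hl : (0 : ℝ) < w.length := by exact_mod_cast List.length_pos_iff.2 hw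
  set k : ℝ := w.length / (2 * T) with hkdef
  have hk : 0 < k := by positivity
  have hkT : k * (2 * T) = w.length := by rw [hkdef]; field_simp
  set K := strandClosure n T fun (q : Fin (2 * n)) t =>
      motion w (w.length * ((t - T) / (2 * T))) ((q : ℕ) : ℂ) with hK
  -- Scale everything above the lower end, then undo the scaling above the new upper end; the caps
  -- and cups are merely translated.
  let Ψ : R3 ≃ₜ R3 := (vertical T).trans ((scaleUpper k hk).trans ((vertical (-w.length)).trans
    (scaleUpper k⁻¹ (inv_pos.2 hk))))
  have h1 : Isotopic K (Ψ '' K) := by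
    have e : Ψ '' K = scaleUpper k⁻¹ (inv_pos.2 hk) '' (vertical (-w.length) ''
        (scaleUpper k hk '' (vertical T '' K))) := by
      rw [Set.image_image, Set.image_image, Set.image_image]; rfl
    rw [e]
    exact (isotopic_vertical _ _).trans ((isotopic_scaleUpper _ _ _).trans
      ((isotopic_vertical _ _).trans (isotopic_scaleUpper _ _ _)))
  have hΨ : ∀ p : R3, Ψ p = (p.1, min (min (p.2 + T) 0 + k * max (p.2 + T) 0 + -w.length) 0 +
      k⁻¹ * max (min (p.2 + T) 0 + k * max (p.2 + T) 0 + -w.length) 0) := fun p => rfl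
  have c1 : ∀ p : R3, T ≤ p.2 → Ψ p = (p.1, p.2 - T) := by
    intro p hp
    rw [hΨ, min_eq_right (by linarith : 0 ≤ p.2 + T), max_eq_left (by linarith : 0 ≤ p.2 + T)]
    have : 0 ≤ 0 + k * (p.2 + T) + -w.length := by nlinarith
    rw [min_eq_right this, max_eq_left this]
    refine Prod.ext rfl ?_
    simp only
    rw [← hkT]
    field_simp; ring
  have c2 : ∀ p : R3, -T ≤ p.2 → p.2 ≤ T → Ψ p = (p.1, w.length * ((p.2 - T) / (2 * T))) := by
    intro p hp hp'
    rw [hΨ, min_eq_right (by linarith : 0 ≤ p.2 + T), max_eq_left (by linarith : 0 ≤ p.2 + T)]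
    have : 0 + k * (p.2 + T) + -w.length ≤ 0 := by nlinarith
    rw [min_eq_left this, max_eq_right this]
    refine Prod.ext rfl ?_
    simp only
    rw [← hkT]
    field_simp; ring
  have c3 : ∀ p : R3, p.2 ≤ -T → Ψ p = (p.1, p.2 + T - w.length) := by
    intro p hp
    rw [hΨ, min_eq_left (by linarith : p.2 + T ≤ 0), max_eq_right (by linarith : p.2 + T ≤ 0)]
    have : p.2 + T + k * 0 + -w.length ≤ 0 := by linarith
    rw [min_eq_left this, max_eq_right this]
    refine Prod.ext rfl ?_
    simp only
    ring
  have key : ∀ p : R3, p ∈ K ↔ Ψ p ∈ platSet w := by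
    intro p
    simp only [hK, strandClosure, platSet, Set.mem_ofPred_eq]
    have hT2 : 0 < 2 * T := by linarith
    rcases le_or_gt T p.2 with hp | hp
    · have e := c1 p hp
      have a3 : (p.1, -T - p.2) ∉ caps n := fun h => by
        have := height_caps_nonneg h
        simp only at this; linarith
      have a4 : ((Ψ p).1, -(w.length : ℝ) - (Ψ p).2) ∉ caps n := fun h => by
        have := height_caps_nonneg h
        rw [e] at this
        simp only at this; linarith
      refine or_congr (by rw [e]) (or_congr ?_ (by simp only [a3, a4]))
      rcases hp.eq_or_lt with h | h
      · have e' := c2 p (by linarith) h.ge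
        rw [e']
        simp only [braidSet, Set.mem_ofPred_eq, ← h]
        simp [hl.le, hT.le]
      · constructor
        · rintro ⟨_, h', _⟩; linarith
        · rintro ⟨_, h', _⟩
          rw [e] at h'
          simp only at h'; linarith
    · have a1 : (p.1, p.2 - T) ∉ caps n := fun h => by
        have := height_caps_nonneg h
        simp only at this; linarith
      rcases le_or_gt p.2 (-T) with hp' | hp'
      · have e := c3 p hp'
        have a2 : Ψ p ∉ caps n := fun h => by
          have := height_caps_nonneg h
          rw [e] at this
          simp only at this; linarith
        refine or_congr (by simp only [a1, a2]) (or_congr ?_ (by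
          rw [e]
          simp only
          rw [show -(w.length : ℝ) - (p.2 + T - w.length) = -T - p.2 by ring]))
        rcases hp'.eq_or_lt with h | h
        · have e' := c2 p h.ge (by linarith)
          rw [e']
          simp only [braidSet, Set.mem_ofPred_eq, h]
          rw [show (w.length : ℝ) * ((-T - T) / (2 * T)) = -w.length by field_simp; ring]
          simp [hl.le, hT.le]
        · constructor
          · rintro ⟨h', _⟩; linarith
          · rintro ⟨h', _⟩
            rw [e] at h'
            simp only at h'; linarith
      · have e := c2 p hp'.le hp.le
        have b1 : (p.2 - T) / (2 * T) < 0 := div_neg_of_neg_of_pos (by linarith) hT2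
        have b2 : -1 < (p.2 - T) / (2 * T) := by rw [lt_div_iff₀ hT2]; linarith
        have a2 : Ψ p ∉ caps n := fun h => by
          have := height_caps_nonneg h
          rw [e] at this
          simp only at this; nlinarith
        have a3 : (p.1, -T - p.2) ∉ caps n := fun h => by
          have := height_caps_nonneg h
          simp only at this; linarith
        have a4 : ((Ψ p).1, -(w.length : ℝ) - (Ψ p).2) ∉ caps n := fun h => by
          have := height_caps_nonneg h
          rw [e] at this
          simp only at this; nlinarith
        simp only [a1, a2, a3, a4, false_or, or_false]
        rw [e]
        simp only [braidSet, Set.mem_ofPred_eq]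
        refine and_congr ⟨fun _ => by nlinarith, fun _ => hp'.le⟩
          (and_congr ⟨fun _ => by nlinarith, fun _ => hp.le⟩ Iff.rfl)
  have himage : Ψ '' K = platSet w := by
    ext p
    constructor
    · rintro ⟨x, hx, rfl⟩
      exact (key x).1 hx
    · intro hp
      exact ⟨Ψ.symm p, (key _).2 (by simpa using hp), by simp⟩
  rwa [himage] at h1

/-- In the plat of the empty word the caps and cups meet directly; the caps are stretched to legs of
length `2 * T`. -/
theorem isotopic_strandClosure_const {n : ℕ} (hn : 1 ≤ n) {T : ℝ} (hT : 0 < T) :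
    Isotopic (strandClosure n T fun (q : Fin (2 * n)) _ => ((q : ℕ) : ℂ))
      (platSet ([] : BraidWord (2 * n))) := by
  obtain ⟨Θ, h1, h2⟩ := exists_homeo_stretch hn (l := 2 * T) (by linarith)
  refine Isotopic.symm ?_
  refine (isotopic_of_eq_on_halfSpace Θ 1 0 (by norm_num) (fun p hp => h1 p (by linarith)) _).trans
    ?_
  convert (isotopic_translate (strandClosure n T fun (q : Fin (2 * n)) _ => ((q : ℕ) : ℂ)) T).symm
    using 1
  have hw : platSet ([] : BraidWord (2 * n)) = caps n ∪ {p | (p.1, -p.2) ∈ caps n} := by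
    ext p
    simp only [platSet, Set.mem_ofPred_eq, Set.mem_union, List.length_nil, Nat.cast_zero, neg_zero,
      zero_sub]
    have : p ∈ braidSet ([] : BraidWord (2 * n)) → p ∈ caps n := fun h => by
      obtain ⟨h1, q, h2⟩ := mem_braidSet_nil.1 h
      have : p = (((q : ℕ) : ℂ), (0 : ℝ)) := Prod.ext h2 h1
      rw [this]; exact mark_mem_caps q
    tauto
  have hid : Θ '' {p | (p.1, -p.2) ∈ caps n} = {p | (p.1, -p.2) ∈ caps n} := by
    have : ∀ p ∈ {p : R3 | (p.1, -p.2) ∈ caps n}, Θ p = p := fun p hp => h1 p (by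
      have := height_caps_nonneg hp
      simp only at this; linarith)
    rw [Set.image_congr this]; simp
  rw [hw, Set.image_union, hid, h2]
  ext p
  simp only [strandClosure, Set.mem_union, Set.mem_ofPred_eq]
  rw [show -T - (p.2 - T) = -p.2 by ring, ← or_assoc]
  refine or_congr ?_ Iff.rfl
  have hleg : ∀ t : ℝ, t ≤ 2 * T → legWidth (2 * T) t = 1 / 2 := by
    intro t ht
    rw [legWidth, max_eq_right (by linarith),
      show (1 / 4 - 0 ^ 2 : ℝ) = (1 / 2) ^ 2 by norm_num, Real.sqrt_sq (by norm_num)]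
  constructor
  · rintro ⟨q, a1, a2, a3⟩
    rcases le_total p.2 (2 * T) with h | h
    · right
      rw [hleg _ h] at a3
      exact ⟨by linarith, by linarith, mark_eq_capPoint.2 ⟨q, a3⟩⟩
    · left
      refine mem_caps_iff.2 ⟨q, by simp only; linarith, by simp only; linarith, ?_⟩
      simp only
      rw [a3, legWidth, max_eq_left (by linarith), show p.2 - T - T = p.2 - 2 * T by ring]
  · rintro (h | ⟨a1, a2, a3⟩)
    · obtain ⟨q, a1, a2, a3⟩ := mem_caps_iff.1 h
      simp only at a1 a2 a3
      refine ⟨q, by linarith, by linarith, ?_⟩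
      rw [a3, legWidth, max_eq_left (by linarith), show p.2 - T - T = p.2 - 2 * T by ring]
    · obtain ⟨q, hq⟩ := mark_eq_capPoint.1 a3
      exact ⟨q, by linarith, by linarith, by rw [hleg _ (by linarith)]; exact hq⟩

theorem strandClosure_comp_perm {n : ℕ} {ι : Type*} (T : ℝ) (Z : ι → ℝ → ℂ) (ρ : Equiv.Perm ι) :
    strandClosure n T (fun q => Z (ρ q)) = strandClosure n T Z := by
  ext p
  refine or_congr Iff.rfl (or_congr (and_congr Iff.rfl (and_congr Iff.rfl ?_)) Iff.rfl)
  exact ρ.surjective.exists (p := fun q => p.1 = Z q p.2) |>.symm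

/-- A system of strands with standard ends is isotopic to a geometric braid, relative to the
ends. -/
theorem exists_word_of_strands {n : ℕ} (hn : 1 ≤ n) {T : ℝ} (hT : 0 < T)
    (Z : Fin (2 * n) → ℝ → ℂ) (hZ : ∀ q, Continuous (Z q))
    (hinj : ∀ t, -T ≤ t → t ≤ T → Function.Injective fun q => Z q t)
    (ρ ρ' : Equiv.Perm (Fin (2 * n))) (hbot : ∀ q, Z q (-T) = ((ρ q : ℕ) : ℂ))
    (htop : ∀ q, Z q T = ((ρ' q : ℕ) : ℂ)) :
    ∃ w : BraidWord (2 * n), Isotopic (strandClosure n T Z) (platSet w) := by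
  let p : Path (std ρ) (std ρ') :=
    { toFun := fun s => ⟨fun q => Z q (-T + 2 * T * s), hinj _ (by nlinarith [s.2.1])
        (by nlinarith [s.2.2])⟩
      continuous_toFun := Continuous.subtype_mk (continuous_pi fun q =>
        (hZ q).comp (by fun_prop)) _
      source' := Subtype.ext (funext fun q => by simpa [std_apply] using hbot q)
      target' := Subtype.ext (funext fun q => by
        have : -T + 2 * T * ((1 : unitInterval) : ℝ) = T := by simp; ring
        simp only [this]
        exact htop q) }
  obtain ⟨w, q, ⟨F⟩, hq⟩ := exists_word_of_path p
  refine ⟨w, ?_⟩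
  have h1 := isotopic_strandClosure_of_homotopy (n := n) (by omega : 1 ≤ 2 * n) hT F Z
    (fun k t => motion w (w.length * ((t - T) / (2 * T))) ((ρ k : ℕ) : ℂ)) (fun k s => rfl)
    (fun k s => by
      rw [hq]
      congr 2
      field_simp; ring)
  refine h1.trans ?_
  -- The strands are relabelled by their lower end points.
  rw [strandClosure_comp_perm T (fun (k : Fin (2 * n)) t =>
    motion w (w.length * ((t - T) / (2 * T))) ((k : ℕ) : ℂ)) ρ]
  by_cases hw : w = []
  · subst hw
    exact isotopic_strandClosure_const hn hT
  · exact isotopic_strandClosure_motion hT w hw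

/-! ### Strands that meet in pairs -/

/-- The strands `Z` approach the height `H` in pairs, ordered by the real part, and the distance in
each pair is comparable to that of a cap of height `H`. -/
def TopOrdered {n : ℕ} {A : Type*} (H : ℝ) (Z : A → ℝ → ℂ) (e : A ≃ Fin n × Bool) : Prop :=
  ∃ c > 0, ∃ C : ℝ, ∀ t, H - 1 ≤ t →
    (∀ i, c * √(H - t) ≤ (Z (e.symm (i, true)) t - Z (e.symm (i, false)) t).re ∧
      ‖Z (e.symm (i, true)) t - Z (e.symm (i, false)) t‖ ≤ C * √(H - t)) ∧
    ∀ α β, (e α).1 < (e β).1 → c ≤ (Z β t - Z α t).re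

/-- A cap whose tip is at height `H` has a width comparable to `√(H - t)`, the rate in `TopOrdered`.
-/
theorem legWidth_bounds {H t : ℝ} (ht : H - 1 ≤ t) :
    √(H - t) / 2 ≤ legWidth (H - 1 / 2) t ∧ legWidth (H - 1 / 2) t ≤ √(H - t) := by
  rcases le_total H t with h | h
  · have h1 : √(H - t) = 0 := Real.sqrt_eq_zero_of_nonpos (by linarith)
    have h2 : legWidth (H - 1 / 2) t = 0 := by
      rw [legWidth, max_eq_left (by linarith)]
      exact Real.sqrt_eq_zero_of_nonpos (by nlinarith)
    rw [h1, h2]; simp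
  · have e : √(H - t) / 2 = √((H - t) / 4) := by
      rw [Real.sqrt_div' _ (by norm_num), show (4 : ℝ) = 2 ^ 2 by norm_num,
        Real.sqrt_sq (by norm_num)]
    rw [e, legWidth]
    constructor
    · apply Real.sqrt_le_sqrt
      rcases le_total (t - (H - 1 / 2)) 0 with h' | h'
      · rw [max_eq_right h']; nlinarith
      · rw [max_eq_left h']; nlinarith
    · apply Real.sqrt_le_sqrt
      rcases le_total (t - (H - 1 / 2)) 0 with h' | h'
      · rw [max_eq_right h']; nlinarith
      · rw [max_eq_left h']; nlinarith

/-- Interpolate linearly to the standard caps. Both systems have the same order of real parts, so in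
between the strands of a pair stay at least a multiple of `√(H - t)` apart, and strands of different
pairs at least a constant. The relative displacements satisfy upper bounds of the same orders. -/
theorem exists_homeo_standardTop {n : ℕ} (hn : 1 ≤ n) {A : Type*} [Fintype A] {H : ℝ}
    (Z : A → ℝ → ℂ) (hZ : ∀ α, Continuous (Z α)) {B : ℝ} (hB : ∀ α t, ‖Z α t‖ ≤ B)
    (e : A ≃ Fin n × Bool) (ht : TopOrdered H Z e) :
    ∃ (Φ : R3 ≃ₜ R3) (Z' : A → ℝ → ℂ), (∀ α, Continuous (Z' α)) ∧
      (∃ B', ∀ α t, ‖Z' α t‖ ≤ B') ∧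
      (∀ α t, Φ (Z α t, t) = (Z' α t, t)) ∧ (∀ p, (Φ p).2 = p.2) ∧
      (∀ p, p.2 ≤ H - 1 → Φ p = p) ∧ (∀ α t, t ≤ H - 1 → Z' α t = Z α t) ∧
      ∀ α t, H - 1 / 2 ≤ t → Z' α t = capPoint (legWidth (H - 1 / 2) t) (e α) := by
  obtain ⟨c, hc, C, hcC⟩ := ht
  have : Nonempty A := ⟨e.symm (⟨0, hn⟩, true)⟩
  -- The interpolation is switched on between the heights `H - 1` and `H - 1 / 2`.
  let φ : ℝ → ℝ := fun t => clamp (2 * (t - (H - 1)))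
  have hφ : Continuous φ := by fun_prop
  have hφ01 : ∀ t, φ t ∈ Set.Icc (0 : ℝ) 1 := fun t => clamp_mem _
  have hφ0 : ∀ t, t ≤ H - 1 → φ t = 0 := fun t ht => clamp_of_nonpos (by linarith)
  have hφ1 : ∀ t, H - 1 / 2 ≤ t → φ t = 1 := fun t ht => clamp_of_one_le (by linarith)
  let W : A → ℝ → ℂ := fun α t => capPoint (legWidth (H - 1 / 2) t) (e α)
  have hW : ∀ α, Continuous (W α) := fun α => by
    have := continuous_legWidth (H - 1 / 2)
    simp only [W]
    unfold capPoint; fun_prop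
  have hWB : ∀ α t, ‖W α t‖ ≤ 2 * n + 2 := by
    intro α t
    simp only [W, capPoint]
    rw [Complex.norm_real, Real.norm_eq_abs]
    have h1 := legWidth_le_half (H - 1 / 2) t
    have h2 : 0 ≤ legWidth (H - 1 / 2) t := Real.sqrt_nonneg _
    have h3 : (((e α).1 : ℕ) : ℝ) ≤ n := by exact_mod_cast (e α).1.2.le
    have h4 : (0 : ℝ) ≤ (((e α).1 : ℕ) : ℝ) := by positivity
    have h5 : |letterSign (e α).2 * legWidth (H - 1 / 2) t| ≤ 1 / 2 := by
      rw [abs_mul, letterSign_abs, one_mul, abs_of_nonneg h2]; exact h1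
    obtain ⟨h6, h7⟩ := abs_le.1 h5
    rw [abs_le]
    constructor <;> linarith
  let D : A → ℝ → ℂ := fun α t => φ t * (W α t - Z α t)
  have hB0 : 0 ≤ B := (norm_nonneg _).trans (hB (Classical.arbitrary A) 0)
  have hDB : ∀ α t, ‖D α t‖ ≤ 2 * n + 2 + B := by
    intro α t
    simp only [D]
    rw [norm_mul, Complex.norm_real, Real.norm_eq_abs, abs_of_nonneg (hφ01 t).1]
    have := norm_sub_le (W α t) (Z α t)
    have h1 := hWB α t
    have h2 := hB α t
    have h3 := (hφ01 t).2
    have h4 := (hφ01 t).1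
    have h5 := norm_nonneg (W α t - Z α t)
    nlinarith
  set m : ℝ := min c 1 with hm
  have hm0 : 0 < m := lt_min hc one_pos
  have hmc : m ≤ c := min_le_left _ _
  have hm1 : m ≤ 1 := min_le_right _ _
  -- The first term is for the two strands of a pair, whose displacements differ by at most `(|C| +
  -- 2) * √(H - t)`; the second is for different pairs, where each displacement is at most `2 * n +
  -- 2 + B`.
  set k : ℝ := max ((|C| + 2) / m) (2 * (2 * n + 2 + B) / m) with hk
  have hk0 : 0 ≤ k := le_max_of_le_left (by positivity)
  obtain ⟨Φ, h1, h2, h3⟩ := exists_homeo_of_linear Z D hZ (fun α => by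
    have := hW α
    have := hZ α
    fun_prop) (by
    intro τ hτ
    refine ⟨k, fun t α β => ?_⟩
    rcases le_total t (H - 1) with ht | ht
    · simp only [D, hφ0 t ht]
      simp only [Complex.ofReal_zero, zero_mul, sub_self, norm_zero]
      positivity
    obtain ⟨hpair, hdist⟩ := hcC t ht
    set s : ℝ := τ * φ t with hs
    have hs0 : 0 ≤ s := mul_nonneg hτ.1 (hφ01 t).1
    have hs1 : s ≤ 1 := mul_le_one₀ hτ.2 (hφ01 t).1 (hφ01 t).2
    have hdiff : ∀ α β, (Z β t + τ * D β t) - (Z α t + τ * D α t) =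
        ((1 - s : ℝ) : ℂ) * (Z β t - Z α t) + (s : ℂ) * (W β t - W α t) := by
      intro α β
      simp only [D, hs]; push_cast; ring
    have hre : ∀ α β, ((Z β t + τ * D β t) - (Z α t + τ * D α t)).re =
        (1 - s) * (Z β t - Z α t).re + s * (W β t - W α t).re := by
      intro α β
      rw [hdiff, Complex.add_re, Complex.re_ofReal_mul, Complex.re_ofReal_mul]
    obtain ⟨hl1, hl2⟩ := legWidth_bounds (H := H) ht
    have case1 : ∀ i, ‖D (e.symm (i, true)) t - D (e.symm (i, false)) t‖ ≤
        k * ‖(Z (e.symm (i, true)) t + τ * D (e.symm (i, true)) t) -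
          (Z (e.symm (i, false)) t + τ * D (e.symm (i, false)) t)‖ := by
      intro i
      obtain ⟨p1, p2⟩ := hpair i
      have hWd : W (e.symm (i, true)) t - W (e.symm (i, false)) t =
          ((2 * legWidth (H - 1 / 2) t : ℝ) : ℂ) := by
        simp only [W, Equiv.apply_symm_apply, capPoint, letterSign]
        push_cast; simp; ring
      have hr := Real.sqrt_nonneg (H - t)
      have low : m * √(H - t) ≤ ‖(Z (e.symm (i, true)) t + τ * D (e.symm (i, true)) t) -
          (Z (e.symm (i, false)) t + τ * D (e.symm (i, false)) t)‖ := by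
        refine le_trans ?_ (Complex.re_le_norm _)
        rw [hre, hWd, Complex.ofReal_re]
        have a1 : m * √(H - t) ≤ (Z (e.symm (i, true)) t - Z (e.symm (i, false)) t).re :=
          (mul_le_mul_of_nonneg_right hmc hr).trans p1
        have a2 : m * √(H - t) ≤ 2 * legWidth (H - 1 / 2) t := by
          have := mul_le_mul_of_nonneg_right hm1 hr
          linarith
        have b1 := mul_le_mul_of_nonneg_left a1 (by linarith : 0 ≤ 1 - s)
        have b2 := mul_le_mul_of_nonneg_left a2 hs0
        linarith
      have up : ‖D (e.symm (i, true)) t - D (e.symm (i, false)) t‖ ≤ (|C| + 2) * √(H - t) := by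
        have e1 : D (e.symm (i, true)) t - D (e.symm (i, false)) t = (φ t : ℂ) *
            ((W (e.symm (i, true)) t - W (e.symm (i, false)) t) -
              (Z (e.symm (i, true)) t - Z (e.symm (i, false)) t)) := by
          simp only [D]; ring
        rw [e1, norm_mul, Complex.norm_real, Real.norm_eq_abs, abs_of_nonneg (hφ01 t).1]
        have n1 := norm_sub_le (W (e.symm (i, true)) t - W (e.symm (i, false)) t)
          (Z (e.symm (i, true)) t - Z (e.symm (i, false)) t)
        have n2 : ‖W (e.symm (i, true)) t - W (e.symm (i, false)) t‖ ≤ 2 * √(H - t) := by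
          rw [hWd, Complex.norm_real, Real.norm_eq_abs, abs_of_nonneg (by linarith)]
          linarith
        have n3 : C * √(H - t) ≤ |C| * √(H - t) := mul_le_mul_of_nonneg_right (le_abs_self C) hr
        have n4 := mul_le_mul_of_nonneg_right (hφ01 t).2 (norm_nonneg
          ((W (e.symm (i, true)) t - W (e.symm (i, false)) t) -
              (Z (e.symm (i, true)) t - Z (e.symm (i, false)) t)))
        linarith
      have hk1 : |C| + 2 ≤ k * m := by
        have := le_max_left ((|C| + 2) / m) (2 * (2 * n + 2 + B) / m)
        rw [← hk, div_le_iff₀ hm0] at this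
        exact this
      calc _ ≤ (|C| + 2) * √(H - t) := up
        _ ≤ k * m * √(H - t) := mul_le_mul_of_nonneg_right hk1 hr
        _ = k * (m * √(H - t)) := by ring
        _ ≤ _ := mul_le_mul_of_nonneg_left low hk0
    have case2 : ∀ α β, (e α).1 < (e β).1 → ‖D β t - D α t‖ ≤
        k * ‖(Z β t + τ * D β t) - (Z α t + τ * D α t)‖ := by
      intro α β hαβ
      have low : m ≤ ‖(Z β t + τ * D β t) - (Z α t + τ * D α t)‖ := by
        refine le_trans ?_ (Complex.re_le_norm _)
        rw [hre]
        have a1 := hmc.trans (hdist α β hαβ)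
        have a2 : m ≤ (W β t - W α t).re := by
          refine hm1.trans ?_
          simp only [W, capPoint, Complex.sub_re, Complex.ofReal_re]
          have h1 := legWidth_le_half (H - 1 / 2) t
          have h2 : 0 ≤ legWidth (H - 1 / 2) t := Real.sqrt_nonneg _
          have h3 : (((e α).1 : ℕ) : ℝ) + 1 ≤ ((e β).1 : ℕ) := by exact_mod_cast hαβ
          have h5 : ∀ b, |letterSign b * legWidth (H - 1 / 2) t| ≤ 1 / 2 := by
            intro b
            rw [abs_mul, letterSign_abs, one_mul, abs_of_nonneg h2]; exact h1
          have h6 := (abs_le.1 (h5 (e α).2)).2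
          have h7 := (abs_le.1 (h5 (e β).2)).1
          linarith
        have b1 := mul_le_mul_of_nonneg_left a1 (by linarith : 0 ≤ 1 - s)
        have b2 := mul_le_mul_of_nonneg_left a2 hs0
        linarith
      have hk1 : 2 * (2 * n + 2 + B) ≤ k * m := by
        have := le_max_right ((|C| + 2) / m) (2 * (2 * n + 2 + B) / m)
        rw [← hk, div_le_iff₀ hm0] at this
        exact this
      have up := (norm_sub_le (D β t) (D α t))
      have := hDB α t
      have := hDB β t
      have := mul_le_mul_of_nonneg_left low hk0
      linarith
    have hswap : ∀ α β, ‖D β t - D α t‖ ≤ k * ‖(Z β t + τ * D β t) - (Z α t + τ * D α t)‖ →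
        ‖D α t - D β t‖ ≤ k * ‖(Z α t + τ * D α t) - (Z β t + τ * D β t)‖ := by
      intro α β h
      rwa [norm_sub_rev (D α t), norm_sub_rev (Z α t + τ * D α t)]
    rcases lt_trichotomy (e α).1 (e β).1 with h | h | h
    · exact hswap α β (case2 α β h)
    · obtain ⟨⟨i, b⟩, rfl⟩ := e.symm.surjective α
      obtain ⟨⟨j, b'⟩, rfl⟩ := e.symm.surjective β
      simp only [Equiv.apply_symm_apply] at h
      subst h
      cases b <;> cases b'
      · simp
      · exact hswap _ _ (case1 i)
      · exact case1 i
      · simp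
    · exact case2 β α h)
  refine ⟨Φ, fun α t => Z α t + D α t, fun α => ?_, ⟨B + (2 * n + 2 + B), fun α t => ?_⟩, h1, h2,
    fun p hp => h3 p fun α => ?_, fun α t ht => ?_, fun α t ht => ?_⟩
  · have := hW α
    have := hZ α
    fun_prop
  · exact (norm_add_le _ _).trans (add_le_add (hB α t) (hDB α t))
  · simp only [D, hφ0 p.2 hp]; simp
  · simp only [D, hφ0 t ht]; simp
  · simp only [D, hφ1 t ht]
    simp [W]

/-- The union of strands over the heights from `-H` to `H`. -/
def strandUnion {A : Type*} (H : ℝ) (Z : A → ℝ → ℂ) : Set R3 :=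
  {p | -H ≤ p.2 ∧ p.2 ≤ H ∧ ∃ α, p.1 = Z α p.2}

theorem image_strandUnion {A : Type*} {H : ℝ} {Z Z' : A → ℝ → ℂ} {Φ : R3 ≃ₜ R3}
    (h : ∀ α t, Φ (Z α t, t) = (Z' α t, t)) : Φ '' strandUnion H Z = strandUnion H Z' := by
  ext p
  constructor
  · rintro ⟨⟨z, t⟩, ⟨h1, h2, α, h3⟩, rfl⟩
    simp only at h1 h2 h3
    subst h3
    rw [h]
    exact ⟨h1, h2, α, rfl⟩
  · rintro ⟨h1, h2, α, h3⟩
    exact ⟨(Z α p.2, p.2), ⟨h1, h2, α, rfl⟩, by rw [h, ← h3]⟩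

/-- The position of a foot of a cap. -/
def footPosition (n : ℕ) (q : Fin n × Bool) : Fin (2 * n) :=
  ⟨2 * q.1 + (if q.2 then 1 else 0), by
    have := q.1.2
    split_ifs <;> omega⟩

theorem footPosition_bijective (n : ℕ) : Function.Bijective (footPosition n) := by
  rw [Fintype.bijective_iff_injective_and_card]
  refine ⟨?_, by simp [mul_comm]⟩
  rintro ⟨i, b⟩ ⟨j, b'⟩ h
  simp only [footPosition, Fin.mk.injEq] at h
  have : i = j := by
    ext
    split_ifs at h <;> omega
  subst this
  cases b <;> cases b' <;> simp at h ⊢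

theorem capPoint_half {n : ℕ} (q : Fin n × Bool) :
    capPoint (1 / 2) q = ((footPosition n q : ℕ) : ℂ) := by
  obtain ⟨i, b⟩ := q
  cases b
  · simp [capPoint, footPosition, letterSign]
  · simp [capPoint, footPosition, letterSign]; ring

theorem legWidth_self (l : ℝ) : legWidth l l = 1 / 2 := by
  rw [legWidth, sub_self, max_self, show (1 / 4 - 0 ^ 2 : ℝ) = (1 / 2) ^ 2 by norm_num,
    Real.sqrt_sq (by norm_num)]

/-- A union of strands that meet in pairs at the top and at the bottom is isotopic to a plat. -/
theorem exists_word_of_topOrdered {n : ℕ} (hn : 1 ≤ n) {A : Type*} [Fintype A] {H : ℝ} (hH : 1 < H)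
    (Z : A → ℝ → ℂ) (hZ : ∀ α, Continuous (Z α)) {B : ℝ} (hB : ∀ α t, ‖Z α t‖ ≤ B)
    (hinj : ∀ t, -H < t → t < H → Function.Injective fun α => Z α t)
    (e e' : A ≃ Fin n × Bool) (htop : TopOrdered H Z e)
    (hbot : TopOrdered H (fun α t => Z α (-t)) e') :
    ∃ w : BraidWord (2 * n), Isotopic (strandUnion H Z) (platSet w) := by
  obtain ⟨Φ, Z₁, c1, ⟨B₁, b1⟩, i1, l1, d1, f1, s1⟩ := exists_homeo_standardTop hn Z hZ hB e htop
  have hbot' : TopOrdered H (fun α t => Z₁ α (-t)) e' := by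
    obtain ⟨c, hc, C, h⟩ := hbot
    refine ⟨c, hc, C, fun t ht => ?_⟩
    have := h t ht
    simp only [f1 _ (-t) (by linarith)]
    exact this
  obtain ⟨Ψ, Z₂, c2, -, i2, l2, d2, f2, s2⟩ := exists_homeo_standardTop hn (fun α t => Z₁ α (-t))
    (fun α => (c1 α).comp continuous_neg) (fun α t => b1 α (-t)) e' hbot'
  -- The lower ends are standardized by conjugating the upper construction with the reflection.
  let Ψ' : R3 ≃ₜ R3 := reflect.trans (Ψ.trans reflect)
  let Z₃ : A → ℝ → ℂ := fun α t => Z₂ α (-t)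
  have hΨ' : ∀ p : R3, Ψ' p = ((Ψ (p.1, -p.2)).1, -(Ψ (p.1, -p.2)).2) := fun p => rfl
  have i3 : ∀ α t, Ψ' (Z₁ α t, t) = (Z₃ α t, t) := by
    intro α t
    have := i2 α (-t)
    simp only [neg_neg] at this
    rw [hΨ', this]
    simp [Z₃]
  have k1 : Isotopic (strandUnion H Z) (strandUnion H Z₁) := by
    rw [← image_strandUnion i1]
    exact isotopic_of_eq_on_halfSpace Φ 1 (H - 1) (by norm_num)
      (fun p hp => d1 p (by linarith)) _
  have k2 : Isotopic (strandUnion H Z₁) (strandUnion H Z₃) := by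
    rw [← image_strandUnion i3]
    refine isotopic_of_eq_on_halfSpace Ψ' (-1) (H - 1) (by norm_num) (fun p hp => ?_) _
    rw [hΨ', d2 _ (by simp only; linarith)]
    simp
  set T := H - 1 / 2 with hT
  have top3 : ∀ α t, T ≤ t → Z₃ α t = capPoint (legWidth T t) (e α) := by
    intro α t ht
    simp only [Z₃]
    rw [f2 _ _ (by linarith), neg_neg, s1 _ _ ht]
  have bot3 : ∀ α t, t ≤ -T → Z₃ α t = capPoint (legWidth T (-t)) (e' α) := by
    intro α t ht
    simp only [Z₃]
    rw [s2 _ _ (by linarith)]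
  have hclosure : strandUnion H Z₃ = strandClosure n T Z₃ := by
    ext p
    have hw : ∀ t, T ≤ t → legWidth T t = √(1 / 4 - (t - T) ^ 2) := by
      intro t ht
      rw [legWidth, max_eq_left (by linarith)]
    constructor
    · rintro ⟨h1, h2, α, h3⟩
      rcases le_or_gt T p.2 with ht | ht
      · left
        refine mem_caps_iff.2 ⟨e α, by simp only; linarith, by simp only; linarith, ?_⟩
        simp only
        rw [h3, top3 _ _ ht, hw _ ht]
      rcases le_or_gt p.2 (-T) with ht' | ht'
      · right; right
        refine mem_caps_iff.2 ⟨e' α, by simp only; linarith, by simp only; linarith, ?_⟩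
        simp only
        rw [h3, bot3 _ _ ht', hw _ (by linarith), show -T - p.2 = -p.2 - T by ring]
      · exact Or.inr (Or.inl ⟨ht'.le, ht.le, α, h3⟩)
    · rintro (h | ⟨h1, h2, h3⟩ | h)
      · obtain ⟨q, a1, a2, a3⟩ := mem_caps_iff.1 h
        simp only at a1 a2 a3
        refine ⟨by linarith, by linarith, e.symm q, ?_⟩
        rw [top3 _ _ (by linarith), hw _ (by linarith), a3, Equiv.apply_symm_apply]
      · exact ⟨by linarith, by linarith, h3⟩
      · obtain ⟨q, a1, a2, a3⟩ := mem_caps_iff.1 h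
        simp only at a1 a2 a3
        refine ⟨by linarith, by linarith, e'.symm q, ?_⟩
        rw [bot3 _ _ (by linarith), hw _ (by linarith), a3, Equiv.apply_symm_apply,
          show -T - p.2 = -p.2 - T by ring]
  let f : Fin n × Bool ≃ Fin (2 * n) := Equiv.ofBijective _ (footPosition_bijective n)
  let g : Fin (2 * n) ≃ A := f.symm.trans e'.symm
  have hcl' : strandClosure n T Z₃ = strandClosure n T fun q => Z₃ (g q) := by
    ext p
    refine or_congr Iff.rfl (or_congr (and_congr Iff.rfl (and_congr Iff.rfl ?_)) Iff.rfl)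
    exact g.surjective.exists (p := fun q => p.1 = Z₃ q p.2)
  obtain ⟨w, hw⟩ := exists_word_of_strands hn (T := T) (by linarith) (fun q => Z₃ (g q))
    (fun q => (c2 _).comp continuous_neg) (by
      intro t h1 h2 q q' h
      apply g.injective
      have h' : Z₃ (g q) t = Z₃ (g q') t := h
      have e1 : Ψ' (Z₁ (g q) t, t) = Ψ' (Z₁ (g q') t, t) := by rw [i3, i3, h']
      have e2 := congrArg Prod.fst (Ψ'.injective e1)
      simp only at e2
      have e3 : Φ (Z (g q) t, t) = Φ (Z (g q') t, t) := by rw [i1, i1, e2]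
      have e4 := congrArg Prod.fst (Φ.injective e3)
      exact hinj t (by linarith) (by linarith) e4)
    (g.trans (e'.trans f)) (g.trans (e.trans f)) (fun q => by
      rw [bot3 _ _ le_rfl, neg_neg, legWidth_self, capPoint_half]; rfl)
    (fun q => by rw [top3 _ _ le_rfl, legWidth_self, capPoint_half]; rfl)
  refine ⟨w, k1.trans (k2.trans ?_)⟩
  rw [hclosure, hcl']
  exact hw

/-! ### Vertical displacement -/

/-- A compact set may be displaced vertically by any amount that depends only on the projection to
the horizontal plane. -/
theorem isotopic_of_vertical {X : Type*} [TopologicalSpace X] [CompactSpace X] (ζ : X → ℂ)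
    (h k : X → ℝ) (hζ : Continuous ζ) (hh : Continuous h) (hk : Continuous k)
    (hc : ∀ x y, ζ x = ζ y → k x - h x = k y - h y) :
    Isotopic (Set.range fun x => ((ζ x, h x) : R3)) (Set.range fun x => ((ζ x, k x) : R3)) := by
  -- The change of height descends to the compact image of `ζ`; Tietze's theorem extends it to the
  -- plane, and the isotopy is the corresponding vertical shear.
  let f : C(X, Set.range ζ) := ⟨fun x => ⟨ζ x, x, rfl⟩, by fun_prop⟩
  have hq : Topology.IsQuotientMap f :=
    f.continuous.isClosedMap.isQuotientMap f.continuous (by rintro ⟨_, x, rfl⟩; exact ⟨x, rfl⟩)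
  let κ : C(X, ℝ) := ⟨fun x => k x - h x, hk.sub hh⟩
  have hfac : Function.FactorsThrough κ f := fun x y hxy => hc x y (congrArg Subtype.val hxy)
  let κ' : C(Set.range ζ, ℝ) := hq.lift κ hfac
  have hκ' : ∀ x, κ' (f x) = k x - h x := fun x => by
    have := hq.lift_comp κ hfac
    exact DFunLike.congr_fun this x
  obtain ⟨g, hg⟩ := κ'.exists_restrict_eq (isCompact_range hζ).isClosed
  have hg' : ∀ x, g (ζ x) = k x - h x := by
    intro x
    rw [← hκ' x, ← hg]; rfl
  have := isotopic_of_family (fun s p => (p.1, p.2 + s * g p.1)) (fun s p => (p.1, p.2 - s * g p.1))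
    (by fun_prop) (by fun_prop) (fun s p => by simp) (fun s p => by simp) (fun p => by simp)
    (Set.range fun x => ((ζ x, h x) : R3))
  convert this using 1
  ext p
  constructor
  · rintro ⟨x, rfl⟩
    exact ⟨_, ⟨x, rfl⟩, by simp [hg']⟩
  · rintro ⟨_, ⟨x, rfl⟩, rfl⟩
    exact ⟨x, by simp [hg']⟩

/-! ### Systems of monotone arcs -/

/-- The arcs `ζ α`, parametrized by the unit interval, end in pairs at the parameter `1`: the tip of
an arc is its only point in its vertical line, distinct tips have distinct real parts, and
the two arcs at a tip leave it to the right and to the left. -/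
structure EndsInPairs {A T : Type} (ζ : A → ℝ → ℂ) (e : A → T × Bool) : Prop where
  bijective : Function.Bijective e
  meets : ∀ α β, (e α).1 = (e β).1 → ζ α 1 = ζ β 1
  isolated : ∀ α β, ∀ y ∈ Set.Icc (0 : ℝ) 1, ζ α 1 = ζ β y → y = 1 ∧ (e α).1 = (e β).1
  distinct : ∀ α β, (ζ α 1).re = (ζ β 1).re → (e α).1 = (e β).1
  slope : ∃ c > 0, ∃ δ > 0, ∀ α x y, 1 - δ ≤ x → x ≤ y → y ≤ 1 →
    c * (y - x) ≤ letterSign (e α).2 * ((ζ α x).re - (ζ α y).re)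

/-- Finitely many arcs in three-space with increasing heights, embedded except that they meet in
pairs at their ends. -/
structure ArcSystem (A T B : Type) where
  ζ : A → ℝ → ℂ
  h : A → ℝ → ℝ
  top : A → T × Bool
  bot : A → B × Bool
  continuous_ζ : ∀ α, Continuous (ζ α)
  continuous_h : ∀ α, Continuous (h α)
  lipschitz : ∃ C : ℝ, ∀ α, ∀ x ∈ Set.Icc (0 : ℝ) 1, ∀ y ∈ Set.Icc (0 : ℝ) 1,
    ‖ζ α x - ζ α y‖ ≤ C * |x - y|
  strictMono : ∀ α, StrictMonoOn (h α) (Set.Icc 0 1)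
  top_ends : EndsInPairs ζ top
  bot_ends : EndsInPairs (fun α x => ζ α (1 - x)) bot
  top_height : ∀ α β, (top α).1 = (top β).1 → h α 1 = h β 1
  bot_height : ∀ α β, (bot α).1 = (bot β).1 → h α 0 = h β 0
  embedded : ∀ α β, ∀ x ∈ Set.Icc (0 : ℝ) 1, ∀ y ∈ Set.Icc (0 : ℝ) 1, ζ α x = ζ β y →
    h α x = h β y → (α = β ∧ x = y) ∨ (x = 1 ∧ y = 1 ∧ (top α).1 = (top β).1) ∨
      (x = 0 ∧ y = 0 ∧ (bot α).1 = (bot β).1)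

/-- The union of the arcs of a system. -/
def ArcSystem.carrier {A T B : Type} (S : ArcSystem A T B) : Set R3 :=
  {p | ∃ α, ∃ x ∈ Set.Icc (0 : ℝ) 1, p = (S.ζ α x, S.h α x)}

theorem exists_pos_forall_le {ι : Type*} [Finite ι] {P : ι → ℝ → Prop}
    (hmono : ∀ i a b, a ≤ b → P i b → P i a) (h : ∀ i, ∃ a > 0, P i a) : ∃ a > 0, ∀ i, P i a := by
  choose f h0 h1 using h
  rcases isEmpty_or_nonempty ι with h | h
  · exact ⟨1, one_pos, fun i => h.elim i⟩
  · obtain ⟨j, hj⟩ := Finite.exists_min f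
    exact ⟨f j, h0 j, fun i => hmono i _ _ (hj i) (h1 i)⟩

/-- Near the tips the projections of the arcs meet only at the tips. Compactness keeps a tip away
from all arcs other than the end parts of its own two; there the real part is strictly monotone
along each arc, and the two arcs lie on opposite sides. -/
theorem EndsInPairs.exists_nhds {A T : Type} [Finite A] {ζ : A → ℝ → ℂ} {e : A → T × Bool}
    (h : EndsInPairs ζ e) (hζ : ∀ α, Continuous (ζ α)) :
    ∃ δ > 0, δ ≤ 1 / 2 ∧ ∀ α β, ∀ x ∈ Set.Icc (1 - δ) 1, ∀ y ∈ Set.Icc (0 : ℝ) 1,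
      ζ α x = ζ β y → (α = β ∧ x = y) ∨ (x = 1 ∧ y = 1 ∧ (e α).1 = (e β).1) := by
  obtain ⟨c, hc, δ₀, hδ₀, hs⟩ := h.slope
  have away : ∀ p : A × A, ∃ δ > 0, ∀ x ∈ Set.Icc (1 - δ) 1, ∀ y ∈ Set.Icc (0 : ℝ) 1,
      ((e p.1).1 = (e p.2).1 → y ≤ 1 - δ₀) → ζ p.1 x ≠ ζ p.2 y := by
    rintro ⟨α, β⟩
    simp only
    set Y := {y ∈ Set.Icc (0 : ℝ) 1 | (e α).1 = (e β).1 → y ≤ 1 - δ₀} with hY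
    have hYc : IsCompact Y := by
      by_cases hab : (e α).1 = (e β).1
      · have : Y = Set.Icc 0 1 ∩ Set.Iic (1 - δ₀) := by ext y; simp [hY, hab]
        rw [this]
        exact isCompact_Icc.inter_right isClosed_Iic
      · have : Y = Set.Icc 0 1 := by ext y; simp [hY, hab]
        rw [this]
        exact isCompact_Icc
    have hclosed : IsClosed (ζ β '' Y) := (hYc.image (hζ β)).isClosed
    have hmem : ζ α 1 ∈ (ζ β '' Y)ᶜ := by
      rintro ⟨y, ⟨hy, hy'⟩, hyy⟩
      obtain ⟨h1, h2⟩ := h.isolated α β y hy hyy.symm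
      have := hy' h2
      linarith
    obtain ⟨δ, hδ, hball⟩ := Metric.isOpen_iff.1 (hclosed.isOpen_compl.preimage (hζ α)) 1 hmem
    refine ⟨δ / 2, by positivity, fun x hx y hy hy' hxy => ?_⟩
    have : x ∈ Metric.ball (1 : ℝ) δ := by
      rw [Metric.mem_ball, Real.dist_eq, abs_lt]
      constructor <;> linarith [hx.1, hx.2]
    exact hball this ⟨y, ⟨hy, hy'⟩, hxy.symm⟩
  obtain ⟨δ, hδ, hd⟩ := exists_pos_forall_le (fun p a b hab hb x hx =>
    hb x ⟨by linarith [hx.1], hx.2⟩) away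
  refine ⟨min (min δ δ₀) (1 / 2), by positivity, min_le_right _ _, fun α β x hx y hy hxy => ?_⟩
  have hle : min (min δ δ₀) (1 / 2) ≤ δ := (min_le_left _ _).trans (min_le_left _ _)
  have hle₀ : min (min δ δ₀) (1 / 2) ≤ δ₀ := (min_le_left _ _).trans (min_le_right _ _)
  have hx' : 1 - δ₀ ≤ x := by linarith [hx.1]
  have hno := hd (α, β) x ⟨by linarith [hx.1], hx.2⟩ y hy
  have hab : (e α).1 = (e β).1 ∧ 1 - δ₀ < y := by
    by_contra hcon
    refine hno (fun h1 => ?_) hxy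
    by_contra h2
    exact hcon ⟨h1, not_le.1 h2⟩
  have hre := congrArg Complex.re hxy
  by_cases hb : (e α).2 = (e β).2
  · left
    obtain rfl : α = β := h.bijective.1 (Prod.ext hab.1 hb)
    refine ⟨rfl, ?_⟩
    rcases le_total x y with hle | hle
    · have := hs α x y hx' hle hy.2
      rw [hre, sub_self, mul_zero] at this
      nlinarith
    · have := hs α y x hab.2.le hle hx.2
      rw [hre, sub_self, mul_zero] at this
      nlinarith
  · right
    have s1 := hs α x 1 hx' hx.2 le_rfl
    have s2 := hs β y 1 hab.2.le hy.2 le_rfl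
    -- The arcs leave the tip in opposite horizontal directions, so equal real parts force both
    -- parameters to be `1`.
    have hsign : letterSign (e β).2 = -letterSign (e α).2 := by
      revert hb
      cases (e α).2 <;> cases (e β).2 <;> simp [letterSign]
    rw [hsign, ← hre, ← h.meets α β hab.1] at s2
    have h1 : c * (1 - x) + c * (1 - y) ≤ 0 := by linarith
    have hx1 : x = 1 := by nlinarith [hx.2, hy.2]
    have hy1 : y = 1 := by nlinarith [hx.2, hy.2]
    exact ⟨hx1, hy1, hab.1⟩

/-- Labels of the tips in the order of their real parts. -/
theorem EndsInPairs.exists_sorted {A T : Type} [Fintype A] [Fintype T] {n : ℕ}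
    (hn : Fintype.card T = n) {ζ : A → ℝ → ℂ} {e : A → T × Bool} (h : EndsInPairs ζ e) :
    ∃ E : A ≃ Fin n × Bool, (∀ α, (E α).2 = (e α).2) ∧
      (∀ α β, (E α).1 = (E β).1 ↔ (e α).1 = (e β).1) ∧
      ∀ α β, (E α).1 < (E β).1 → (ζ α 1).re < (ζ β 1).re := by
  let e' : A ≃ T × Bool := Equiv.ofBijective e h.bijective
  let f : T → ℝ := fun t => (ζ (e'.symm (t, true)) 1).re
  have he' : ∀ q, e (e'.symm q) = q := fun q => e'.apply_symm_apply q
  have hf : Function.Injective f := by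
    intro s t hst
    have := h.distinct _ _ hst
    simpa [he'] using this
  let _ : LinearOrder T := LinearOrder.lift' f hf
  let o : Fin n ≃o T := Fintype.orderIsoFinOfCardEq T hn
  refine ⟨e'.trans (Equiv.prodCongr o.symm.toEquiv (Equiv.refl Bool)), fun α => rfl,
    fun α β => o.symm.injective.eq_iff, fun α β hlt => ?_⟩
  have h1 : (e α).1 < (e β).1 := o.symm.lt_iff_lt.1 hlt
  have h2 : f (e α).1 < f (e β).1 := h1
  have h3 : ∀ α, f (e α).1 = (ζ α 1).re := by
    intro α
    simp only [f]
    rw [h.meets (e'.symm ((e α).1, true)) α (by rw [he'])]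
  rwa [h3, h3] at h2

/-- Horizontal distances near a tip are linear in the arc parameter. A parabolic height makes `1 -
x` proportional to `√(H - t)`, which is the rate required of a cap. -/
theorem EndsInPairs.topOrdered {A T : Type} [Fintype A] [Fintype T] {n : ℕ}
    (hn : Fintype.card T = n) {ζ : A → ℝ → ℂ} {e : A → T × Bool} (h : EndsInPairs ζ e)
    {C : ℝ} (hC : ∀ α, ∀ x ∈ Set.Icc (0 : ℝ) 1, ∀ y ∈ Set.Icc (0 : ℝ) 1,
      ‖ζ α x - ζ α y‖ ≤ C * |x - y|) :
    ∃ E : A ≃ Fin n × Bool, ∃ r > 0, ∀ (L H : ℝ) (Z : A → ℝ → ℂ), 0 < L → 1 / √L ≤ r →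
      (∀ α t, H - 1 ≤ t → Z α t = ζ α (1 - √(H - t) / √L)) → TopOrdered H Z E := by
  obtain ⟨E, hE1, hE2, hE3⟩ := h.exists_sorted hn
  obtain ⟨c, hc, δ, hδ, hs⟩ := h.slope
  obtain ⟨g, hg, hgap⟩ := exists_pos_forall_le (ι := A × A)
    (P := fun p g => (E p.1).1 < (E p.2).1 → g ≤ (ζ p.2 1).re - (ζ p.1 1).re)
    (fun p a b hab hb hlt => hab.trans (hb hlt)) (fun p => by
      by_cases hlt : (E p.1).1 < (E p.2).1
      · exact ⟨_, sub_pos.2 (hE3 _ _ hlt), fun _ => le_rfl⟩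
      · exact ⟨1, one_pos, fun h' => absurd h' hlt⟩)
  -- The last bound keeps each point within a quarter of the gap `g` from its tip, so different tips
  -- remain ordered with a gap of at least `g / 2`.
  refine ⟨E, min (min δ 1) (g / (4 * (|C| + 1))), by positivity, fun L H Z hL hr hZ => ?_⟩
  have hsL : 0 < √L := Real.sqrt_pos.2 hL
  refine ⟨min (2 * c / √L) (g / 2), by positivity, 2 * |C| / √L, fun t ht => ?_⟩
  set x : ℝ := 1 - √(H - t) / √L with hx
  have hq0 : 0 ≤ √(H - t) := Real.sqrt_nonneg _
  have hq1 : √(H - t) ≤ 1 := by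
    exact Real.sqrt_le_iff.2 ⟨zero_le_one, by linarith⟩
  have h1x : 1 - x = √(H - t) / √L := by rw [hx]; ring
  have hxr : 1 - x ≤ min (min δ 1) (g / (4 * (|C| + 1))) := by
    rw [h1x]
    exact (div_le_div_of_nonneg_right hq1 hsL.le).trans hr
  have hx1 : x ≤ 1 := by
    have : 0 ≤ √(H - t) / √L := by positivity
    linarith
  have hxδ : 1 - δ ≤ x := by
    have := hxr.trans ((min_le_left _ _).trans (min_le_left _ _)); linarith
  have hx0 : 0 ≤ x := by
    have := hxr.trans ((min_le_left _ _).trans (min_le_right _ _)); linarith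
  have hxg : (1 - x) * (4 * (|C| + 1)) ≤ g := by
    have := hxr.trans (min_le_right _ _)
    rwa [le_div_iff₀ (by positivity)] at this
  have hnear : ∀ α, ‖ζ α x - ζ α 1‖ ≤ |C| * (1 - x) := by
    intro α
    refine (hC α x ⟨hx0, hx1⟩ 1 ⟨zero_le_one, le_rfl⟩).trans ?_
    rw [abs_sub_comm, abs_of_nonneg (by linarith : 0 ≤ 1 - x)]
    exact mul_le_mul_of_nonneg_right (le_abs_self C) (by linarith)
  simp only [hZ _ t ht]
  refine ⟨fun i => ?_, fun α β hlt => ?_⟩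
  · set α := E.symm (i, true) with hα
    set β := E.symm (i, false) with hβ
    have eα : E α = (i, true) := E.apply_symm_apply _
    have eβ : E β = (i, false) := E.apply_symm_apply _
    have htip : ζ α 1 = ζ β 1 := h.meets α β ((hE2 α β).1 (by rw [eα, eβ]))
    have s1 := hs α x 1 hxδ hx1 le_rfl
    have s2 := hs β x 1 hxδ hx1 le_rfl
    rw [← hE1, eα] at s1
    rw [← hE1, eβ] at s2
    simp only [letterSign, if_true] at s1 s2
    rw [htip] at s1
    constructor
    · refine (mul_le_mul_of_nonneg_right (min_le_left _ _) hq0).trans ?_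
      have : 2 * c / √L * √(H - t) = 2 * c * (1 - x) := by rw [h1x]; ring
      rw [this, Complex.sub_re]
      simp at s2
      linarith
    · have e1 : ζ α x - ζ β x = (ζ α x - ζ α 1) - (ζ β x - ζ β 1) := by rw [htip]; ring
      have e2 : 2 * |C| / √L * √(H - t) = |C| * (1 - x) + |C| * (1 - x) := by rw [h1x]; ring
      rw [e1, e2]
      exact (norm_sub_le _ _).trans (add_le_add (hnear α) (hnear β))
  · have h1 := hgap (α, β) hlt
    simp only at h1
    have a1 := (abs_le.1 ((Complex.abs_re_le_norm _).trans (hnear α))).2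
    have a2 := (abs_le.1 ((Complex.abs_re_le_norm _).trans (hnear β))).1
    rw [Complex.sub_re] at a1 a2
    refine (min_le_right _ _).trans ?_
    rw [Complex.sub_re]
    nlinarith

/-! ### Plats from systems of arcs -/

/-- The odd square function. -/
def oddSquare (x : ℝ) : ℝ := x * |x|

@[fun_prop]
theorem continuous_oddSquare : Continuous oddSquare := by unfold oddSquare; fun_prop

theorem oddSquare_of_nonneg {x : ℝ} (h : 0 ≤ x) : oddSquare x = x ^ 2 := by
  rw [oddSquare, abs_of_nonneg h, sq]

theorem oddSquare_of_nonpos {x : ℝ} (h : x ≤ 0) : oddSquare x = -x ^ 2 := by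
  rw [oddSquare, abs_of_nonpos h]; ring

theorem strictMono_oddSquare : StrictMono oddSquare := by
  intro x y hxy
  rcases le_total 0 x with hx | hx
  · rw [oddSquare_of_nonneg hx, oddSquare_of_nonneg (hx.trans hxy.le)]
    nlinarith
  · rw [oddSquare_of_nonpos hx]
    rcases le_total 0 y with hy | hy
    · rw [oddSquare_of_nonneg hy]
      rcases hx.eq_or_lt with h | h
      · nlinarith
      · nlinarith
    · rw [oddSquare_of_nonpos hy]
      nlinarith

/-! ### Parabolic ends of height functions -/

/-- The height function `a` on the unit interval, with steep parabolic ends that go up to `H` and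
down to `-H`, extended to the real line. -/
def peakHeight (a : ℝ → ℝ) (H L x : ℝ) : ℝ :=
  min (max (a (clamp x)) (H - L * oddSquare (1 - x))) (-H + L * oddSquare x)

theorem monotone_clamp : Monotone clamp := fun _ _ h => max_le_max le_rfl (min_le_min le_rfl h)

section peak

variable {a : ℝ → ℝ} {M H L : ℝ}

theorem continuous_peakHeight (ha : Continuous a) : Continuous (peakHeight a H L) := by
  unfold peakHeight; fun_prop

theorem peakHeight_upper (hM : ∀ x ∈ Set.Icc (0 : ℝ) 1, |a x| ≤ M) (hH : H = M + 2)
    (hL : 4 * H ≤ L) {x : ℝ} (hx : 1 / 2 ≤ x) (hx' : H - 1 ≤ H - L * oddSquare (1 - x)) :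
    peakHeight a H L x = H - L * oddSquare (1 - x) := by
  have hM0 : 0 ≤ M := (abs_nonneg _).trans (hM 0 (by simp))
  have h1 := (abs_le.1 (hM _ (clamp_mem x))).2
  rw [peakHeight, max_eq_right (by linarith), min_eq_left]
  rcases le_total x 1 with h | h
  · rw [oddSquare_of_nonneg (by linarith), oddSquare_of_nonneg (by linarith)]
    nlinarith [sq_nonneg (2 * x - 1)]
  · rw [oddSquare_of_nonpos (by linarith), oddSquare_of_nonneg (by linarith)]
    nlinarith

theorem peakHeight_lower (hM : ∀ x ∈ Set.Icc (0 : ℝ) 1, |a x| ≤ M) (hH : H = M + 2)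
    {x : ℝ} (hx' : -H + L * oddSquare x ≤ -H + 1) :
    peakHeight a H L x = -H + L * oddSquare x := by
  have h1 := (abs_le.1 (hM _ (clamp_mem x))).1
  rw [peakHeight, min_eq_right]
  exact le_max_of_le_left (by linarith)

theorem peakHeight_middle (hM : ∀ x ∈ Set.Icc (0 : ℝ) 1, |a x| ≤ M) (hH : H = M + 2) {δ : ℝ}
    (hδ : 0 ≤ δ) (hLδ : 2 * H ≤ L * δ ^ 2) (hL0 : 0 ≤ L) {x : ℝ} (h0 : δ ≤ x) (h1 : x ≤ 1 - δ) :
    peakHeight a H L x = a x := by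
  have hx : clamp x = x := clamp_of_mem (by linarith) (by linarith)
  obtain ⟨b1, b2⟩ := abs_le.1 (hM x ⟨by linarith, by linarith⟩)
  have e1 : L * δ ^ 2 ≤ L * (1 - x) ^ 2 :=
    mul_le_mul_of_nonneg_left (by nlinarith) hL0
  have e2 : L * δ ^ 2 ≤ L * x ^ 2 := mul_le_mul_of_nonneg_left (by nlinarith) hL0
  rw [peakHeight, hx, oddSquare_of_nonneg (by linarith), oddSquare_of_nonneg (by linarith),
    max_eq_left (by linarith), min_eq_left (by linarith)]

/-- The parabolic branches are strictly monotone on the whole line. Where the truncated function `a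
∘ clamp` is constant, one of these branches is the active one. -/
theorem strictMono_peakHeight (hM : ∀ x ∈ Set.Icc (0 : ℝ) 1, |a x| ≤ M) (hH : H = M + 2)
    (hL : 4 * H ≤ L) (hmono : StrictMonoOn a (Set.Icc 0 1)) : StrictMono (peakHeight a H L) := by
  have hM0 : 0 ≤ M := (abs_nonneg _).trans (hM 0 (by simp))
  have hL0 : 0 < L := by linarith
  intro x y hxy
  have hd : -H + L * oddSquare x < -H + L * oddSquare y := by
    have := mul_lt_mul_of_pos_left (strictMono_oddSquare hxy) hL0
    linarith
  have hb : H - L * oddSquare (1 - x) < H - L * oddSquare (1 - y) := by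
    have := mul_lt_mul_of_pos_left (strictMono_oddSquare (by linarith : 1 - y < 1 - x)) hL0
    linarith
  refine lt_min ?_ ((min_le_right _ _).trans_lt hd)
  rcases (monotone_clamp hxy.le).eq_or_lt with he | hlt
  · rcases le_or_gt y 0 with hy | hy
    · refine (min_le_right _ _).trans_lt (lt_of_lt_of_le ?_ (le_max_left _ _))
      have h1 := (abs_le.1 (hM _ (clamp_mem y))).1
      have h2 : oddSquare y ≤ 0 := by rw [oddSquare_of_nonpos hy]; nlinarith
      have := mul_le_mul_of_nonneg_left h2 hL0.le
      linarith
    · have hx1 : 1 ≤ x := by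
        by_contra hcon
        push Not at hcon
        have h1 : clamp x < clamp y := by
          unfold clamp
          rw [min_eq_right hcon.le]
          refine max_lt (lt_max_of_lt_right (lt_min one_pos hy)) (lt_max_of_lt_right (lt_min hcon hxy))
        exact h1.ne he
      refine (min_le_left _ _).trans_lt ?_
      have h1 := (abs_le.1 (hM _ (clamp_mem x))).2
      have h2 : oddSquare (1 - x) ≤ 0 := by rw [oddSquare_of_nonpos (by linarith)]; nlinarith
      have := mul_le_mul_of_nonneg_left h2 hL0.le
      rw [max_eq_right (by linarith)]
      exact lt_max_of_lt_right hb
  · refine (min_le_left _ _).trans_lt ?_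
    exact max_lt_max (hmono (clamp_mem x) (clamp_mem y) hlt) hb

theorem peakHeight_sqrt_upper (hM : ∀ x ∈ Set.Icc (0 : ℝ) 1, |a x| ≤ M) (hH : H = M + 2)
    (hL : 4 * H ≤ L) {t : ℝ} (h1 : H - 1 ≤ t) (h2 : t ≤ H) :
    peakHeight a H L (1 - √(H - t) / √L) = t := by
  have hM0 : 0 ≤ M := (abs_nonneg _).trans (hM 0 (by simp))
  have hL0 : 0 < L := by linarith
  have hsL : 0 < √L := Real.sqrt_pos.2 hL0
  have hq : 0 ≤ √(H - t) / √L := by positivity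
  have hval : L * oddSquare (1 - (1 - √(H - t) / √L)) = H - t := by
    rw [show 1 - (1 - √(H - t) / √L) = √(H - t) / √L by ring, oddSquare_of_nonneg hq, div_pow,
      Real.sq_sqrt (by linarith), Real.sq_sqrt hL0.le]
    field_simp
  rw [peakHeight_upper hM hH hL, hval]
  · ring
  · have : √(H - t) / √L ≤ 1 / 2 := by
      rw [div_le_iff₀ hsL]
      have h3 : √(H - t) ≤ 1 := Real.sqrt_le_iff.2 ⟨zero_le_one, by linarith⟩
      have h4 : 2 ≤ √L := Real.le_sqrt_of_sq_le (by linarith)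
      linarith
    linarith
  · rw [hval]; linarith

theorem peakHeight_sqrt_lower (hM : ∀ x ∈ Set.Icc (0 : ℝ) 1, |a x| ≤ M) (hH : H = M + 2)
    (hL : 4 * H ≤ L) {t : ℝ} (h1 : H - 1 ≤ t) (h2 : t ≤ H) :
    peakHeight a H L (√(H - t) / √L) = -t := by
  have hM0 : 0 ≤ M := (abs_nonneg _).trans (hM 0 (by simp))
  have hL0 : 0 < L := by linarith
  have hq : 0 ≤ √(H - t) / √L := by positivity
  have hval : L * oddSquare (√(H - t) / √L) = H - t := by
    rw [oddSquare_of_nonneg hq, div_pow, Real.sq_sqrt (by linarith), Real.sq_sqrt hL0.le]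
    field_simp
  rw [peakHeight_lower hM hH, hval]
  · ring
  · rw [hval]; linarith

theorem peakHeight_one (hM : ∀ x ∈ Set.Icc (0 : ℝ) 1, |a x| ≤ M) (hH : H = M + 2)
    (hL : 4 * H ≤ L) : peakHeight a H L 1 = H := by
  have := peakHeight_sqrt_upper hM hH hL (t := H) (by linarith) le_rfl
  simpa using this

theorem peakHeight_zero (hM : ∀ x ∈ Set.Icc (0 : ℝ) 1, |a x| ≤ M) (hH : H = M + 2)
    (hL : 4 * H ≤ L) : peakHeight a H L 0 = -H := by
  have := peakHeight_sqrt_lower hM hH hL (t := H) (by linarith) le_rfl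
  simpa using this

/-- Expresses the arc parameter as a continuous function of the height, so that an arc becomes a
strand; the explicit square roots at both ends are the input of `EndsInPairs.topOrdered`. -/
theorem exists_peak_inverse (hM : ∀ x ∈ Set.Icc (0 : ℝ) 1, |a x| ≤ M) (hH : H = M + 2)
    (hL : 4 * H ≤ L) (ha : Continuous a) (hmono : StrictMonoOn a (Set.Icc 0 1)) :
    ∃ X : ℝ → ℝ, Continuous X ∧ (∀ t, X t ∈ Set.Icc (0 : ℝ) 1) ∧
      (∀ t, -H ≤ t → t ≤ H → peakHeight a H L (X t) = t) ∧
      (∀ x ∈ Set.Icc (0 : ℝ) 1, X (peakHeight a H L x) = x) ∧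
      (∀ t, H - 1 ≤ t → X t = 1 - √(H - t) / √L) ∧
      (∀ t, H - 1 ≤ t → X (-t) = √(H - t) / √L) := by
  have hM0 : 0 ≤ M := (abs_nonneg _).trans (hM 0 (by simp))
  have hsm := strictMono_peakHeight hM hH hL hmono
  have hcont := continuous_peakHeight (H := H) (L := L) ha
  have h0 := peakHeight_zero hM hH hL
  have h1 := peakHeight_one hM hH hL
  have hmaps : ∀ x ∈ Set.Icc (0 : ℝ) 1, peakHeight a H L x ∈ Set.Icc (-H) H := fun x hx =>
    ⟨h0.ge.trans (hsm.monotone hx.1), (hsm.monotone hx.2).trans h1.le⟩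
  let f : Set.Icc (0 : ℝ) 1 → Set.Icc (-H) H := fun x => ⟨_, hmaps x x.2⟩
  have hf : StrictMono f := fun x y hxy => hsm hxy
  have hsurj : Function.Surjective f := by
    rintro ⟨t, ht⟩
    have := intermediate_value_Icc zero_le_one hcont.continuousOn
    rw [h0, h1] at this
    obtain ⟨x, hx, hxt⟩ := this ht
    exact ⟨⟨x, hx⟩, Subtype.ext hxt⟩
  let o : Set.Icc (0 : ℝ) 1 ≃o Set.Icc (-H) H := hf.orderIsoOfSurjective f hsurj
  have hle : -H ≤ H := by linarith
  let X : ℝ → ℝ := fun t => o.symm (Set.projIcc (-H) H hle t)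
  have hX1 : ∀ t, -H ≤ t → t ≤ H → peakHeight a H L (X t) = t := by
    intro t h1 h2
    have : o (o.symm (Set.projIcc (-H) H hle t)) = Set.projIcc (-H) H hle t := o.apply_symm_apply _
    have h3 := congrArg Subtype.val this
    rw [Set.projIcc_of_mem hle ⟨h1, h2⟩] at h3
    simp only [X]
    rw [Set.projIcc_of_mem hle ⟨h1, h2⟩]
    exact h3
  have hXmem : ∀ t, X t ∈ Set.Icc (0 : ℝ) 1 := fun t => Subtype.prop _
  have hXtop : ∀ t, H ≤ t → X t = X H := by
    intro t ht
    simp only [X]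
    rw [Set.projIcc_of_right_le hle ht, Set.projIcc_right]
  have hXbot : ∀ t, t ≤ -H → X t = X (-H) := by
    intro t ht
    simp only [X]
    rw [Set.projIcc_of_le_left hle ht, Set.projIcc_left]
  refine ⟨X, ?_, hXmem, hX1, fun x hx => ?_, fun t ht => ?_, fun t ht => ?_⟩
  · exact continuous_subtype_val.comp (o.symm.continuous.comp continuous_projIcc)
  · exact hsm.injective (hX1 _ (hmaps x hx).1 (hmaps x hx).2)
  · rcases le_total t H with h | h
    · apply hsm.injective
      rw [hX1 t (by linarith) h, peakHeight_sqrt_upper hM hH hL ht h]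
    · rw [hXtop t h, Real.sqrt_eq_zero_of_nonpos (by linarith : H - t ≤ 0)]
      apply hsm.injective
      rw [hX1 H hle le_rfl]
      simpa using h1.symm
  · rcases le_total t H with h | h
    · apply hsm.injective
      rw [hX1 (-t) (by linarith) (by linarith), peakHeight_sqrt_lower hM hH hL ht h]
    · rw [hXbot (-t) (by linarith), Real.sqrt_eq_zero_of_nonpos (by linarith : H - t ≤ 0)]
      apply hsm.injective
      rw [hX1 (-H) le_rfl hle]
      simpa using h0.symm

end peak

/-- The union of a system of arcs is isotopic to a plat. -/
theorem ArcSystem.exists_word {A T B : Type} [Fintype A] [Fintype T] [Fintype B] {n : ℕ}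
    (hn : 1 ≤ n) (hT : Fintype.card T = n) (hB : Fintype.card B = n) (S : ArcSystem A T B) :
    ∃ w : BraidWord (2 * n), Isotopic S.carrier (platSet w) := by
  obtain ⟨C, hC⟩ := S.lipschitz
  obtain ⟨E, r, hr, hE⟩ := S.top_ends.topOrdered hT hC
  obtain ⟨E', r', hr', hE'⟩ := S.bot_ends.topOrdered hB (C := C) (fun α x hx y hy => by
    have := hC α (1 - x) ⟨by linarith [hx.2], by linarith [hx.1]⟩ (1 - y)
      ⟨by linarith [hy.2], by linarith [hy.1]⟩
    rwa [show 1 - x - (1 - y) = -(x - y) by ring, abs_neg] at this)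
  obtain ⟨δ₁, hδ₁, hδ₁', iso₁⟩ := S.top_ends.exists_nhds S.continuous_ζ
  obtain ⟨δ₂, hδ₂, hδ₂', iso₂⟩ := S.bot_ends.exists_nhds fun α =>
    (S.continuous_ζ α).comp (by fun_prop)
  have hbd : ∃ M : ℝ, ∀ α, ∀ x ∈ Set.Icc (0 : ℝ) 1, |S.h α x| ≤ M := by
    have h1 : ∀ α, ∃ M : ℝ, ∀ x ∈ Set.Icc (0 : ℝ) 1, |S.h α x| ≤ M := fun α => by
      obtain ⟨M, hM⟩ := isCompact_Icc.exists_bound_of_continuousOn (s := Set.Icc (0 : ℝ) 1)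
        (S.continuous_h α).continuousOn
      exact ⟨M, hM⟩
    choose M hM using h1
    exact ⟨∑ α, |M α|, fun α x hx => (hM α x hx).trans ((le_abs_self _).trans
      (Finset.single_le_sum (f := fun α => |M α|) (fun α _ => abs_nonneg _) (Finset.mem_univ α)))⟩
  have hbdζ : ∃ M : ℝ, ∀ α, ∀ x ∈ Set.Icc (0 : ℝ) 1, ‖S.ζ α x‖ ≤ M := by
    have h1 : ∀ α, ∃ M : ℝ, ∀ x ∈ Set.Icc (0 : ℝ) 1, ‖S.ζ α x‖ ≤ M := fun α =>
      isCompact_Icc.exists_bound_of_continuousOn (S.continuous_ζ α).continuousOn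
    choose M hM using h1
    exact ⟨∑ α, |M α|, fun α x hx => (hM α x hx).trans ((le_abs_self _).trans
      (Finset.single_le_sum (f := fun α => |M α|) (fun α _ => abs_nonneg _) (Finset.mem_univ α)))⟩
  obtain ⟨M₀, hM₀⟩ := hbd
  obtain ⟨Mζ, hMζ⟩ := hbdζ
  set M : ℝ := |M₀| with hMdef
  have hM : ∀ α, ∀ x ∈ Set.Icc (0 : ℝ) 1, |S.h α x| ≤ M := fun α x hx =>
    (hM₀ α x hx).trans (le_abs_self _)
  have hM0 : 0 ≤ M := abs_nonneg _
  set H : ℝ := M + 2 with hH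
  set δ := min δ₁ δ₂ with hδ
  have hδ0 : 0 < δ := lt_min hδ₁ hδ₂
  set ρ := min (min r r') δ with hρ
  have hρ0 : 0 < ρ := lt_min (lt_min hr hr') hδ0
  -- So steep that the heights change only within `δ` of the ends and that the last unit of height
  -- uses parameters within `r` and `r'` of the tips.
  set L : ℝ := 4 * H + (2 * H + 1) / ρ ^ 2 with hLdef
  have hL : 4 * H ≤ L := by
    have : 0 ≤ (2 * H + 1) / ρ ^ 2 := by positivity
    linarith
  have hL0 : 0 < L := by linarith
  have hLρ : 2 * H + 1 ≤ L * ρ ^ 2 := by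
    have h1 : (2 * H + 1) / ρ ^ 2 * ρ ^ 2 = 2 * H + 1 := by field_simp
    have h2 : 0 ≤ 4 * H * ρ ^ 2 := by positivity
    rw [hLdef, add_mul, h1]; linarith
  have hLδ : 2 * H ≤ L * δ ^ 2 := by
    have h1 : ρ ≤ δ := min_le_right _ _
    have h2 : L * ρ ^ 2 ≤ L * δ ^ 2 := mul_le_mul_of_nonneg_left (by nlinarith) hL0.le
    linarith
  have hsρ : 1 / √L ≤ ρ := by
    rw [div_le_iff₀ (Real.sqrt_pos.2 hL0)]
    have h1 : 1 ≤ √(L * ρ ^ 2) := Real.le_sqrt_of_sq_le (by linarith)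
    rwa [Real.sqrt_mul hL0.le, Real.sqrt_sq hρ0.le, mul_comm] at h1
  choose X hXc hXm hX1 hX2 hX3 hX4 using fun α =>
    exists_peak_inverse (hM α) hH hL (S.continuous_h α) (S.strictMono α)
  let g : A → ℝ → ℝ := fun α => peakHeight (S.h α) H L
  have hg1 : ∀ α, g α 1 = H := fun α => peakHeight_one (hM α) hH hL
  have hg0 : ∀ α, g α 0 = -H := fun α => peakHeight_zero (hM α) hH hL
  -- The change of height depends only on the projection: away from the ends it is zero, and near
  -- them distinct points with the same projection are the two ends at a tip, which are moved to the
  -- same height.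
  have hκ : ∀ α β, ∀ x ∈ Set.Icc (0 : ℝ) 1, ∀ y ∈ Set.Icc (0 : ℝ) 1, S.ζ α x = S.ζ β y →
      g α x - S.h α x = g β y - S.h β y := by
    have near : ∀ α β, ∀ x ∈ Set.Icc (0 : ℝ) 1, ∀ y ∈ Set.Icc (0 : ℝ) 1, S.ζ α x = S.ζ β y →
        ¬(δ ≤ x ∧ x ≤ 1 - δ) → g α x - S.h α x = g β y - S.h β y := by
      intro α β x hx y hy hxy hnot
      rcases le_or_gt x (1 - δ) with h1 | h1
      · have h2 : x < δ := by
          by_contra hcon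
          exact hnot ⟨not_lt.1 hcon, h1⟩
        rcases iso₂ α β (1 - x) ⟨by linarith [min_le_right δ₁ δ₂], by linarith [hx.1]⟩ (1 - y)
          ⟨by linarith [hy.2], by linarith [hy.1]⟩ (by simpa using hxy) with ⟨h3, h4⟩ | ⟨h3, h4, h5⟩
        · have : x = y := by linarith
          rw [h3, this]
        · have e1 : x = 0 := by linarith
          have e2 : y = 0 := by linarith
          rw [e1, e2, hg0, hg0, S.bot_height α β h5]
      · rcases iso₁ α β x ⟨by linarith [min_le_left δ₁ δ₂], hx.2⟩ y hy hxy with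
          ⟨h3, h4⟩ | ⟨h3, h4, h5⟩
        · rw [h3, h4]
        · rw [h3, h4, hg1, hg1, S.top_height α β h5]
    have mid : ∀ α x, δ ≤ x ∧ x ≤ 1 - δ → g α x = S.h α x := fun α x hx =>
      peakHeight_middle (hM α) hH hδ0.le hLδ hL0.le hx.1 hx.2
    intro α β x hx y hy hxy
    by_cases h1 : δ ≤ x ∧ x ≤ 1 - δ
    · by_cases h2 : δ ≤ y ∧ y ≤ 1 - δ
      · rw [mid α x h1, mid β y h2, sub_self, sub_self]
      · exact (near β α y hy x hx hxy.symm h2).symm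
    · exact near α β x hx y hy hxy h1
  let Z : A → ℝ → ℂ := fun α t => S.ζ α (X α t)
  have hiso : Isotopic S.carrier (strandUnion H Z) := by
    let _ : TopologicalSpace A := ⊥
    have : DiscreteTopology A := ⟨rfl⟩
    have hc : ∀ f : A → ℝ → ℝ, (∀ α, Continuous (f α)) →
        Continuous fun p : A × unitInterval => f p.1 p.2 := fun f hf =>
      continuous_prod_of_discrete_left.2 fun α => (hf α).comp continuous_subtype_val
    have hc' : Continuous fun p : A × unitInterval => S.ζ p.1 p.2 :=
      continuous_prod_of_discrete_left.2 fun α => (S.continuous_ζ α).comp continuous_subtype_val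
    have := isotopic_of_vertical (fun p : A × unitInterval => S.ζ p.1 p.2)
      (fun p => S.h p.1 p.2) (fun p => g p.1 p.2) hc' (hc _ S.continuous_h)
      (hc _ fun α => continuous_peakHeight (S.continuous_h α))
      (fun p q h => hκ p.1 q.1 p.2 p.2.2 q.2 q.2.2 h)
    convert this using 1
    · ext p
      constructor
      · rintro ⟨α, x, hx, rfl⟩
        exact ⟨(α, ⟨x, hx⟩), rfl⟩
      · rintro ⟨⟨α, x⟩, rfl⟩
        exact ⟨α, x, x.2, rfl⟩
    · ext p
      constructor
      · rintro ⟨h1, h2, α, h3⟩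
        exact ⟨(α, ⟨X α p.2, hXm α p.2⟩), Prod.ext h3.symm (hX1 α p.2 h1 h2)⟩
      · rintro ⟨⟨α, x⟩, rfl⟩
        have hsm := strictMono_peakHeight (hM α) hH hL (S.strictMono α)
        refine ⟨?_, ?_, α, ?_⟩
        · rw [← hg0 α]; exact hsm.monotone x.2.1
        · rw [← hg1 α]; exact hsm.monotone x.2.2
        · simp only [Z, g]
          rw [hX2 α x x.2]
  obtain ⟨w, hw⟩ := exists_word_of_topOrdered hn (H := H) (by linarith) Z
    (fun α => (S.continuous_ζ α).comp (hXc α)) (fun α t => hMζ α _ (hXm α t)) (by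
      intro t h1 h2 α β hab
      have hab' : S.ζ α (X α t) = S.ζ β (X β t) := hab
      have h3 := hκ α β _ (hXm α t) _ (hXm β t) hab'
      have e1 : g α (X α t) = t := hX1 α t h1.le h2.le
      have e2 : g β (X β t) = t := hX1 β t h1.le h2.le
      rcases S.embedded α β _ (hXm α t) _ (hXm β t) hab' (by linarith) with
        ⟨h, -⟩ | ⟨h, -, -⟩ | ⟨h, -, -⟩
      · exact h
      · rw [h, hg1] at e1; linarith
      · rw [h, hg0] at e1; linarith)
    E E' (hE L H Z hL0 (hsρ.trans ((min_le_left _ _).trans (min_le_left _ _)))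
      fun α t ht => by simp only [Z, hX3 α t ht])
    (hE' L H _ hL0 (hsρ.trans ((min_le_left _ _).trans (min_le_right _ _)))
      fun α t ht => by simp only [Z, hX4 α t ht, sub_sub_cancel])
  exact ⟨w, hiso.trans hw⟩

/-! ### Stabilization of systems of arcs -/

open Classical in
/-- The parameter intervals of the arcs of a subdivided system: the arc `α₀` is divided at `x₁` and
`x₂` into three parts, the middle one of which is run through backwards. -/
def splitPar {A : Type} (α₀ : A) (x₁ x₂ : ℝ) : A ⊕ Bool → ℝ → ℝ
  | Sum.inl α, x => x * (if α = α₀ then x₁ else 1)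
  | Sum.inr b, x => x₂ + x * ((if b then 1 else x₁) - x₂)

/-- The arc of which an arc of a subdivided system is a part. -/
def splitArc {A : Type} (α₀ : A) : A ⊕ Bool → A := Sum.elim id fun _ => α₀

open Classical in
/-- The labels at the upper ends of the arcs of a subdivided system. -/
def splitTop {A T : Type} (top : A → T × Bool) (α₀ : A) : A ⊕ Bool → Option T × Bool
  | Sum.inl α => if α = α₀ then (none, (top α₀).2) else (some (top α).1, (top α).2)
  | Sum.inr b => if b then (some (top α₀).1, (top α₀).2) else (none, !(top α₀).2)

/-- The labels at the lower ends of the arcs of a subdivided system. -/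
def splitBot {A T B : Type} (top : A → T × Bool) (bot : A → B × Bool) (α₀ : A) :
    A ⊕ Bool → Option B × Bool
  | Sum.inl α => (some (bot α).1, (bot α).2)
  | Sum.inr b => (none, if b then !(top α₀).2 else (top α₀).2)

section split

variable {A T B : Type} {α₀ : A} {x₁ x₂ : ℝ}

theorem splitPar_inl (α : A) (h : α ≠ α₀) (x : ℝ) : splitPar α₀ x₁ x₂ (Sum.inl α) x = x := by
  simp [splitPar, h]

theorem splitPar_inl_self (x : ℝ) : splitPar α₀ x₁ x₂ (Sum.inl α₀) x = x * x₁ := by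
  simp [splitPar]

theorem splitPar_inr_true (x : ℝ) :
    splitPar α₀ x₁ x₂ (Sum.inr true) x = x₂ + x * (1 - x₂) := by simp [splitPar]

theorem splitPar_inr_false (x : ℝ) :
    splitPar α₀ x₁ x₂ (Sum.inr false) x = x₂ + x * (x₁ - x₂) := by simp [splitPar]

/-- Case distinction for the arcs of a subdivided system. -/
theorem split_cases {P : A ⊕ Bool → Prop} (h1 : ∀ α, α ≠ α₀ → P (Sum.inl α))
    (h2 : P (Sum.inl α₀)) (h3 : P (Sum.inr false)) (h4 : P (Sum.inr true)) (a : A ⊕ Bool) : P a := by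
  rcases a with α | b
  · by_cases h : α = α₀
    · exact h ▸ h2
    · exact h1 α h
  · cases b
    · exact h3
    · exact h4

theorem continuous_splitPar (a : A ⊕ Bool) : Continuous (splitPar α₀ x₁ x₂ a) := by
  rcases a with α | b <;> unfold splitPar <;> fun_prop

theorem splitPar_mem (h0 : 0 < x₁) (h12 : x₁ < x₂) (h2 : x₂ < 1) (a : A ⊕ Bool) {x : ℝ}
    (hx : x ∈ Set.Icc (0 : ℝ) 1) : splitPar α₀ x₁ x₂ a x ∈ Set.Icc (0 : ℝ) 1 := by
  obtain ⟨ha, hb⟩ := hx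
  refine split_cases (α₀ := α₀) (P := fun a => splitPar α₀ x₁ x₂ a x ∈ Set.Icc (0 : ℝ) 1)
    (fun α h => ?_) ?_ ?_ ?_ a
  · rw [splitPar_inl α h]; exact ⟨ha, hb⟩
  · rw [splitPar_inl_self]; constructor <;> nlinarith
  · rw [splitPar_inr_false]; constructor <;> nlinarith
  · rw [splitPar_inr_true]; constructor <;> nlinarith

theorem splitPar_inr_ge (h12 : x₁ < x₂) (h2 : x₂ < 1) (b : Bool) {x : ℝ}
    (hx : x ∈ Set.Icc (0 : ℝ) 1) : x₁ ≤ splitPar α₀ x₁ x₂ (Sum.inr b) x := by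
  obtain ⟨ha, hb⟩ := hx
  cases b
  · rw [splitPar_inr_false]; nlinarith
  · rw [splitPar_inr_true]; nlinarith

/-- Two points of a subdivided system with the same image. -/
theorem split_eq (h0 : 0 < x₁) (h12 : x₁ < x₂) (h2 : x₂ < 1) {a b : A ⊕ Bool} {x y : ℝ}
    (hx : x ∈ Set.Icc (0 : ℝ) 1) (hy : y ∈ Set.Icc (0 : ℝ) 1) (hab : splitArc α₀ a = splitArc α₀ b)
    (hxy : splitPar α₀ x₁ x₂ a x = splitPar α₀ x₁ x₂ b y) :
    (a = b ∧ x = y) ∨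
    (x = 1 ∧ y = 1 ∧ (a = Sum.inl α₀ ∨ a = Sum.inr false) ∧ (b = Sum.inl α₀ ∨ b = Sum.inr false)) ∨
    (x = 0 ∧ y = 0 ∧ (∃ c, a = Sum.inr c) ∧ ∃ c, b = Sum.inr c) := by
  obtain ⟨x0, x1⟩ := hx
  obtain ⟨y0, y1⟩ := hy
  have key : ∀ (x y : ℝ), 0 ≤ x → x ≤ 1 → 0 ≤ y → y ≤ 1 → ∀ {c : Bool},
      x * x₁ = splitPar α₀ x₁ x₂ (Sum.inr c) y → x = 1 ∧ y = 1 ∧ c = false := by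
    intro x y x0 x1 y0 y1 c h
    cases c
    · rw [splitPar_inr_false] at h
      have : y = 1 := by nlinarith
      subst this
      exact ⟨by nlinarith, rfl, rfl⟩
    · rw [splitPar_inr_true] at h
      nlinarith
  rcases a with α | c <;> rcases b with β | d
  · have : α = β := hab
    subst this
    by_cases h : α = α₀
    · subst h
      rw [splitPar_inl_self, splitPar_inl_self] at hxy
      exact Or.inl ⟨rfl, mul_right_cancel₀ h0.ne' hxy⟩
    · rw [splitPar_inl α h, splitPar_inl α h] at hxy
      exact Or.inl ⟨rfl, hxy⟩
  · have : α = α₀ := hab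
    subst this
    rw [splitPar_inl_self] at hxy
    obtain ⟨h1, h2, h3⟩ := key x y x0 x1 y0 y1 hxy
    exact Or.inr (Or.inl ⟨h1, h2, Or.inl rfl, Or.inr (by rw [h3])⟩)
  · have : α₀ = β := hab
    subst this
    rw [splitPar_inl_self] at hxy
    obtain ⟨h1, h2, h3⟩ := key y x y0 y1 x0 x1 hxy.symm
    exact Or.inr (Or.inl ⟨h2, h1, Or.inr (by rw [h3]), Or.inl rfl⟩)
  · cases c <;> cases d
    · rw [splitPar_inr_false, splitPar_inr_false] at hxy
      exact Or.inl ⟨rfl, mul_right_cancel₀ (sub_ne_zero.2 h12.ne) (by linarith)⟩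
    · rw [splitPar_inr_false, splitPar_inr_true] at hxy
      have hx0 : x = 0 := by nlinarith
      have hy0 : y = 0 := by nlinarith
      exact Or.inr (Or.inr ⟨hx0, hy0, ⟨_, rfl⟩, ⟨_, rfl⟩⟩)
    · rw [splitPar_inr_false, splitPar_inr_true] at hxy
      have hx0 : x = 0 := by nlinarith
      have hy0 : y = 0 := by nlinarith
      exact Or.inr (Or.inr ⟨hx0, hy0, ⟨_, rfl⟩, ⟨_, rfl⟩⟩)
    · rw [splitPar_inr_true, splitPar_inr_true] at hxy
      exact Or.inl ⟨rfl, mul_right_cancel₀ (by linarith : 1 - x₂ ≠ 0) (by linarith)⟩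

theorem splitTop_some {top : A → T × Bool} {a : A ⊕ Bool} {t : T}
    (h : (splitTop top α₀ a).1 = some t) :
    (top (splitArc α₀ a)).1 = t ∧ splitPar α₀ x₁ x₂ a 1 = 1 := by
  revert h
  refine split_cases (α₀ := α₀) (P := fun a => (splitTop top α₀ a).1 = some t →
    (top (splitArc α₀ a)).1 = t ∧ splitPar α₀ x₁ x₂ a 1 = 1) (fun α h => ?_) ?_ ?_ ?_ a
  · simp [splitTop, h, splitArc, splitPar]
  · simp [splitTop]
  · simp [splitTop]
  · simp [splitTop, splitArc, splitPar]

theorem splitTop_none {top : A → T × Bool} {a : A ⊕ Bool} :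
    (splitTop top α₀ a).1 = none ↔ (a = Sum.inl α₀ ∨ a = Sum.inr false) := by
  refine split_cases (α₀ := α₀) (P := fun a => (splitTop top α₀ a).1 = none ↔
    (a = Sum.inl α₀ ∨ a = Sum.inr false)) (fun α h => ?_) ?_ ?_ ?_ a
  · simp [splitTop, h]
  · simp [splitTop]
  · simp [splitTop]
  · simp [splitTop]

theorem splitTop_of_eq_one (h0 : 0 < x₁) (h12 : x₁ < x₂) (h2 : x₂ < 1) {top : A → T × Bool}
    {a : A ⊕ Bool} {y : ℝ}
    (hy : y ∈ Set.Icc (0 : ℝ) 1) (h : splitPar α₀ x₁ x₂ a y = 1) :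
    y = 1 ∧ (splitTop top α₀ a).1 = some (top (splitArc α₀ a)).1 := by
  obtain ⟨y0, y1⟩ := hy
  revert h
  refine split_cases (α₀ := α₀) (P := fun a => splitPar α₀ x₁ x₂ a y = 1 →
    y = 1 ∧ (splitTop top α₀ a).1 = some (top (splitArc α₀ a)).1) (fun α h => ?_) ?_ ?_ ?_ a
  · rw [splitPar_inl α h]
    simp [splitTop, h, splitArc]
  · rw [splitPar_inl_self]
    intro h
    have := mul_le_mul_of_nonneg_right y1 h0.le
    linarith
  · rw [splitPar_inr_false]
    intro h; nlinarith
  · rw [splitPar_inr_true]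
    intro h
    refine ⟨by nlinarith, ?_⟩
    simp [splitTop, splitArc]

theorem splitTop_bijective [Fintype A] [Fintype T] {top : A → T × Bool}
    (h : Function.Bijective top) : Function.Bijective (splitTop top α₀) := by
  rw [Fintype.bijective_iff_injective_and_card]
  constructor
  · have hc : ∀ {α}, α ≠ α₀ → top α ≠ top α₀ := fun hne h' => hne (h.1 h')
    intro a b
    refine split_cases (α₀ := α₀) (P := fun a => splitTop top α₀ a = splitTop top α₀ b → a = b)
      (fun α hα => ?_) ?_ ?_ ?_ a
    all_goals
      refine split_cases (α₀ := α₀) (P := fun b => splitTop top α₀ _ = splitTop top α₀ b → _ = b)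
        (fun β hβ => ?_) ?_ ?_ ?_ b
    · simp only [splitTop, hα, hβ, if_false, Prod.mk.injEq, Option.some.injEq, Sum.inl.injEq]
      exact fun hh => h.1 (Prod.ext hh.1 hh.2)
    · simp [splitTop, hα]
    · simp [splitTop, hα]
    · simp only [splitTop, hα, if_false, if_true, Prod.mk.injEq, Option.some.injEq]
      exact fun hh => absurd (Prod.ext hh.1 hh.2) (hc hα)
    · simp [splitTop, hβ]
    · simp
    · simp [splitTop]
    · simp [splitTop]
    · simp [splitTop, hβ]
    · simp [splitTop]
    · simp
    · simp [splitTop]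
    · simp only [splitTop, hβ, if_false, if_true, Prod.mk.injEq, Option.some.injEq]
      exact fun hh => absurd (Prod.ext hh.1.symm hh.2.symm) (hc hβ)
    · simp [splitTop]
    · simp [splitTop]
    · simp
  · have := Fintype.card_of_bijective h
    simp only [Fintype.card_prod, Fintype.card_bool] at this
    simp [this]; ring

theorem splitBot_bijective [Fintype A] [Fintype B] {top : A → T × Bool} {bot : A → B × Bool}
    (h : Function.Bijective bot) : Function.Bijective (splitBot top bot α₀) := by
  rw [Fintype.bijective_iff_injective_and_card]
  constructor
  · rintro (α | c) (β | d)
    · simp only [splitBot, Prod.mk.injEq, Option.some.injEq, Sum.inl.injEq]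
      exact fun hh => h.1 (Prod.ext hh.1 hh.2)
    · simp [splitBot]
    · simp [splitBot]
    · cases c <;> cases d <;> simp [splitBot]
  · have := Fintype.card_of_bijective h
    simp only [Fintype.card_prod, Fintype.card_bool] at this
    simp [this]; ring

end split

/-- The heights of a subdivided system. -/
def splitHeight {A : Type} (h : A → ℝ → ℝ) (α₀ : A) (x₁ x₂ : ℝ) (a : A ⊕ Bool) (x : ℝ) : ℝ :=
  match a with
  | Sum.inl α => h α (splitPar α₀ x₁ x₂ (Sum.inl α) x)
  -- The new minimum, at the parameter `x₂`, is placed one unit below the new maximum at `x₁`.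
  | Sum.inr b => h α₀ x₁ - 1 + x * ((if b then h α₀ 1 else h α₀ x₁) - (h α₀ x₁ - 1))

theorem splitHeight_one {A : Type} (h : A → ℝ → ℝ) (α₀ : A) (x₁ x₂ : ℝ) (a : A ⊕ Bool) :
    splitHeight h α₀ x₁ x₂ a 1 = h (splitArc α₀ a) (splitPar α₀ x₁ x₂ a 1) := by
  rcases a with α | b
  · rfl
  · cases b <;> simp [splitHeight, splitArc, splitPar]

/-- Every system of arcs is isotopic to one with an additional maximum and minimum. -/
theorem ArcSystem.exists_stabilization {A T B : Type} [Fintype A] [Fintype T] [Fintype B]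
    [Nonempty A] (S : ArcSystem A T B) :
    ∃ S' : ArcSystem (A ⊕ Bool) (Option T) (Option B), Isotopic S.carrier S'.carrier := by
  let α₀ : A := Classical.arbitrary A
  obtain ⟨δ₁, hδ₁, hδ₁', iso₁⟩ := S.top_ends.exists_nhds S.continuous_ζ
  obtain ⟨c, hc, δ₂, hδ₂, hslope⟩ := S.top_ends.slope
  obtain ⟨c', hc', δ₃, hδ₃, hslope'⟩ := S.bot_ends.slope
  -- Both division points are taken in this end part of `α₀`, where no other part of the system has
  -- the same projection and the real part is strictly monotone. The arc can therefore be bent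
  -- vertically there.
  set δ := min δ₁ δ₂ with hδ
  have hδ0 : 0 < δ := lt_min hδ₁ hδ₂
  have hδh : δ ≤ 1 / 2 := (min_le_left _ _).trans hδ₁'
  have iso : ∀ β, ∀ x ∈ Set.Icc (1 - δ) 1, ∀ y ∈ Set.Icc (0 : ℝ) 1, S.ζ α₀ x = S.ζ β y →
      (α₀ = β ∧ x = y) ∨ (x = 1 ∧ y = 1 ∧ (S.top α₀).1 = (S.top β).1) := fun β x hx =>
    iso₁ α₀ β x ⟨by linarith [hx.1, min_le_left δ₁ δ₂], hx.2⟩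
  have slope : ∀ x y, 1 - δ ≤ x → x ≤ y → y ≤ 1 →
      c * (y - x) ≤ letterSign (S.top α₀).2 * ((S.ζ α₀ x).re - (S.ζ α₀ y).re) := fun x y hx =>
    hslope α₀ x y (by linarith [min_le_right δ₁ δ₂])
  -- the new tips avoid the real parts of the old ones
  obtain ⟨x₁, x₂, hx₁, h12, h2, hF₁, hF₂⟩ : ∃ x₁ x₂, 1 - δ < x₁ ∧ x₁ < x₂ ∧ x₂ < 1 ∧
      (∀ β, (S.ζ α₀ x₁).re ≠ (S.ζ β 1).re) ∧ ∀ β, (S.ζ α₀ x₂).re ≠ (S.ζ β 0).re := by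
    have hinj : Set.InjOn (fun x => (S.ζ α₀ x).re) (Set.Ioo (1 - δ) 1) := by
      intro x hx y hy hxy
      simp only at hxy
      rcases le_total x y with h | h
      · have := slope x y hx.1.le h hy.2.le
        rw [hxy, sub_self, mul_zero] at this
        nlinarith
      · have := slope y x hy.1.le h hx.2.le
        rw [hxy, sub_self, mul_zero] at this
        nlinarith
    have pick : ∀ (a : ℝ) (F : Set ℝ), 1 - δ ≤ a → a < 1 → F.Finite →
        ∃ x, a < x ∧ x < 1 ∧ (S.ζ α₀ x).re ∉ F := by
      intro a F ha ha1 hF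
      have h1 : ((fun x => (S.ζ α₀ x).re) '' Set.Ioo a 1).Infinite :=
        (Set.Ioo_infinite ha1).image (hinj.mono (Set.Ioo_subset_Ioo_left ha))
      obtain ⟨_, ⟨x, hx, rfl⟩, hxF⟩ := h1.exists_notMem_finite hF
      exact ⟨x, hx.1, hx.2, hxF⟩
    obtain ⟨x₁, a1, a2, a3⟩ := pick (1 - δ) (Set.range fun β => (S.ζ β 1).re) le_rfl (by linarith)
      (Set.finite_range _)
    obtain ⟨x₂, b1, b2, b3⟩ := pick x₁ (Set.range fun β => (S.ζ β 0).re) a1.le a2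
      (Set.finite_range _)
    exact ⟨x₁, x₂, a1, b1, b2, fun β h => a3 ⟨β, h.symm⟩, fun β h => b3 ⟨β, h.symm⟩⟩
  have h0 : 0 < x₁ := by linarith
  let par := splitPar α₀ x₁ x₂
  let ζ' : A ⊕ Bool → ℝ → ℂ := fun a x => S.ζ (splitArc α₀ a) (par a x)
  let h' := splitHeight S.h α₀ x₁ x₂
  have hpar : ∀ a, ∀ x ∈ Set.Icc (0 : ℝ) 1, par a x ∈ Set.Icc (0 : ℝ) 1 := fun a x hx =>
    splitPar_mem h0 h12 h2 a hx
  have hcζ : ∀ a, Continuous (ζ' a) := fun a => (S.continuous_ζ _).comp (continuous_splitPar a)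
  have hch : ∀ a, Continuous (h' a) := by
    rintro (α | b)
    · exact (S.continuous_h _).comp (continuous_splitPar _)
    · exact (by fun_prop : Continuous fun x : ℝ => S.h α₀ x₁ - 1 +
        x * ((if b then S.h α₀ 1 else S.h α₀ x₁) - (S.h α₀ x₁ - 1)))
  -- the change of height depends only on the projection
  have hκ : ∀ a b, ∀ x ∈ Set.Icc (0 : ℝ) 1, ∀ y ∈ Set.Icc (0 : ℝ) 1, ζ' a x = ζ' b y →
      h' a x - S.h (splitArc α₀ a) (par a x) = h' b y - S.h (splitArc α₀ b) (par b y) := by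
    -- The heights are changed only on the parts after `x₁`, where coinciding projections come from
    -- the same point of `α₀` or from its old tip, whose height is kept.
    have key : ∀ c b, ∀ x ∈ Set.Icc (0 : ℝ) 1, ∀ y ∈ Set.Icc (0 : ℝ) 1, ζ' (Sum.inr c) x = ζ' b y →
        h' (Sum.inr c) x - S.h (splitArc α₀ (Sum.inr c)) (par (Sum.inr c) x) =
          h' b y - S.h (splitArc α₀ b) (par b y) := by
      intro c b x hx y hy hxy
      have hge := splitPar_inr_ge (α₀ := α₀) h12 h2 c hx
      rcases iso _ _ ⟨by linarith, (hpar _ _ hx).2⟩ _ (hpar b y hy) hxy with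
        ⟨e1, e2⟩ | ⟨e1, e2, e3⟩
      · rcases split_eq (α₀ := α₀) (a := Sum.inr c) (b := b) h0 h12 h2 hx hy e1 e2 with
          ⟨rfl, rfl⟩ | ⟨rfl, rfl, -, -⟩ |
          ⟨rfl, rfl, -, ⟨d, rfl⟩⟩
        · rfl
        · simp only [h', splitHeight_one]
          simp [par]
        · have : par (Sum.inr c) 0 = par (Sum.inr d) 0 := e2
          rw [this]
          simp [h', splitHeight, splitArc]
      · obtain ⟨rfl, -⟩ := splitTop_of_eq_one (top := S.top) h0 h12 h2 hx e1
        obtain ⟨rfl, -⟩ := splitTop_of_eq_one (top := S.top) h0 h12 h2 hy e2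
        simp only [h', splitHeight_one]
        simp [par]
    rintro (α | c) b x hx y hy hxy
    · rcases b with β | d
      · simp [h', splitHeight, splitArc, par]
      · exact (key d _ y hy x hx hxy.symm).symm
    · exact key c b x hx y hy hxy
  have hlt1 : S.h α₀ x₁ < S.h α₀ 1 :=
    S.strictMono α₀ ⟨h0.le, by linarith⟩ ⟨zero_le_one, le_rfl⟩ (by linarith)
  let S' : ArcSystem (A ⊕ Bool) (Option T) (Option B) :=
    { ζ := ζ'
      h := h'
      top := splitTop S.top α₀
      bot := splitBot S.top S.bot α₀
      continuous_ζ := hcζ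
      continuous_h := hch
      lipschitz := by
        obtain ⟨C, hC⟩ := S.lipschitz
        refine ⟨|C|, fun a x hx y hy => ?_⟩
        refine (hC _ _ (hpar a x hx) _ (hpar a y hy)).trans ?_
        refine (mul_le_mul_of_nonneg_right (le_abs_self C) (abs_nonneg _)).trans ?_
        refine mul_le_mul_of_nonneg_left ?_ (abs_nonneg C)
        have hlin : ∃ k : ℝ, |k| ≤ 1 ∧ par a x - par a y = k * (x - y) := by
          refine split_cases (α₀ := α₀) (P := fun a => ∃ k : ℝ, |k| ≤ 1 ∧
            par a x - par a y = k * (x - y)) (fun α h => ?_) ?_ ?_ ?_ a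
          · exact ⟨1, by simp, by simp only [par, splitPar_inl α h]; ring⟩
          · exact ⟨x₁, by rw [abs_of_pos h0]; linarith, by simp only [par, splitPar_inl_self]; ring⟩
          · exact ⟨x₁ - x₂, by rw [abs_of_neg (by linarith)]; linarith,
              by simp only [par, splitPar_inr_false]; ring⟩
          · exact ⟨1 - x₂, by rw [abs_of_pos (by linarith)]; linarith,
              by simp only [par, splitPar_inr_true]; ring⟩
        obtain ⟨k, hk, hkk⟩ := hlin
        rw [hkk, abs_mul]
        exact mul_le_of_le_one_left (abs_nonneg _) hk
      strictMono := by
        intro a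
        refine split_cases (α₀ := α₀) (P := fun a => StrictMonoOn (h' a) (Set.Icc 0 1))
          (fun α h => ?_) ?_ ?_ ?_ a
        · intro x hx y hy hxy
          simp only [h', splitHeight, splitPar_inl α h]
          exact S.strictMono α hx hy hxy
        · intro x hx y hy hxy
          refine S.strictMono α₀ (hpar (Sum.inl α₀) x hx) (hpar (Sum.inl α₀) y hy) ?_
          simp only [par, splitPar_inl_self]
          exact mul_lt_mul_of_pos_right hxy h0
        · intro x hx y hy hxy
          simp only [h', splitHeight]
          norm_num
          linarith
        · intro x hx y hy hxy
          simp only [h', splitHeight, if_true]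
          nlinarith
      top_ends := by
        refine ⟨splitTop_bijective S.top_ends.bijective, fun a b hab => ?_, fun a b y hy hab => ?_,
          fun a b hab => ?_, ?_⟩
        · cases hb : (splitTop S.top α₀ b).1 with
          | none =>
            rw [hb] at hab
            have e : ∀ a, (splitTop S.top α₀ a).1 = none → ζ' a 1 = S.ζ α₀ x₁ := by
              intro a ha
              rcases splitTop_none.1 ha with rfl | rfl <;> simp [ζ', par, splitArc, splitPar]
            rw [e a hab, e b hb]
          | some t =>
            rw [hb] at hab
            obtain ⟨a1, a2⟩ := splitTop_some (x₁ := x₁) (x₂ := x₂) hab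
            obtain ⟨b1, b2⟩ := splitTop_some (x₁ := x₁) (x₂ := x₂) hb
            simp only [ζ', par, a2, b2]
            exact S.top_ends.meets _ _ (a1.trans b1.symm)
        · cases ha : (splitTop S.top α₀ a).1 with
          | none =>
            have e : ζ' a 1 = S.ζ α₀ x₁ := by
              rcases splitTop_none.1 ha with rfl | rfl <;> simp [ζ', par, splitArc, splitPar]
            rw [e] at hab
            rcases iso _ x₁ ⟨hx₁.le, by linarith⟩ _ (hpar b y hy) hab with ⟨e1, e2⟩ | ⟨e1, -, -⟩
            · have e3 : splitPar α₀ x₁ x₂ (Sum.inl α₀) 1 = splitPar α₀ x₁ x₂ b y := by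
                rw [splitPar_inl_self, one_mul]; exact e2
              rcases split_eq h0 h12 h2 ⟨zero_le_one, le_rfl⟩ hy (a := Sum.inl α₀) e1 e3 with
                ⟨rfl, rfl⟩ | ⟨-, rfl, -, hb⟩ | ⟨h, -, -⟩
              · exact ⟨rfl, by simp [splitTop]⟩
              · exact ⟨rfl, (splitTop_none.2 hb).symm⟩
              · norm_num at h
            · linarith
          | some t =>
            obtain ⟨a1, a2⟩ := splitTop_some (x₁ := x₁) (x₂ := x₂) ha
            simp only [ζ', par, a2] at hab
            obtain ⟨b1, b2⟩ := S.top_ends.isolated _ _ _ (hpar b y hy) hab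
            obtain ⟨b3, b4⟩ := splitTop_of_eq_one (top := S.top) h0 h12 h2 hy b1
            exact ⟨b3, by rw [b4, ← b2, a1]⟩
        · have e : ∀ a, (splitTop S.top α₀ a).1 = none → ζ' a 1 = S.ζ α₀ x₁ := by
            intro a ha
            rcases splitTop_none.1 ha with rfl | rfl <;> simp [ζ', par, splitArc, splitPar]
          have e' : ∀ a t, (splitTop S.top α₀ a).1 = some t → ζ' a 1 = S.ζ (splitArc α₀ a) 1 := by
            intro a t ha
            simp only [ζ', par, (splitTop_some (x₁ := x₁) (x₂ := x₂) ha).2]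
          cases ha : (splitTop S.top α₀ a).1 with
          | none =>
            cases hb : (splitTop S.top α₀ b).1 with
            | none => rfl
            | some t =>
              rw [e a ha, e' b t hb] at hab
              exact absurd hab (hF₁ _)
          | some s =>
            cases hb : (splitTop S.top α₀ b).1 with
            | none =>
              rw [e b hb, e' a s ha] at hab
              exact absurd hab.symm (hF₁ _)
            | some t =>
              rw [e' a s ha, e' b t hb] at hab
              have := S.top_ends.distinct _ _ hab
              rw [(splitTop_some (x₁ := x₁) (x₂ := x₂) ha).1,
                (splitTop_some (x₁ := x₁) (x₂ := x₂) hb).1] at this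
              rw [this]
        · have hex : ∃ m > 0, ∀ a : A ⊕ Bool, ∀ x y, 1 - m ≤ x → x ≤ y → y ≤ 1 →
              m * (y - x) ≤ letterSign (splitTop S.top α₀ a).2 * ((ζ' a x).re - (ζ' a y).re) := by
            refine exists_pos_forall_le (fun a m m' hm hP x y hx hxy hy =>
              (mul_le_mul_of_nonneg_right hm (by linarith)).trans
                (hP x y (by linarith) hxy hy)) fun a => ?_
            refine split_cases (α₀ := α₀) (P := fun a => ∃ m > 0, ∀ x y, 1 - m ≤ x → x ≤ y → y ≤ 1 →
              m * (y - x) ≤ letterSign (splitTop S.top α₀ a).2 * ((ζ' a x).re - (ζ' a y).re))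
              (fun α h => ?_) ?_ ?_ ?_ a
            · refine ⟨min c δ₂, lt_min hc hδ₂, fun x y hx hxy hy => ?_⟩
              have := hslope α x y (by linarith [min_le_right c δ₂]) hxy hy
              simp only [ζ', par, splitPar_inl α h, splitTop, h, if_false, splitArc, Sum.elim_inl, id]
              exact (mul_le_mul_of_nonneg_right (min_le_left _ _) (by linarith)).trans this
            · refine ⟨min (c * x₁) (x₁ - (1 - δ)), lt_min (by positivity) (by linarith),
                fun x y hx hxy hy => ?_⟩
              have hx0 : 1 - δ ≤ x * x₁ := by
                have := min_le_right (c * x₁) (x₁ - (1 - δ))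
                nlinarith
              have := slope (x * x₁) (y * x₁) hx0 (mul_le_mul_of_nonneg_right hxy h0.le)
                (by nlinarith)
              simp only [ζ', par, splitPar_inl_self, splitTop, if_true, splitArc, Sum.elim_inl, id]
              refine (mul_le_mul_of_nonneg_right (min_le_left _ _) (by linarith)).trans ?_
              linarith
            · refine ⟨min (c * (x₂ - x₁)) 1, lt_min (mul_pos hc (by linarith)) one_pos,
                fun x y hx hxy hy => ?_⟩
              have hx0 : 0 ≤ x := by linarith [min_le_right (c * (x₂ - x₁)) 1]
              have := slope (x₂ + y * (x₁ - x₂)) (x₂ + x * (x₁ - x₂)) (by nlinarith) (by nlinarith)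
                (by nlinarith)
              simp only [ζ', par, splitPar_inr_false, splitTop, splitArc, Sum.elim_inr]
              have hs : letterSign (!(S.top α₀).2) = -letterSign (S.top α₀).2 := by
                cases (S.top α₀).2 <;> simp [letterSign]
              norm_num
              rw [hs]
              refine (mul_le_mul_of_nonneg_right (min_le_left _ _) (by linarith)).trans ?_
              linarith
            · refine ⟨min (c * (1 - x₂)) 1, lt_min (mul_pos hc (by linarith)) one_pos,
                fun x y hx hxy hy => ?_⟩
              have hx0 : 0 ≤ x := by linarith [min_le_right (c * (1 - x₂)) 1]
              have := slope (x₂ + x * (1 - x₂)) (x₂ + y * (1 - x₂)) (by nlinarith) (by nlinarith)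
                (by nlinarith)
              simp only [ζ', par, splitPar_inr_true, splitTop, splitArc, Sum.elim_inr, if_true]
              refine (mul_le_mul_of_nonneg_right (min_le_left _ _) (by linarith)).trans ?_
              linarith
          obtain ⟨m, hm, hP⟩ := hex
          exact ⟨m, hm, m, hm, hP⟩
      bot_ends := by
        have hinl0 : ∀ α, ζ' (Sum.inl α) 0 = S.ζ α 0 := by
          intro α; simp [ζ', par, splitPar, splitArc]
        have hinr0 : ∀ b, ζ' (Sum.inr b) 0 = S.ζ α₀ x₂ := by
          intro b; simp [ζ', par, splitPar, splitArc]
        refine ⟨splitBot_bijective S.bot_ends.bijective, fun a b hab => ?_, fun a b y hy hab => ?_,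
          fun a b hab => ?_, ?_⟩
        · simp only [sub_self]
          rcases a with α | c <;> rcases b with β | d
          · rw [hinl0, hinl0]
            have := S.bot_ends.meets α β (by simpa [splitBot] using hab)
            simpa using this
          · simp [splitBot] at hab
          · simp [splitBot] at hab
          · rw [hinr0, hinr0]
        · simp only [sub_self] at hab
          have hy' : 1 - y ∈ Set.Icc (0 : ℝ) 1 := ⟨by linarith [hy.2], by linarith [hy.1]⟩
          have hp := hpar b (1 - y) hy'
          rcases a with α | c
          · rw [hinl0] at hab
            obtain ⟨b1, b2⟩ := S.bot_ends.isolated α (splitArc α₀ b) (1 - par b (1 - y))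
              ⟨by linarith [hp.2], by linarith [hp.1]⟩ (by simpa using hab)
            have b3 : par b (1 - y) = 0 := by linarith
            rcases b with β | d
            · have hy1 : y = 1 := by
                simp only [par, splitPar] at b3
                rcases mul_eq_zero.1 b3 with h | h
                · linarith
                · split_ifs at h
                  · linarith
                  · norm_num at h
              exact ⟨hy1, by simp only [splitBot]; exact congrArg some b2⟩
            · have := splitPar_inr_ge (α₀ := α₀) h12 h2 d hy'
              simp only [par] at b3
              linarith
          · rw [hinr0] at hab
            rcases iso _ x₂ ⟨by linarith, by linarith⟩ _ hp hab with ⟨e1, e2⟩ | ⟨e1, -, -⟩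
            · have e3 : splitPar α₀ x₁ x₂ (Sum.inr true) 0 = splitPar α₀ x₁ x₂ b (1 - y) := by
                rw [splitPar_inr_true, zero_mul, add_zero]; exact e2
              rcases split_eq h0 h12 h2 ⟨le_rfl, zero_le_one⟩ hy' (a := Sum.inr true) e1 e3 with
                ⟨rfl, h⟩ | ⟨h, -, -⟩ | ⟨-, h, -, ⟨d, rfl⟩⟩
              · exact ⟨by linarith, rfl⟩
              · norm_num at h
              · exact ⟨by linarith, rfl⟩
            · linarith
        · simp only [sub_self] at hab
          rcases a with α | c <;> rcases b with β | d
          · rw [hinl0, hinl0] at hab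
            have := S.bot_ends.distinct α β (by simpa using hab)
            simp only [splitBot, this]
          · rw [hinl0, hinr0] at hab
            exact absurd hab.symm (hF₂ α)
          · rw [hinl0, hinr0] at hab
            exact absurd hab (hF₂ β)
          · rfl
        · have hex : ∃ m > 0, ∀ a : A ⊕ Bool, ∀ x y, 1 - m ≤ x → x ≤ y → y ≤ 1 →
              m * (y - x) ≤ letterSign (splitBot S.top S.bot α₀ a).2 *
                ((ζ' a (1 - x)).re - (ζ' a (1 - y)).re) := by
            refine exists_pos_forall_le (fun a m m' hm hP x y hx hxy hy =>
              (mul_le_mul_of_nonneg_right hm (by linarith)).trans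
                (hP x y (by linarith) hxy hy)) fun a => ?_
            have inl_case : ∀ (α : A) (k : ℝ), 0 < k → k ≤ 1 →
                (∀ x, par (Sum.inl α) x = x * k) → ∃ m > 0, ∀ x y, 1 - m ≤ x → x ≤ y → y ≤ 1 →
              m * (y - x) ≤ letterSign (splitBot S.top S.bot α₀ (Sum.inl α)).2 *
                ((ζ' (Sum.inl α) (1 - x)).re - (ζ' (Sum.inl α) (1 - y)).re) := by
              intro α k hk0 hk1 hk
              refine ⟨min (c' * k) δ₃, lt_min (by positivity) hδ₃, fun x y hx hxy hy => ?_⟩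
              have hm := min_le_right (c' * k) δ₃
              have := hslope' α (1 - (1 - x) * k) (1 - (1 - y) * k) (by nlinarith) (by nlinarith)
                (by nlinarith)
              simp only [sub_sub_cancel] at this
              simp only [ζ', hk, splitBot, splitArc, Sum.elim_inl, id]
              refine (mul_le_mul_of_nonneg_right (min_le_left _ _) (by linarith)).trans ?_
              linarith
            refine split_cases (α₀ := α₀) (P := fun a => ∃ m > 0, ∀ x y, 1 - m ≤ x → x ≤ y → y ≤ 1 →
              m * (y - x) ≤ letterSign (splitBot S.top S.bot α₀ a).2 *
                ((ζ' a (1 - x)).re - (ζ' a (1 - y)).re)) (fun α h => ?_) ?_ ?_ ?_ a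
            · exact inl_case α 1 one_pos le_rfl fun x => by
                simp only [par, splitPar_inl α h, mul_one]
            · exact inl_case α₀ x₁ h0 (by linarith) fun x => by simp only [par, splitPar_inl_self]
            · refine ⟨min (c * (x₂ - x₁)) 1, lt_min (mul_pos hc (by linarith)) one_pos,
                fun x y hx hxy hy => ?_⟩
              have hx0 : 0 ≤ x := by linarith [min_le_right (c * (x₂ - x₁)) 1]
              have := slope (x₂ + (1 - x) * (x₁ - x₂)) (x₂ + (1 - y) * (x₁ - x₂)) (by nlinarith)
                (by nlinarith) (by nlinarith)
              simp only [ζ', par, splitPar_inr_false, splitBot, splitArc, Sum.elim_inr]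
              norm_num
              refine (mul_le_mul_of_nonneg_right (min_le_left _ _) (by linarith)).trans ?_
              linarith
            · refine ⟨min (c * (1 - x₂)) 1, lt_min (mul_pos hc (by linarith)) one_pos,
                fun x y hx hxy hy => ?_⟩
              have hx0 : 0 ≤ x := by linarith [min_le_right (c * (1 - x₂)) 1]
              have := slope (x₂ + (1 - y) * (1 - x₂)) (x₂ + (1 - x) * (1 - x₂)) (by nlinarith)
                (by nlinarith) (by nlinarith)
              simp only [ζ', par, splitPar_inr_true, splitBot, splitArc, Sum.elim_inr, if_true]
              have hs : letterSign (!(S.top α₀).2) = -letterSign (S.top α₀).2 := by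
                cases (S.top α₀).2 <;> simp [letterSign]
              rw [hs]
              refine (mul_le_mul_of_nonneg_right (min_le_left _ _) (by linarith)).trans ?_
              linarith
          obtain ⟨m, hm, hP⟩ := hex
          exact ⟨m, hm, m, hm, hP⟩
      top_height := by
        intro a b hab
        simp only [h', splitHeight_one]
        cases hb : (splitTop S.top α₀ b).1 with
        | none =>
          rw [hb] at hab
          rcases splitTop_none.1 hab with rfl | rfl <;> rcases splitTop_none.1 hb with rfl | rfl <;>
            simp [splitArc, splitPar]
        | some t =>
          rw [hb] at hab
          obtain ⟨a1, a2⟩ := splitTop_some (x₁ := x₁) (x₂ := x₂) hab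
          obtain ⟨b1, b2⟩ := splitTop_some (x₁ := x₁) (x₂ := x₂) hb
          rw [a2, b2]
          exact S.top_height _ _ (a1.trans b1.symm)
      bot_height := by
        rintro (α | c) (β | d) hab
        · simp only [h', splitHeight, splitPar, zero_mul]
          exact S.bot_height α β (by simpa [splitBot] using hab)
        · simp [splitBot] at hab
        · simp [splitBot] at hab
        · simp [h', splitHeight]
      embedded := by
        intro a b x hx y hy hab hh
        have hh' := hκ a b x hx y hy hab
        rcases S.embedded _ _ _ (hpar a x hx) _ (hpar b y hy) hab (by linarith) with
          ⟨e1, e2⟩ | ⟨e1, e2, e3⟩ | ⟨e1, e2, e3⟩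
        · rcases split_eq h0 h12 h2 hx hy e1 e2 with h | ⟨rfl, rfl, ha, hb⟩ |
            ⟨rfl, rfl, ⟨c, rfl⟩, ⟨d, rfl⟩⟩
          · exact Or.inl h
          · exact Or.inr (Or.inl ⟨rfl, rfl, (splitTop_none.2 ha).trans (splitTop_none.2 hb).symm⟩)
          · exact Or.inr (Or.inr ⟨rfl, rfl, rfl⟩)
        · obtain ⟨a1, a2⟩ := splitTop_of_eq_one (top := S.top) h0 h12 h2 hx e1
          obtain ⟨b1, b2⟩ := splitTop_of_eq_one (top := S.top) h0 h12 h2 hy e2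
          exact Or.inr (Or.inl ⟨a1, b1, by rw [a2, b2, e3]⟩)
        · have hz : ∀ (a : A ⊕ Bool), ∀ x ∈ Set.Icc (0 : ℝ) 1, par a x = 0 →
              x = 0 ∧ ∃ α, a = Sum.inl α := by
            rintro (α | c) x hx h
            · refine ⟨?_, α, rfl⟩
              simp only [par, splitPar] at h
              rcases mul_eq_zero.1 h with h | h
              · exact h
              · split_ifs at h
                · linarith
                · norm_num at h
            · have := splitPar_inr_ge (α₀ := α₀) h12 h2 c hx
              simp only [par] at h
              linarith
          obtain ⟨a1, α, rfl⟩ := hz a x hx e1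
          obtain ⟨b1, β, rfl⟩ := hz b y hy e2
          exact Or.inr (Or.inr ⟨a1, b1, by simp only [splitBot]; exact congrArg some e3⟩) }
  refine ⟨S', ?_⟩
  let _ : TopologicalSpace (A ⊕ Bool) := ⊥
  have : DiscreteTopology (A ⊕ Bool) := ⟨rfl⟩
  have hc : ∀ f : A ⊕ Bool → ℝ → ℝ, (∀ a, Continuous (f a)) →
      Continuous fun p : (A ⊕ Bool) × unitInterval => f p.1 p.2 := fun f hf =>
    continuous_prod_of_discrete_left.2 fun a => (hf a).comp continuous_subtype_val
  have := isotopic_of_vertical (fun p : (A ⊕ Bool) × unitInterval => ζ' p.1 p.2)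
    (fun p => S.h (splitArc α₀ p.1) (par p.1 p.2)) (fun p => h' p.1 p.2)
    (continuous_prod_of_discrete_left.2 fun a => (hcζ a).comp continuous_subtype_val)
    (hc (fun a x => S.h (splitArc α₀ a) (par a x)) fun a =>
      (S.continuous_h _).comp (continuous_splitPar a)) (hc _ hch)
    (fun p q h => hκ p.1 q.1 p.2 p.2.2 q.2 q.2.2 h)
  convert this using 1
  · ext p
    constructor
    · rintro ⟨α, x, hx, rfl⟩
      have hex : ∃ a, ∃ y ∈ Set.Icc (0 : ℝ) 1, splitArc α₀ a = α ∧ par a y = x := by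
        by_cases hα : α = α₀
        · subst hα
          rcases le_total x x₁ with h | h
          · refine ⟨Sum.inl α₀, x / x₁, ⟨div_nonneg hx.1 h0.le, (div_le_one h0).2 h⟩, rfl, ?_⟩
            simp only [par, splitPar_inl_self]
            exact div_mul_cancel₀ _ h0.ne'
          rcases le_total x x₂ with h' | h'
          · have hpos : 0 < x₂ - x₁ := by linarith
            refine ⟨Sum.inr false, (x₂ - x) / (x₂ - x₁), ⟨div_nonneg (by linarith) hpos.le,
              (div_le_one hpos).2 (by linarith)⟩, rfl, ?_⟩
            simp only [par, splitPar_inr_false]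
            field_simp; ring
          · have hpos : 0 < 1 - x₂ := by linarith
            refine ⟨Sum.inr true, (x - x₂) / (1 - x₂), ⟨div_nonneg (by linarith) hpos.le,
              (div_le_one hpos).2 (by linarith [hx.2])⟩, rfl, ?_⟩
            simp only [par, splitPar_inr_true]
            field_simp; ring
        · exact ⟨Sum.inl α, x, hx, rfl, by simp only [par, splitPar_inl α hα]⟩
      obtain ⟨a, y, hy, rfl, rfl⟩ := hex
      exact ⟨(a, ⟨y, hy⟩), rfl⟩
    · rintro ⟨⟨a, y⟩, rfl⟩
      exact ⟨splitArc α₀ a, par a y, hpar a y y.2, rfl⟩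
  · ext p
    constructor
    · rintro ⟨a, x, hx, rfl⟩
      exact ⟨(a, ⟨x, hx⟩), rfl⟩
    · rintro ⟨⟨a, x⟩, rfl⟩
      exact ⟨a, x, x.2, rfl⟩

/-- The union of a system of arcs is isotopic to a plat on any sufficiently large number of
strands. -/
theorem ArcSystem.exists_word_of_le {A T B : Type} [Fintype A] [Fintype T] [Fintype B] {n : ℕ}
    (hn : 1 ≤ n) (hT : 1 ≤ Fintype.card T) (hTB : Fintype.card T = Fintype.card B)
    (hTn : Fintype.card T ≤ n) (S : ArcSystem A T B) :
    ∃ w : BraidWord (2 * n), Isotopic S.carrier (platSet w) := by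
  induction hk : n - Fintype.card T generalizing A T B with
  | zero => exact S.exists_word hn (by omega) (by omega)
  | succ k ih =>
    have : Nonempty T := Fintype.card_pos_iff.1 hT
    have : Nonempty A :=
      ⟨(Equiv.ofBijective _ S.top_ends.bijective).symm (Classical.arbitrary T, true)⟩
    obtain ⟨S', hS'⟩ := S.exists_stabilization
    obtain ⟨w, hw⟩ := ih (by simp) (by simp [hTB]) (by simp; omega) S' (by simp; omega)
    exact ⟨w, hS'.trans hw⟩

/-! ### Zeros of periodic functions and monotonicity between critical points -/

/-- Reduction modulo one is injective on a half-open interval of length one. -/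
theorem finite_zeros_Ioc {g : ℝ → ℝ} (hg : Function.Periodic g 1)
    (hf : {t ∈ Set.Ico (0 : ℝ) 1 | g t = 0}.Finite) (s : ℝ) :
    {t ∈ Set.Ioc s (s + 1) | g t = 0}.Finite := by
  refine Set.Finite.of_finite_image (f := Int.fract) (hf.subset ?_) ?_
  · rintro _ ⟨t, ⟨-, h⟩, rfl⟩
    refine ⟨⟨Int.fract_nonneg t, Int.fract_lt_one t⟩, ?_⟩
    have := hg.sub_int_mul_eq ⌊t⌋ (x := t)
    rw [mul_one] at this
    rw [Int.fract, this, h]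
  · rintro x ⟨hx, -⟩ y ⟨hy, -⟩ hxy
    obtain ⟨n, hn⟩ := Int.fract_eq_fract.1 hxy
    have h1 : n < 1 := by
      have : (n : ℝ) < 1 := by linarith [hx.2, hy.1]
      exact_mod_cast this
    have h2 : -1 < n := by
      have : (-1 : ℝ) < n := by linarith [hy.2, hx.1]
      exact_mod_cast this
    obtain rfl : n = 0 := by omega
    simp only [Int.cast_zero] at hn
    linarith

theorem exists_next_zero {g : ℝ → ℝ} (hg : Function.Periodic g 1)
    (hf : {t ∈ Set.Ico (0 : ℝ) 1 | g t = 0}.Finite) {s : ℝ} (hs : g s = 0) :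
    ∃ t ∈ Set.Ioc s (s + 1), g t = 0 ∧ ∀ x ∈ Set.Ioo s t, g x ≠ 0 := by
  obtain ⟨t, ⟨ht, ht0⟩, hmin⟩ := Set.exists_min_image _ id (finite_zeros_Ioc hg hf s)
    ⟨s + 1, ⟨by linarith, le_rfl⟩, by rw [hg s, hs]⟩
  refine ⟨t, ht, ht0, fun x hx hx0 => ?_⟩
  have := hmin x ⟨⟨hx.1, hx.2.le.trans ht.2⟩, hx0⟩
  simp only [id] at this
  linarith [hx.2]

theorem exists_prev_zero {g : ℝ → ℝ} (hg : Function.Periodic g 1)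
    (hf : {t ∈ Set.Ico (0 : ℝ) 1 | g t = 0}.Finite) {s : ℝ} (hs : g s = 0) (t : ℝ) :
    ∃ r ≤ t, g r = 0 ∧ ∀ x ∈ Set.Ioc r t, g x ≠ 0 := by
  have hne : {x ∈ Set.Ioc (t - 1) (t - 1 + 1) | g x = 0}.Nonempty := by
    obtain ⟨y, hy, hy'⟩ := hg.exists_mem_Ioc one_pos s (t - 1)
    exact ⟨y, hy, by rw [← hy', hs]⟩
  obtain ⟨r, ⟨hr, hr0⟩, hmax⟩ := Set.exists_max_image _ id (finite_zeros_Ioc hg hf (t - 1)) hne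
  refine ⟨r, by linarith [hr.2], hr0, fun x hx hx0 => ?_⟩
  have := hmax x ⟨⟨by linarith [hr.1, hx.1], by linarith [hx.2]⟩, hx0⟩
  simp only [id] at this
  linarith [hx.1]

/-- Between a non-degenerate minimum and the next critical point a function increases, and that
critical point, if it is non-degenerate, is a maximum. -/
theorem strictMonoOn_of_deriv_ne_zero {f : ℝ → ℝ} (hf : ContDiff ℝ ∞ f) {s t : ℝ} (hst : s < t)
    (hs : deriv f s = 0) (ht : deriv f t = 0) (hne : ∀ x ∈ Set.Ioo s t, deriv f x ≠ 0)
    (hs2 : 0 < deriv (deriv f) s) (ht2 : deriv (deriv f) t ≠ 0) :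
    StrictMonoOn f (Set.Icc s t) ∧ deriv (deriv f) t < 0 := by
  have hd : ContDiff ℝ ∞ (deriv f) := (contDiff_infty_iff_deriv.1 hf).2
  have hd1 : Differentiable ℝ (deriv f) := hd.differentiable (by simp)
  have hcont : Continuous (deriv f) := hd.continuous
  -- The second derivative makes the derivative positive just after `s`; having no zeros, it keeps
  -- its sign by the intermediate value theorem.
  have hpos : ∀ x ∈ Set.Ioo s t, 0 < deriv f x := by
    have hslope := (hd1 s).hasDerivAt.tendsto_slope
    have hev : ∀ᶠ x in nhdsWithin s (Set.Ioi s), 0 < slope (deriv f) s x :=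
      (hslope.mono_left (nhdsWithin_mono _ fun x hx => ne_of_gt hx)).eventually_const_lt hs2
    obtain ⟨y, hy1, hy2, hy3⟩ := (hev.and (Ioo_mem_nhdsGT hst)).exists
    have hy0 : 0 < deriv f y := by
      rw [slope_def_field, hs, sub_zero] at hy1
      exact (div_pos_iff_of_pos_right (sub_pos.2 hy2)).1 hy1
    intro x hx
    by_contra hcon
    obtain ⟨z, hz, hz0⟩ := (isPreconnected_Ioo (a := s) (b := t)).intermediate_value hx ⟨hy2, hy3⟩
      hcont.continuousOn ⟨not_lt.1 hcon, hy0.le⟩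
    exact hne z hz hz0
  refine ⟨strictMonoOn_of_deriv_pos (convex_Icc s t) hf.continuous.continuousOn (by simpa using hpos),
    lt_of_le_of_ne (not_lt.1 fun h => ?_) ht2⟩
  have hslope := (hd1 t).hasDerivAt.tendsto_slope
  have hev : ∀ᶠ x in nhdsWithin t (Set.Iio t), 0 < slope (deriv f) t x :=
    (hslope.mono_left (nhdsWithin_mono _ fun x hx => ne_of_lt hx)).eventually_const_lt h
  obtain ⟨y, hy1, hy2, hy3⟩ := (hev.and (Ioo_mem_nhdsLT hst)).exists
  rw [slope_def_field, ht, sub_zero] at hy1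
  have := hpos y ⟨hy2, hy3⟩
  have := div_neg_of_pos_of_neg this (sub_neg.2 hy3)
  linarith

theorem strictAntiOn_of_deriv_ne_zero {f : ℝ → ℝ} (hf : ContDiff ℝ ∞ f) {s t : ℝ} (hst : s < t)
    (hs : deriv f s = 0) (ht : deriv f t = 0) (hne : ∀ x ∈ Set.Ioo s t, deriv f x ≠ 0)
    (hs2 : deriv (deriv f) s < 0) (ht2 : deriv (deriv f) t ≠ 0) :
    StrictAntiOn f (Set.Icc s t) ∧ 0 < deriv (deriv f) t := by
  have e1 : deriv (-f) = -deriv f := by ext x; simp [deriv.neg]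
  have e2 : deriv (-deriv f) = -deriv (deriv f) := by ext x; simp [deriv.neg]
  obtain ⟨h1, h2⟩ := strictMonoOn_of_deriv_ne_zero (f := -f) hf.neg hst (by simp [e1, hs])
    (by simp [e1, ht]) (fun x hx => by simpa [e1] using hne x hx) (by simpa [e1, e2] using hs2)
    (by simpa [e1, e2] using ht2)
  refine ⟨fun x hx y hy hxy => by simpa using h1 hx hy hxy, ?_⟩
  simpa [e1, e2] using h2

/-- Strict differentiability bounds the error by half of `|d|` times the distance of `x` and `y`.
The constant `δ` serves both as the radius and as the slope. -/
theorem exists_slope {f : ℝ → ℝ} {d t : ℝ} (hf : HasStrictDerivAt f d t) (hd : d ≠ 0) :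
    ∃ δ > 0, ∀ x y, t - δ ≤ x → x ≤ y → y ≤ t →
      δ * (y - x) ≤ letterSign (decide (d < 0)) * (f x - f y) := by
  have hd0 : 0 < |d| := abs_pos.2 hd
  have h := hf.hasStrictFDerivAt.isLittleO.def (half_pos hd0)
  rw [nhds_prod_eq, Filter.eventually_iff, Filter.mem_prod_self_iff] at h
  obtain ⟨U, hU, hsub⟩ := h
  obtain ⟨r, hr, hball⟩ := Metric.mem_nhds_iff.1 hU
  refine ⟨min (r / 2) (|d| / 2), by positivity, fun x y hx hxy hy => ?_⟩
  have hm1 := min_le_left (r / 2) (|d| / 2)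
  have hm2 := min_le_right (r / 2) (|d| / 2)
  have hmem : ∀ z, x ≤ z → z ≤ t → z ∈ U := fun z h1 h2 => hball (by
    rw [Metric.mem_ball, Real.dist_eq, abs_lt]; constructor <;> linarith)
  have hxyU := hsub (Set.mk_mem_prod (hmem x le_rfl (hxy.trans hy)) (hmem y hxy hy))
  simp only [Set.mem_ofPred_eq, ContinuousLinearMap.toSpanSingleton_apply, smul_eq_mul,
    Real.norm_eq_abs] at hxyU
  rw [abs_sub_comm x y, abs_of_nonneg (sub_nonneg.2 hxy)] at hxyU
  refine (mul_le_mul_of_nonneg_right hm2 (sub_nonneg.2 hxy)).trans ?_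
  have := abs_le.1 hxyU
  rcases lt_or_gt_of_ne hd with h | h
  · rw [abs_of_neg h] at this ⊢
    simp only [letterSign, h, decide_true, if_true]
    linarith [this.1]
  · rw [abs_of_pos h] at this ⊢
    simp only [letterSign, not_lt.2 h.le, decide_false]
    norm_num
    linarith [this.2]

/-- A system of segments of smooth curves ends in pairs at the points with the parameters `b α`, if
the sides are given by the derivatives. -/
theorem EndsInPairs.of_curves {A T : Type} [Finite A] {z : A → ℝ → ℂ}
    (hz : ∀ α, ContDiff ℝ 1 (z α)) {a b : A → ℝ} {e : A → T × Bool}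
    (bijective : Function.Bijective e)
    (meets : ∀ α β, (e α).1 = (e β).1 → z α (b α) = z β (b β))
    (isolated : ∀ α β, ∀ y ∈ Set.Icc (0 : ℝ) 1, z α (b α) = z β (a β + y * (b β - a β)) →
      y = 1 ∧ (e α).1 = (e β).1)
    (distinct : ∀ α β, (z α (b α)).re = (z β (b β)).re → (e α).1 = (e β).1)
    (hne : ∀ α, (b α - a α) * (deriv (z α) (b α)).re ≠ 0)
    (hside : ∀ α, (e α).2 = decide ((b α - a α) * (deriv (z α) (b α)).re < 0)) :
    EndsInPairs (fun α x => z α (a α + x * (b α - a α))) e := by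
  have h1 : ∀ α, a α + 1 * (b α - a α) = b α := fun α => by ring
  refine ⟨bijective, fun α β h => ?_, fun α β y hy h => ?_, fun α β h => ?_, ?_⟩
  · simp only [h1]; exact meets α β h
  · simp only [h1] at h; exact isolated α β y hy h
  · simp only [h1] at h; exact distinct α β h
  · obtain ⟨δ, hδ, h⟩ : ∃ δ > 0, ∀ α, ∀ x y, 1 - δ ≤ x → x ≤ y → y ≤ 1 →
        δ * (y - x) ≤ letterSign (e α).2 * ((z α (a α + x * (b α - a α))).re -
          (z α (a α + y * (b α - a α))).re) := by
      refine exists_pos_forall_le (fun α m m' hm hP x y hx hxy hy =>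
        (mul_le_mul_of_nonneg_right hm (by linarith)).trans (hP x y (by linarith) hxy hy))
        fun α => ?_
      rw [hside α]
      refine exists_slope (f := fun x => (z α (a α + x * (b α - a α))).re) ?_ (hne α)
      have hlin : HasStrictDerivAt (fun x : ℝ => a α + x * (b α - a α)) (b α - a α) 1 := by
        simpa using ((hasStrictDerivAt_id (1 : ℝ)).mul_const (b α - a α)).const_add (a α)
      have hzα : HasStrictDerivAt (z α) (deriv (z α) (b α)) (a α + 1 * (b α - a α)) := by
        rw [h1]
        exact (hz α).contDiffAt.hasStrictDerivAt (by simp)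
      have := hzα.scomp (1 : ℝ) hlin
      have : HasStrictDerivAt (fun x => (z α (a α + x * (b α - a α))).re)
          (Complex.reCLM ((b α - a α) • deriv (z α) (b α))) 1 :=
        Complex.reCLM.hasStrictFDerivAt.comp_hasStrictDerivAt (1 : ℝ) this
      simpa using this
    exact ⟨δ, hδ, δ, hδ, h⟩

/-! ### The system of arcs of a link in general position -/

/-- A link whose height function is a Morse function and whose position is general: the critical
points are the only ones in their vertical lines and have distinct real parts, and the
real part is a local coordinate at each of them. -/
structure IsGeneric {k : ℕ} (γ : Fin k → ℝ → R3) : Prop where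
  smooth : ∀ i, ContDiff ℝ ∞ (γ i)
  periodic : ∀ i, Function.Periodic (γ i) 1
  injective : ∀ i j, ∀ s ∈ Set.Ico (0 : ℝ) 1, ∀ t ∈ Set.Ico (0 : ℝ) 1,
    γ i s = γ j t → i = j ∧ s = t
  finite : (critical γ).Finite
  nondegenerate : ∀ p ∈ critical γ, iteratedDeriv 2 (height γ p.1) p.2 ≠ 0
  isolated : ∀ p ∈ critical γ, ∀ j t, (γ j t).1 = (γ p.1 p.2).1 → γ j t = γ p.1 p.2
  distinct : ∀ p ∈ critical γ, ∀ q ∈ critical γ, (γ p.1 p.2).1.re = (γ q.1 q.2).1.re → p = q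
  slanted : ∀ p ∈ critical γ, (deriv (fun t => (γ p.1 t).1) p.2).re ≠ 0

theorem periodic_deriv {E : Type*} [NormedAddCommGroup E] [NormedSpace ℝ E] {f : ℝ → E}
    (hf : Function.Periodic f 1) : Function.Periodic (deriv f) 1 := by
  intro x
  rw [← deriv_comp_add_const f 1 x]
  congr 1
  ext y
  exact hf y

theorem periodic_add_int {E : Type*} {f : ℝ → E} (hf : Function.Periodic f 1) (t : ℝ) (n : ℤ) :
    f (t + n) = f t := by
  simpa using hf.int_mul n t

theorem periodic_fract {E : Type*} {f : ℝ → E} (hf : Function.Periodic f 1) (t : ℝ) :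
    f (Int.fract t) = f t := by
  conv_rhs => rw [← Int.fract_add_floor t]
  rw [periodic_add_int hf]

/-! ### Arcs between consecutive critical points -/

/-- The parameters `a` and `b` bound an interval on the circle through `p` that starts at `p` and
contains no critical point in its interior. -/
structure IsGap {k : ℕ} (γ : Fin k → ℝ → R3) (p : Fin k × ℝ) (a b : ℝ) : Prop where
  ne : a ≠ b
  min_eq : min a b = p.2
  max_le : max a b ≤ p.2 + 1
  deriv_left : deriv (height γ p.1) a = 0
  deriv_right : deriv (height γ p.1) b = 0
  deriv_ne_zero : ∀ x ∈ Set.Ioo (min a b) (max a b), deriv (height γ p.1) x ≠ 0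

theorem IsGap.symm {k : ℕ} {γ : Fin k → ℝ → R3} {p : Fin k × ℝ} {a b : ℝ} (h : IsGap γ p a b) :
    IsGap γ p b a :=
  ⟨h.ne.symm, min_comm a b ▸ h.min_eq, max_comm a b ▸ h.max_le, h.deriv_right, h.deriv_left,
    min_comm a b ▸ max_comm a b ▸ h.deriv_ne_zero⟩

theorem IsGap.deriv_min {k : ℕ} {γ : Fin k → ℝ → R3} {p : Fin k × ℝ} {a b : ℝ}
    (h : IsGap γ p a b) : deriv (height γ p.1) (min a b) = 0 := by
  rcases min_choice a b with h' | h' <;> rw [h']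
  exacts [h.deriv_left, h.deriv_right]

theorem IsGap.deriv_max {k : ℕ} {γ : Fin k → ℝ → R3} {p : Fin k × ℝ} {a b : ℝ}
    (h : IsGap γ p a b) : deriv (height γ p.1) (max a b) = 0 := by
  rcases max_choice a b with h' | h' <;> rw [h']
  exacts [h.deriv_left, h.deriv_right]

theorem mem_Ioo_min_max {a b y : ℝ} (hab : a ≠ b) (hy : y ∈ Set.Ioo (0 : ℝ) 1) :
    a + y * (b - a) ∈ Set.Ioo (min a b) (max a b) := by
  obtain ⟨h0, h1⟩ := hy
  rcases lt_or_gt_of_ne hab with h | h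
  · rw [min_eq_left h.le, max_eq_right h.le]; constructor <;> nlinarith
  · rw [min_eq_right h.le, max_eq_left h.le]; constructor <;> nlinarith

theorem IsGap.eq_zero_or_one {k : ℕ} {γ : Fin k → ℝ → R3} {p : Fin k × ℝ} {a b y : ℝ}
    (h : IsGap γ p a b) (hy : y ∈ Set.Icc (0 : ℝ) 1)
    (hd : deriv (height γ p.1) (a + y * (b - a)) = 0) : y = 0 ∨ y = 1 := by
  by_contra hcon
  rw [not_or] at hcon
  exact h.deriv_ne_zero _ (mem_Ioo_min_max h.ne
    ⟨lt_of_le_of_ne hy.1 (Ne.symm hcon.1), lt_of_le_of_ne hy.2 hcon.2⟩) hd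

namespace IsGeneric

variable {k : ℕ} {γ : Fin k → ℝ → R3}

theorem eq_iff (hγ : IsGeneric γ) {i j : Fin k} {s t : ℝ} :
    γ i s = γ j t ↔ i = j ∧ Int.fract s = Int.fract t := by
  constructor
  · intro h
    rw [← periodic_fract (hγ.periodic i), ← periodic_fract (hγ.periodic j)] at h
    exact hγ.injective i j _ ⟨Int.fract_nonneg _, Int.fract_lt_one _⟩ _
      ⟨Int.fract_nonneg _, Int.fract_lt_one _⟩ h
  · rintro ⟨rfl, h⟩
    rw [← periodic_fract (hγ.periodic i) s, h, periodic_fract (hγ.periodic i)]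

theorem periodic_fst (hγ : IsGeneric γ) (i : Fin k) : Function.Periodic (fun t => (γ i t).1) 1 :=
  fun t => congrArg Prod.fst (hγ.periodic i t)

theorem periodic_height (hγ : IsGeneric γ) (i : Fin k) : Function.Periodic (height γ i) 1 :=
  fun t => congrArg Prod.snd (hγ.periodic i t)

theorem contDiff_height (hγ : IsGeneric γ) (i : Fin k) : ContDiff ℝ ∞ (height γ i) :=
  (hγ.smooth i).snd

theorem fract_mem_critical (hγ : IsGeneric γ) {i : Fin k} {t : ℝ}
    (ht : deriv (height γ i) t = 0) : (i, Int.fract t) ∈ critical γ :=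
  ⟨⟨Int.fract_nonneg _, Int.fract_lt_one _⟩, by
    rw [periodic_fract (periodic_deriv (hγ.periodic_height i)), ht]⟩

theorem deriv_deriv_ne_zero (hγ : IsGeneric γ) {i : Fin k} {t : ℝ}
    (ht : deriv (height γ i) t = 0) : deriv (deriv (height γ i)) t ≠ 0 := by
  have := hγ.nondegenerate _ (hγ.fract_mem_critical ht)
  rw [iteratedDeriv_succ, iteratedDeriv_one] at this
  rwa [periodic_fract (periodic_deriv (periodic_deriv (hγ.periodic_height i)))] at this

theorem finite_zeros (hγ : IsGeneric γ) (i : Fin k) :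
    {t ∈ Set.Ico (0 : ℝ) 1 | deriv (height γ i) t = 0}.Finite :=
  (hγ.finite.preimage (f := fun t => (i, t)) fun _ _ _ _ h => (Prod.ext_iff.1 h).2).subset
    fun _ ht => ht

/-- The arc that starts at a critical point, directed upwards. -/
theorem exists_arc (hγ : IsGeneric γ) {p : Fin k × ℝ} (hp : p ∈ critical γ) :
    ∃ a b, IsGap γ p a b ∧ 0 < deriv (deriv (height γ p.1)) a ∧
      deriv (deriv (height γ p.1)) b < 0 ∧
      StrictMonoOn (fun y => height γ p.1 (a + y * (b - a))) (Set.Icc 0 1) := by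
  obtain ⟨t, ht, ht0, hne⟩ := exists_next_zero (periodic_deriv (hγ.periodic_height p.1))
    (hγ.finite_zeros p.1) hp.2
  rcases lt_or_gt_of_ne (hγ.deriv_deriv_ne_zero hp.2) with h | h
  · obtain ⟨h1, h2⟩ := strictAntiOn_of_deriv_ne_zero (hγ.contDiff_height p.1) ht.1 hp.2 ht0 hne h
      (hγ.deriv_deriv_ne_zero ht0)
    refine ⟨t, p.2, ⟨ht.1.ne', min_eq_right ht.1.le, (max_eq_left ht.1.le).le.trans ht.2, ht0, hp.2, ?_⟩,
      h2, h, fun x hx y hy hxy => ?_⟩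
    · rw [min_eq_right ht.1.le, max_eq_left ht.1.le]; exact hne
    · have := ht.1
      exact h1 ⟨by nlinarith [hy.2], by nlinarith [hy.1]⟩ ⟨by nlinarith [hx.2], by nlinarith [hx.1]⟩
        (by nlinarith)
  · obtain ⟨h1, h2⟩ := strictMonoOn_of_deriv_ne_zero (hγ.contDiff_height p.1) ht.1 hp.2 ht0 hne h
      (hγ.deriv_deriv_ne_zero ht0)
    refine ⟨p.2, t, ⟨ht.1.ne, min_eq_left ht.1.le, (max_eq_right ht.1.le).le.trans ht.2, hp.2, ht0, ?_⟩,
      h, h2, fun x hx y hy hxy => ?_⟩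
    · rw [min_eq_left ht.1.le, max_eq_right ht.1.le]; exact hne
    · have := ht.1
      exact h1 ⟨by nlinarith [hx.1], by nlinarith [hx.2]⟩ ⟨by nlinarith [hy.1], by nlinarith [hy.2]⟩
        (by nlinarith)

/-- Gaps that overlap up to a translation agree. -/
theorem eq_of_gap (hγ : IsGeneric γ) {p q : Fin k × ℝ} (hp : p ∈ critical γ) (hq : q ∈ critical γ)
    (hpq : p.1 = q.1) {a b a' b' : ℝ} (h : IsGap γ p a b) (h' : IsGap γ q a' b') {n : ℤ} {x : ℝ}
    (hx : x + n ∈ Set.Ioo (min a b) (max a b)) (hx' : x ∈ Set.Ioo (min a' b') (max a' b')) :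
    p = q ∧ n = 0 := by
  have hper := periodic_deriv (hγ.periodic_height p.1)
  have heq : p.2 = q.2 + n := by
    rw [← h.min_eq, ← h'.min_eq]
    -- If the starting points differed, the later one would be a critical point inside the other
    -- gap.
    rcases lt_trichotomy (min a b) (min a' b' + n) with hlt | heq | hgt
    · refine absurd ?_ (h.deriv_ne_zero (min a' b' + n) ⟨hlt, by linarith [hx'.1, hx.2]⟩)
      rw [periodic_add_int hper, hpq, h'.deriv_min]
    · exact heq
    · refine absurd ?_ (h'.deriv_ne_zero (min a b + (-n : ℤ))
        ⟨by push_cast; linarith, by push_cast; linarith [hx'.2, hx.1]⟩)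
      rw [← hpq, periodic_add_int hper, h.deriv_min]
  have hn : n = 0 := by
    have h1 : (n : ℝ) < 1 := by linarith [hp.1.2, hq.1.1]
    have h2 : (-1 : ℝ) < n := by linarith [hp.1.1, hq.1.2]
    have h1' : n < 1 := by exact_mod_cast h1
    have h2' : -1 < n := by exact_mod_cast h2
    omega
  refine ⟨Prod.ext hpq ?_, hn⟩
  rw [heq, hn]; simp

/-- Two gaps that reach the same point of the circle from the same side overlap near it when `b` is
their right end; when `b` is their left end, it is the starting point itself. -/
theorem eq_of_gap_right (hγ : IsGeneric γ) {p q : Fin k × ℝ} (hp : p ∈ critical γ)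
    (hq : q ∈ critical γ) (hpq : p.1 = q.1) {a b a' b' : ℝ} (h : IsGap γ p a b)
    (h' : IsGap γ q a' b') (hb : Int.fract b = Int.fract b') (hs : a < b ↔ a' < b') : p = q := by
  obtain ⟨n, hn⟩ := Int.fract_eq_fract.1 hb
  rcases lt_or_gt_of_ne h.ne with hlt | hgt
  · have hlt' := hs.1 hlt
    obtain ⟨x, hx⟩ := exists_between (max_lt (by linarith : a - n < b') hlt')
    refine (hγ.eq_of_gap hp hq hpq h h' (n := n) (x := x) ?_ ?_).1
    · rw [min_eq_left hlt.le, max_eq_right hlt.le]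
      have := (max_lt_iff.1 hx.1).1
      constructor <;> linarith [hx.2]
    · rw [min_eq_left hlt'.le, max_eq_right hlt'.le]
      exact ⟨(max_lt_iff.1 hx.1).2, hx.2⟩
  · have hgt' : b' ≤ a' := not_lt.1 fun hc => hgt.not_gt (hs.2 hc)
    have h1 := h.min_eq
    have h2 := h'.min_eq
    rw [min_eq_right hgt.le] at h1
    rw [min_eq_right hgt'] at h2
    rw [h1, h2, Int.fract_eq_self.2 ⟨hp.1.1, hp.1.2⟩, Int.fract_eq_self.2 ⟨hq.1.1, hq.1.2⟩] at hb
    exact Prod.ext hpq hb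

/-- Rolle's theorem provides a critical point on each component. The gap that begins at the last
critical point not after `t`, moved into the fundamental interval, contains `t`. -/
theorem exists_gap_mem (hγ : IsGeneric γ) (i : Fin k) (t : ℝ) :
    ∃ p ∈ critical γ, p.1 = i ∧ ∀ a b, IsGap γ p a b →
      ∃ y ∈ Set.Icc (0 : ℝ) 1, γ i (a + y * (b - a)) = γ i t := by
  obtain ⟨s, -, hs⟩ := exists_deriv_eq_zero (f := height γ i) zero_lt_one
    (hγ.contDiff_height i).continuous.continuousOn (by simpa using (hγ.periodic_height i 0).symm)
  have hper := periodic_deriv (hγ.periodic_height i)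
  obtain ⟨r, hrt, hr, hne⟩ := exists_prev_zero hper (hγ.finite_zeros i) hs t
  refine ⟨_, hγ.fract_mem_critical hr, rfl, fun a b h => ?_⟩
  have hr' := Int.fract_add_floor r
  have hmin := h.min_eq
  simp only at hmin
  have hlt : t - ⌊r⌋ < max a b := by
    by_contra hcon
    have hlt := min_lt_max.2 h.ne
    refine hne (max a b + ⌊r⌋) ⟨by linarith, by linarith⟩ ?_
    rw [periodic_add_int hper, h.deriv_max]
  have hmem : t - ⌊r⌋ ∈ segment ℝ a b := by
    rw [segment_eq_uIcc]
    exact ⟨by change min a b ≤ _; linarith, hlt.le⟩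
  rw [segment_eq_image'] at hmem
  obtain ⟨y, hy, hyt⟩ := hmem
  refine ⟨y, hy, ?_⟩
  simp only [smul_eq_mul] at hyt
  rw [hyt, ← periodic_add_int (hγ.periodic i) _ ⌊r⌋, sub_add_cancel]

end IsGeneric

theorem exists_lipschitz {ι : Type*} [Finite ι] {f : ι → ℝ → ℂ} (hf : ∀ i, ContDiff ℝ 1 (f i))
    (r : ℝ) : ∃ C, 0 ≤ C ∧ ∀ i, ∀ x ∈ Set.Icc 0 r, ∀ y ∈ Set.Icc 0 r,
      ‖f i x - f i y‖ ≤ C * |x - y| := by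
  have h : ∀ i, ∃ K, LipschitzOnWith K (f i) (Set.Icc 0 r) := fun i =>
    (hf i).locallyLipschitz.locallyLipschitzOn.exists_lipschitzOnWith_of_compact isCompact_Icc
  choose K hK using h
  obtain ⟨M, hM⟩ := (Set.finite_range K).bddAbove
  refine ⟨M, M.2, fun i x hx y hy => ?_⟩
  have := (hK i).dist_le_mul x hx y hy
  rw [dist_eq_norm, Real.dist_eq] at this
  refine this.trans (mul_le_mul_of_nonneg_right ?_ (abs_nonneg _))
  exact_mod_cast hM ⟨i, rfl⟩

/-- A link in general position is the union of a system of arcs. -/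
theorem IsGeneric.exists_arcSystem {k : ℕ} {γ : Fin k → ℝ → R3} (hγ : IsGeneric γ)
    [Fintype (critical γ)] :
    ∃ (T B : Type) (_ : Fintype T) (_ : Fintype B) (S : ArcSystem (critical γ) T B),
      Fintype.card (critical γ) = 2 * Fintype.card T ∧ Fintype.card T = Fintype.card B ∧
      S.carrier = {x | ∃ i t, x = γ i t} := by
  classical
  have harc := fun p : critical γ => hγ.exists_arc p.2
  choose a b hgap ha hb hmono using harc
  let D2 : Fin k → ℝ → ℝ := fun i => deriv (deriv (height γ i))
  have hD2 : ∀ i t, D2 i (Int.fract t) = D2 i t := fun i =>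
    periodic_fract (periodic_deriv (periodic_deriv (hγ.periodic_height i)))
  have hD : ∀ i t, deriv (height γ i) (Int.fract t) = deriv (height γ i) t := fun i =>
    periodic_fract (periodic_deriv (hγ.periodic_height i))
  -- The critical points are nondegenerate, so these are the maxima, and `B` consists of the minima.
  -- An arc is labelled by the critical point at which its gap starts and is directed upwards.
  let T := {p : critical γ // ¬ 0 < D2 p.1.1 p.1.2}
  let B := {p : critical γ // 0 < D2 p.1.1 p.1.2}
  let hi : critical γ → T := fun p =>
    ⟨⟨_, hγ.fract_mem_critical (hgap p).deriv_right⟩, by rw [hD2]; exact (hb p).not_gt⟩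
  let lo : critical γ → B := fun p =>
    ⟨⟨_, hγ.fract_mem_critical (hgap p).deriv_left⟩, by rw [hD2]; exact ha p⟩
  have hhi : ∀ p q, hi p = hi q ↔ p.1.1 = q.1.1 ∧ Int.fract (b p) = Int.fract (b q) :=
    fun p q => (Subtype.ext_iff.trans Subtype.ext_iff).trans Prod.ext_iff
  have hlo : ∀ p q, lo p = lo q ↔ p.1.1 = q.1.1 ∧ Int.fract (a p) = Int.fract (a q) :=
    fun p q => (Subtype.ext_iff.trans Subtype.ext_iff).trans Prod.ext_iff
  let z : critical γ → ℝ → ℂ := fun p t => (γ p.1.1 t).1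
  have hz : ∀ p, ContDiff ℝ 1 (z p) := fun p => ((hγ.smooth p.1.1).fst).of_le (by simp)
  have hzd : ∀ (p : critical γ) t, deriv (height γ p.1.1) t = 0 → (deriv (z p) t).re ≠ 0 := by
    intro p t ht
    have := hγ.slanted _ (hγ.fract_mem_critical ht)
    rwa [periodic_fract (periodic_deriv (hγ.periodic_fst _))] at this
  let top : critical γ → T × Bool := fun p =>
    (hi p, decide ((b p - a p) * (deriv (z p) (b p)).re < 0))
  let bot : critical γ → B × Bool := fun p =>
    (lo p, decide ((a p - b p) * (deriv (z p) (a p)).re < 0))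
  -- The side of an arc at its end is the sign of its parameter direction times the horizontal
  -- velocity. The velocity is common to the two arcs at a critical point and is not zero, so equal
  -- sides mean equal directions, and `eq_of_gap_right` identifies the arcs.
  have hsign : ∀ {x y w : ℝ}, x ≠ 0 → y ≠ 0 → w ≠ 0 → (x * w < 0 ↔ y * w < 0) →
      (0 < x ↔ 0 < y) := by
    intro x y w hx hy hw h
    rw [mul_neg_iff, mul_neg_iff] at h
    rcases lt_or_gt_of_ne hw with hw | hw <;>
      simp only [hw, hw.not_gt, and_true, and_false, or_false, false_or] at h
    · exact h
    · rw [← not_iff_not, not_lt, not_lt, hx.le_iff_lt, hy.le_iff_lt, h]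
  have htop : Function.Injective top := by
    intro p q hpq
    obtain ⟨h1, h2⟩ := Prod.ext_iff.1 hpq
    obtain ⟨e1, e2⟩ := (hhi p q).1 h1
    have ez : (deriv (z q) (b q)).re = (deriv (z p) (b p)).re := by
      have hper := periodic_deriv (hγ.periodic_fst p.1.1)
      have : deriv (z q) (b q) = deriv (z p) (b q) := by simp only [z, e1]
      rw [this]
      simp only [z]
      rw [← periodic_fract hper (b q), ← e2, periodic_fract hper]
    simp only [top, ez, decide_eq_decide] at h2
    refine Subtype.ext (hγ.eq_of_gap_right p.2 q.2 e1 (hgap p) (hgap q) e2 ?_)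
    rw [← sub_pos, ← sub_pos (a := b q)]
    exact hsign (sub_ne_zero.2 (hgap p).ne.symm) (sub_ne_zero.2 (hgap q).ne.symm)
      (hzd p _ (hgap p).deriv_right) h2
  have hbot : Function.Injective bot := by
    intro p q hpq
    obtain ⟨h1, h2⟩ := Prod.ext_iff.1 hpq
    obtain ⟨e1, e2⟩ := (hlo p q).1 h1
    have ez : (deriv (z q) (a q)).re = (deriv (z p) (a p)).re := by
      have hper := periodic_deriv (hγ.periodic_fst p.1.1)
      have : deriv (z q) (a q) = deriv (z p) (a q) := by simp only [z, e1]
      rw [this]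
      simp only [z]
      rw [← periodic_fract hper (a q), ← e2, periodic_fract hper]
    simp only [bot, ez, decide_eq_decide] at h2
    refine Subtype.ext (hγ.eq_of_gap_right p.2 q.2 e1 (hgap p).symm (hgap q).symm e2 ?_)
    rw [← sub_pos, ← sub_pos (a := a q)]
    exact hsign (sub_ne_zero.2 (hgap p).ne) (sub_ne_zero.2 (hgap q).ne)
      (hzd p _ (hgap p).deriv_left) h2
  -- There are as many arcs as critical points. Injectivity of the labels bounds this number by
  -- twice the number of maxima and by twice the number of minima; as these two numbers add up to
  -- it, both bounds are equalities.
  have hcard : Fintype.card (critical γ) = 2 * Fintype.card T ∧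
      Fintype.card T = Fintype.card B := by
    have h1 := Fintype.card_le_of_injective _ htop
    have h2 := Fintype.card_le_of_injective _ hbot
    have h3 : Fintype.card T = Fintype.card (critical γ) - Fintype.card B :=
      Fintype.card_subtype_compl _
    have h4 : Fintype.card B ≤ Fintype.card (critical γ) := Fintype.card_subtype_le _
    rw [Fintype.card_prod, Fintype.card_bool] at h1 h2
    omega
  have htop' : Function.Bijective top := (Fintype.bijective_iff_injective_and_card _).2
    ⟨htop, by rw [Fintype.card_prod, Fintype.card_bool]; omega⟩
  have hbot' : Function.Bijective bot := (Fintype.bijective_iff_injective_and_card _).2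
    ⟨hbot, by rw [Fintype.card_prod, Fintype.card_bool]; omega⟩
  have h0 : ∀ p, a p + 0 * (b p - a p) = a p := fun p => by ring
  have h1 : ∀ p, a p + 1 * (b p - a p) = b p := fun p => by ring
  have meet_hi : ∀ p q : critical γ, ∀ y ∈ Set.Icc (0 : ℝ) 1,
      γ p.1.1 (b p) = γ q.1.1 (a q + y * (b q - a q)) → y = 1 ∧ hi p = hi q := by
    intro p q y hy h
    obtain ⟨e1, e2⟩ := hγ.eq_iff.1 h
    rcases (hgap q).eq_zero_or_one hy (by rw [← hD, ← e2, hD, ← e1, (hgap p).deriv_right]) with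
      rfl | rfl
    · have h2 := ha q
      have h3 := hb p
      rw [h0] at e2
      have : D2 p.1.1 (b p) = D2 q.1.1 (a q) := by rw [← hD2, e2, hD2, e1]
      simp only [D2] at this
      linarith
    · rw [h1] at e2
      exact ⟨rfl, (hhi p q).2 ⟨e1, e2⟩⟩
  have meet_lo : ∀ p q : critical γ, ∀ y ∈ Set.Icc (0 : ℝ) 1,
      γ p.1.1 (a p) = γ q.1.1 (a q + y * (b q - a q)) → y = 0 ∧ lo p = lo q := by
    intro p q y hy h
    obtain ⟨e1, e2⟩ := hγ.eq_iff.1 h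
    rcases (hgap q).eq_zero_or_one hy (by rw [← hD, ← e2, hD, ← e1, (hgap p).deriv_left]) with
      rfl | rfl
    · rw [h0] at e2
      exact ⟨rfl, (hlo p q).2 ⟨e1, e2⟩⟩
    · have h2 := ha p
      have h3 := hb q
      rw [h1] at e2
      have : D2 p.1.1 (a p) = D2 q.1.1 (b q) := by rw [← hD2, e2, hD2, e1]
      simp only [D2] at this
      linarith
  have crit : ∀ (p : critical γ) t, deriv (height γ p.1.1) t = 0 → ∀ j s, (γ j s).1 = z p t →
      γ j s = γ p.1.1 t := by
    intro p t ht j s h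
    have := hγ.isolated _ (hγ.fract_mem_critical ht) j s
    simp only [periodic_fract (hγ.periodic _)] at this
    exact this h
  have crit_re : ∀ (p q : critical γ) s t, deriv (height γ p.1.1) s = 0 →
      deriv (height γ q.1.1) t = 0 → (z p s).re = (z q t).re →
      p.1.1 = q.1.1 ∧ Int.fract s = Int.fract t := by
    intro p q s t hs ht h
    have := hγ.distinct _ (hγ.fract_mem_critical hs) _ (hγ.fract_mem_critical ht)
    simp only [periodic_fract (hγ.periodic _)] at this
    exact Prod.ext_iff.1 (this h)
  have hbound : ∀ p, ∀ x ∈ Set.Icc (0 : ℝ) 1, a p + x * (b p - a p) ∈ Set.Icc (0 : ℝ) 2 := by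
    intro p x hx
    have e1 : 0 ≤ min (a p) (b p) := (hgap p).min_eq ▸ p.2.1.1
    have e2 : max (a p) (b p) ≤ 2 := (hgap p).max_le.trans (by linarith [p.2.1.2])
    obtain ⟨a0, b0⟩ := le_min_iff.1 e1
    obtain ⟨a2, b2⟩ := max_le_iff.1 e2
    constructor <;> nlinarith [hx.1, hx.2]
  let S : ArcSystem (critical γ) T B :=
    { ζ := fun p x => z p (a p + x * (b p - a p))
      h := fun p x => height γ p.1.1 (a p + x * (b p - a p))
      top := top
      bot := bot
      continuous_ζ := fun p => (hz p).continuous.comp (by fun_prop)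
      continuous_h := fun p => (hγ.contDiff_height _).continuous.comp (by fun_prop)
      lipschitz := by
        obtain ⟨C, hC, h⟩ := exists_lipschitz hz 2
        refine ⟨C * 2, fun p x hx y hy => (h p _ (hbound p x hx) _ (hbound p y hy)).trans ?_⟩
        have e : a p + x * (b p - a p) - (a p + y * (b p - a p)) = (b p - a p) * (x - y) := by ring
        rw [e, abs_mul, mul_assoc]
        refine mul_le_mul_of_nonneg_left (mul_le_mul_of_nonneg_right ?_ (abs_nonneg _)) hC
        have e0 := hbound p 0 ⟨le_rfl, zero_le_one⟩
        have e1 := hbound p 1 ⟨zero_le_one, le_rfl⟩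
        rw [h0] at e0
        rw [h1] at e1
        rw [abs_le]
        constructor <;> linarith [e0.1, e0.2, e1.1, e1.2]
      strictMono := hmono
      top_ends := by
        refine EndsInPairs.of_curves hz htop' (fun p q h => ?_) (fun p q y hy h => ?_)
          (fun p q h => ?_) (fun p => ?_) (fun p => rfl)
        · exact congrArg Prod.fst (hγ.eq_iff.2 ((hhi p q).1 h))
        · exact meet_hi p q y hy (crit p _ (hgap p).deriv_right _ _ h.symm).symm
        · exact (hhi p q).2 (crit_re p q _ _ (hgap p).deriv_right (hgap q).deriv_right h)
        · exact mul_ne_zero (sub_ne_zero.2 (hgap p).ne.symm) (hzd p _ (hgap p).deriv_right)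
      bot_ends := by
        have e : ∀ p x, a p + (1 - x) * (b p - a p) = b p + x * (a p - b p) := fun p x => by ring
        simp only [e]
        refine EndsInPairs.of_curves hz hbot' (fun p q h => ?_) (fun p q y hy h => ?_)
          (fun p q h => ?_) (fun p => ?_) (fun p => rfl)
        · exact congrArg Prod.fst (hγ.eq_iff.2 ((hlo p q).1 h))
        · rw [← e] at h
          obtain ⟨h2, h3⟩ := meet_lo p q (1 - y) ⟨by linarith [hy.2], by linarith [hy.1]⟩
            (crit p _ (hgap p).deriv_left _ _ h.symm).symm
          exact ⟨by linarith, h3⟩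
        · exact (hlo p q).2 (crit_re p q _ _ (hgap p).deriv_left (hgap q).deriv_left h)
        · exact mul_ne_zero (sub_ne_zero.2 (hgap p).ne) (hzd p _ (hgap p).deriv_left)
      top_height := fun p q h => by
        simp only [h1]
        exact congrArg Prod.snd (hγ.eq_iff.2 ((hhi p q).1 h))
      bot_height := fun p q h => by
        simp only [h0]
        exact congrArg Prod.snd (hγ.eq_iff.2 ((hlo p q).1 h))
      embedded := by
        intro p q x hx y hy hζ hh
        have heq : γ p.1.1 (a p + x * (b p - a p)) = γ q.1.1 (a q + y * (b q - a q)) :=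
          Prod.ext hζ hh
        obtain ⟨e1, e2⟩ := hγ.eq_iff.1 heq
        by_cases hd : deriv (height γ p.1.1) (a p + x * (b p - a p)) = 0
        · rcases (hgap p).eq_zero_or_one hx hd with rfl | rfl
          · rw [h0] at heq
            obtain ⟨hy0, hl⟩ := meet_lo p q y hy heq
            exact Or.inr (Or.inr ⟨rfl, hy0, hl⟩)
          · rw [h1] at heq
            obtain ⟨hy1, hl⟩ := meet_hi p q y hy heq
            exact Or.inr (Or.inl ⟨rfl, hy1, hl⟩)
        · have hd' : deriv (height γ q.1.1) (a q + y * (b q - a q)) ≠ 0 := by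
            rwa [← hD, ← e2, hD, ← e1]
          have inner : ∀ (r : critical γ), ∀ w ∈ Set.Icc (0 : ℝ) 1,
              deriv (height γ r.1.1) (a r + w * (b r - a r)) ≠ 0 → w ∈ Set.Ioo (0 : ℝ) 1 := by
            intro r w hw hr
            refine ⟨lt_of_le_of_ne hw.1 ?_, lt_of_le_of_ne hw.2 ?_⟩
            · rintro rfl
              rw [h0] at hr
              exact hr (hgap r).deriv_left
            · rintro rfl
              rw [h1] at hr
              exact hr (hgap r).deriv_right
          -- A common point that is not critical lies inside both gaps, up to a whole number of
          -- periods, so the gaps are equal and the period shift is zero.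
          obtain ⟨n, hn⟩ := Int.fract_eq_fract.1 e2
          have hm := mem_Ioo_min_max (hgap p).ne (inner p x hx hd)
          rw [← sub_add_cancel (a p + x * (b p - a p)) (a q + y * (b q - a q)), hn, add_comm] at hm
          obtain ⟨e3, rfl⟩ := hγ.eq_of_gap p.2 q.2 e1 (hgap p) (hgap q) hm
            (mem_Ioo_min_max (hgap q).ne (inner q y hy hd'))
          obtain rfl : p = q := Subtype.ext e3
          refine Or.inl ⟨rfl, ?_⟩
          have : (x - y) * (b p - a p) = 0 := by simp only [Int.cast_zero] at hn; linarith
          rcases mul_eq_zero.1 this with h | h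
          · linarith
          · exact absurd (by linarith) (hgap p).ne }
  refine ⟨T, B, inferInstance, inferInstance, S, hcard.1, hcard.2, ?_⟩
  ext x
  constructor
  · rintro ⟨p, y, -, rfl⟩
    exact ⟨p.1.1, a p + y * (b p - a p), rfl⟩
  · rintro ⟨i, t, rfl⟩
    obtain ⟨p, hp, rfl, h⟩ := hγ.exists_gap_mem i t
    obtain ⟨y, hy, hyt⟩ := h _ _ (hgap ⟨p, hp⟩)
    exact ⟨⟨p, hp⟩, y, hy, hyt.symm⟩

/-! ### General position -/

open MeasureTheory in
-- Regarded as a function of the real part, the curve is a differentiable map of the plane on the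
-- real line, a null set, and such maps preserve null sets.
theorem volume_image_eq_zero {f : ℝ → ℂ} {s : Set ℝ} (hf : ∀ t ∈ s, DifferentiableAt ℝ f t) :
    volume (f '' s) = 0 := by
  let L : Submodule ℝ ℂ := LinearMap.ker Complex.imLm
  have hL : L ≠ ⊤ := by
    intro h
    have : Complex.I ∈ L := h ▸ Submodule.mem_top
    simp [L] at this
  have h0 : volume ((L : Set ℂ) ∩ Complex.re ⁻¹' s) = 0 :=
    measure_mono_null Set.inter_subset_left (Measure.addHaar_submodule volume L hL)
  have h1 := addHaar_image_eq_zero_of_differentiableOn_of_addHaar_eq_zero volume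
    (f := fun w : ℂ => f w.re) (fun w hw => DifferentiableAt.differentiableWithinAt
      (DifferentiableAt.comp (𝕜 := ℝ) w (hf w.re hw.2) Complex.reCLM.differentiableAt)) h0
  refine measure_mono_null ?_ h1
  rintro _ ⟨t, ht, rfl⟩
  exact ⟨(t : ℂ), ⟨by simp [L], by simpa using ht⟩, by simp⟩

/-- The linear map of three-space that tilts the vertical lines by `u` and multiplies the horizontal
planes by `1 + r i`. -/
def tilt (u : ℂ) (r : ℝ) (p : R3) : R3 := ((1 + r * Complex.I) * (p.1 - p.2 * u), p.2)

theorem one_add_mul_I_ne_zero (r : ℝ) : (1 + r * Complex.I : ℂ) ≠ 0 := by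
  intro h
  simpa using congrArg Complex.re h

theorem isotopic_tilt (u : ℂ) (r : ℝ) (K : Set R3) : Isotopic K (tilt u r '' K) := by
  have hne : ∀ s : unitInterval, (1 + (((s : ℝ) * r : ℝ) : ℂ) * Complex.I) ≠ 0 := fun s =>
    one_add_mul_I_ne_zero _
  have := isotopic_of_family (fun s => tilt ((s : ℝ) * u) (s * r))
    (fun s p => (p.1 / (1 + (((s : ℝ) * r : ℝ) : ℂ) * Complex.I) + p.2 * ((s : ℝ) * u), p.2))
    (by unfold tilt; fun_prop)
    (by
      refine Continuous.prodMk (Continuous.add (Continuous.div (by fun_prop) (by fun_prop)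
        fun q => hne q.1) (by fun_prop)) (by fun_prop))
    (fun s p => by simp only [tilt]; rw [mul_div_cancel_left₀ _ (hne s), sub_add_cancel])
    (fun s p => by simp only [tilt]; rw [add_sub_cancel_right, mul_div_cancel₀ _ (hne s)])
    (fun p => by simp [tilt]) K
  simpa using this

/-- A link in bridge position can be put in general position by a linear map. -/
theorem IsBridgePosition.exists_isGeneric {m k : ℕ} {γ : Fin k → ℝ → R3}
    (hγ : IsBridgePosition m γ) : ∃ u r, IsGeneric fun i t => tilt u r (γ i t) := by
  have hdiff : ∀ i, Differentiable ℝ (γ i) := fun i => (hγ.isLink.smooth i).differentiable (by simp)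
  obtain ⟨u, hu⟩ : ∃ u : ℂ, ∀ p ∈ critical γ, ∀ j t, (γ j t).2 ≠ (γ p.1 p.2).2 →
      u ≠ ((γ j t).1 - (γ p.1 p.2).1) / (((γ j t).2 - (γ p.1 p.2).2 : ℝ) : ℂ) := by
    -- The slopes of the secants from a critical point to the points of other heights. They form
    -- finitely many curves, hence a null set; tilting by a `u` outside it leaves each critical
    -- point alone in its vertical line.
    let bad : Set ℂ := ⋃ p ∈ critical γ, ⋃ j, (fun t => ((γ j t).1 - (γ p.1 p.2).1) /
      (((γ j t).2 - (γ p.1 p.2).2 : ℝ) : ℂ)) '' {t | (γ j t).2 ≠ (γ p.1 p.2).2}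
    have hbad : MeasureTheory.volume bad = 0 := by
      refine (MeasureTheory.measure_biUnion_null_iff hγ.finite.countable).2 fun p _ =>
        MeasureTheory.measure_iUnion_null fun j => volume_image_eq_zero fun t ht => ?_
      have h1 : DifferentiableAt ℝ (fun t => (γ j t).1 - (γ p.1 p.2).1) t :=
        ((hdiff j t).fst).sub_const _
      have h2 : DifferentiableAt ℝ (fun t => (((γ j t).2 - (γ p.1 p.2).2 : ℝ) : ℂ)) t :=
        Complex.ofRealCLM.differentiableAt.comp t (((hdiff j t).snd).sub_const _)
      refine h1.div h2 ?_
      exact Complex.ofReal_ne_zero.2 (sub_ne_zero.2 ht)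
    obtain ⟨u, hu⟩ : ∃ u, u ∉ bad := by
      by_contra! hcon
      rw [Set.eq_univ_of_forall hcon] at hbad
      exact (MeasureTheory.Measure.measure_univ_ne_zero.2 (NeZero.ne _)) hbad
    refine ⟨u, fun p hp j t ht h => hu ?_⟩
    simp only [bad, Set.mem_iUnion]
    exact ⟨p, hp, j, t, ht, h.symm⟩
  have hlift : ∀ p ∈ critical γ, ∀ j t, (γ j t).1 - (γ j t).2 * u =
      (γ p.1 p.2).1 - (γ p.1 p.2).2 * u → γ j t = γ p.1 p.2 := by
    intro p hp j t h
    by_cases hh : (γ j t).2 = (γ p.1 p.2).2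
    · rw [hh] at h
      exact Prod.ext (sub_left_injective h) hh
    · refine absurd ?_ (hu p hp j t hh)
      rw [eq_div_iff (Complex.ofReal_ne_zero.2 (sub_ne_zero.2 hh))]
      push_cast
      linear_combination -h
  let w : Fin k × ℝ → ℂ := fun p => (γ p.1 p.2).1 - (γ p.1 p.2).2 * u
  -- The vectors that must not become vertical in the plane: the differences of projected critical
  -- points and the tangents there. Since `((1 + r i) v).re = v.re - r * v.im`, each non-zero one
  -- excludes at most one value of `r`.
  let V : Set ℂ := (fun pq : (Fin k × ℝ) × (Fin k × ℝ) => w pq.1 - w pq.2) ''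
    (critical γ ×ˢ critical γ) ∪ (fun p : Fin k × ℝ => (deriv (γ p.1) p.2).1) '' critical γ
  have hV : V.Finite := ((hγ.finite.prod hγ.finite).image _).union (hγ.finite.image _)
  obtain ⟨r, hr⟩ := (hV.image fun v => v.re / v.im).exists_notMem
  have hre : ∀ v ∈ V, v ≠ 0 → ((1 + r * Complex.I) * v).re ≠ 0 := by
    intro v hv hv0 h
    have h' : v.re = r * v.im := by
      simp [Complex.mul_re] at h
      linarith
    by_cases him : v.im = 0
    · exact hv0 (Complex.ext (by rw [h', him]; simp) him)
    · exact hr ⟨v, hv, by simp only; rw [h']; field_simp⟩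
  refine ⟨u, r, ?_, fun i t => ?_, fun i j s hs t ht h => ?_, hγ.finite, hγ.nondegenerate,
    fun p hp j t h => ?_, fun p hp q hq h => ?_, fun p hp => ?_⟩
  · intro i
    have h1 := hγ.isLink.smooth i
    have h2 : ContDiff ℝ ∞ fun t => ((γ i t).2 : ℂ) := Complex.ofRealCLM.contDiff.comp h1.snd
    unfold tilt
    fun_prop
  · simp only [hγ.isLink.periodic i t]
  · refine hγ.isLink.injective i j s hs t ht ?_
    obtain ⟨h1, h2⟩ := Prod.ext_iff.1 h
    have h3 := mul_left_cancel₀ (one_add_mul_I_ne_zero r) h1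
    simp only [tilt] at h2
    rw [h2] at h3
    exact Prod.ext (sub_left_injective h3) h2
  · exact congrArg (tilt u r) (hlift p hp j t (mul_left_cancel₀ (one_add_mul_I_ne_zero r) h))
  · by_contra hpq
    have hne : w p - w q ≠ 0 := by
      intro h0
      have := hlift q hq p.1 p.2 (sub_eq_zero.1 h0)
      obtain ⟨e1, e2⟩ := hγ.isLink.injective _ _ _ hp.1 _ hq.1 this
      exact hpq (Prod.ext e1 e2)
    refine hre _ (Or.inl ⟨(p, q), ⟨hp, hq⟩, rfl⟩) hne ?_
    rw [mul_sub, Complex.sub_re, sub_eq_zero]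
    exact h
  · have hd := (hdiff p.1 p.2).hasDerivAt
    have h1 : HasDerivAt (fun t => (γ p.1 t).1) (deriv (γ p.1) p.2).1 p.2 := hd.fst
    have h2 : HasDerivAt (height γ p.1) (deriv (γ p.1) p.2).2 p.2 := hd.snd
    -- The tangent at a critical point is horizontal, so its horizontal part is not zero because the
    -- link is immersed.
    have h20 : (deriv (γ p.1) p.2).2 = 0 := by rw [← h2.deriv]; exact hp.2
    have h10 : (deriv (γ p.1) p.2).1 ≠ 0 := fun h0 =>
      hγ.isLink.immersed p.1 p.2 (Prod.ext h0 h20)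
    have h3 : HasDerivAt (fun t => (tilt u r (γ p.1 t)).1)
        ((1 + r * Complex.I) * ((deriv (γ p.1) p.2).1 - ((deriv (γ p.1) p.2).2 : ℂ) * u)) p.2 :=
      (h1.sub (h2.ofReal_comp.mul_const u)).const_mul _
    rw [h3.deriv, h20]
    simp only [Complex.ofReal_zero, zero_mul, sub_zero]
    exact hre _ (Or.inr ⟨p, hp, rfl⟩) h10

/-- A link in `m`-bridge position is isotopic to a plat on `2 n` strands, for every `n ≥ m`. -/
theorem IsBridgePosition.exists_word {m k n : ℕ} {γ : Fin k → ℝ → R3}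
    (hγ : IsBridgePosition m γ) (hm : 1 ≤ m) (hmn : m ≤ n) :
    ∃ w : BraidWord (2 * n), AmbientIsotopic (trace γ) (plat w) := by
  obtain ⟨u, r, hg⟩ := hγ.exists_isGeneric
  have : Fintype (critical fun i t => tilt u r (γ i t)) := hg.finite.fintype
  have hcard : Fintype.card (critical fun i t => tilt u r (γ i t)) = 2 * m := by
    rw [← Nat.card_eq_fintype_card, Nat.card_coe_set_eq]
    exact hγ.card
  obtain ⟨T, B, _, _, S, h1, h2, h3⟩ := hg.exists_arcSystem
  obtain ⟨w, hw⟩ := S.exists_word_of_le (n := n) (by omega) (by omega) h2 (by omega)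
  refine ⟨w, ?_⟩
  have h4 := isotopic_tilt u r {x | ∃ i t, x = γ i t}
  have h5 : tilt u r '' {x | ∃ i t, x = γ i t} = S.carrier := by
    rw [h3]
    ext x
    constructor
    · rintro ⟨_, ⟨i, t, rfl⟩, rfl⟩
      exact ⟨i, t, rfl⟩
    · rintro ⟨i, t, rfl⟩
      exact ⟨_, ⟨i, t, rfl⟩, rfl⟩
  have h6 : trace γ = (fun p : R3 => (p : S3)) '' {x | ∃ i t, x = γ i t} := by
    ext x
    constructor
    · rintro ⟨i, t, rfl⟩
      exact ⟨_, ⟨i, t, rfl⟩, rfl⟩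
    · rintro ⟨_, ⟨i, t, rfl⟩, rfl⟩
      exact ⟨i, t, rfl⟩
  rw [h5] at h4
  rw [h6, plat_eq]
  exact h4.trans hw

theorem platBraids_nonempty {n : ℕ} {𝓛 : Set (Set S3)} (h𝓛 : IsLinkType 𝓛)
    (hb : bridgeNumber 𝓛 ≤ n) : (platBraids n 𝓛).Nonempty := by
  have hne : {b : ℕ∞ | ∃ m : ℕ, b = m ∧ 1 ≤ m ∧
      ∃ (k : ℕ) (γ : Fin k → ℝ → R3), IsBridgePosition m γ ∧ trace γ ∈ 𝓛}.Nonempty := by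
    -- With no bridge position at all the infimum would be `⊤`, which is not at most `n`.
    by_contra hcon
    rw [Set.not_nonempty_iff_eq_empty] at hcon
    rw [bridgeNumber, hcon, sInf_empty] at hb
    exact absurd hb (not_le.2 (ENat.natCast_lt_top n))
  obtain ⟨m, hm, hm1, k, γ, hγ, hγ𝓛⟩ := csInf_mem hne
  have hmn : m ≤ n := by
    have : (m : ℕ∞) ≤ n := hm ▸ hb
    exact_mod_cast this
  obtain ⟨w, hw⟩ := hγ.exists_word hm1 hmn
  obtain ⟨k', δ, -, -, rfl⟩ := h𝓛
  exact ⟨w.toBraid, w, rfl, AmbientIsotopic.trans hγ𝓛 hw⟩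

end Plat

end

theorem mainTheorem2 (n : ℕ) (hn : 1 ≤ n) (c : Plat.BraidGroup (2 * n) → ℕ)
    (hc : Plat.ProperComplexity c) (𝓛 : Set (Set Plat.S3)) (h𝓛 : Plat.IsLinkType 𝓛)
    (hb : Plat.bridgeNumber 𝓛 ≤ n) :
    (∀ β, Plat.IsDehornoyLeast (Plat.minimalElements c (Plat.platBraids n 𝓛)) β ↔
      β = Plat.globalBraid c 𝓛) ∧
    (∀ β, Plat.IsDehornoyLeast (Plat.minimalElements c (Plat.canPlat c 𝓛).elements) β ↔
      β = Plat.cosetRep c (Plat.canPlat c 𝓛)) ∧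
    Plat.globalBraid c 𝓛 = Plat.cosetRep c (Plat.canPlat c 𝓛) := by
  exact Plat.canonical_representative hc (Plat.platBraids_nonempty h𝓛 hb) fun _ hβ _ h =>
    Plat.mem_platBraids_of_platClass_eq hn h𝓛 hβ h
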